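/- Let $M$ be a compact real-analytic manifold of dimension $n$ (Hausdorff, without boundary), $g$ a real-analytic Riemannian metric on $M$, and $\beta$ a closed real-analytic $2$-form on $M$. Let $\pi:T^*M\to M$ be the cotangent bundle, $\theta$ its canonical $1$-form, $\omega=-d\theta$, $\omega^\beta=\omega-\pi^*\beta$, $E(x,p)=\tfrac12 g(p,p)$, and $T^{*,R}M=\{(x,p): g(p,p)<R^2\}$. Let $\Phi_\sigma=\Phi^\beta_\sigma$ be the Hamiltonian flow of $E$ with respect to $\omega^\beta$ (that is, $\omega^\beta(X_E,\cdot)=dE$); let $V_z\subset T_z^{\mathbb C}T^*M$ be the complexified vertical subspace $(\ker \pi_*)_{\mathbb C}$, and for $\sigma\in\mathbb R$ let $$P_z(\sigma)=(\Phi_\sigma)_*\big(V_{\Phi_{-\sigma}(z)}\big)\subset T_z^{\mathbb C}T^*M .$$ Let $D_\rho\subset\mathbb C$ be the open disk of radius $\rho$ about $0$. A complex structure on an open subset of $T^*M$ is a smooth almost complex structure $J$ admitting local holomorphic coordinates; its $(1,0)$-distribution is the $i$-eigenbundle of $J$. A complex structure on $T^{*,R}M$ whose $(1,0)$-space at each $z$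 is $P_z(i)$, the value at $i$ of the analytic continuation of $\sigma\mapsto P_z(\sigma)$ to a disk about the origin of radius greater than $1$, is called the magnetic complex structure on $T^{*,R}M$ (relative to $g$ and $\beta$). **Theorem.** The flow $\Phi_\sigma$ is defined for all $\sigma\in\mathbb R$, and the following hold. 1. There are $R>0$ and $\varepsilon>0$ such that $(*)$ for each $z\in T^{*,R}M$ the map $\sigma\mapsto P_z(\sigma)$ continues analytically to a holomorphic map $w\mapsto P_z(w)$ of $D_{1+\varepsilon}$ into the Grassmannian of $n$-dimensional subspaces of $T_z^{\mathbb C}T^*M$, and $(z,w)\mapsto P_z(w)$ is real-analytic on $T^{*,R}M\times D_{1+\varepsilon}$; moreover all $P_z(w)$ are Lagrangian for $\omega^\beta$. 2. For all $R,\varepsilon>0$ satisfying $(*)$ there is $r\in(0,R]$ such that: (a) for all $w\in D_{1+\varepsilon}$ with $\operatorname{Im}w\neq0$ and all $z\in T^{*,r}M$, $P_z(w)\cap\overline{P_z(w)}=0$, and there is a unique complex structure on $T^{*,r}M$ with $(1,0)$-distribution $z\mapsto P_z(w)$; (b) for all $w=\sigma+i\tau\in D_{1+\varepsilon}$ with $\tau>0$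 and all $z\in T^{*,r}M$, $P_z(w)$ is a positive Lagrangian subspace with respect to $\omega^\beta$, i.e. it is Lagrangian and $-i\,\omega^\beta(Z,\overline Z)>0$ for all nonzero $Z\in P_z(w)$; and the complex structure in (a) together with $\omega^\beta$ is a Kähler structure on $T^{*,r}M$. In particular (with $w=i$) the magnetic complex structure together with $\omega^\beta=\omega-\pi^*\beta$ is Kähler on $T^{*,r}M$. 3. There is $R>0$ such that the magnetic complex structures for $\beta$ and for $-\beta$ both exist on $T^{*,R}M$ and are Kähler together with $\omega^{\beta}$ and $\omega^{-\beta}$, respectively. 4. Whenever the magnetic complex structure exists on some $T^{*,R}M$, $R>0$, it is unique, and the zero-section is a maximal totally real submanifold with respect to it. 5. Whenever the magnetic complex structures $J_\beta$ and $J_{-\beta}$ for $\beta$ and for $-\beta$ exist on $T^{*,R}M$, $R>0$, the fiber inversion $\nu(x,p)=(x,-p)$ is an antiholomorphic map from $(T^{*,R}M,J_\beta)$ to $(T^{*,R}M,J_{-\beta})$; that is, $\nu_*\big(T^{(1,0)}_\beta\big)=T^{(0,1)}_{-\beta}$. -/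

import Mathlib

open Set Bundle
open scoped Manifold ContDiff TensorProduct Topology

noncomputable section

namespace MagneticFlow

/-! ### Differential forms on manifolds without boundary -/

section Forms

variable {E : Type*} [NormedAddCommGroup E] [NormedSpace ℝ E]
  {H : Type*} [TopologicalSpace H] (I : ModelWithCorners ℝ E H)
  {N : Type*} [TopologicalSpace N] [ChartedSpace H N] {k : ℕ}

/-- A (not necessarily continuous) differential `k`-form on `N`. -/
abbrev DiffForm (N : Type*) [TopologicalSpace N] [ChartedSpace H N] (k : ℕ) : Type _ :=
  (x : N) → (TangentSpace I x) [⋀^Fin k]→L[ℝ] ℝ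

variable {I}

/-- The coordinate expression of a form in the preferred chart around `x₀`: its pullback to the
model space under the inverse of the chart (meaningful on the target of the chart). -/
def DiffForm.inChart (α : DiffForm I N k) (x₀ : N) (y : E) : E [⋀^Fin k]→L[ℝ] ℝ :=
  (α ((extChartAt I x₀).symm y)).compContinuousLinearMap
    (mfderiv 𝓘(ℝ, E) I (extChartAt I x₀).symm y)

/-- The form has `C^m` coordinate expressions (`m = ω`: real-analytic, `m = ∞`: smooth). -/
def DiffForm.IsCk (m : WithTop ℕ∞) (α : DiffForm I N k) : Prop :=
  ∀ x₀ : N, ContDiffOn ℝ m (α.inChart x₀) (extChartAt I x₀).target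

/-- The exterior derivative, computed at `x` in the preferred chart around `x`. -/
def DiffForm.d (α : DiffForm I N k) : DiffForm I N (k + 1) := fun x =>
  (extDeriv (α.inChart x) (extChartAt I x x)).compContinuousLinearMap
    (mfderiv I 𝓘(ℝ, E) (extChartAt I x) x)

end Forms

/-! ### Complexification of a real vector space -/

section Complexification

variable {V : Type*} [AddCommGroup V] [Module ℝ V]

/-- Complex conjugation on `V_ℂ = ℂ ⊗ V`. -/
def conjC : ℂ ⊗[ℝ] V →ₗ[ℝ] ℂ ⊗[ℝ] V :=
  LinearMap.rTensor V Complex.conjAe.toLinearMap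

/-- The real part `X` of `Z = X + iY ∈ V_ℂ`. -/
def reC : ℂ ⊗[ℝ] V →ₗ[ℝ] V :=
  (TensorProduct.lid ℝ V).toLinearMap ∘ₗ LinearMap.rTensor V Complex.reLm

/-- The imaginary part `Y` of `Z = X + iY ∈ V_ℂ`. -/
def imC : ℂ ⊗[ℝ] V →ₗ[ℝ] V :=
  (TensorProduct.lid ℝ V).toLinearMap ∘ₗ LinearMap.rTensor V Complex.imLm

variable [TopologicalSpace V]

/-- The complex bilinear extension of a real alternating 2-form. -/
def formC (w : V [⋀^Fin 2]→L[ℝ] ℝ) (Z W : ℂ ⊗[ℝ] V) : ℂ :=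
  ((w ![reC Z, reC W] - w ![imC Z, imC W] : ℝ) : ℂ)
    + Complex.I * ((w ![reC Z, imC W] + w ![imC Z, reC W] : ℝ) : ℂ)

/-- `P` is a Lagrangian subspace of `V_ℂ`: isotropic, of half the dimension. -/
def IsLagrangian (w : V [⋀^Fin 2]→L[ℝ] ℝ) (P : Submodule ℂ (ℂ ⊗[ℝ] V)) : Prop :=
  (∀ Z ∈ P, ∀ W ∈ P, formC w Z W = 0) ∧
    2 * Module.finrank ℂ P = Module.finrank ℂ (ℂ ⊗[ℝ] V)

/-- `P` is a positive Lagrangian subspace: Lagrangian, and `-i w(Z, Z̄)` is a positive real number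
for every nonzero `Z ∈ P`. -/
def IsPositiveLagrangian (w : V [⋀^Fin 2]→L[ℝ] ℝ) (P : Submodule ℂ (ℂ ⊗[ℝ] V)) : Prop :=
  IsLagrangian w P ∧ ∀ Z ∈ P, Z ≠ 0 →
    0 < (-Complex.I * formC w Z (conjC Z)).re ∧ (-Complex.I * formC w Z (conjC Z)).im = 0

/-- The `(1,0)`-subspace of an endomorphism `J` of `V`: the `i`-eigenspace in `V_ℂ`. -/
def type10 (J : V →L[ℝ] V) : Submodule ℂ (ℂ ⊗[ℝ] V) :=
  Module.End.eigenspace (J.toLinearMap.baseChange ℂ) Complex.I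

/-- The `(0,1)`-subspace of an endomorphism `J` of `V`: the `-i`-eigenspace in `V_ℂ`. -/
def type01 (J : V →L[ℝ] V) : Submodule ℂ (ℂ ⊗[ℝ] V) :=
  Module.End.eigenspace (J.toLinearMap.baseChange ℂ) (-Complex.I)

/-- A map `S` from `D ⊆ ℂ` to the Grassmannian of `n`-dimensional subspaces of a complex vector
space `W` is holomorphic: near every point it is spanned by a holomorphic frame. -/
def IsHolomorphicGrassmann {W : Type*} [AddCommGroup W] [Module ℂ W] (n : ℕ)
    (S : ℂ → Submodule ℂ W) (D : Set ℂ) : Prop :=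
  ∀ w₀ ∈ D, ∃ U ∈ 𝓝 w₀, ∃ v : Fin n → ℂ → W,
    (∀ j, ∀ φ : Module.Dual ℂ W, DifferentiableOn ℂ (fun w => φ (v j w)) U) ∧
    ∀ w ∈ U, LinearIndependent ℂ (fun j => v j w) ∧ Submodule.span ℂ (range fun j => v j w) = S w

end Complexification

/-! ### The cotangent bundle, the metric and the magnetic flow -/

section Cotangent

variable {n : ℕ}

/-- The model space of the fibres of the cotangent bundle. -/
abbrev Covec (n : ℕ) : Type := EuclideanSpace ℝ (Fin n) →L[ℝ] ℝ

/-- The cotangent bundle `T*M`, with the manifold structure provided by Mathlib. -/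
abbrev Cot (n : ℕ) (M : Type*) [TopologicalSpace M] [ChartedSpace (EuclideanSpace ℝ (Fin n)) M]
    [IsManifold (𝓡 n) ω M] : Type _ :=
  TotalSpace (Covec n) (fun x : M => TangentSpace (𝓡 n) x →L[ℝ] ℝ)

/-- The model with corners of `T*M`. -/
abbrev cotModel (n : ℕ) : ModelWithCorners ℝ (EuclideanSpace ℝ (Fin n) × Covec n)
    (ModelProd (EuclideanSpace ℝ (Fin n)) (Covec n)) :=
  (𝓡 n).prod 𝓘(ℝ, Covec n)

variable {M : Type*} [TopologicalSpace M] [ChartedSpace (EuclideanSpace ℝ (Fin n)) M]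
  [IsManifold (𝓡 n) ω M]

/-- The tangent space of `T*M` at `z`. -/
abbrev TCot (z : Cot n M) : Type := TangentSpace (cotModel n) z

/-- The complexified tangent space of `T*M` at `z`. -/
abbrev TCotC (z : Cot n M) : Type := ℂ ⊗[ℝ] (TCot z)

/-- The projection `π : T*M → M`. -/
def proj (z : Cot n M) : M := z.proj

/-- A real-analytic Riemannian metric on `M`. -/
abbrev AnalyticMetric (n : ℕ) (M : Type*) [TopologicalSpace M]
    [ChartedSpace (EuclideanSpace ℝ (Fin n)) M] [IsManifold (𝓡 n) ω M] : Type _ :=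
  ContMDiffRiemannianMetric (𝓡 n) ω (EuclideanSpace ℝ (Fin n))
    (fun x : M => TangentSpace (𝓡 n) x)

theorem exists_sharp (g : AnalyticMetric n M) (x : M) (p : TangentSpace (𝓡 n) x →L[ℝ] ℝ) :
    ∃ v : TangentSpace (𝓡 n) x, g.inner x v = p := by
  have : FiniteDimensional ℝ (TangentSpace (𝓡 n) x) :=
    inferInstanceAs (FiniteDimensional ℝ (EuclideanSpace ℝ (Fin n)))
  let L : TangentSpace (𝓡 n) x →ₗ[ℝ] Module.Dual ℝ (TangentSpace (𝓡 n) x) :=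
    { toFun := fun v => (g.inner x v).toLinearMap
      map_add' := fun a b => by ext; simp
      map_smul' := fun a b => by ext; simp }
  have hinj : Function.Injective L := by
    rw [← LinearMap.ker_eq_bot, LinearMap.ker_eq_bot']
    intro v hv
    by_contra hne
    have h1 := g.pos x v hne
    have h2 : L v v = 0 := by rw [hv]; rfl
    exact (ne_of_gt h1) h2
  have hsurj : Function.Surjective L :=
    (LinearMap.injective_iff_surjective_of_finrank_eq_finrank
      (Subspace.dual_finrank_eq).symm).1 hinj
  obtain ⟨v, hv⟩ := hsurj p.toLinearMap
  exact ⟨v, by ext w; exact LinearMap.congr_fun hv w⟩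

/-- The vector `p♯` that the metric identifies with the covector `p`. -/
def sharp (g : AnalyticMetric n M) (x : M) (p : TangentSpace (𝓡 n) x →L[ℝ] ℝ) :
    TangentSpace (𝓡 n) x :=
  (exists_sharp g x p).choose

/-- The squared length `g(p, p)` of a covector `z = (x, p)`. -/
def normSq (g : AnalyticMetric n M) (z : Cot n M) : ℝ := z.snd (sharp g z.proj z.snd)

/-- The energy `E(x, p) = g(p, p) / 2`. -/
def energy (g : AnalyticMetric n M) (z : Cot n M) : ℝ := normSq g z / 2

/-- The tube `T^{*,R} M`. -/
def tube (g : AnalyticMetric n M) (R : ℝ) : Set (Cot n M) := {z | normSq g z < R ^ 2}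

/-- The canonical 1-form `θ` on `T*M`: `θ_{(x,p)}(ξ) = p(π_* ξ)`. -/
def canonicalForm : DiffForm (cotModel n) (Cot n M) 1 := fun z =>
  ContinuousAlternatingMap.ofSubsingleton ℝ (TCot z) ℝ (0 : Fin 1)
    ((z.snd : TangentSpace (𝓡 n) z.proj →L[ℝ] ℝ).comp (mfderiv (cotModel n) (𝓡 n) proj z))

/-- The pullback `π^* β` of a 2-form on `M`. -/
def pullbackForm (β : DiffForm (𝓡 n) M 2) : DiffForm (cotModel n) (Cot n M) 2 := fun z =>
  (β (proj z)).compContinuousLinearMap (mfderiv (cotModel n) (𝓡 n) proj z)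

/-- The twisted symplectic form `ω^β = -dθ - π^* β`. -/
def twistedForm (β : DiffForm (𝓡 n) M 2) : DiffForm (cotModel n) (Cot n M) 2 :=
  fun z => -DiffForm.d canonicalForm z - pullbackForm β z

/-- `X` is the Hamiltonian vector field of `E` with respect to `ω^β`: `ω^β(X, ·) = dE`. -/
def IsHamiltonianField (g : AnalyticMetric n M) (β : DiffForm (𝓡 n) M 2)
    (X : (z : Cot n M) → TCot z) : Prop :=
  ∀ (z : Cot n M) (ξ : TCot z),
    twistedForm β z ![X z, ξ] = mfderiv (cotModel n) 𝓘(ℝ, ℝ) (energy g) z ξ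

/-- `Φ` is the (complete) Hamiltonian flow of `E` with respect to `ω^β`. -/
def IsMagneticFlow (g : AnalyticMetric n M) (β : DiffForm (𝓡 n) M 2)
    (Φ : ℝ → Cot n M → Cot n M) : Prop :=
  ∃ X : (z : Cot n M) → TCot z, IsHamiltonianField g β X ∧
    ∀ z, Φ 0 z = z ∧ IsMIntegralCurve (I := cotModel n) (fun σ => Φ σ z) X

open Classical in
/-- The magnetic flow `Φ_σ` (the identity if there is no complete Hamiltonian flow). -/
def magneticFlow (g : AnalyticMetric n M) (β : DiffForm (𝓡 n) M 2) : ℝ → Cot n M → Cot n M :=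
  if h : ∃ Φ, IsMagneticFlow g β Φ then h.choose else fun _ z => z

/-- The complexified vertical subspace `V_z = (ker π_*)_ℂ`. -/
def vertical (z : Cot n M) : Submodule ℂ (TCotC z) :=
  Submodule.baseChange ℂ (LinearMap.ker (mfderiv (cotModel n) (𝓡 n) proj z).toLinearMap)

/-- The differential of `Φ_σ` at `Φ_{-σ}(z)`, as a map into the tangent space at
`z = Φ_σ(Φ_{-σ}(z))`. -/
def flowDeriv (g : AnalyticMetric n M) (β : DiffForm (𝓡 n) M 2) (z : Cot n M) (σ : ℝ) :
    TCot (magneticFlow g β (-σ) z) →L[ℝ] TCot z :=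
  (mfderiv (cotModel n) (cotModel n) (magneticFlow g β σ) (magneticFlow g β (-σ) z) :)

/-- `P_z(σ) = (Φ_σ)_* (V_{Φ_{-σ}(z)})` for real `σ`. -/
def P (g : AnalyticMetric n M) (β : DiffForm (𝓡 n) M 2) (z : Cot n M) (σ : ℝ) :
    Submodule ℂ (TCotC z) :=
  (vertical (magneticFlow g β (-σ) z)).map ((flowDeriv g β z σ).toLinearMap.baseChange ℂ)

/-- `S` is an analytic continuation of `σ ↦ P_z(σ)` to the disk of radius `ρ`, as a map into the
Grassmannian of `n`-dimensional subspaces of the complexified tangent space at `z`. -/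
def IsContinuationAt (g : AnalyticMetric n M) (β : DiffForm (𝓡 n) M 2) (z : Cot n M) (ρ : ℝ)
    (S : ℂ → Submodule ℂ (TCotC z)) : Prop :=
  IsHolomorphicGrassmann n S (Metric.ball 0 ρ) ∧ ∀ σ : ℝ, |σ| < ρ → S σ = P g β z σ

/-- A family of `n`-dimensional subspaces `Q z w` of the complexified tangent spaces of `T*M` is
real-analytic in `(z, w) ∈ D`: it has local frames whose real and imaginary parts are real-analytic
maps into the tangent bundle of `T*M`. -/
def IsAnalyticFamily (Q : (z : Cot n M) → ℂ → Submodule ℂ (TCotC z))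
    (D : Set (Cot n M × ℂ)) : Prop :=
  ∀ a ∈ D, ∃ U ∈ 𝓝 a, ∃ v : Fin n → (z : Cot n M) → ℂ → TCotC z,
    (∀ j,
      ContMDiffOn ((cotModel n).prod 𝓘(ℝ, ℂ)) (cotModel n).tangent ω
        (fun q : Cot n M × ℂ => (⟨q.1, reC (v j q.1 q.2)⟩ : TangentBundle (cotModel n) (Cot n M)))
        U ∧
      ContMDiffOn ((cotModel n).prod 𝓘(ℝ, ℂ)) (cotModel n).tangent ω
        (fun q : Cot n M × ℂ => (⟨q.1, imC (v j q.1 q.2)⟩ : TangentBundle (cotModel n) (Cot n M)))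
        U) ∧
    ∀ q ∈ U, LinearIndependent ℂ (fun j => v j q.1 q.2) ∧
      Submodule.span ℂ (range fun j => v j q.1 q.2) = Q q.1 q.2

/-- `Q z w = P_z(w)` is the analytic continuation of `σ ↦ P_z(σ)` to the disk of radius `1 + ε`,
for all `z` in the tube of radius `R`, and it is real-analytic in `(z, w)`. -/
def IsContinuation (g : AnalyticMetric n M) (β : DiffForm (𝓡 n) M 2) (R ε : ℝ)
    (Q : (z : Cot n M) → ℂ → Submodule ℂ (TCotC z)) : Prop :=
  (∀ z ∈ tube g R, IsContinuationAt g β z (1 + ε) (Q z)) ∧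
    IsAnalyticFamily Q (tube g R ×ˢ Metric.ball 0 (1 + ε))

/-! ### Complex and Kähler structures -/

/-- A field of endomorphisms of the tangent spaces of `T*M`. -/
abbrev EndField (n : ℕ) (M : Type*) [TopologicalSpace M]
    [ChartedSpace (EuclideanSpace ℝ (Fin n)) M] [IsManifold (𝓡 n) ω M] : Type _ :=
  (z : Cot n M) → (TCot z →L[ℝ] TCot z)

/-- The differential at `y` of a function on `T*M` with values in `ℂⁿ`. -/
def cDeriv (F : Cot n M → EuclideanSpace ℂ (Fin n)) (y : Cot n M) :
    TCot y →L[ℝ] EuclideanSpace ℂ (Fin n) :=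
  (mfderiv (cotModel n) 𝓘(ℝ, EuclideanSpace ℂ (Fin n)) F y :)

/-- `J` is a complex structure on the open set `T ⊆ T*M`: a smooth almost complex structure such
that around every point of `T` there are holomorphic coordinates with values in `ℂⁿ`. -/
def IsComplexStructureOn (J : EndField n M) (T : Set (Cot n M)) : Prop :=
  ContMDiffOn (cotModel n)
    ((cotModel n).prod 𝓘(ℝ, (EuclideanSpace ℝ (Fin n) × Covec n) →L[ℝ]
      (EuclideanSpace ℝ (Fin n) × Covec n))) ∞
    (fun z => TotalSpace.mk' ((EuclideanSpace ℝ (Fin n) × Covec n) →L[ℝ]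
      (EuclideanSpace ℝ (Fin n) × Covec n))
      (E := fun z : Cot n M => TCot z →L[ℝ] TCot z) z (J z)) T ∧
  (∀ z ∈ T, ∀ ξ : TCot z, J z (J z ξ) = -ξ) ∧
  ∀ z ∈ T, ∃ U : Set (Cot n M), IsOpen U ∧ z ∈ U ∧ U ⊆ T ∧
    ∃ F : Cot n M → EuclideanSpace ℂ (Fin n),
      ContMDiffOn (cotModel n) 𝓘(ℝ, EuclideanSpace ℂ (Fin n)) ∞ F U ∧ InjOn F U ∧
      ∀ y ∈ U,
        Function.Bijective (cDeriv F y) ∧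
        ∀ ξ : TCot y, cDeriv F y (J y ξ) = Complex.I • cDeriv F y ξ

/-- The complex structure `J` and the 2-form `w` together form a Kähler structure on the open set
`T`: `w` is smooth, closed, `J`-invariant, and `w(ξ, Jξ) > 0` for `ξ ≠ 0`. -/
def IsKaehlerOn (J : EndField n M) (w : DiffForm (cotModel n) (Cot n M) 2)
    (T : Set (Cot n M)) : Prop :=
  IsComplexStructureOn J T ∧ w.IsCk ∞ ∧ (∀ z ∈ T, w.d z = 0) ∧
  (∀ z ∈ T, ∀ ξ η : TCot z, w z ![J z ξ, J z η] = w z ![ξ, η]) ∧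
  ∀ z ∈ T, ∀ ξ : TCot z, ξ ≠ 0 → 0 < w z ![ξ, J z ξ]

/-- `J` is the magnetic complex structure on the tube of radius `R`: a complex structure there
whose `(1,0)`-distribution is `P_z(i)`. -/
def IsMagneticComplexStructure (g : AnalyticMetric n M) (β : DiffForm (𝓡 n) M 2) (R : ℝ)
    (J : EndField n M) : Prop :=
  IsComplexStructureOn J (tube g R) ∧
  ∀ z ∈ tube g R, ∃ ρ > 1, ∃ S : ℂ → Submodule ℂ (TCotC z),
    IsContinuationAt g β z ρ S ∧ type10 (J z) = S Complex.I

/-- The zero-section `M → T*M`. -/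
def zeroSec (x : M) : Cot n M := ⟨x, 0⟩

/-- The image of `f : M → T*M` is a maximal totally real submanifold for `J`: `f` is a smooth
embedding, and at every point the tangent space `L` of the image satisfies `L ∩ J L = 0` and
has half the dimension of the ambient space. -/
def IsMaximalTotallyReal (J : EndField n M) (f : M → Cot n M) : Prop :=
  ContMDiff (𝓡 n) (cotModel n) ∞ f ∧ Topology.IsEmbedding f ∧
  ∀ x, Function.Injective (mfderiv (𝓡 n) (cotModel n) f x) ∧
    Disjoint (LinearMap.range (mfderiv (𝓡 n) (cotModel n) f x).toLinearMap)
      ((LinearMap.range (mfderiv (𝓡 n) (cotModel n) f x).toLinearMap).map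
        (J (f x)).toLinearMap) ∧
    2 * Module.finrank ℝ (LinearMap.range (mfderiv (𝓡 n) (cotModel n) f x).toLinearMap) =
      Module.finrank ℝ (TCot (f x))

/-- Inversion in the fibres, `ν(x, p) = (x, -p)`. -/
def fiberInv (z : Cot n M) : Cot n M := ⟨z.proj, -z.snd⟩

/-- `f` maps `(T, J)` antiholomorphically to `(T', J')`: it is smooth and
`f_* ∘ J = -J' ∘ f_*`. -/
def IsAntiholomorphic (J : EndField n M) (T : Set (Cot n M)) (J' : EndField n M)
    (T' : Set (Cot n M)) (f : Cot n M → Cot n M) : Prop :=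
  MapsTo f T T' ∧ ContMDiffOn (cotModel n) (cotModel n) ∞ f T ∧
  ∀ z ∈ T, ∀ ξ : TCot z,
    mfderiv (cotModel n) (cotModel n) f z (J z ξ) =
      -J' (f z) (mfderiv (cotModel n) (cotModel n) f z ξ)

end Cotangent

end MagneticFlow

end

open MagneticFlow

set_option linter.unusedSectionVars false
set_option linter.unusedVariables false

noncomputable section

namespace MagneticFlow

/-! ### Absolutely summable sequences -/

section SummableSequences

variable {V W G : Type*} [NormedAddCommGroup V] [NormedSpace ℝ V]
  [NormedAddCommGroup W] [NormedSpace ℝ W]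
  [NormedAddCommGroup G] [NormedSpace ℝ G]

/-! The mechanism is perturbation from the zero section, where the Hamiltonian field vanishes
because `E` is quadratic in the momentum. Near a rest point the flow exists for arbitrarily long
complex times, the linearized flow at the rest point is explicit, and compactness of `M` turns
statements near each `(x, 0)` into statements on a tube.

Complex time. Fix `T > 0` and let `Y = -T X` be the rescaled Hamiltonian field in a cotangent chart.
The trajectory through `z`, as a power series in `t = σ / T`, solves `u = z + ∫ Y(u)` in the Banach
space `L1` of absolutely summable coefficient sequences. The constant series solves this at a rest
point, and the linearized equation `1 - ∫ A` is invertible whatever the size of `A`, since iterated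
integration has norm at most `1 / k!` (`L1.isUnit_one_sub_integ_map`). The analytic inverse function
theorem gives `u` depending analytically on `z` (`exists_powerSeries_flow`), and an absolutely
summable series can be evaluated on the closed complex unit disk.

Continuation of `P_z`. As `Φ_σ` has inverse `Φ_{-σ}`, the space `P_z(σ)` is the complexified kernel
of `d(π ∘ Φ_{-σ})` at `z` (`mem_PVal_iff`). In coordinates this is the kernel of `dMap u (σ / T)`,
which makes sense at complex time (`IsLocalFlow.eventually_PVal`). At a rest point the horizontal
block of `dMap` is the identity (`IsLocalFlow.horPart_rest`). By openness it stays invertible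
nearby, so the kernel is the graph of a map `graphMap` from the vertical space, holomorphic in `w`
and analytic in `(z, w)`. Continuations are unique by an identity theorem for maps into a
Grassmannian (`IsHolomorphicGrassmann.eqOn`).

Symplectic properties. At real time the kernel is isotropic because the flow preserves `ω^β` and
vertical spaces are isotropic; the identity theorem extends this to complex time
(`IsLocalFlow.eventually_isotropic`). Hence `-i ω^β(Z, Z̄)` vanishes on the graph at real time. At a
rest point its derivative in the imaginary time direction is positive: the magnetic terms recombine
into the transported covector `N`, leaving `2T (g(Re N, Re N) + g(Im N, Im N))`
(`IsLocalFlow.positivityDeriv_rest`). This persists nearby, and the mean value theorem along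
vertical segments gives `-i ω^β(Z, Z̄)` the sign of `Im w` (`IsLocalFlow.eventually_graphForm`).
Positivity also yields transversality to the conjugate.

Complex structure. Conjugating the equation of the kernel shows that `P_z(w)` is the `(1,0)`-space
of the structure for which `π ∘ Φ_{-w̄}`, read in a chart, is holomorphic (`mem_localP_iff_conj`).
Transversality makes its differential bijective, so these maps are local holomorphic coordinates and
no integrability theorem is needed. A positive Lagrangian `(1,0)`-space is exactly compatibility
with `ω^β`, which gives the Kähler property.

Zero section and fibre inversion. At `(x, 0)` a graph over the vertical space contains no nonzero
horizontal vector, so the zero section is totally real. Inversion `ν` satisfies `ν^* ω^β = -ω^{-β}`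
and preserves `E`, hence conjugates the flow of `β` to the reversed flow of `-β`. Thus `P^{-β}_{ν
z}(i) = ν_* P_z(-i)` (from `realP_neg_form` by continuation), and Schwarz reflection identifies
`P_z(-i)` with the conjugate of `P_z(i)`. -/

/-- Absolutely summable sequences in `V`, regarded as coefficients of power series. -/
abbrev L1 (V : Type*) [NormedAddCommGroup V] : Type _ := lp (fun _ : ℕ => V) 1

theorem L1.hasSum_norm (u : L1 V) : HasSum (fun m => ‖u m‖) ‖u‖ := by
  have h := lp.hasSum_norm (p := 1) (by norm_num) u
  simpa using h

theorem L1.summable_norm (u : L1 V) : Summable (fun m => ‖u m‖) := u.hasSum_norm.summable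

/-- The sequence with a single nonzero term. -/
def L1.single (m : ℕ) : V →L[ℝ] L1 V :=
  lp.singleContinuousLinearMap ℝ (fun _ : ℕ => V) 1 m

theorem L1.single_apply (m k : ℕ) (v : V) : L1.single m v k = if k = m then v else 0 := by
  simp only [L1.single, lp.singleContinuousLinearMap_apply]
  by_cases h : k = m
  · subst h; simp
  · simp [h, lp.single_apply]

theorem L1.norm_single (m : ℕ) (v : V) : ‖L1.single m v‖ = ‖v‖ := by
  simp only [L1.single, lp.singleContinuousLinearMap_apply]
  exact lp.norm_single (by norm_num) _ _

theorem L1.opNorm_single_le (m : ℕ) : ‖(L1.single m : V →L[ℝ] L1 V)‖ ≤ 1 :=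
  ContinuousLinearMap.opNorm_le_bound _ zero_le_one fun v => by rw [L1.norm_single, one_mul]

/-- Finitely supported sequences are dense for the `ℓ¹` norm. Most operator identities below are
reduced to a single monomial in this way. -/
theorem L1.ext_single {A B : L1 V →L[ℝ] G} (h : ∀ m v, A (L1.single m v) = B (L1.single m v)) :
    A = B :=
  lp.ext_continuousLinearMap (p := 1) (by norm_num) fun m => by
    ext v; exact h m v

variable [CompleteSpace G]

theorem L1.summable_apply {B : ℕ → V →L[ℝ] G} {C : ℝ} (hB : ∀ m, ‖B m‖ ≤ C) (u : L1 V) :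
    Summable fun m => B m (u m) :=
  Summable.of_norm_bounded (u.summable_norm.mul_left C) fun m => (B m).le_of_opNorm_le (hB m) _

/-- The linear map on summable sequences induced by a bounded sequence of linear maps. -/
def L1.lift (B : ℕ → V →L[ℝ] G) (C : ℝ) (hB : ∀ m, ‖B m‖ ≤ C) : L1 V →L[ℝ] G :=
  LinearMap.mkContinuous
    { toFun := fun u => ∑' m, B m (u m)
      map_add' := fun u v => by
        simp only [lp.coeFn_add, Pi.add_apply, map_add]
        exact (L1.summable_apply hB u).tsum_add (L1.summable_apply hB v)
      map_smul' := fun c u => by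
        simp only [lp.coeFn_smul, Pi.smul_apply, map_smul, RingHom.id_apply]
        exact (L1.summable_apply hB u).tsum_const_smul c } C fun u => by
    refine tsum_of_norm_bounded (u.hasSum_norm.mul_left C) fun m =>
      (B m).le_of_opNorm_le (hB m) _

theorem L1.lift_apply (B : ℕ → V →L[ℝ] G) (C : ℝ) (hB : ∀ m, ‖B m‖ ≤ C) (u : L1 V) :
    L1.lift B C hB u = ∑' m, B m (u m) := rfl

theorem L1.hasSum_lift (B : ℕ → V →L[ℝ] G) (C : ℝ) (hB : ∀ m, ‖B m‖ ≤ C) (u : L1 V) :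
    HasSum (fun m => B m (u m)) (L1.lift B C hB u) :=
  (L1.summable_apply hB u).hasSum

theorem L1.lift_single (B : ℕ → V →L[ℝ] G) (C : ℝ) (hB : ∀ m, ‖B m‖ ≤ C) (m : ℕ) (v : V) :
    L1.lift B C hB (L1.single m v) = B m v := by
  rw [L1.lift_apply, tsum_eq_single m, L1.single_apply, if_pos rfl]
  intro k hk
  rw [L1.single_apply, if_neg hk, map_zero]

theorem L1.norm_lift_le (B : ℕ → V →L[ℝ] G) (C : ℝ) (hB : ∀ m, ‖B m‖ ≤ C) :
    ‖L1.lift B C hB‖ ≤ C :=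
  LinearMap.mkContinuous_norm_le _ ((norm_nonneg _).trans (hB 0)) _

/-- The `m`-th coefficient. -/
def L1.coeff (m : ℕ) : L1 V →L[ℝ] V := lp.evalCLM ℝ (fun _ : ℕ => V) (p := 1) m

@[simp] theorem L1.coeff_apply (m : ℕ) (u : L1 V) : L1.coeff m u = u m := rfl

variable [CompleteSpace V] [CompleteSpace W]

/-- Integration of power series: `∑ aₘ tᵐ ↦ ∑ aₘ tᵐ⁺¹ / (m+1)`. -/
def L1.integ : L1 V →L[ℝ] L1 V :=
  L1.lift (fun m => ((m : ℝ) + 1)⁻¹ • L1.single (m + 1)) 1 fun m => by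
    rw [norm_smul, norm_inv, Real.norm_of_nonneg (by positivity)]
    exact mul_le_one₀ (inv_le_one_of_one_le₀ (by linarith [(Nat.cast_nonneg m : (0:ℝ) ≤ m)]))
      (norm_nonneg _) (L1.opNorm_single_le _)

theorem L1.integ_single (m : ℕ) (v : V) :
    L1.integ (L1.single m v) = L1.single (m + 1) (((m : ℝ) + 1)⁻¹ • v) := by
  rw [L1.integ, L1.lift_single, map_smul]; rfl

theorem L1.integ_zero (u : L1 V) : L1.integ u 0 = 0 := by
  have : (L1.coeff 0).comp (L1.integ (V := V)) = 0 := L1.ext_single fun m v => by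
    simp [L1.integ_single, L1.single_apply]
  exact congrArg (fun A => A u) this

theorem L1.integ_succ (u : L1 V) (k : ℕ) : L1.integ u (k + 1) = ((k : ℝ) + 1)⁻¹ • u k := by
  have : (L1.coeff (k + 1)).comp (L1.integ (V := V)) = ((k : ℝ) + 1)⁻¹ • L1.coeff k :=
    L1.ext_single fun m v => by
      simp only [ContinuousLinearMap.comp_apply, L1.integ_single, L1.coeff_apply, L1.single_apply,
        smul_apply, Nat.add_right_cancel_iff]
      split_ifs with h
      · rw [h]
      · simp
  exact congrArg (fun A => A u) this

/-- Multiplication of a power series by the variable. -/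
def L1.shift : L1 V →L[ℝ] L1 V :=
  L1.lift (fun m => L1.single (m + 1)) 1 fun m => L1.opNorm_single_le _

theorem L1.norm_shift_le : ‖(L1.shift : L1 V →L[ℝ] L1 V)‖ ≤ 1 := L1.norm_lift_le _ _ _

/-- A linear map applied coefficientwise. -/
def L1.map (A : V →L[ℝ] W) : L1 V →L[ℝ] L1 W :=
  L1.lift (fun m => (L1.single m).comp A) ‖A‖ fun m =>
    (ContinuousLinearMap.opNorm_comp_le _ _).trans
      (mul_le_of_le_one_left (norm_nonneg _) (L1.opNorm_single_le _))

theorem L1.map_single (A : V →L[ℝ] W) (m : ℕ) (v : V) :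
    L1.map A (L1.single m v) = L1.single m (A v) := L1.lift_single _ _ _ _ _

theorem L1.map_apply (A : V →L[ℝ] W) (u : L1 V) (k : ℕ) : L1.map A u k = A (u k) := by
  have : (L1.coeff k).comp (L1.map A) = A.comp (L1.coeff k) := L1.ext_single fun m v => by
    simp only [ContinuousLinearMap.comp_apply, L1.map_single, L1.coeff_apply, L1.single_apply]
    split_ifs <;> simp
  exact congrArg (fun A => A u) this

theorem L1.norm_map_le (A : V →L[ℝ] W) : ‖L1.map A‖ ≤ ‖A‖ := L1.norm_lift_le _ _ _

/-- This commutation splits `(integ * map A) ^ k` into powers of the two factors, so that the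
factorial decay of `integ ^ k` can be used. -/
theorem L1.map_integ (A : V →L[ℝ] W) : (L1.map A).comp L1.integ = L1.integ.comp (L1.map A) :=
  L1.ext_single fun m v => by
    simp [L1.integ_single, L1.map_single]

/-- The cut-off outside `|t| ≤ 1` keeps the coefficients bounded for every `t`, which makes
evaluation a total function with values in operators of norm at most one. -/
theorem L1.norm_evalCoeff_le (t : ℝ) (m : ℕ) :
    ‖(if |t| ≤ 1 then t ^ m else 0) • ContinuousLinearMap.id ℝ V‖ ≤ 1 := by
  rw [norm_smul]
  refine mul_le_one₀ ?_ (norm_nonneg _) ContinuousLinearMap.norm_id_le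
  split_ifs with ht
  · rw [norm_pow, Real.norm_eq_abs]
    exact pow_le_one₀ (abs_nonneg _) ht
  · simp

/-- Evaluation of a power series at a real point of the closed unit interval (and zero outside). -/
def L1.eval (t : ℝ) : L1 V →L[ℝ] V :=
  L1.lift (fun m => (if |t| ≤ 1 then t ^ m else 0) • ContinuousLinearMap.id ℝ V) 1
    (L1.norm_evalCoeff_le t)

theorem L1.hasSum_eval {t : ℝ} (ht : |t| ≤ 1) (u : L1 V) :
    HasSum (fun m => t ^ m • u m) (L1.eval t u) := by
  have := L1.hasSum_lift (G := V) (fun m => (if |t| ≤ 1 then t ^ m else 0) •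
    ContinuousLinearMap.id ℝ V) 1 (L1.norm_evalCoeff_le t) u
  rw [L1.eval]
  convert this using 2 with m
  rw [if_pos ht]
  rfl

theorem L1.eval_single {t : ℝ} (ht : |t| ≤ 1) (m : ℕ) (v : V) :
    L1.eval t (L1.single m v) = t ^ m • v := by
  rw [L1.eval, L1.lift_single, if_pos ht]; rfl

theorem L1.eval_zero (u : L1 V) : L1.eval 0 u = u 0 := by
  rw [← (L1.hasSum_eval (by simp) u).tsum_eq, tsum_eq_single 0 (by intro m hm; simp [hm])]
  simp

theorem L1.eval_shift {t : ℝ} (ht : |t| ≤ 1) (u : L1 V) :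
    L1.eval t (L1.shift u) = t • L1.eval t u := by
  have : (L1.eval t).comp (L1.shift (V := V)) = t • L1.eval t := L1.ext_single fun m v => by
    simp [L1.shift, L1.lift_single, L1.eval_single ht, pow_succ', mul_smul]
  exact congrArg (fun A => A u) this

theorem L1.norm_eval_le (t : ℝ) : ‖(L1.eval t : L1 V →L[ℝ] V)‖ ≤ 1 :=
  L1.norm_lift_le _ _ _

/-- The derivative of the value of an integrated power series. -/
theorem L1.hasDerivAt_eval_integ (a : L1 V) {t : ℝ} (ht : |t| < 1) :
    HasDerivAt (fun s : ℝ => L1.eval s (L1.integ a)) (L1.eval t a) t := by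
  have h1 : ∀ s ∈ Metric.ball (0 : ℝ) 1, L1.eval s (L1.integ a)
      = ∑' m : ℕ, ((((m : ℝ) + 1)⁻¹ * s ^ (m + 1)) • a m) := by
    intro s hs
    have hs : |s| ≤ 1 := by simpa using (Metric.mem_ball.1 hs).le
    have h2 := (L1.hasSum_eval hs (L1.integ a))
    rw [← h2.tsum_eq, h2.summable.tsum_eq_zero_add]
    simp [L1.integ_zero, L1.integ_succ, smul_smul, mul_comm]
  have h3 : HasDerivAt (fun s : ℝ => ∑' m : ℕ, ((((m : ℝ) + 1)⁻¹ * s ^ (m + 1)) • a m))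
      (∑' m : ℕ, t ^ m • a m) t := by
    -- The factor `1 / (m + 1)` cancels on differentiation, so the derived series is dominated by
    -- `‖a m‖` on the whole unit ball and no radius is lost.
    refine hasDerivAt_tsum_of_isPreconnected (u := fun m => ‖a m‖) (t := Metric.ball (0 : ℝ) 1)
      (g' := fun m s => s ^ m • a m) (y₀ := 0)
      a.summable_norm Metric.isOpen_ball (convex_ball _ _).isPreconnected ?_ ?_ (by simp) ?_
      (by simpa using ht)
    · intro m s hs
      have := ((hasDerivAt_pow (m + 1) s).const_mul (((m : ℝ) + 1)⁻¹)).smul_const (a m)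
      convert this using 1
      congr 1
      have : (m : ℝ) + 1 ≠ 0 := by positivity
      push_cast
      field_simp
    · intro m s hs
      have hs : |s| ≤ 1 := by simpa using (Metric.mem_ball.1 hs).le
      rw [norm_smul, norm_pow, Real.norm_eq_abs]
      exact mul_le_of_le_one_left (norm_nonneg _) (pow_le_one₀ (abs_nonneg _) hs)
    · simp [summable_zero]
  rw [(L1.hasSum_eval ht.le a).tsum_eq] at h3
  refine h3.congr_of_eventuallyEq ?_
  filter_upwards [Metric.isOpen_ball.mem_nhds (show t ∈ Metric.ball (0 : ℝ) 1 by simpa using ht)]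
    with s hs using h1 s hs

theorem norm_pow_comp_le {s : G →L[ℝ] G} (hs : ‖s‖ ≤ 1) (A : V →L[ℝ] G) (m : ℕ) :
    ‖(s ^ m).comp A‖ ≤ ‖A‖ :=
  (ContinuousLinearMap.opNorm_comp_le _ _).trans
    (mul_le_of_le_one_left (norm_nonneg _) (by
      -- The zeroth power is the identity, whose norm is at most one but may be zero on a trivial
      -- space.
      rcases Nat.eq_zero_or_pos m with rfl | hm
      · exact ContinuousLinearMap.norm_id_le
      · exact (norm_pow_le' s hm).trans (pow_le_one₀ (norm_nonneg _) hs)))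

/-- The extension of a linear map along the powers of a contraction. -/
def L1.liftPow (s : G →L[ℝ] G) (hs : ‖s‖ ≤ 1) : (V →L[ℝ] G) →L[ℝ] (L1 V →L[ℝ] G) :=
  LinearMap.mkContinuous
    { toFun := fun A => L1.lift (fun m => (s ^ m).comp A) ‖A‖ (norm_pow_comp_le hs A)
      map_add' := fun A B => L1.ext_single fun m v => by simp [L1.lift_single]
      map_smul' := fun c A => L1.ext_single fun m v => by simp [L1.lift_single] } 1
    fun A => by rw [one_mul]; exact L1.norm_lift_le _ _ (norm_pow_comp_le hs A)

theorem L1.liftPow_single (s : G →L[ℝ] G) (hs : ‖s‖ ≤ 1) (A : V →L[ℝ] G) (m : ℕ) (v : V) :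
    L1.liftPow s hs A (L1.single m v) = (s ^ m) (A v) :=
  L1.lift_single _ _ (norm_pow_comp_le hs A) _ _

theorem L1.norm_liftPow_le (s : G →L[ℝ] G) (hs : ‖s‖ ≤ 1) :
    ‖(L1.liftPow s hs : (V →L[ℝ] G) →L[ℝ] (L1 V →L[ℝ] G))‖ ≤ 1 :=
  LinearMap.mkContinuous_norm_le _ zero_le_one _

theorem norm_compContinuousMultilinearMapL_le (s : W →L[ℝ] G) (k : ℕ) :
    ‖ContinuousLinearMap.compContinuousMultilinearMapL ℝ (fun _ : Fin k => V) W G s‖ ≤ ‖s‖ :=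
  ContinuousLinearMap.opNorm_le_bound _ (norm_nonneg _) fun f =>
    s.norm_compContinuousMultilinearMap_le f

/-- The extension of a multilinear map to power series, by the Cauchy product. -/
def L1.extend : (k : ℕ) → (V [×k]→L[ℝ] W) →L[ℝ] (L1 V [×k]→L[ℝ] L1 W)
  | 0 => (((continuousMultilinearCurryFin0 ℝ (L1 V) (L1 W)).symm.toContinuousLinearEquiv :
            L1 W →L[ℝ] _).comp (L1.single 0)).comp
          ((continuousMultilinearCurryFin0 ℝ V W).toContinuousLinearEquiv :
            (V [×0]→L[ℝ] W) →L[ℝ] W)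
  -- Peel off the first argument: the monomial `t ^ m v` must give `t ^ m` times the extension of
  -- the curried map `f v`. Multiplication by `t ^ m` is the `m`-th power of the shift on the
  -- target, a contraction, so `liftPow` extends this from monomials to `L1 V`.
  | (k + 1) =>
      (((continuousMultilinearCurryLeftEquiv ℝ (fun _ : Fin (k + 1) => L1 V)
            (L1 W)).symm.toContinuousLinearEquiv : _ →L[ℝ] (L1 V [×(k + 1)]→L[ℝ] L1 W)).comp
        (L1.liftPow (V := V) (ContinuousLinearMap.compContinuousMultilinearMapL ℝ
          (fun _ : Fin k => L1 V) (L1 W) (L1 W) L1.shift)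
          ((norm_compContinuousMultilinearMapL_le _ _).trans L1.norm_shift_le))).comp
      ((ContinuousLinearMap.compL ℝ V (V [×k]→L[ℝ] W) (L1 V [×k]→L[ℝ] L1 W) (L1.extend k)).comp
        ((continuousMultilinearCurryLeftEquiv ℝ (fun _ : Fin (k + 1) => V)
            W).toContinuousLinearEquiv : (V [×(k + 1)]→L[ℝ] W) →L[ℝ] _))

/-- Each step of the recursion is composed of isometries and maps of norm at most one. Since no
constant is lost with the degree, a Taylor series keeps at least its radius of convergence after
extension. -/
theorem L1.norm_extend_le (k : ℕ) (f : V [×k]→L[ℝ] W) : ‖L1.extend k f‖ ≤ ‖f‖ := by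
  induction k with
  | zero =>
    simp only [L1.extend, ContinuousLinearMap.comp_apply]
    refine ((LinearIsometryEquiv.norm_map _ _).trans (L1.norm_single _ _)).le.trans ?_
    exact (LinearIsometryEquiv.norm_map _ _).le
  | succ k ih =>
    simp only [L1.extend, ContinuousLinearMap.comp_apply]
    refine (LinearIsometryEquiv.norm_map _ _).le.trans ?_
    refine (ContinuousLinearMap.le_of_opNorm_le _ (L1.norm_liftPow_le _ _) _).trans ?_
    rw [one_mul]
    refine ContinuousLinearMap.opNorm_le_bound _ (norm_nonneg _) fun v => ?_
    refine (ih _).trans ?_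
    refine (ContinuousLinearMap.le_opNorm _ v).trans ?_
    exact mul_le_mul_of_nonneg_right (LinearIsometryEquiv.norm_map _ _).le (norm_nonneg _)

/-- Evaluation at `t` turns multiplication by the variable into multiplication by `t`, hence Cauchy
products into pointwise values. This ties the extended analytic map to the original one. -/
theorem L1.eval_extend {t : ℝ} (ht : |t| ≤ 1) (k : ℕ) (f : V [×k]→L[ℝ] W) (u : Fin k → L1 V) :
    L1.eval t (L1.extend k f u) = f fun i => L1.eval t (u i) := by
  induction k with
  | zero =>
    have : L1.extend 0 f u = L1.single 0 (f 0) := rfl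
    rw [this, L1.eval_single ht, pow_zero, one_smul]
    congr 1
    exact Subsingleton.elim _ _
  | succ k ih =>
    have key : (L1.eval t).comp ((ContinuousMultilinearMap.apply ℝ (fun _ : Fin k => L1 V) (L1 W)
          (Fin.tail u)).comp ((continuousMultilinearCurryLeftEquiv ℝ (fun _ : Fin (k + 1) => L1 V)
            (L1 W)) (L1.extend (k + 1) f)))
        = (((ContinuousMultilinearMap.apply ℝ (fun _ : Fin k => V) W
          (fun i => L1.eval t (Fin.tail u i))).comp
            (continuousMultilinearCurryLeftEquiv ℝ (fun _ : Fin (k + 1) => V) W f)).comp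
              (L1.eval t)) := by
      refine L1.ext_single fun m v => ?_
      have h1 : (continuousMultilinearCurryLeftEquiv ℝ (fun _ : Fin (k + 1) => L1 V)
            (L1 W)) (L1.extend (k + 1) f) (L1.single m v) =
          ((ContinuousLinearMap.compContinuousMultilinearMapL ℝ
            (fun _ : Fin k => L1 V) (L1 W) (L1 W) L1.shift) ^ m) (L1.extend k
              (continuousMultilinearCurryLeftEquiv ℝ (fun _ : Fin (k + 1) => V) W f v)) := by
        simp only [L1.extend, ContinuousLinearMap.comp_apply]
        erw [LinearIsometryEquiv.apply_symm_apply, L1.liftPow_single]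
        rfl
      have h2 : ∀ (g : L1 V [×k]→L[ℝ] L1 W) (x : Fin k → L1 V),
          L1.eval t ((((ContinuousLinearMap.compContinuousMultilinearMapL ℝ
            (fun _ : Fin k => L1 V) (L1 W) (L1 W) L1.shift) ^ m) g) x) = t ^ m • L1.eval t (g x) := by
        intro g x
        clear h1
        induction m with
        | zero => simp
        | succ m ihm =>
          rw [pow_succ', pow_succ', mul_smul, ← ihm, ← L1.eval_shift ht]
          rfl
      simp only [ContinuousLinearMap.comp_apply, ContinuousMultilinearMap.apply_apply]
      rw [h1, h2, ih, L1.eval_single ht]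
      simp [map_smul]
    have h3 := congrArg (fun A => A (u 0)) key
    simp only [ContinuousLinearMap.comp_apply, ContinuousMultilinearMap.apply_apply] at h3
    rw [continuousMultilinearCurryLeftEquiv_apply, continuousMultilinearCurryLeftEquiv_apply] at h3
    rw [show Fin.cons (u 0) (Fin.tail u) = u from Fin.cons_self_tail u] at h3
    rw [h3]
    congr 1
    ext i
    refine Fin.cases ?_ (fun j => ?_) i <;> simp [Fin.tail]

/-- Needed to identify the derivative of the extended analytic map at a constant series with the
coefficientwise derivative. -/
theorem L1.extend_one_apply (f : V [×1]→L[ℝ] W) (u : Fin 1 → L1 V) :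
    L1.extend 1 f u = L1.map (continuousMultilinearCurryFin1 ℝ V W f) (u 0) := by
  have key : (ContinuousMultilinearMap.apply ℝ (fun _ : Fin 0 => L1 V) (L1 W)
          (Fin.tail u)).comp ((continuousMultilinearCurryLeftEquiv ℝ (fun _ : Fin (0 + 1) => L1 V)
            (L1 W)) (L1.extend (0 + 1) f)) = L1.map (continuousMultilinearCurryFin1 ℝ V W f) := by
    refine L1.ext_single fun m v => ?_
    have h1 : (continuousMultilinearCurryLeftEquiv ℝ (fun _ : Fin (0 + 1) => L1 V)
          (L1 W)) (L1.extend (0 + 1) f) (L1.single m v) =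
        ((ContinuousLinearMap.compContinuousMultilinearMapL ℝ
          (fun _ : Fin 0 => L1 V) (L1 W) (L1 W) L1.shift) ^ m) (L1.extend 0
            (continuousMultilinearCurryLeftEquiv ℝ (fun _ : Fin (0 + 1) => V) W f v)) := by
      simp only [L1.extend, ContinuousLinearMap.comp_apply]
      erw [LinearIsometryEquiv.apply_symm_apply, L1.liftPow_single]
      rfl
    simp only [ContinuousLinearMap.comp_apply, ContinuousMultilinearMap.apply_apply]
    rw [h1, L1.map_single]
    have h2 : ∀ (g : L1 V [×0]→L[ℝ] L1 W) (x : Fin 0 → L1 V),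
        ((((ContinuousLinearMap.compContinuousMultilinearMapL ℝ
          (fun _ : Fin 0 => L1 V) (L1 W) (L1 W) L1.shift) ^ m) g) x) = (L1.shift ^ m) (g x) := by
      intro g x
      clear h1
      induction m with
      | zero => simp
      | succ m ihm =>
        rw [pow_succ', pow_succ']
        exact congrArg L1.shift ihm
    rw [h2]
    have h3 : ∀ v : W, (L1.shift ^ m) (L1.single 0 v) = L1.single m v := by
      intro v
      clear h1 h2
      induction m with
      | zero => simp
      | succ m ihm =>
        rw [pow_succ']
        refine (congrArg L1.shift ihm).trans ?_
        rw [L1.shift, L1.lift_single]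
    erw [h3]
    congr 1
    simp only [continuousMultilinearCurryFin1_apply]
    erw [continuousMultilinearCurryLeftEquiv_apply]
    congr 1
    ext i
    fin_cases i
    rfl
  have h3 := congrArg (fun A => A (u 0)) key
  simp only [ContinuousLinearMap.comp_apply, ContinuousMultilinearMap.apply_apply] at h3
  rw [continuousMultilinearCurryLeftEquiv_apply] at h3
  rw [show Fin.cons (u 0) (Fin.tail u) = u from Fin.cons_self_tail u] at h3
  exact h3

end SummableSequences

/-! ### Power series solutions of analytic differential equations near a rest point -/

section AnalyticFlow

variable {V W : Type*} [NormedAddCommGroup V] [NormedSpace ℝ V] [CompleteSpace V]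
  [NormedAddCommGroup W] [NormedSpace ℝ W] [CompleteSpace W]

/-- A real-analytic map acts on power series whose values are close to the base point. -/
theorem L1.exists_analytic_extension {Y : V → W} {z₀ : V} (hY : AnalyticAt ℝ Y z₀) :
    ∃ Yhat : L1 V → L1 W, AnalyticAt ℝ Yhat (L1.single 0 z₀) ∧
      HasFDerivAt Yhat (L1.map (fderiv ℝ Y z₀)) (L1.single 0 z₀) ∧
      Yhat (L1.single 0 z₀) = L1.single 0 (Y z₀) ∧
      ∀ᶠ u in 𝓝 (L1.single 0 z₀), ∀ t : ℝ, |t| ≤ 1 → L1.eval t (Yhat u) = Y (L1.eval t u) := by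
  obtain ⟨p, r, hp⟩ := hY
  let q : FormalMultilinearSeries ℝ (L1 V) (L1 W) := fun k => L1.extend k (p k)
  -- The Taylor series of `Y` is extended degree by degree; by `L1.norm_extend_le` it converges on a
  -- ball at least as large.
  have hrad : p.radius ≤ q.radius :=
    FormalMultilinearSeries.radius_le_of_le fun {k} => L1.norm_extend_le k (p k)
  have hpos : 0 < q.radius := hp.r_pos.trans_le (hp.r_le.trans hrad)
  have hq : HasFPowerSeriesOnBall (fun u => q.sum (u - L1.single 0 z₀)) q (L1.single 0 z₀)
      q.radius := by
    simpa using (q.hasFPowerSeriesOnBall hpos).comp_sub (L1.single 0 z₀)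
  refine ⟨fun u => q.sum (u - L1.single 0 z₀), hq.analyticAt, ?_, ?_, ?_⟩
  · have h1 := hq.hasFPowerSeriesAt.hasFDerivAt
    have h2 : L1.map (fderiv ℝ Y z₀) = continuousMultilinearCurryFin1 ℝ (L1 V) (L1 W) (q 1) := by
      rw [hp.hasFPowerSeriesAt.fderiv_eq]
      refine ContinuousLinearMap.ext fun u => ?_
      exact (L1.extend_one_apply (p 1) (fun _ => u)).symm
    rw [h2]
    exact h1
  · have h1 := hq.coeff_zero 0
    rw [← hp.coeff_zero 0]
    exact h1.symm
  · have h1 : ∀ᶠ u in 𝓝 (L1.single 0 z₀), u ∈ Metric.eball (L1.single 0 z₀) r :=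
      Metric.isOpen_eball.mem_nhds (Metric.mem_eball_self hp.r_pos)
    filter_upwards [h1] with u hu t ht
    set h := u - L1.single 0 z₀ with hh
    have hu' : h ∈ Metric.eball (0 : L1 V) r := by
      simpa [Metric.mem_eball, edist_eq_enorm_sub, hh] using hu
    have h2 : HasSum (fun k => q k fun _ => h) (q.sum h) :=
      q.hasSum (Metric.eball_subset_eball (hp.r_le.trans hrad) hu')
    have h3 := (L1.eval t : L1 W →L[ℝ] W).hasSum h2
    -- Evaluation has norm at most one, so the evaluated increment stays in the ball where the
    -- Taylor series of `Y` represents `Y`.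
    have hu2 : L1.eval t h ∈ Metric.eball (0 : V) r := by
      rw [Metric.mem_eball, edist_zero_right] at hu' ⊢
      refine lt_of_le_of_lt ?_ hu'
      rw [enorm_le_iff_norm_le]
      simpa using ContinuousLinearMap.le_of_opNorm_le _ (L1.norm_eval_le t) h
    have h4 := hp.hasSum hu2
    have h5 : z₀ + L1.eval t h = L1.eval t u := by
      rw [hh, map_sub, L1.eval_single ht]; simp
    rw [h5] at h4
    refine h3.unique ?_
    convert h4 using 2 with k
    exact L1.eval_extend ht k (p k) fun _ => h

/-- Evaluation is 1-Lipschitz uniformly in `t`, so convergence in `L1` to the constant series is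
uniform convergence of whole trajectories to the rest point. -/
theorem eventually_eval_of_tendsto {X : Type*} {l : Filter X} {u : X → L1 V} {z₀ : V}
    (hu : Filter.Tendsto u l (𝓝 (L1.single 0 z₀))) {Q : V → Prop} (hQ : ∀ᶠ y in 𝓝 z₀, Q y) :
    ∀ᶠ x in l, ∀ t : ℝ, |t| ≤ 1 → Q (L1.eval t (u x)) := by
  obtain ⟨δ, hδ, hball⟩ := Metric.eventually_nhds_iff.1 hQ
  filter_upwards [hu.eventually (Metric.ball_mem_nhds _ hδ)] with x hx t ht
  apply hball
  have h1 : L1.eval t (u x) - z₀ = L1.eval t (u x - L1.single 0 z₀) := by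
    rw [map_sub, L1.eval_single ht, pow_zero, one_smul]
  rw [dist_eq_norm, h1]
  refine lt_of_le_of_lt (ContinuousLinearMap.le_of_opNorm_le _ (L1.norm_eval_le t) _) ?_
  rwa [one_mul, ← dist_eq_norm]

/-- On `ℓ¹` an operator norm is the supremum over monomials. -/
theorem L1.opNorm_le_of_single {A : L1 V →L[ℝ] W} {C : ℝ}
    (h : ∀ m v, ‖A (L1.single m v)‖ ≤ C * ‖v‖) (hC : 0 ≤ C) : ‖A‖ ≤ C := by
  have hB : ∀ m, ‖A.comp (L1.single m)‖ ≤ C := fun m =>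
    ContinuousLinearMap.opNorm_le_bound _ hC (h m)
  have : A = L1.lift (fun m => A.comp (L1.single m)) C hB :=
    L1.ext_single fun m v => by rw [L1.lift_single]; rfl
  rw [this]
  exact L1.norm_lift_le _ _ _

theorem L1.integ_pow_single (k m : ℕ) (v : V) :
    (L1.integ ^ k : L1 V →L[ℝ] L1 V) (L1.single m v) =
      ((m.factorial : ℝ) / (m + k).factorial) • L1.single (m + k) v := by
  induction k generalizing m v with
  | zero => simp [div_self (Nat.cast_ne_zero.2 (Nat.factorial_ne_zero m) : (m.factorial : ℝ) ≠ 0)]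
  | succ k ih =>
    rw [pow_succ]
    change (L1.integ ^ k : L1 V →L[ℝ] L1 V) (L1.integ (L1.single m v)) = _
    rw [L1.integ_single, ih, map_smul, smul_smul, Nat.factorial_succ m,
      show m + 1 + k = m + (k + 1) by ring]
    congr 1
    have : (m : ℝ) + 1 ≠ 0 := by positivity
    push_cast
    field_simp

/-- On a monomial of degree `m` the factor is `m! / (m + k)!`, and `m! k!` divides `(m + k)!`. -/
theorem L1.norm_integ_pow_le (k : ℕ) : ‖(L1.integ ^ k : L1 V →L[ℝ] L1 V)‖ ≤ 1 / k.factorial := by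
  refine L1.opNorm_le_of_single (fun m v => ?_) (by positivity)
  rw [L1.integ_pow_single, norm_smul, L1.norm_single]
  refine mul_le_mul_of_nonneg_right ?_ (norm_nonneg _)
  rw [Real.norm_of_nonneg (by positivity), div_le_div_iff₀ (by positivity) (by positivity)]
  have := Nat.le_of_dvd (Nat.factorial_pos _) (Nat.factorial_mul_factorial_dvd_factorial_add m k)
  rw [one_mul]
  exact_mod_cast this

/-- A Volterra operator is quasi-nilpotent, so `A` need not be small. This is why every time scale
`T` is allowed below, provided the initial point is close enough to the rest point. -/
theorem L1.isUnit_one_sub_integ_map (A : V →L[ℝ] V) :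
    IsUnit (1 - L1.integ * L1.map A : L1 V →L[ℝ] L1 V) := by
  set N : L1 V →L[ℝ] L1 V := L1.integ * L1.map A with hN
  have hcomm : Commute (L1.integ : L1 V →L[ℝ] L1 V) (L1.map A) := (L1.map_integ A).symm
  have hbound : ∀ k, 0 < k → ‖N ^ k‖ ≤ ‖A‖ ^ k / k.factorial := by
    intro k hk
    rw [hN, hcomm.mul_pow]
    refine (norm_mul_le _ _).trans ?_
    rw [div_eq_inv_mul, ← one_div]
    exact mul_le_mul (L1.norm_integ_pow_le k)
      ((norm_pow_le' _ hk).trans (pow_le_pow_left₀ (norm_nonneg _) (L1.norm_map_le A) k))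
      (norm_nonneg _) (by positivity)
  have hlim := FloorSemiring.tendsto_pow_div_factorial_atTop (‖A‖)
  obtain ⟨k, hk, hk0⟩ := ((hlim.eventually (gt_mem_nhds (zero_lt_one' ℝ))).and
    (Filter.eventually_gt_atTop 0)).exists
  have h1 : IsUnit (1 - N ^ k) := isUnit_one_sub_of_norm_lt_one ((hbound k hk0).trans_lt hk)
  -- `1 - N` is a factor of the unit `1 - N ^ k` and commutes with the complementary geometric sum,
  -- hence is itself a unit.
  rw [← mul_neg_geom_sum] at h1
  have hc : Commute (1 - N) (∑ i ∈ Finset.range k, N ^ i) := by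
    refine Commute.sum_right _ _ _ fun i _ => ?_
    exact (Commute.one_left _).sub_left ((Commute.refl N).pow_right i)
  exact (hc.isUnit_mul_iff.1 h1).1

/-- Near a zero of a real-analytic vector field, the flow is given on the time interval `[-1, 1]`
by absolutely convergent power series in time that depend analytically on the initial point. -/
theorem exists_powerSeries_flow {Y : V → V} {z₀ : V} (hY : AnalyticAt ℝ Y z₀) (h0 : Y z₀ = 0) :
    ∃ u : V → L1 V, AnalyticAt ℝ u z₀ ∧ u z₀ = L1.single 0 z₀ ∧
      (∀ᶠ z in 𝓝 z₀, (u z) 0 = z ∧ ∀ t : ℝ, |t| < 1 →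
        HasDerivAt (fun t => L1.eval t (u z)) (Y (L1.eval t (u z))) t) ∧
      (∀ᶠ z in 𝓝 z₀, ∀ ξ, (fderiv ℝ u z ξ) 0 = ξ ∧ ∀ t : ℝ, |t| < 1 →
        HasDerivAt (fun t => L1.eval t (fderiv ℝ u z ξ))
          (fderiv ℝ Y (L1.eval t (u z)) (L1.eval t (fderiv ℝ u z ξ))) t) ∧
      (∀ ξ, (fderiv ℝ u z₀ ξ) 0 = ξ ∧ ∀ m : ℕ, (fderiv ℝ u z₀ ξ) (m + 1)
        = ((m : ℝ) + 1)⁻¹ • fderiv ℝ Y z₀ ((fderiv ℝ u z₀ ξ) m)) := by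
  obtain ⟨Yhat, hYa, hYd, hY0, hYe⟩ := L1.exists_analytic_extension hY
  set u₀ : L1 V := L1.single 0 z₀ with hu₀
  set A := fderiv ℝ Y z₀ with hA
  -- Picard's integral equation in `L1` reads `F u = z`, with `z` a constant series. As `Y z₀ = 0`,
  -- the constant series at `z₀` is a solution, around which `F` is inverted.
  let F : L1 V → L1 V := fun u => u - L1.integ (Yhat u)
  have hF0 : F u₀ = u₀ := by simp [F, hY0, h0]
  have hFa : AnalyticAt ℝ F u₀ :=
    analyticAt_id.sub (((L1.integ : L1 V →L[ℝ] L1 V).analyticAt (Yhat u₀)).fun_comp hYa)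
  obtain ⟨U, hU⟩ := L1.isUnit_one_sub_integ_map A
  let e : L1 V ≃L[ℝ] L1 V := ContinuousLinearEquiv.unitsEquiv ℝ (L1 V) U
  have he : (e : L1 V →L[ℝ] L1 V) = 1 - L1.integ * L1.map A := by rw [← hU]; rfl
  have hFd : HasFDerivAt F (e : L1 V →L[ℝ] L1 V) u₀ := by
    rw [he]
    exact (hasFDerivAt_id u₀).sub (L1.integ.hasFDerivAt.comp u₀ hYd)
  have hFc : ContDiffAt ℝ ω F u₀ := hFa.contDiffAt
  let S := hFc.localInverse hFd (by simp)
  have hS0 : S u₀ = u₀ := by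
    have := hFc.localInverse_apply_image hFd (by simp)
    rwa [hF0] at this
  have hSc : ContDiffAt ℝ ω S u₀ := by
    have := hFc.to_localInverse hFd (by simp)
    rwa [hF0] at this
  have hright : ∀ᶠ v in 𝓝 u₀, F (S v) = v := by
    have := (hFc.hasStrictFDerivAt' hFd (by simp)).eventually_right_inverse
    rwa [hF0] at this
  have hSa : AnalyticAt ℝ S u₀ := hSc.analyticAt
  let u : V → L1 V := fun z => S (L1.single 0 z)
  have hua : AnalyticAt ℝ u z₀ := hSa.comp ((L1.single 0).analyticAt z₀)
  have htend : Filter.Tendsto (fun z : V => (L1.single 0 z : L1 V)) (𝓝 z₀) (𝓝 u₀) :=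
    (L1.single 0 : V →L[ℝ] L1 V).continuous.tendsto z₀
  have hu0 : u z₀ = u₀ := hS0
  have hFu : ∀ᶠ z in 𝓝 z₀, u z = L1.single 0 z + L1.integ (Yhat (u z)) := by
    filter_upwards [htend.eventually hright] with z hz
    exact sub_eq_iff_eq_add.1 hz
  have hutend : Filter.Tendsto u (𝓝 z₀) (𝓝 u₀) := hu0 ▸ hua.continuousAt.tendsto
  -- Differentiating the integral equation in the initial point gives the integrated variational
  -- equation.
  have hderiv : ∀ᶠ z in 𝓝 z₀, ∀ ξ, fderiv ℝ u z ξ =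
      L1.single 0 ξ + L1.integ (fderiv ℝ Yhat (u z) (fderiv ℝ u z ξ)) := by
    filter_upwards [hFu.eventually_nhds, hua.eventually_analyticAt,
      hutend.eventually hYa.eventually_analyticAt] with z hz hz1 hz2 ξ
    have h1 : HasFDerivAt u (fderiv ℝ u z) z := hz1.differentiableAt.hasFDerivAt
    have h2 : HasFDerivAt (fun z => (L1.single 0 z : L1 V) + L1.integ (Yhat (u z)))
        ((L1.single 0 : V →L[ℝ] L1 V) +
          L1.integ.comp ((fderiv ℝ Yhat (u z)).comp (fderiv ℝ u z))) z :=
      (L1.single 0 : V →L[ℝ] L1 V).hasFDerivAt.add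
        (L1.integ.hasFDerivAt.comp z (hz2.differentiableAt.hasFDerivAt.comp z h1))
    have h3 := (h2.congr_of_eventuallyEq hz).unique h1
    exact (congrArg (fun B : V →L[ℝ] L1 V => B ξ) h3).symm
  refine ⟨u, hua, hu0, ?_, ?_, ?_⟩
  · filter_upwards [hFu, hutend.eventually hYe] with z hz hz'
    refine ⟨?_, fun t ht => ?_⟩
    · rw [hz, lp.coeFn_add, Pi.add_apply, L1.integ_zero, add_zero, L1.single_apply, if_pos rfl]
    · rw [← hz' t ht.le]
      have h1 := (L1.hasDerivAt_eval_integ (Yhat (u z)) ht).const_add z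
      refine h1.congr_of_eventuallyEq ?_
      have ht' : ∀ᶠ s : ℝ in 𝓝 t, |s| < 1 := (continuous_abs.tendsto t).eventually (gt_mem_nhds ht)
      filter_upwards [ht'] with s hs
      conv_lhs => rw [hz, map_add, L1.eval_single hs.le, pow_zero, one_smul]
  · filter_upwards [hderiv, hutend.eventually hYe.eventually_nhds,
      hutend.eventually hYa.eventually_analyticAt,
      eventually_eval_of_tendsto hutend hY.eventually_analyticAt] with z hz hz1 hz2 hz3 ξ
    refine ⟨?_, fun t ht => ?_⟩
    · rw [hz ξ, lp.coeFn_add, Pi.add_apply, L1.integ_zero, add_zero, L1.single_apply, if_pos rfl]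
    · set h := fderiv ℝ u z ξ with hh
      -- The identity between the extension and `Y` holds on an open set of series, so it may be
      -- differentiated there.
      have h1 : L1.eval t (fderiv ℝ Yhat (u z) h) = fderiv ℝ Y (L1.eval t (u z)) (L1.eval t h) := by
        have h2 : HasFDerivAt (fun v => L1.eval t (Yhat v))
            ((L1.eval t).comp (fderiv ℝ Yhat (u z))) (u z) :=
          (L1.eval t : L1 V →L[ℝ] V).hasFDerivAt.comp (u z) hz2.differentiableAt.hasFDerivAt
        have h3 : HasFDerivAt (fun v => Y (L1.eval t v))
            ((fderiv ℝ Y (L1.eval t (u z))).comp (L1.eval t)) (u z) :=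
          (hz3 t ht.le).differentiableAt.hasFDerivAt.comp (u z)
            (L1.eval t : L1 V →L[ℝ] V).hasFDerivAt
        have h4 : (fun v => L1.eval t (Yhat v)) =ᶠ[𝓝 (u z)] fun v => Y (L1.eval t v) := by
          filter_upwards [hz1] with v hv using hv t ht.le
        exact congrArg (fun B : L1 V →L[ℝ] V => B h) (h2.unique (h3.congr_of_eventuallyEq h4))
      rw [← h1]
      have h2 := (L1.hasDerivAt_eval_integ (fderiv ℝ Yhat (u z) h) ht).const_add ξ
      refine h2.congr_of_eventuallyEq ?_
      have ht' : ∀ᶠ s : ℝ in 𝓝 t, |s| < 1 := (continuous_abs.tendsto t).eventually (gt_mem_nhds ht)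
      filter_upwards [ht'] with s hs
      conv_lhs => rw [hh, hz ξ, ← hh, map_add, L1.eval_single hs.le, pow_zero, one_smul]
  · intro ξ
    have h4 := hderiv.self_of_nhds ξ
    rw [hu0, hYd.fderiv] at h4
    refine ⟨?_, fun m => ?_⟩
    · rw [h4, lp.coeFn_add, Pi.add_apply, L1.integ_zero, add_zero, L1.single_apply, if_pos rfl]
    · conv_lhs => rw [h4, lp.coeFn_add, Pi.add_apply, L1.integ_succ, L1.map_apply,
        L1.single_apply, if_neg (Nat.succ_ne_zero m), zero_add]

end AnalyticFlow

/-! ### Real and imaginary parts in a complexified vector space -/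

section ComplexificationLemmas

variable {V W : Type*} [AddCommGroup V] [Module ℝ V] [AddCommGroup W] [Module ℝ W]

/-- The element `X + iY` of the complexification. -/
def mkC (X Y : V) : ℂ ⊗[ℝ] V := (1 : ℂ) ⊗ₜ[ℝ] X + Complex.I ⊗ₜ[ℝ] Y

@[simp] theorem reC_tmul (a : ℂ) (X : V) : reC (a ⊗ₜ[ℝ] X) = a.re • X := by
  simp [reC]

@[simp] theorem imC_tmul (a : ℂ) (X : V) : imC (a ⊗ₜ[ℝ] X) = a.im • X := by
  simp [imC]

@[simp] theorem conjC_tmul (a : ℂ) (X : V) :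
    conjC (a ⊗ₜ[ℝ] X) = (starRingEnd ℂ a) ⊗ₜ[ℝ] X := by
  simp [conjC]

@[simp] theorem reC_mkC (X Y : V) : reC (mkC X Y) = X := by simp [mkC]

@[simp] theorem imC_mkC (X Y : V) : imC (mkC X Y) = Y := by simp [mkC]

theorem mkC_reC_imC (Z : ℂ ⊗[ℝ] V) : mkC (reC Z) (imC Z) = Z := by
  induction Z with
  | zero => simp [mkC]
  | tmul a X =>
    simp only [mkC, reC_tmul, imC_tmul, ← TensorProduct.smul_tmul, ← TensorProduct.add_tmul]
    congr 1
    apply Complex.ext <;> simp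
  | add Z Z' h h' =>
    conv_rhs => rw [← h, ← h']
    simp only [mkC, map_add, TensorProduct.tmul_add]
    abel

theorem extC {Z Z' : ℂ ⊗[ℝ] V} (h : reC Z = reC Z') (h' : imC Z = imC Z') : Z = Z' := by
  rw [← mkC_reC_imC Z, ← mkC_reC_imC Z', h, h']

theorem eq_zero_iffC {Z : ℂ ⊗[ℝ] V} : Z = 0 ↔ reC Z = 0 ∧ imC Z = 0 :=
  ⟨fun h => by simp [h], fun h => extC (by simp [h.1]) (by simp [h.2])⟩

@[simp] theorem reC_conjC (Z : ℂ ⊗[ℝ] V) : reC (conjC Z) = reC Z := by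
  rw [← mkC_reC_imC Z]; simp [mkC]

@[simp] theorem imC_conjC (Z : ℂ ⊗[ℝ] V) : imC (conjC Z) = -imC Z := by
  rw [← mkC_reC_imC Z]; simp [mkC]

@[simp] theorem conjC_conjC (Z : ℂ ⊗[ℝ] V) : conjC (conjC Z) = Z := extC (by simp) (by simp)

theorem reC_smul (a : ℂ) (Z : ℂ ⊗[ℝ] V) : reC (a • Z) = a.re • reC Z - a.im • imC Z := by
  rw [← mkC_reC_imC Z]
  simp [mkC, TensorProduct.smul_tmul', sub_eq_add_neg]

theorem imC_smul (a : ℂ) (Z : ℂ ⊗[ℝ] V) : imC (a • Z) = a.re • imC Z + a.im • reC Z := by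
  rw [← mkC_reC_imC Z]
  simp [mkC, TensorProduct.smul_tmul', add_comm]

theorem conjC_smul (a : ℂ) (Z : ℂ ⊗[ℝ] V) : conjC (a • Z) = (starRingEnd ℂ a) • conjC Z :=
  extC (by simp [reC_smul]) (by simp [imC_smul, add_comm])

@[simp] theorem reC_baseChange (f : V →ₗ[ℝ] W) (Z : ℂ ⊗[ℝ] V) :
    reC (f.baseChange ℂ Z) = f (reC Z) := by
  rw [← mkC_reC_imC Z]; simp [mkC]

@[simp] theorem imC_baseChange (f : V →ₗ[ℝ] W) (Z : ℂ ⊗[ℝ] V) :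
    imC (f.baseChange ℂ Z) = f (imC Z) := by
  rw [← mkC_reC_imC Z]; simp [mkC]

/-- Complex conjugation of subspaces. -/
def conjSubmodule (P : Submodule ℂ (ℂ ⊗[ℝ] V)) : Submodule ℂ (ℂ ⊗[ℝ] V) where
  carrier := {Z | conjC Z ∈ P}
  add_mem' := fun {a b} ha hb => by
    simp only [mem_ofPred_eq, map_add] at *
    exact P.add_mem ha hb
  zero_mem' := by simp
  smul_mem' := fun c x hx => by
    simp only [mem_ofPred_eq, conjC_smul] at *
    exact P.smul_mem _ hx

@[simp] theorem mem_conjSubmodule {P : Submodule ℂ (ℂ ⊗[ℝ] V)} {Z : ℂ ⊗[ℝ] V} :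
    Z ∈ conjSubmodule P ↔ conjC Z ∈ P := Iff.rfl

theorem mem_baseChange_iff (p : Submodule ℝ V) (Z : ℂ ⊗[ℝ] V) :
    Z ∈ p.baseChange ℂ ↔ reC Z ∈ p ∧ imC Z ∈ p := by
  constructor
  · intro h
    rw [Submodule.baseChange_eq_span] at h
    induction h using Submodule.span_induction with
    | mem x hx =>
      obtain ⟨y, hy, rfl⟩ := hx
      simpa using hy
    | zero => simp
    | add x y _ _ hx hy => simpa using ⟨p.add_mem hx.1 hy.1, p.add_mem hx.2 hy.2⟩
    | smul a x _ hx =>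
      rw [reC_smul, imC_smul]
      exact ⟨p.sub_mem (p.smul_mem _ hx.1) (p.smul_mem _ hx.2),
        p.add_mem (p.smul_mem _ hx.2) (p.smul_mem _ hx.1)⟩
  · rintro ⟨h, h'⟩
    rw [← mkC_reC_imC Z]
    exact add_mem (Submodule.tmul_mem_baseChange_of_mem _ h)
      (Submodule.tmul_mem_baseChange_of_mem _ h')

variable {F : Type*} [AddCommGroup F] [Module ℂ F] [Module ℝ F] [IsScalarTower ℝ ℂ F]

/-- The kernel in the complexification of the complex-linear extension of a real-linear map. -/
def kerC (D : V →ₗ[ℝ] F) : Submodule ℂ (ℂ ⊗[ℝ] V) := LinearMap.ker (D.liftBaseChange ℂ)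

theorem mem_kerC {D : V →ₗ[ℝ] F} {Z : ℂ ⊗[ℝ] V} :
    Z ∈ kerC D ↔ D (reC Z) + Complex.I • D (imC Z) = 0 := by
  conv_lhs => rw [← mkC_reC_imC Z]
  simp [kerC, mkC]

theorem mem_map_baseChange_iff (e : V ≃ₗ[ℝ] W) (P : Submodule ℂ (ℂ ⊗[ℝ] V)) (Z : ℂ ⊗[ℝ] W) :
    Z ∈ P.map (e.toLinearMap.baseChange ℂ) ↔ e.symm.toLinearMap.baseChange ℂ Z ∈ P := by
  constructor
  · rintro ⟨X, hX, rfl⟩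
    convert! hX
    exact extC (by simp) (by simp)
  · intro h
    exact ⟨_, h, extC (by simp) (by simp)⟩

end ComplexificationLemmas

/-! ### Linear algebra of 2-forms -/

section Forms

variable {V : Type*} [AddCommGroup V] [Module ℝ V] [TopologicalSpace V]

theorem form_add_left (w : V [⋀^Fin 2]→L[ℝ] ℝ) (a b c : V) :
    w ![a + b, c] = w ![a, c] + w ![b, c] := by
  have := w.toMultilinearMap.cons_add ![c] a b
  exact this

theorem form_smul_left (w : V [⋀^Fin 2]→L[ℝ] ℝ) (r : ℝ) (a c : V) :
    w ![r • a, c] = r * w ![a, c] := by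
  have := w.toMultilinearMap.cons_smul ![c] r a
  exact this

theorem form_swap (w : V [⋀^Fin 2]→L[ℝ] ℝ) (a b : V) : w ![a, b] = -w ![b, a] := by
  have := w.map_swap ![b, a] (i := 0) (j := 1) (by simp)
  change w (![b, a] ∘ Equiv.swap 0 1) = -w ![b, a] at this
  rw [← this]
  congr 1
  ext i
  fin_cases i <;> simp

theorem form_self (w : V [⋀^Fin 2]→L[ℝ] ℝ) (a : V) : w ![a, a] = 0 := by
  have := form_swap w a a
  linarith

theorem form_add_right (w : V [⋀^Fin 2]→L[ℝ] ℝ) (a b c : V) :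
    w ![a, b + c] = w ![a, b] + w ![a, c] := by
  rw [form_swap, form_add_left, form_swap w b, form_swap w c]; ring

theorem form_smul_right (w : V [⋀^Fin 2]→L[ℝ] ℝ) (r : ℝ) (a c : V) :
    w ![a, r • c] = r * w ![a, c] := by
  rw [form_swap, form_smul_left, form_swap w c]; ring

theorem form_neg_left (w : V [⋀^Fin 2]→L[ℝ] ℝ) (a c : V) : w ![-a, c] = -w ![a, c] := by
  rw [← neg_one_smul ℝ, form_smul_left]; ring

theorem form_neg_right (w : V [⋀^Fin 2]→L[ℝ] ℝ) (a c : V) : w ![a, -c] = -w ![a, c] := by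
  rw [← neg_one_smul ℝ, form_smul_right]; ring

theorem form_sub_right (w : V [⋀^Fin 2]→L[ℝ] ℝ) (a b c : V) :
    w ![a, b - c] = w ![a, b] - w ![a, c] := by
  rw [sub_eq_add_neg, form_add_right, form_neg_right]; ring

theorem form_zero_left (w : V [⋀^Fin 2]→L[ℝ] ℝ) (a : V) : w ![0, a] = 0 := by
  have := form_smul_left w 0 0 a
  simpa using this

theorem form_zero_right (w : V [⋀^Fin 2]→L[ℝ] ℝ) (a : V) : w ![a, 0] = 0 := by
  rw [form_swap, form_zero_left, neg_zero]

/-- The complex bilinear extension of a real 2-form as a bilinear map. -/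
def formCBilin (w : V [⋀^Fin 2]→L[ℝ] ℝ) : ℂ ⊗[ℝ] V →ₗ[ℂ] ℂ ⊗[ℝ] V →ₗ[ℂ] ℂ :=
  LinearMap.mk₂ ℂ (formC w)
    (fun Z Z' U => by
      apply Complex.ext <;> simp [formC, form_add_left] <;> ring)
    (fun a Z U => by
      apply Complex.ext <;>
        simp [formC, reC_smul, imC_smul, form_add_left, form_smul_left] <;> ring)
    (fun Z U U' => by
      apply Complex.ext <;> simp [formC, form_add_right] <;> ring)
    (fun a Z U => by
      apply Complex.ext <;>
        simp [formC, reC_smul, imC_smul, form_add_right, form_sub_right, form_smul_right] <;> ring)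

/-- This reduces positivity of a Lagrangian subspace to a real inequality between real and imaginary
parts. -/
theorem formC_conjC (w : V [⋀^Fin 2]→L[ℝ] ℝ) (Z : ℂ ⊗[ℝ] V) :
    -Complex.I * formC w Z (conjC Z) = ((-2 * w ![reC Z, imC Z] : ℝ) : ℂ) := by
  have h := form_swap w (imC Z) (reC Z)
  have h1 := form_self w (reC Z)
  have h2 := form_self w (imC Z)
  apply Complex.ext <;> simp [formC, form_neg_right, h1, h2, h]
  ring

end Forms

/-! ### Kernels of real-linear maps into `ℂⁿ` as graphs over the vertical space -/

section Coordinates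

variable {n : ℕ}

/-- The complexification of `EuclideanSpace ℝ (Fin n)`. -/
abbrev EC (n : ℕ) : Type := EuclideanSpace ℂ (Fin n)

/-- The model space of `T*M`. -/
abbrev VM (n : ℕ) : Type := EuclideanSpace ℝ (Fin n) × Covec n

instance instNormedAddCommGroupCovec : NormedAddCommGroup (Covec n) :=
  ContinuousLinearMap.toNormedAddCommGroup

instance instNormedSpaceCovec : NormedSpace ℝ (Covec n) :=
  ContinuousLinearMap.toNormedSpace

instance instNormedAddCommGroupVM : NormedAddCommGroup (VM n) := Prod.normedAddCommGroup

instance instNormedSpaceVM : NormedSpace ℝ (VM n) := Prod.normedSpace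

instance instCompleteSpaceVM : CompleteSpace (VM n) := inferInstance

instance instContinuousSMulVM : ContinuousSMul ℝ (VM n) := inferInstance

instance instContinuousSMulEC : ContinuousSMul ℂ (EC n) := inferInstance

instance instContinuousSMulRealEC : ContinuousSMul ℝ (EC n) := inferInstance

instance instCompleteSpaceEC : CompleteSpace (EC n) := inferInstance

instance instNormedAddCommGroupVMForm : NormedAddCommGroup ((VM n) [⋀^Fin 2]→L[ℝ] ℝ) :=
  inferInstance

instance instNormedSpaceVMForm : NormedSpace ℝ ((VM n) [⋀^Fin 2]→L[ℝ] ℝ) := inferInstance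

instance instNormedAddCommGroupVMDual : NormedAddCommGroup (VM n →L[ℝ] ℝ) :=
  ContinuousLinearMap.toNormedAddCommGroup

instance instNormedSpaceVMDual : NormedSpace ℝ (VM n →L[ℝ] ℝ) :=
  ContinuousLinearMap.toNormedSpace

instance instNormedAddCommGroupVMEnd : NormedAddCommGroup (VM n →L[ℝ] VM n) :=
  ContinuousLinearMap.toNormedAddCommGroup

instance instNormedSpaceVMEnd : NormedSpace ℝ (VM n →L[ℝ] VM n) :=
  ContinuousLinearMap.toNormedSpace

instance instNormedAddCommGroupVMBilin : NormedAddCommGroup (VM n →L[ℝ] VM n →L[ℝ] ℝ) :=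
  ContinuousLinearMap.toNormedAddCommGroup

instance instNormedSpaceVMBilin : NormedSpace ℝ (VM n →L[ℝ] VM n →L[ℝ] ℝ) :=
  ContinuousLinearMap.toNormedSpace

instance instNormedAddCommGroupVMHom : NormedAddCommGroup (VM n →L[ℝ] EC n) :=
  ContinuousLinearMap.toNormedAddCommGroup

instance instNormedSpaceRealVMHom : NormedSpace ℝ (VM n →L[ℝ] EC n) :=
  ContinuousLinearMap.toNormedSpace

instance instNormedSpaceComplexVMHom : NormedSpace ℂ (VM n →L[ℝ] EC n) :=
  ContinuousLinearMap.toNormedSpace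

/-- The inclusion of real vectors. -/
def ofRealE : EuclideanSpace ℝ (Fin n) →L[ℝ] EC n :=
  LinearMap.toContinuousLinearMap
    { toFun := fun x => WithLp.toLp 2 fun j => (x j : ℂ)
      map_add' := fun x y => by ext j; simp
      map_smul' := fun c x => by ext j; simp }

/-- The real part of a complex vector. -/
def reE : EC n →L[ℝ] EuclideanSpace ℝ (Fin n) :=
  LinearMap.toContinuousLinearMap
    { toFun := fun x => WithLp.toLp 2 fun j => (x j).re
      map_add' := fun x y => by ext j; simp
      map_smul' := fun c x => by ext j; simp }

/-- The imaginary part of a complex vector. -/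
def imE : EC n →L[ℝ] EuclideanSpace ℝ (Fin n) :=
  LinearMap.toContinuousLinearMap
    { toFun := fun x => WithLp.toLp 2 fun j => (x j).im
      map_add' := fun x y => by ext j; simp
      map_smul' := fun c x => by ext j; simp }

@[simp] theorem ofRealE_apply (x : EuclideanSpace ℝ (Fin n)) (j : Fin n) :
    ofRealE x j = (x j : ℂ) := rfl

@[simp] theorem reE_apply (x : EC n) (j : Fin n) : reE x j = (x j).re := rfl

@[simp] theorem imE_apply (x : EC n) (j : Fin n) : imE x j = (x j).im := rfl

@[simp] theorem reE_ofRealE (x : EuclideanSpace ℝ (Fin n)) : reE (ofRealE x) = x := by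
  ext j; simp

@[simp] theorem imE_ofRealE (x : EuclideanSpace ℝ (Fin n)) : imE (ofRealE x) = 0 := by
  ext j; simp

theorem ofRealE_reE_imE (v : EC n) : ofRealE (reE v) + Complex.I • ofRealE (imE v) = v := by
  ext j
  apply Complex.ext <;> simp

theorem extE {v v' : EC n} (h : reE v = reE v') (h' : imE v = imE v') : v = v' := by
  rw [← ofRealE_reE_imE v, ← ofRealE_reE_imE v', h, h']

@[simp] theorem reE_I_smul (v : EC n) : reE (Complex.I • v) = -imE v := by ext j; simp

@[simp] theorem imE_I_smul (v : EC n) : imE (Complex.I • v) = reE v := by ext j; simp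

/-- A linear identification of vectors and covectors. -/
def covE (n : ℕ) : EuclideanSpace ℝ (Fin n) ≃L[ℝ] Covec n :=
  ContinuousLinearEquiv.ofFinrankEq (by
    rw [← LinearMap.toContinuousLinearMap.finrank_eq, Module.finrank_linearMap]
    simp)

/-- The complex-linear extension of a real-linear map on `EuclideanSpace ℝ (Fin n)`. -/
def extendE : (EuclideanSpace ℝ (Fin n) →L[ℝ] EC n) →L[ℂ] (EC n →L[ℂ] EC n) :=
  haveI : FiniteDimensional ℂ (EuclideanSpace ℝ (Fin n) →L[ℝ] EC n) :=
    FiniteDimensional.right ℝ ℂ _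
  LinearMap.toContinuousLinearMap
    { toFun := fun A => LinearMap.toContinuousLinearMap
        { toFun := fun v => A (reE v) + Complex.I • A (imE v)
          map_add' := fun v v' => by simp only [map_add, smul_add]; abel
          map_smul' := fun c v => by
            have h1 : reE (c • v) = c.re • reE v - c.im • imE v := by ext j; simp
            have h2 : imE (c • v) = c.re • imE v + c.im • reE v := by ext j; simp
            simp only [h1, h2, map_add, map_sub, map_smul, RingHom.id_apply]
            ext j
            apply Complex.ext <;> simp <;> ring }
      map_add' := fun A B => by ext v j; simp; ring
      map_smul' := fun c A => by ext v j; simp; ring }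

theorem extendE_apply (A : EuclideanSpace ℝ (Fin n) →L[ℝ] EC n) (v : EC n) :
    extendE A v = A (reE v) + Complex.I • A (imE v) := rfl

/-- The identification of `EC n × EC n` with the complexification of the model space of `T*M`. -/
def toTensor : EC n × EC n →ₗ[ℂ] ℂ ⊗[ℝ] (VM n) where
  toFun p := mkC (reE p.1, covE n (reE p.2)) (imE p.1, covE n (imE p.2))
  map_add' p q := extC (by simp) (by simp)
  map_smul' c p := by
    have h1 : ∀ v : EC n, reE (c • v) = c.re • reE v - c.im • imE v := fun v => by ext j; simp
    have h2 : ∀ v : EC n, imE (c • v) = c.re • imE v + c.im • reE v := fun v => by ext j; simp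
    refine extC ?_ ?_
    · simp [reC_smul, h1]
    · simp [imC_smul, h2]

@[simp] theorem reC_toTensor (p : EC n × EC n) :
    reC (toTensor p) = (reE p.1, covE n (reE p.2)) := by simp [toTensor]

@[simp] theorem imC_toTensor (p : EC n × EC n) :
    imC (toTensor p) = (imE p.1, covE n (imE p.2)) := by simp [toTensor]

theorem toTensor_injective : Function.Injective (toTensor (n := n)) := by
  rw [← LinearMap.ker_eq_bot, LinearMap.ker_eq_bot']
  intro p hp
  rw [eq_zero_iffC] at hp
  simp only [reC_toTensor, imC_toTensor, Prod.mk_eq_zero, map_eq_zero_iff _ (covE n).injective]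
    at hp
  exact Prod.ext (extE (by simp [hp.1.1]) (by simp [hp.2.1]))
    (extE (by simp [hp.1.2]) (by simp [hp.2.2]))

theorem toTensor_surjective : Function.Surjective (toTensor (n := n)) := by
  intro Z
  refine ⟨(ofRealE (reC Z).1 + Complex.I • ofRealE (imC Z).1,
    ofRealE ((covE n).symm (reC Z).2) + Complex.I • ofRealE ((covE n).symm (imC Z).2)), ?_⟩
  refine extC ?_ ?_
  · simp
  · simp

/-- Precomposition with a real-linear map, as a complex-linear map. -/
def precompE {V₁ V₂ : Type*} [NormedAddCommGroup V₁] [NormedSpace ℝ V₁] [NormedAddCommGroup V₂]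
    [NormedSpace ℝ V₂] (A : V₁ →L[ℝ] V₂) : (V₂ →L[ℝ] EC n) →L[ℂ] (V₁ →L[ℝ] EC n) :=
  LinearMap.mkContinuous (σ := RingHom.id ℂ)
    { toFun := fun D => D.comp A
      map_add' := fun _ _ => rfl
      map_smul' := fun _ _ => rfl } ‖A‖
    fun D => (ContinuousLinearMap.opNorm_comp_le _ _).trans (mul_comm _ _).le

/-- The part of a real-linear map into `EC n` that acts on vectors. -/
def horPart : (VM n →L[ℝ] EC n) →L[ℂ] (EC n →L[ℂ] EC n) :=
  extendE.comp (precompE (ContinuousLinearMap.inl ℝ _ _))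

/-- The part of a real-linear map into `EC n` that acts on covectors. -/
def verPart : (VM n →L[ℝ] EC n) →L[ℂ] (EC n →L[ℂ] EC n) :=
  extendE.comp (precompE ((ContinuousLinearMap.inr ℝ _ _).comp
    (covE n : EuclideanSpace ℝ (Fin n) →L[ℝ] Covec n)))

theorem horPart_apply (D : VM n →L[ℝ] EC n) (v : EC n) :
    horPart D v = D (reE v, 0) + Complex.I • D (imE v, 0) := rfl

theorem verPart_apply (D : VM n →L[ℝ] EC n) (c : EC n) :
    verPart D c = D (0, covE n (reE c)) + Complex.I • D (0, covE n (imE c)) := rfl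

theorem toTensor_mem_kerC (D : VM n →L[ℝ] EC n) (p : EC n × EC n) :
    toTensor p ∈ kerC D.toLinearMap ↔ horPart D p.1 + verPart D p.2 = 0 := by
  rw [mem_kerC, reC_toTensor, imC_toTensor, horPart_apply, verPart_apply]
  have h : ∀ (x : EuclideanSpace ℝ (Fin n)) (q : Covec n), D (x, q) = D (x, 0) + D (0, q) :=
    fun x q => by rw [← map_add]; simp
  have h' : D (reE p.1, covE n (reE p.2)) + Complex.I • D (imE p.1, covE n (imE p.2)) =
      D (reE p.1, 0) + Complex.I • D (imE p.1, 0) +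
      (D (0, covE n (reE p.2)) + Complex.I • D (0, covE n (imE p.2))) := by
    rw [h (reE p.1), h (imE p.1), smul_add]; abel
  rw [← h']
  rfl

/-- The complex symmetric matrix describing the kernel as a graph over the vertical space. -/
def graphMap (D : VM n →L[ℝ] EC n) : EC n →L[ℂ] EC n :=
  -(Ring.inverse (horPart D)) * verPart D

/-- The equation of the kernel is `horPart v + verPart c = 0`; it is solved for `v`, and `c` becomes
a free parameter. -/
theorem mem_kerC_iff_graph {D : VM n →L[ℝ] EC n} (hD : IsUnit (horPart D)) (Z : ℂ ⊗[ℝ] (VM n)) :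
    Z ∈ kerC D.toLinearMap ↔ ∃ c, toTensor (graphMap D c, c) = Z := by
  have hl : ∀ v, Ring.inverse (horPart D) (horPart D v) = v := fun v =>
    congrArg (fun A : EC n →L[ℂ] EC n => A v) (Ring.inverse_mul_cancel _ hD)
  have hr : ∀ v, horPart D (Ring.inverse (horPart D) v) = v := fun v =>
    congrArg (fun A : EC n →L[ℂ] EC n => A v) (Ring.mul_inverse_cancel _ hD)
  have hg : ∀ c, graphMap D c = -Ring.inverse (horPart D) (verPart D c) := fun c => rfl
  constructor
  · intro h
    obtain ⟨p, rfl⟩ := toTensor_surjective Z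
    rw [toTensor_mem_kerC] at h
    refine ⟨p.2, ?_⟩
    congr 1
    refine Prod.ext ?_ rfl
    rw [hg, ← hl p.1, eq_neg_of_add_eq_zero_left h, map_neg]
  · rintro ⟨c, rfl⟩
    rw [toTensor_mem_kerC]
    simp [hg, hr]

/-- The vectors of a frame of the kernel. -/
def graphFrame (D : VM n →L[ℝ] EC n) (j : Fin n) : ℂ ⊗[ℝ] (VM n) :=
  toTensor (graphMap D (EuclideanSpace.single j 1), EuclideanSpace.single j 1)

theorem toTensor_graph_eq_sum (D : VM n →L[ℝ] EC n) (c : EC n) :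
    toTensor (graphMap D c, c) = ∑ j, c j • graphFrame D j := by
  have hc : c = ∑ j, c j • EuclideanSpace.single j (1 : ℂ) := by
    ext i
    simp [Pi.single_apply]
  simp only [graphFrame, ← map_smul, ← map_sum]
  congr 1
  refine Prod.ext ?_ ?_
  · conv_lhs => rw [hc]
    simp [Prod.fst_sum]
  · conv_lhs => rw [hc]
    simp [Prod.snd_sum]

theorem span_graphFrame {D : VM n →L[ℝ] EC n} (hD : IsUnit (horPart D)) :
    Submodule.span ℂ (range (graphFrame D)) = kerC D.toLinearMap := by
  ext Z
  rw [mem_kerC_iff_graph hD, Submodule.mem_span_range_iff_exists_fun]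
  constructor
  · rintro ⟨c, rfl⟩
    refine ⟨WithLp.toLp 2 c, ?_⟩
    rw [toTensor_graph_eq_sum]
  · rintro ⟨c, rfl⟩
    exact ⟨fun j => c j, (toTensor_graph_eq_sum D c).symm⟩

theorem linearIndependent_graphFrame (D : VM n →L[ℝ] EC n) :
    LinearIndependent ℂ (graphFrame D) := by
  rw [Fintype.linearIndependent_iff]
  intro c hc j
  have h := toTensor_graph_eq_sum D (WithLp.toLp 2 c)
  rw [hc, map_eq_zero_iff _ toTensor_injective] at h
  exact congrArg (fun v : EC n => v j) (Prod.mk_eq_zero.1 h).2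

theorem finrank_kerC {D : VM n →L[ℝ] EC n} (hD : IsUnit (horPart D)) :
    Module.finrank ℂ (kerC D.toLinearMap) = n := by
  rw [← span_graphFrame hD, finrank_span_eq_card (linearIndependent_graphFrame D)]
  simp

end Coordinates

/-! ### Evaluation of time series at complex times -/

section ComplexEvaluation

variable {V : Type*} [NormedAddCommGroup V] [NormedSpace ℝ V] [CompleteSpace V] {n : ℕ}

theorem L1.norm_evalCCoeff_le (ι : V →L[ℝ] EC n) (w : ℂ) (m : ℕ) :
    ‖(if ‖w‖ ≤ 1 then w ^ m else 0) • ι‖ ≤ ‖ι‖ := by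
  rw [norm_smul]
  refine mul_le_of_le_one_left (norm_nonneg _) ?_
  split_ifs with hw
  · rw [norm_pow]
    exact pow_le_one₀ (norm_nonneg _) hw
  · simp

/-- Evaluation of a power series at a complex point of the closed unit disk (and zero outside),
after a linear map into `EC n`. -/
def L1.evalC (ι : V →L[ℝ] EC n) (w : ℂ) : L1 V →L[ℝ] EC n :=
  L1.lift (fun m => (if ‖w‖ ≤ 1 then w ^ m else 0) • ι) ‖ι‖ (L1.norm_evalCCoeff_le ι w)

theorem L1.hasSum_evalC (ι : V →L[ℝ] EC n) {w : ℂ} (hw : ‖w‖ ≤ 1) (u : L1 V) :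
    HasSum (fun m => w ^ m • ι (u m)) (L1.evalC ι w u) := by
  have h : (fun m => w ^ m • ι (u m)) =
      fun m => ((if ‖w‖ ≤ 1 then w ^ m else 0) • ι) (u m) := by
    ext1 m
    rw [if_pos hw]
    rfl
  rw [h]
  exact L1.hasSum_lift _ _ (L1.norm_evalCCoeff_le ι w) u

theorem L1.evalC_single (ι : V →L[ℝ] EC n) {w : ℂ} (hw : ‖w‖ ≤ 1) (m : ℕ) (v : V) :
    L1.evalC ι w (L1.single m v) = w ^ m • ι v := by
  rw [L1.evalC, L1.lift_single, if_pos hw]; rfl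

theorem L1.evalC_zero (ι : V →L[ℝ] EC n) (u : L1 V) : L1.evalC ι 0 u = ι (u 0) := by
  rw [← (L1.hasSum_evalC ι (by simp) u).tsum_eq, tsum_eq_single 0 (by intro m hm; simp [hm])]
  simp

theorem L1.evalC_ofReal (ι : V →L[ℝ] EC n) {t : ℝ} (ht : |t| ≤ 1) (u : L1 V) :
    L1.evalC ι t u = ι (L1.eval t u) := by
  have : L1.evalC ι t = ι.comp (L1.eval t) := L1.ext_single fun m v => by
    rw [L1.evalC_single ι (by simpa using ht), ContinuousLinearMap.comp_apply, L1.eval_single ht,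
      map_smul, ← Complex.ofReal_pow, Complex.coe_smul]
  rw [this]; rfl

/-- The series has real coefficients, so its value at the conjugate time is the conjugate value. -/
theorem L1.evalC_star (A : V →L[ℝ] EuclideanSpace ℝ (Fin n)) {w : ℂ} (hw : ‖w‖ ≤ 1) (u : L1 V) :
    reE (L1.evalC (ofRealE.comp A) (starRingEnd ℂ w) u) = reE (L1.evalC (ofRealE.comp A) w u) ∧
    imE (L1.evalC (ofRealE.comp A) (starRingEnd ℂ w) u) =
      -imE (L1.evalC (ofRealE.comp A) w u) := by
  have hw' : ‖starRingEnd ℂ w‖ ≤ 1 := by simpa using hw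
  constructor
  · have : reE.comp (L1.evalC (ofRealE.comp A) (starRingEnd ℂ w)) =
        reE.comp (L1.evalC (ofRealE.comp A) w) := L1.ext_single fun m v => by
      simp only [ContinuousLinearMap.comp_apply, L1.evalC_single _ hw, L1.evalC_single _ hw',
        (map_pow (starRingEnd ℂ) w m).symm]
      ext j; simp [-map_pow]
    exact congrArg (fun B => B u) this
  · have : imE.comp (L1.evalC (ofRealE.comp A) (starRingEnd ℂ w)) =
        -imE.comp (L1.evalC (ofRealE.comp A) w) := L1.ext_single fun m v => by
      simp only [ContinuousLinearMap.comp_apply, neg_apply, L1.evalC_single _ hw,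
        L1.evalC_single _ hw', (map_pow (starRingEnd ℂ) w m).symm]
      ext j; simp [-map_pow]
    exact congrArg (fun B => B u) this

theorem L1.evalC_comp_apply (A : V →L[ℝ] EuclideanSpace ℝ (Fin n))
    (L : EuclideanSpace ℝ (Fin n) →L[ℝ] EuclideanSpace ℝ (Fin n)) {w : ℂ} (hw : ‖w‖ ≤ 1)
    (u : L1 V) : L1.evalC (ofRealE.comp (L.comp A)) w u =
      extendE (ofRealE.comp L) (L1.evalC (ofRealE.comp A) w u) := by
  have : L1.evalC (ofRealE.comp (L.comp A)) w =
      ((extendE (ofRealE.comp L)).restrictScalars ℝ).comp (L1.evalC (ofRealE.comp A) w) :=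
    L1.ext_single fun m v => by
      simp only [ContinuousLinearMap.comp_apply, L1.evalC_single _ hw,
        ContinuousLinearMap.coe_restrictScalars', map_smul]
      congr 1
      simp [extendE_apply]
  rw [this]; rfl

theorem L1.differentiableOn_evalC (ι : V →L[ℝ] EC n) :
    DifferentiableOn ℂ (fun w => L1.evalC ι w) (Metric.ball 0 1) := by
  intro w hw
  -- As operators the coefficient maps are only bounded, not summable, so convergence in operator
  -- norm needs the geometric factor of a smaller disk.
  obtain ⟨r, hwr, hr⟩ := exists_between (show ‖w‖ < 1 by simpa using hw)
  have hr0 : 0 ≤ r := (norm_nonneg _).trans hwr.le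
  have hb : ∀ (m : ℕ) (w : ℂ), w ∈ Metric.ball (0 : ℂ) r →
      ‖w ^ m • ι.comp (L1.coeff m)‖ ≤ r ^ m * ‖ι‖ := by
    intro m w hw
    have hw : ‖w‖ < r := by simpa using hw
    rw [norm_smul, norm_pow]
    refine mul_le_mul (pow_le_pow_left₀ (norm_nonneg _) hw.le m) ?_ (norm_nonneg _) (by positivity)
    refine ContinuousLinearMap.opNorm_le_bound _ (norm_nonneg _) fun u => ?_
    refine (ι.le_opNorm _).trans (mul_le_mul_of_nonneg_left ?_ (norm_nonneg _))
    exact lp.norm_apply_le_norm (by norm_num) u m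
  have hs : Summable fun m : ℕ => r ^ m * ‖ι‖ :=
    (summable_geometric_of_lt_one hr0 hr).mul_right _
  have h1 : DifferentiableOn ℂ (fun w : ℂ => ∑' m, w ^ m • ι.comp (L1.coeff m))
      (Metric.ball 0 r) :=
    Complex.differentiableOn_tsum_of_summable_norm hs
      (fun m => ((differentiable_id.pow m).smul_const _).differentiableOn) Metric.isOpen_ball hb
  have hwr' : w ∈ Metric.ball (0 : ℂ) r := by simpa using hwr
  have h2 : (fun w : ℂ => L1.evalC ι w) =ᶠ[𝓝 w] fun w => ∑' m, w ^ m • ι.comp (L1.coeff m) := by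
    filter_upwards [Metric.isOpen_ball.mem_nhds hwr'] with z hz
    have hz1 : ‖z‖ ≤ 1 := by
      have : ‖z‖ < r := by simpa using hz
      linarith
    have hsum : Summable fun m => z ^ m • ι.comp (L1.coeff (V := V) m) :=
      Summable.of_norm_bounded hs fun m => hb m z hz
    ext1 u
    have h3 := hsum.hasSum.mapL (ContinuousLinearMap.apply ℝ (EC n) u)
    exact (L1.hasSum_evalC ι hz1 u).unique h3
  exact ((h1.differentiableAt (Metric.isOpen_ball.mem_nhds hwr')).congr_of_eventuallyEq
    h2).differentiableWithinAt

theorem L1.contDiffOn_evalC (ι : V →L[ℝ] EC n) :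
    ContDiffOn ℝ ω (fun w => L1.evalC ι w) (Metric.ball 0 1) :=
  ((L1.differentiableOn_evalC ι).analyticOnNhd Metric.isOpen_ball).restrictScalars.contDiffOn
    Metric.isOpen_ball.uniqueDiffOn

theorem L1.hasDerivAt_evalC (ι : V →L[ℝ] EC n) {u a : L1 V}
    (h : ∀ m : ℕ, u (m + 1) = ((m : ℝ) + 1)⁻¹ • a m) {w : ℂ} (hw : ‖w‖ < 1) :
    HasDerivAt (fun w => L1.evalC ι w u) (L1.evalC ι w a) w := by
  have h1 : ∀ s ∈ Metric.ball (0 : ℂ) 1, L1.evalC ι s u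
      = ι (u 0) + ∑' m : ℕ, ((((m : ℂ) + 1)⁻¹ * s ^ (m + 1)) • ι (a m)) := by
    intro s hs
    have hs : ‖s‖ ≤ 1 := by simpa using (Metric.mem_ball.1 hs).le
    have h2 := L1.hasSum_evalC ι hs u
    rw [← h2.tsum_eq, h2.summable.tsum_eq_zero_add, pow_zero, one_smul]
    congr 1
    refine tsum_congr fun m => ?_
    rw [h, map_smul, mul_comm, mul_smul]
    congr 1
    rw [← Complex.coe_smul]
    push_cast
    rfl
  have h3 : HasDerivAt (fun s : ℂ => ∑' m : ℕ, ((((m : ℂ) + 1)⁻¹ * s ^ (m + 1)) • ι (a m)))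
      (∑' m : ℕ, w ^ m • ι (a m)) w := by
    refine hasDerivAt_tsum_of_isPreconnected (u := fun m => ‖ι‖ * ‖a m‖)
      (t := Metric.ball (0 : ℂ) 1)
      (g' := fun m s => s ^ m • ι (a m)) (y₀ := 0)
      (a.summable_norm.mul_left _) Metric.isOpen_ball (convex_ball _ _).isPreconnected ?_ ?_
      (by simp) ?_ (by simpa using hw)
    · intro m s hs
      have := ((hasDerivAt_pow (m + 1) s).const_mul (((m : ℂ) + 1)⁻¹)).smul_const (ι (a m))
      convert this using 1
      congr 1
      have : (m : ℂ) + 1 ≠ 0 := Nat.cast_add_one_ne_zero m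
      push_cast
      field_simp
    · intro m s hs
      have hs : ‖s‖ ≤ 1 := by simpa using (Metric.mem_ball.1 hs).le
      rw [norm_smul, norm_pow]
      exact (mul_le_of_le_one_left (norm_nonneg _) (pow_le_one₀ (norm_nonneg _) hs)).trans
        (ι.le_opNorm _)
    · simp [summable_zero]
  rw [(L1.hasSum_evalC ι hw.le a).tsum_eq] at h3
  refine (h3.const_add (ι (u 0))).congr_of_eventuallyEq ?_
  filter_upwards [Metric.isOpen_ball.mem_nhds (show w ∈ Metric.ball (0 : ℂ) 1 by simpa using hw)]
    with s hs using h1 s hs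

end ComplexEvaluation

/-! ### Currying of 2-forms -/

section FormBilinear

variable {V : Type*} [NormedAddCommGroup V] [NormedSpace ℝ V]

/-- Currying of alternating 2-forms. -/
def curryForm : (V [⋀^Fin 2]→L[ℝ] ℝ) →L[ℝ] (V →L[ℝ] V →L[ℝ] ℝ) :=
  ((ContinuousLinearMap.compL ℝ V (V [×1]→L[ℝ] ℝ) (V →L[ℝ] ℝ)
      ((continuousMultilinearCurryFin1 ℝ V ℝ).toContinuousLinearEquiv :
        (V [×1]→L[ℝ] ℝ) →L[ℝ] _)).comp
    ((continuousMultilinearCurryLeftEquiv ℝ (fun _ : Fin 2 => V) ℝ).toContinuousLinearEquiv :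
        (V [×2]→L[ℝ] ℝ) →L[ℝ] _)).comp
    (ContinuousAlternatingMap.toContinuousMultilinearMapCLM ℝ)

theorem curryForm_apply (w : V [⋀^Fin 2]→L[ℝ] ℝ) (a b : V) : curryForm w a b = w ![a, b] := by
  change w.toContinuousMultilinearMap (Fin.cons a ((fun i : Fin 1 => b))) = _
  change w _ = w _
  congr 1
  ext i
  fin_cases i <;> rfl

end FormBilinear

/-! ### The flow near a rest point: invariance of the form and linearization -/

section LocalFlow

variable {n : ℕ}

theorem eq_zero_of_eq_zero_on_real {F : Type*} [NormedAddCommGroup F] [NormedSpace ℂ F]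
    [CompleteSpace F] {f : ℂ → F} {ρ : ℝ} (hf : DifferentiableOn ℂ f (Metric.ball 0 ρ))
    (h0 : ∀ t : ℝ, |t| < ρ → f t = 0) {w : ℂ} (hw : w ∈ Metric.ball (0 : ℂ) ρ) : f w = 0 := by
  have hρ : 0 < ρ := Metric.pos_of_mem_ball hw
  have hfreq : ∃ᶠ w in 𝓝[≠] (0 : ℂ), f w = 0 := by
    have htend : Filter.Tendsto (fun t : ℝ => (t : ℂ)) (𝓝[≠] 0) (𝓝[≠] 0) := by
      refine tendsto_nhdsWithin_of_tendsto_nhds_of_eventually_within _ ?_ ?_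
      · exact (Complex.continuous_ofReal.tendsto' 0 0 (by simp)).mono_left nhdsWithin_le_nhds
      · filter_upwards [self_mem_nhdsWithin] with t ht
        simpa using ht
    refine htend.frequently (Filter.Eventually.frequently ?_)
    have : ∀ᶠ t : ℝ in 𝓝 0, |t| < ρ := (continuous_abs.tendsto' 0 0 (by simp)).eventually
      (gt_mem_nhds hρ)
    filter_upwards [nhdsWithin_le_nhds this] with t ht using h0 t ht
  exact (hf.analyticOnNhd Metric.isOpen_ball).eqOn_zero_of_preconnected_of_frequently_eq_zero
    (convex_ball _ _).isPreconnected (Metric.mem_ball_self hρ) hfreq hw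

/-- The differential of the horizontal component of a flow given by power series in time, at
complex time `w`. -/
def dMap (u : VM n → L1 (VM n)) (w : ℂ) (z : VM n) : VM n →L[ℝ] EC n :=
  (L1.evalC (ofRealE.comp (ContinuousLinearMap.fst ℝ _ _)) w).comp (fderiv ℝ u z)

theorem dMap_apply (u : VM n → L1 (VM n)) (w : ℂ) (z ξ : VM n) : dMap u w z ξ =
    L1.evalC (ofRealE.comp (ContinuousLinearMap.fst ℝ _ _)) w (fderiv ℝ u z ξ) := rfl

theorem dMap_ofReal (u : VM n → L1 (VM n)) {t : ℝ} (ht : |t| ≤ 1) (z ξ : VM n) :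
    dMap u t z ξ = ofRealE (L1.eval t (fderiv ℝ u z ξ)).1 := by
  exact L1.evalC_ofReal _ ht _

theorem dMap_star (u : VM n → L1 (VM n)) {w : ℂ} (hw : ‖w‖ ≤ 1) (z ξ : VM n) :
    reE (dMap u (starRingEnd ℂ w) z ξ) = reE (dMap u w z ξ) ∧
      imE (dMap u (starRingEnd ℂ w) z ξ) = -imE (dMap u w z ξ) := by
  simp only [dMap_apply]
  have h := L1.evalC_star (V := VM n) (ContinuousLinearMap.fst ℝ _ _) hw (fderiv ℝ u z ξ)
  exact h

theorem contDiffAt_dMap {u : VM n → L1 (VM n)} {z : VM n} (hu : AnalyticAt ℝ u z) {w : ℂ}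
    (hw : ‖w‖ < 1) : ContDiffAt ℝ ω (fun p : VM n × ℂ => dMap u p.2 p.1) (z, w) := by
  have h1 : ContDiffAt ℝ ω (fun p : VM n × ℂ => fderiv ℝ u p.1) (z, w) :=
    ContDiffAt.comp (z, w) (f := Prod.fst) (g := fderiv ℝ u) hu.fderiv.contDiffAt contDiffAt_fst
  have h2 := (L1.contDiffOn_evalC (ofRealE.comp
    (ContinuousLinearMap.fst ℝ (EuclideanSpace ℝ (Fin n)) (Covec n)))).contDiffAt
        (Metric.isOpen_ball.mem_nhds (show w ∈ Metric.ball (0 : ℂ) 1 by simpa using hw))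
  have h3 := ContDiffAt.comp (z, w) (f := Prod.snd) h2 (contDiffAt_snd (E := VM n))
  exact h3.clm_comp h1

theorem differentiableOn_dMap (u : VM n → L1 (VM n)) (z : VM n) :
    DifferentiableOn ℂ (fun w => dMap u w z) (Metric.ball 0 1) := by
  have h := L1.differentiableOn_evalC (ofRealE.comp
    (ContinuousLinearMap.fst ℝ (EuclideanSpace ℝ (Fin n)) (Covec n)))
  have h2 := (precompE (n := n) (fderiv ℝ u z)).differentiable
  have h3 := h2.comp_differentiableOn h
  exact h3

theorem contDiffAt_graphMap {D : VM n →L[ℝ] EC n} (hD : IsUnit (horPart D)) :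
    ContDiffAt ℂ ω (graphMap (n := n)) D := by
  obtain ⟨U, hU⟩ := hD
  have h1 : ContDiffAt ℂ ω (fun D : VM n →L[ℝ] EC n => Ring.inverse (horPart D)) D := by
    have := contDiffAt_ringInverse ℂ (n := ω) U
    rw [hU] at this
    exact this.comp D (horPart (n := n)).contDiff.contDiffAt
  exact (h1.neg).mul (verPart (n := n)).contDiff.contDiffAt

theorem contDiffAt_graphMap_dMap {u : VM n → L1 (VM n)} {z : VM n} (hu : AnalyticAt ℝ u z) {w : ℂ}
    (hw : ‖w‖ < 1) (hD : IsUnit (horPart (dMap u w z))) :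
    ContDiffAt ℝ ω (fun p : VM n × ℂ => graphMap (dMap u p.2 p.1)) (z, w) :=
  ContDiffAt.comp (z, w) (f := fun p : VM n × ℂ => dMap u p.2 p.1) (g := graphMap)
    ((contDiffAt_graphMap hD).restrict_scalars ℝ) (contDiffAt_dMap hu hw)

/-- A Hamiltonian system near a rest point on the zero section: `Y` is `-T` times the Hamiltonian
vector field, `Ω` the symplectic form; `G` is the dual metric and `b` the magnetic form at the
rest point. -/
structure IsLocalSystem (Y : VM n → VM n) (Ω : VM n → (VM n) [⋀^Fin 2]→L[ℝ] ℝ) (z₀ : VM n) (T : ℝ)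
    (G : Covec n →L[ℝ] EuclideanSpace ℝ (Fin n))
    (b : (EuclideanSpace ℝ (Fin n)) [⋀^Fin 2]→L[ℝ] ℝ) : Prop where
  analytic : AnalyticAt ℝ Y z₀
  rest : Y z₀ = 0
  smooth : ContDiffAt ℝ ω Ω z₀
  lie : ∀ᶠ y in 𝓝 z₀, ∀ ξ η, fderiv ℝ Ω y (Y y) ![ξ, η] + Ω y ![fderiv ℝ Y y ξ, η] +
    Ω y ![ξ, fderiv ℝ Y y η] = 0
  vert : ∀ᶠ y in 𝓝 z₀, ∀ q q', Ω y ![(0, q), (0, q')] = 0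
  deriv_fst : ∀ v q, (fderiv ℝ Y z₀ (v, q)).1 = -(T • G q)
  deriv_snd : ∀ v q v', (fderiv ℝ Y z₀ (v, q)).2 v' = T * b ![G q, v']
  form : ∀ (v : EuclideanSpace ℝ (Fin n)) (q : Covec n) (v' : EuclideanSpace ℝ (Fin n))
    (q' : Covec n), Ω z₀ ![(v, q), (v', q')] = q' v - q v' - b ![v, v']
  pos : ∀ q : Covec n, q ≠ 0 → 0 < q (G q)
  time_pos : 0 < T

/-- The power series solution of a local system. -/
structure IsLocalFlow (u : VM n → L1 (VM n)) (Y : VM n → VM n) (z₀ : VM n) : Prop where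
  analytic : AnalyticAt ℝ u z₀
  base : u z₀ = L1.single 0 z₀
  flow : ∀ᶠ z in 𝓝 z₀, (u z) 0 = z ∧ ∀ t : ℝ, |t| < 1 →
        HasDerivAt (fun t => L1.eval t (u z)) (Y (L1.eval t (u z))) t
  variational : ∀ᶠ z in 𝓝 z₀, ∀ ξ, (fderiv ℝ u z ξ) 0 = ξ ∧ ∀ t : ℝ, |t| < 1 →
        HasDerivAt (fun t => L1.eval t (fderiv ℝ u z ξ))
          (fderiv ℝ Y (L1.eval t (u z)) (L1.eval t (fderiv ℝ u z ξ))) t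
  linear : ∀ ξ, (fderiv ℝ u z₀ ξ) 0 = ξ ∧ ∀ m : ℕ, (fderiv ℝ u z₀ ξ) (m + 1)
        = ((m : ℝ) + 1)⁻¹ • fderiv ℝ Y z₀ ((fderiv ℝ u z₀ ξ) m)

variable {Y : VM n → VM n} {Ω : VM n → (VM n) [⋀^Fin 2]→L[ℝ] ℝ} {z₀ : VM n} {T : ℝ}
  {G : Covec n →L[ℝ] EuclideanSpace ℝ (Fin n)} {b : (EuclideanSpace ℝ (Fin n)) [⋀^Fin 2]→L[ℝ] ℝ}
  {u : VM n → L1 (VM n)}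

theorem IsLocalSystem.exists_flow (h : IsLocalSystem Y Ω z₀ T G b) :
    ∃ u, IsLocalFlow u Y z₀ := by
  obtain ⟨u, h1, h2, h3, h4, h5⟩ := exists_powerSeries_flow h.analytic h.rest
  exact ⟨u, h1, h2, h3, h4, h5⟩

theorem IsLocalFlow.tendsto (hu : IsLocalFlow u Y z₀) :
    Filter.Tendsto u (𝓝 z₀) (𝓝 (L1.single 0 z₀)) := hu.base ▸ hu.analytic.continuousAt.tendsto

theorem IsLocalFlow.eventually_eval (hu : IsLocalFlow u Y z₀) {Q : VM n → Prop}
    (hQ : ∀ᶠ y in 𝓝 z₀, Q y) : ∀ᶠ z in 𝓝 z₀, ∀ t : ℝ, |t| ≤ 1 → Q (L1.eval t (u z)) :=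
  eventually_eval_of_tendsto hu.tendsto hQ

/-- The flow preserves the symplectic form. -/
theorem IsLocalFlow.eventually_form_eq (hu : IsLocalFlow u Y z₀)
    (h : IsLocalSystem Y Ω z₀ T G b) :
    ∀ᶠ z in 𝓝 z₀, ∀ t : ℝ, |t| < 1 → ∀ ξ η,
      Ω (L1.eval t (u z)) ![L1.eval t (fderiv ℝ u z ξ), L1.eval t (fderiv ℝ u z η)] =
        Ω z ![ξ, η] := by
  have hΩ : ∀ᶠ y in 𝓝 z₀, DifferentiableAt ℝ Ω y := by
    filter_upwards [h.smooth.analyticAt.eventually_analyticAt] with y hy using hy.differentiableAt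
  filter_upwards [hu.flow, hu.variational, hu.eventually_eval h.lie, hu.eventually_eval hΩ]
    with z hz hz1 hz2 hz3 t ht ξ η
  -- By the variational equation the derivative of this function of time is the Lie derivative of
  -- the form along the field, which vanishes.
  let f : ℝ → ℝ := fun t => curryForm (Ω (L1.eval t (u z))) (L1.eval t (fderiv ℝ u z ξ))
    (L1.eval t (fderiv ℝ u z η))
  have hf : ∀ s ∈ Metric.ball (0 : ℝ) 1, HasDerivAt f 0 s := by
    intro s hs
    have hs : |s| < 1 := by simpa using hs
    have h2 : HasDerivAt (fun t => curryForm (Ω (L1.eval t (u z))))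
        (curryForm (fderiv ℝ Ω (L1.eval s (u z)) (Y (L1.eval s (u z))))) s :=
      ((curryForm (V := VM n)).hasFDerivAt.comp _ (hz3 s hs.le).hasFDerivAt).comp_hasDerivAt
        (f := fun t => L1.eval t (u z)) s (hz.2 s hs)
    have h3 := (h2.clm_apply ((hz1 ξ).2 s hs)).clm_apply ((hz1 η).2 s hs)
    refine h3.congr_deriv ?_
    have h4 := hz2 s hs.le (L1.eval s (fderiv ℝ u z ξ)) (L1.eval s (fderiv ℝ u z η))
    simp only [add_apply, curryForm_apply]
    linarith
  have hconst : f t = f 0 := by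
    have hd : DifferentiableOn ℝ f (Metric.ball 0 1) := fun s hs =>
      (hf s hs).differentiableAt.differentiableWithinAt
    exact Metric.isOpen_ball.is_const_of_deriv_eq_zero (convex_ball _ _).isPreconnected hd
      (fun s hs => (hf s hs).deriv) (by simpa using ht) (by simp)
  simpa only [f, curryForm_apply, L1.eval_zero, hz.1, (hz1 ξ).1, (hz1 η).1] using hconst

/-- The flow carries vectors of the kernel to vertical vectors; vertical spaces are isotropic and
the flow preserves the form. -/
theorem IsLocalFlow.eventually_isotropic_real (hu : IsLocalFlow u Y z₀)
    (h : IsLocalSystem Y Ω z₀ T G b) :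
    ∀ᶠ z in 𝓝 z₀, ∀ t : ℝ, |t| < 1 → ∀ ξ η, dMap u t z ξ = 0 → dMap u t z η = 0 →
      Ω z ![ξ, η] = 0 := by
  filter_upwards [hu.eventually_form_eq h, hu.eventually_eval h.vert] with z hz hz1 t ht ξ η hξ hη
  have hinj : ∀ x : EuclideanSpace ℝ (Fin n), ofRealE x = 0 → x = 0 := fun x hx => by
    rw [← reE_ofRealE x, hx, map_zero]
  rw [dMap_ofReal u ht.le] at hξ hη
  rw [← hz t ht ξ η]
  have h1 := hz1 t ht.le (L1.eval t (fderiv ℝ u z ξ)).2 (L1.eval t (fderiv ℝ u z η)).2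
  rw [← hinj _ hξ] at h1
  conv at h1 in (_, (L1.eval t (fderiv ℝ u z η)).2) => rw [hinj _ hξ, ← hinj _ hη]
  exact h1

/-- At real time `dMap` takes real values, so its kernel is the complexification of a real subspace.
-/
theorem mem_kerC_dMap_ofReal {t : ℝ} (ht : |t| ≤ 1) {z : VM n} {Z : ℂ ⊗[ℝ] (VM n)} :
    Z ∈ kerC (dMap u t z).toLinearMap ↔ dMap u t z (reC Z) = 0 ∧ dMap u t z (imC Z) = 0 := by
  rw [mem_kerC]
  simp only [ContinuousLinearMap.coe_coe, dMap_ofReal u ht]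
  constructor
  · intro h
    have h1 := congrArg reE h
    have h2 := congrArg imE h
    simp only [map_add, reE_I_smul, imE_I_smul, reE_ofRealE, imE_ofRealE, map_zero, neg_zero,
      add_zero, zero_add] at h1 h2
    simp [h1, h2]
  · rintro ⟨h1, h2⟩
    simp [h1, h2]

/-! The linearized flow at the rest point. -/

theorem IsLocalFlow.linear_fst (hu : IsLocalFlow u Y z₀) (h : IsLocalSystem Y Ω z₀ T G b)
    (ξ : VM n) (m : ℕ) : (fderiv ℝ u z₀ ξ (m + 1)).1 =
      ((m : ℝ) + 1)⁻¹ • -(T • G (fderiv ℝ u z₀ ξ m).2) := by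
  rw [(hu.linear ξ).2 m, Prod.smul_fst, ← h.deriv_fst (fderiv ℝ u z₀ ξ m).1]

theorem IsLocalFlow.linear_snd (hu : IsLocalFlow u Y z₀) (h : IsLocalSystem Y Ω z₀ T G b)
    (ξ : VM n) (m : ℕ) (v : EuclideanSpace ℝ (Fin n)) : (fderiv ℝ u z₀ ξ (m + 1)).2 v =
      ((m : ℝ) + 1)⁻¹ * (T * b ![G (fderiv ℝ u z₀ ξ m).2, v]) := by
  rw [(hu.linear ξ).2 m, Prod.smul_snd, ← h.deriv_snd (fderiv ℝ u z₀ ξ m).1]; rfl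

/-- The linearized field `(-T G q, T b(G q, ·))` conserves `q + b(v, ·)`. This conserved quantity
later absorbs all magnetic terms. -/
theorem IsLocalFlow.linear_rel (hu : IsLocalFlow u Y z₀) (h : IsLocalSystem Y Ω z₀ T G b)
    (ξ : VM n) (m : ℕ) (v : EuclideanSpace ℝ (Fin n)) : (fderiv ℝ u z₀ ξ (m + 1)).2 v =
      -b ![(fderiv ℝ u z₀ ξ (m + 1)).1, v] := by
  rw [hu.linear_snd h, hu.linear_fst h, form_smul_left, form_neg_left, form_smul_left]
  ring

/-- The linearized field depends on the covector only, so horizontal vectors do not move. -/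
theorem IsLocalFlow.linear_hor (hu : IsLocalFlow u Y z₀) (h : IsLocalSystem Y Ω z₀ T G b)
    (v : EuclideanSpace ℝ (Fin n)) : fderiv ℝ u z₀ (v, 0) = L1.single 0 (v, 0) := by
  have key : ∀ m : ℕ, fderiv ℝ u z₀ (v, 0) (m + 1) = 0 := by
    intro m
    have h2 : (fderiv ℝ u z₀ (v, 0) m).2 = 0 := by
      induction m with
      | zero => rw [(hu.linear _).1]
      | succ m ih =>
        ext v'
        rw [hu.linear_snd h, ih, map_zero, form_zero_left]
        simp
    refine Prod.ext ?_ ?_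
    · rw [hu.linear_fst h, h2]; simp
    · ext v'
      rw [hu.linear_snd h, h2, map_zero, form_zero_left]
      simp
  ext m : 2
  rw [L1.single_apply]
  cases m with
  | zero => rw [if_pos rfl, (hu.linear _).1]
  | succ m => rw [if_neg (Nat.succ_ne_zero m), key]

/-- Base point of the perturbation argument: over the zero section the kernel is a graph at every
time of the closed unit disk. -/
theorem IsLocalFlow.horPart_rest (hu : IsLocalFlow u Y z₀) (h : IsLocalSystem Y Ω z₀ T G b)
    {w : ℂ} (hw : ‖w‖ ≤ 1) : horPart (dMap u w z₀) = 1 := by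
  ext1 v
  have h1 : ∀ x, dMap u w z₀ (x, 0) = ofRealE x := fun x => by
    rw [dMap, ContinuousLinearMap.comp_apply, hu.linear_hor h, L1.evalC_single _ hw]
    simp
  rw [horPart_apply, h1, h1, ofRealE_reE_imE]; rfl

/-- The horizontal component of the graph at the rest point. -/
theorem IsLocalFlow.graphMap_rest (hu : IsLocalFlow u Y z₀) (h : IsLocalSystem Y Ω z₀ T G b)
    {w : ℂ} (hw : ‖w‖ ≤ 1) (c : EC n) : graphMap (dMap u w z₀) c =
      -(dMap u w z₀ (0, covE n (reE c)) + Complex.I • dMap u w z₀ (0, covE n (imE c))) := by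
  rw [← verPart_apply, graphMap, hu.horPart_rest h hw, Ring.inverse_one]
  simp

/-- The covector component of the linearized flow at the rest point. -/
def restCovector (u : VM n → L1 (VM n)) (z₀ : VM n) (w : ℂ) (c : EC n) : EC n :=
  L1.evalC (ofRealE.comp (((covE n).symm : Covec n →L[ℝ] _).comp (ContinuousLinearMap.snd ℝ _ _))) w
    (fderiv ℝ u z₀ (0, covE n (reE c))) + Complex.I •
  L1.evalC (ofRealE.comp (((covE n).symm : Covec n →L[ℝ] _).comp (ContinuousLinearMap.snd ℝ _ _))) w
    (fderiv ℝ u z₀ (0, covE n (imE c)))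

theorem hasSum_reE_evalC {V : Type*} [NormedAddCommGroup V] [NormedSpace ℝ V] [CompleteSpace V]
    (A : V →L[ℝ] EuclideanSpace ℝ (Fin n)) {w : ℂ}
    (hw : ‖w‖ ≤ 1) (a : L1 V) :
    HasSum (fun m => (w ^ m).re • A (a m)) (reE (L1.evalC (ofRealE.comp A) w a)) := by
  have := (reE (n := n)).hasSum (L1.hasSum_evalC (ofRealE.comp A) hw a)
  convert this using 2 with m
  ext j; simp

theorem hasSum_imE_evalC {V : Type*} [NormedAddCommGroup V] [NormedSpace ℝ V] [CompleteSpace V]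
    (A : V →L[ℝ] EuclideanSpace ℝ (Fin n)) {w : ℂ}
    (hw : ‖w‖ ≤ 1) (a : L1 V) :
    HasSum (fun m => (w ^ m).im • A (a m)) (imE (L1.evalC (ofRealE.comp A) w a)) := by
  have := (imE (n := n)).hasSum (L1.hasSum_evalC (ofRealE.comp A) hw a)
  convert this using 2 with m
  ext j; simp

end LocalFlow

/-! ### The growth of `-i ω(Z, Z̄)` in imaginary time at a rest point -/

section LocalPositivity

variable {n : ℕ} {Y : VM n → VM n} {Ω : VM n → (VM n) [⋀^Fin 2]→L[ℝ] ℝ} {z₀ : VM n} {T : ℝ}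
  {G : Covec n →L[ℝ] EuclideanSpace ℝ (Fin n)} {b : (EuclideanSpace ℝ (Fin n)) [⋀^Fin 2]→L[ℝ] ℝ}
  {u : VM n → L1 (VM n)}

theorem L1.evalC_map {V W : Type*} [NormedAddCommGroup V] [NormedSpace ℝ V] [CompleteSpace V]
    [NormedAddCommGroup W] [NormedSpace ℝ W] [CompleteSpace W] (ι : W →L[ℝ] EC n) (A : V →L[ℝ] W)
    {w : ℂ} (hw : ‖w‖ ≤ 1) (a : L1 V) : L1.evalC ι w (L1.map A a) = L1.evalC (ι.comp A) w a := by
  have : (L1.evalC ι w).comp (L1.map A) = L1.evalC (ι.comp A) w := L1.ext_single fun m v => by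
    rw [ContinuousLinearMap.comp_apply, L1.map_single, L1.evalC_single _ hw, L1.evalC_single _ hw]
    rfl
  exact congrArg (fun B => B a) this

/-- The covector coordinates on the model space. -/
def covPart : VM n →L[ℝ] EuclideanSpace ℝ (Fin n) :=
  ((covE n).symm : Covec n →L[ℝ] _).comp (ContinuousLinearMap.snd ℝ _ _)

theorem covPart_apply (ξ : VM n) : covPart ξ = (covE n).symm ξ.2 := rfl

theorem restCovector_eq (w : ℂ) (c : EC n) : restCovector u z₀ w c =
    L1.evalC (ofRealE.comp covPart) w (fderiv ℝ u z₀ (0, covE n (reE c))) + Complex.I •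
    L1.evalC (ofRealE.comp covPart) w (fderiv ℝ u z₀ (0, covE n (imE c))) := rfl

theorem IsLocalFlow.restCovector_zero (hu : IsLocalFlow u Y z₀) (c : EC n) :
    restCovector u z₀ 0 c = c := by
  rw [restCovector_eq, L1.evalC_zero, L1.evalC_zero, (hu.linear _).1, (hu.linear _).1]
  simp only [ContinuousLinearMap.comp_apply, covPart_apply, ContinuousLinearEquiv.symm_apply_apply]
  exact ofRealE_reE_imE c

theorem form_eq_clm (b : (EuclideanSpace ℝ (Fin n)) [⋀^Fin 2]→L[ℝ] ℝ)
    (v : EuclideanSpace ℝ (Fin n)) :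
    ∃ L : EuclideanSpace ℝ (Fin n) →L[ℝ] ℝ, ∀ x, L x = b ![x, v] :=
  ⟨(curryForm b).flip v, fun x => curryForm_apply b x v⟩

/-- Conservation of `q + b(v, ·)` holds coefficientwise in time: the constant term is `q` and all
others vanish. Summing the series gives it at complex time; the imaginary part is zero because the
initial covector is real. -/
theorem IsLocalFlow.covector_rel (hu : IsLocalFlow u Y z₀) (h : IsLocalSystem Y Ω z₀ T G b)
    {w : ℂ} (hw : ‖w‖ ≤ 1) (q : Covec n) (v : EuclideanSpace ℝ (Fin n)) :
    covE n (reE (L1.evalC (ofRealE.comp covPart) w (fderiv ℝ u z₀ (0, q)))) v +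
        b ![reE (dMap u w z₀ (0, q)), v] = q v ∧
    covE n (imE (L1.evalC (ofRealE.comp covPart) w (fderiv ℝ u z₀ (0, q)))) v +
        b ![imE (dMap u w z₀ (0, q)), v] = 0 := by
  obtain ⟨L, hL⟩ := form_eq_clm b v
  let K : EuclideanSpace ℝ (Fin n) →L[ℝ] ℝ :=
    (ContinuousLinearMap.apply ℝ ℝ v).comp (covE n : EuclideanSpace ℝ (Fin n) →L[ℝ] Covec n)
  set H := fderiv ℝ u z₀ (0, q) with hH
  have hterm : ∀ m : ℕ, K (covPart (H m)) + L (H m).1 = if m = 0 then q v else 0 := by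
    intro m
    have h1 : K (covPart (H m)) = (H m).2 v := by
      simp [K, covPart_apply]
    rw [h1, hL]
    cases m with
    | zero => rw [(hu.linear (0, q)).1, if_pos rfl, form_zero_left, add_zero]
    | succ m => rw [hu.linear_rel h, if_neg (Nat.succ_ne_zero m)]; ring
  constructor
  · have h1 := K.hasSum (hasSum_reE_evalC covPart hw H)
    have h2 := L.hasSum (hasSum_reE_evalC (ContinuousLinearMap.fst ℝ _ _) hw H)
    have h3 := h1.add h2
    rw [← hL]
    refine h3.unique ?_
    convert hasSum_ite_eq 0 (q v) using 2 with m
    have := hterm m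
    simp only [map_smul, smul_eq_mul, ContinuousLinearMap.coe_fst'] at this ⊢
    rw [← mul_add, this]
    split_ifs with hm <;> simp [hm]
  · have h1 := K.hasSum (hasSum_imE_evalC covPart hw H)
    have h2 := L.hasSum (hasSum_imE_evalC (ContinuousLinearMap.fst ℝ _ _) hw H)
    have h3 := h1.add h2
    rw [← hL]
    refine h3.unique ?_
    convert hasSum_zero with m
    have := hterm m
    simp only [map_smul, smul_eq_mul, ContinuousLinearMap.coe_fst'] at this ⊢
    rw [← mul_add, this]
    split_ifs with hm <;> simp [hm]

/-- The plus sign in front of `b` comes from the graph being minus the horizontal displacement, see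
`IsLocalFlow.graphMap_rest`. -/
theorem IsLocalFlow.restCovector_rel (hu : IsLocalFlow u Y z₀) (h : IsLocalSystem Y Ω z₀ T G b)
    {w : ℂ} (hw : ‖w‖ ≤ 1) (c : EC n) (v : EuclideanSpace ℝ (Fin n)) :
    covE n (reE (restCovector u z₀ w c)) v =
      covE n (reE c) v + b ![reE (graphMap (dMap u w z₀) c), v] ∧
    covE n (imE (restCovector u z₀ w c)) v =
      covE n (imE c) v + b ![imE (graphMap (dMap u w z₀) c), v] := by
  have h1 := hu.covector_rel h hw (covE n (reE c)) v
  have h2 := hu.covector_rel h hw (covE n (imE c)) v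
  rw [hu.graphMap_rest h hw, restCovector_eq]
  simp only [map_add, map_neg, reE_I_smul, imE_I_smul, add_apply, neg_apply, form_neg_left,
    form_add_left]
  constructor <;> linarith [h1.1, h1.2, h2.1, h2.2]

theorem IsLocalFlow.hasDerivAt_evalC (hu : IsLocalFlow u Y z₀) (ι : VM n →L[ℝ] EC n) (ξ : VM n)
    {w : ℂ} (hw : ‖w‖ < 1) : HasDerivAt (fun w => L1.evalC ι w (fderiv ℝ u z₀ ξ))
      (L1.evalC (ι.comp (fderiv ℝ Y z₀)) w (fderiv ℝ u z₀ ξ)) w := by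
  rw [← L1.evalC_map ι _ hw.le]
  refine L1.hasDerivAt_evalC ι (fun m => ?_) hw
  rw [L1.map_apply]
  exact (hu.linear ξ).2 m

/-- At the rest point the velocity of the horizontal component is `-T G` applied to the covector
component; the sign disappears because the graph is minus that component. -/
theorem IsLocalFlow.hasDerivAt_graphMap (hu : IsLocalFlow u Y z₀) (h : IsLocalSystem Y Ω z₀ T G b)
    (c : EC n) {w : ℂ} (hw : ‖w‖ < 1) :
    ∃ s' : EC n, HasDerivAt (fun w => graphMap (dMap u w z₀) c) s' w ∧
      reE s' = T • G (covE n (reE (restCovector u z₀ w c))) ∧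
      imE s' = T • G (covE n (imE (restCovector u z₀ w c))) := by
  let L : EuclideanSpace ℝ (Fin n) →L[ℝ] EuclideanSpace ℝ (Fin n) :=
    -(T • G.comp (covE n : EuclideanSpace ℝ (Fin n) →L[ℝ] Covec n))
  have hA : (ContinuousLinearMap.fst ℝ (EuclideanSpace ℝ (Fin n)) (Covec n)).comp (fderiv ℝ Y z₀) =
      L.comp covPart := by
    refine ContinuousLinearMap.ext fun ξ => ?_
    have := h.deriv_fst ξ.1 ξ.2
    simp only [Prod.mk.eta] at this
    simp [L, covPart_apply, this]
  have hd : ∀ q : Covec n, HasDerivAt (fun w => dMap u w z₀ (0, q))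
      (extendE (ofRealE.comp L) (L1.evalC (ofRealE.comp covPart) w (fderiv ℝ u z₀ (0, q)))) w := by
    intro q
    have h1 := hu.hasDerivAt_evalC (ofRealE.comp (ContinuousLinearMap.fst ℝ _ _)) (0, q) hw
    rw [ContinuousLinearMap.comp_assoc, hA, L1.evalC_comp_apply _ _ hw.le] at h1
    exact h1
  have hd2 := ((hd (covE n (reE c))).add ((hd (covE n (imE c))).const_smul Complex.I)).neg
  refine ⟨-(extendE (ofRealE.comp L) (restCovector u z₀ w c)), ?_, ?_, ?_⟩
  · rw [restCovector_eq, map_add, map_smul]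
    refine hd2.congr_of_eventuallyEq ?_
    filter_upwards [Metric.isOpen_ball.mem_nhds (show w ∈ Metric.ball (0 : ℂ) 1 by simpa using hw)]
      with w' hw'
    exact hu.graphMap_rest h (by simpa using (Metric.mem_ball.1 hw').le) c
  · simp [extendE_apply, L]
  · simp [extendE_apply, L]

/-- The covector component of the linearized field involves only the covector, so it satisfies a
closed linear equation with constant coefficients. -/
theorem IsLocalFlow.hasDerivAt_restCovector (hu : IsLocalFlow u Y z₀)
    (h : IsLocalSystem Y Ω z₀ T G b) (c : EC n) : ∃ B : EC n →L[ℂ] EC n, ∀ w : ℂ, ‖w‖ < 1 →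
      HasDerivAt (fun w => restCovector u z₀ w c) (B (restCovector u z₀ w c)) w := by
  let L : EuclideanSpace ℝ (Fin n) →L[ℝ] EuclideanSpace ℝ (Fin n) :=
    (covPart.comp (fderiv ℝ Y z₀)).comp ((ContinuousLinearMap.inr ℝ _ _).comp
      (covE n : EuclideanSpace ℝ (Fin n) →L[ℝ] Covec n))
  have hA : covPart.comp (fderiv ℝ Y z₀) = L.comp covPart := by
    refine ContinuousLinearMap.ext fun ξ => ?_
    simp only [L, ContinuousLinearMap.comp_apply, covPart_apply]
    congr 1
    ext v
    have h1 := h.deriv_snd ξ.1 ξ.2 v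
    simp only [Prod.mk.eta] at h1
    rw [h1]
    simp only [ContinuousLinearEquiv.coe_coe, ContinuousLinearEquiv.apply_symm_apply,
      ContinuousLinearMap.inr_apply]
    rw [h.deriv_snd]
  have hd : ∀ (q : Covec n) (w : ℂ), ‖w‖ < 1 →
      HasDerivAt (fun w => L1.evalC (ofRealE.comp covPart) w (fderiv ℝ u z₀ (0, q)))
      (extendE (ofRealE.comp L) (L1.evalC (ofRealE.comp covPart) w (fderiv ℝ u z₀ (0, q)))) w := by
    intro q w hw
    have h1 := hu.hasDerivAt_evalC (ofRealE.comp covPart) (0, q) hw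
    rw [ContinuousLinearMap.comp_assoc, hA, L1.evalC_comp_apply _ _ hw.le] at h1
    exact h1
  refine ⟨extendE (ofRealE.comp L), fun w hw => ?_⟩
  have hd2 := (hd (covE n (reE c)) w hw).add ((hd (covE n (imE c)) w hw).const_smul Complex.I)
  rw [restCovector_eq, map_add, map_smul]
  exact hd2

/-- Multiplied by `exp (-w B)`, the solution of the linear equation is constant; its initial value
`c` is nonzero. -/
theorem IsLocalFlow.restCovector_ne_zero (hu : IsLocalFlow u Y z₀)
    (h : IsLocalSystem Y Ω z₀ T G b) {c : EC n} (hc : c ≠ 0) {w : ℂ} (hw : ‖w‖ < 1) :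
    restCovector u z₀ w c ≠ 0 := by
  obtain ⟨B, hB⟩ := hu.hasDerivAt_restCovector h c
  intro h0
  let f : ℂ → EC n := fun w => NormedSpace.exp (w • (-B)) (restCovector u z₀ w c)
  have hf : ∀ w ∈ Metric.ball (0 : ℂ) 1, HasDerivAt f 0 w := by
    intro w hw
    have h1 : HasDerivAt (fun w : ℂ => NormedSpace.exp (w • (-B)))
        (NormedSpace.exp (w • (-B)) * (-B)) w := hasDerivAt_exp_smul_const (-B) w
    have h2 := h1.clm_apply (hB w (by simpa using hw))
    refine h2.congr_deriv ?_
    change NormedSpace.exp (w • (-B)) (-(B (restCovector u z₀ w c))) + _ = 0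
    rw [map_neg]
    exact neg_add_cancel _
  have hd : DifferentiableOn ℂ f (Metric.ball 0 1) := fun s hs =>
    (hf s hs).differentiableAt.differentiableWithinAt
  have h1 : f w = f 0 := Metric.isOpen_ball.is_const_of_deriv_eq_zero
    (convex_ball _ _).isPreconnected hd (fun s hs => (hf s hs).deriv) (by simpa using hw) (by simp)
  have h2 : NormedSpace.exp ((0 : ℂ) • (-B)) = 1 :=
    (congrArg NormedSpace.exp (zero_smul ℂ (-B))).trans NormedSpace.exp_zero
  simp only [f, h0, map_zero, hu.restCovector_zero] at h1
  rw [h2] at h1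
  exact hc h1.symm

/-- The derivative of the graph map in the imaginary time direction. -/
def graphMapDeriv (u : VM n → L1 (VM n)) (z : VM n) (w : ℂ) : EC n →L[ℂ] EC n :=
  fderiv ℝ (fun p : VM n × ℂ => graphMap (dMap u p.2 p.1)) (z, w) (0, Complex.I)

/-- The derivative of `-i ω(Z, Z̄)` along the graph in the imaginary time direction. -/
def positivityDeriv (u : VM n → L1 (VM n)) (Ω : VM n → (VM n) [⋀^Fin 2]→L[ℝ] ℝ)
    (z : VM n) (w : ℂ) (c : EC n) : ℝ :=
  -2 * (curryForm (Ω z) (reE (graphMapDeriv u z w c), 0)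
      (imE (graphMap (dMap u w z) c), covE n (imE c)) +
    curryForm (Ω z) (reE (graphMap (dMap u w z) c), covE n (reE c))
      (imE (graphMapDeriv u z w c), 0))

theorem hasDerivAt_graphMap_vertical {z : VM n} (hu : AnalyticAt ℝ u z) {σ τ : ℝ}
    (hw : ‖(σ + τ * Complex.I : ℂ)‖ < 1)
    (hD : IsUnit (horPart (dMap u (σ + τ * Complex.I) z))) (c : EC n) :
    HasDerivAt (fun t : ℝ => graphMap (dMap u (σ + t * Complex.I) z) c)
      (graphMapDeriv u z (σ + τ * Complex.I) c) τ := by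
  have h1 : HasFDerivAt (fun p : VM n × ℂ => graphMap (dMap u p.2 p.1))
      (fderiv ℝ (fun p : VM n × ℂ => graphMap (dMap u p.2 p.1)) (z, (σ + τ * Complex.I : ℂ)))
      (z, (σ + τ * Complex.I : ℂ)) :=
    ((contDiffAt_graphMap_dMap hu hw hD).differentiableAt (by simp)).hasFDerivAt
  have h2 : HasDerivAt (fun t : ℝ => (z, (σ + t * Complex.I : ℂ))) (0, Complex.I) τ := by
    refine (hasDerivAt_const τ z).prodMk ?_
    have := ((Complex.ofRealCLM.hasDerivAt (x := τ)).mul_const Complex.I).const_add (σ : ℂ)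
    simpa using this
  have h3 := h1.comp_hasDerivAt τ h2
  have h4 : HasDerivAt (fun t : ℝ => graphMap (dMap u (σ + t * Complex.I) z))
    (graphMapDeriv u z (σ + τ * Complex.I)) τ := h3
  have h5 := ((ContinuousLinearMap.apply ℂ (EC n) c).restrictScalars ℝ).hasFDerivAt.comp_hasDerivAt
    τ h4
  exact h5

/-- The heart of the positivity. In the imaginary direction the graph moves with velocity `i s'`,
where `s' = T G N` and `N` is the transported covector. Inserting this in the form, the terms in `c`
and in `b` combine by `IsLocalFlow.restCovector_rel` into `N` itself, leaving `2T` times the dual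
metric on `Re N` and `Im N`. -/
theorem IsLocalFlow.positivityDeriv_rest (hu : IsLocalFlow u Y z₀)
    (h : IsLocalSystem Y Ω z₀ T G b) {c : EC n} (hc : c ≠ 0) {w : ℂ} (hw : ‖w‖ < 1) :
    0 < positivityDeriv u Ω z₀ w c := by
  obtain ⟨s', hs, hre, him⟩ := hu.hasDerivAt_graphMap h c hw
  have hwe : ((w.re : ℂ) + (w.im : ℂ) * Complex.I) = w := Complex.re_add_im w
  have hunit : IsUnit (horPart (dMap u w z₀)) := by
    rw [hu.horPart_rest h hw.le]; exact isUnit_one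
  have h1 := hasDerivAt_graphMap_vertical (σ := w.re) (τ := w.im) hu.analytic (by rwa [hwe])
    (by rwa [hwe]) c
  rw [hwe] at h1
  have h2 : HasDerivAt (fun t : ℝ => graphMap (dMap u (w.re + t * Complex.I) z₀) c)
      (Complex.I • s') w.im := by
    have h3 : HasDerivAt (fun t : ℝ => (w.re + t * Complex.I : ℂ)) Complex.I w.im := by
      have := ((Complex.ofRealCLM.hasDerivAt (x := w.im)).mul_const Complex.I).const_add (w.re : ℂ)
      simpa using this
    rw [← hwe] at hs
    exact hs.scomp w.im h3
  have h4 : graphMapDeriv u z₀ w c = Complex.I • s' := h1.unique h2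
  have hrel := fun v => hu.restCovector_rel h hw.le c v
  set N := restCovector u z₀ w c with hN
  have hNne : N ≠ 0 := hu.restCovector_ne_zero h hc hw
  rw [positivityDeriv, h4, reE_I_smul, imE_I_smul, curryForm_apply, curryForm_apply, h.form, h.form]
  have e1 := (hrel (imE s')).2
  have e2 := (hrel (reE s')).1
  have e3 : b ![-imE s', imE (graphMap (dMap u w z₀) c)] =
      b ![imE (graphMap (dMap u w z₀) c), imE s'] := by
    rw [form_neg_left, ← form_swap]
  have e4 : covE n (reE N) (reE s') = T * covE n (reE N) (G (covE n (reE N))) := by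
    rw [hre, map_smul, smul_eq_mul]
  have e5 : covE n (imE N) (imE s') = T * covE n (imE N) (G (covE n (imE N))) := by
    rw [him, map_smul, smul_eq_mul]
  have hnn : ∀ q : Covec n, 0 ≤ q (G q) := fun q => by
    by_cases hq : q = 0
    · simp [hq]
    · exact (h.pos q hq).le
  have key : 0 < covE n (reE N) (G (covE n (reE N))) + covE n (imE N) (G (covE n (imE N))) := by
    by_cases hr : reE N = 0
    · have hi : imE N ≠ 0 := fun hi => hNne (extE (by simpa using hr) (by simpa using hi))
      have := h.pos (covE n (imE N)) (by simpa using hi)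
      linarith [hnn (covE n (reE N))]
    · have := h.pos (covE n (reE N)) (by simpa using hr)
      linarith [hnn (covE n (imE N))]
  rw [e3, map_neg, zero_apply, zero_apply]
  nlinarith [mul_pos h.time_pos key]

end LocalPositivity

/-! ### Lagrangian and positive kernels near a rest point -/

section LocalTheorem

variable {n : ℕ} {Y : VM n → VM n} {Ω : VM n → (VM n) [⋀^Fin 2]→L[ℝ] ℝ} {z₀ : VM n} {T : ℝ}
  {G : Covec n →L[ℝ] EuclideanSpace ℝ (Fin n)} {b : (EuclideanSpace ℝ (Fin n)) [⋀^Fin 2]→L[ℝ] ℝ}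
  {u : VM n → L1 (VM n)}

/-- Invertibility is open and holds at the rest point for all `w`; compactness of the closed disk
makes the neighbourhood uniform in `w`. -/
theorem IsLocalFlow.eventually_isUnit_horPart (hu : IsLocalFlow u Y z₀)
    (h : IsLocalSystem Y Ω z₀ T G b) {ρ : ℝ} (hρ : ρ < 1) :
    ∀ᶠ z in 𝓝 z₀, ∀ w ∈ Metric.closedBall (0 : ℂ) ρ, IsUnit (horPart (dMap u w z)) := by
  refine (isCompact_closedBall (0 : ℂ) ρ).eventually_forall_of_forall_eventually fun w hw => ?_
  have hw1 : ‖w‖ < 1 := by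
    have := mem_closedBall_zero_iff.1 hw
    linarith
  have h1 : ContinuousAt (fun p : VM n × ℂ => horPart (dMap u p.2 p.1)) (z₀, w) :=
    (horPart (n := n)).continuous.continuousAt.comp
      (contDiffAt_dMap hu.analytic hw1).continuousAt
  have h2 : IsUnit (horPart (dMap u w z₀)) := by rw [hu.horPart_rest h hw1.le]; exact isUnit_one
  exact h1.eventually (Units.isOpen.mem_nhds h2)

theorem continuousAt_positivityDeriv {z : VM n} (hu : AnalyticAt ℝ u z) (hΩ : ContinuousAt Ω z)
    {w : ℂ} (hw : ‖w‖ < 1) (hD : IsUnit (horPart (dMap u w z))) (c : EC n) :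
    ContinuousAt (fun p : VM n × (ℂ × EC n) => positivityDeriv u Ω p.1 p.2.1 p.2.2)
      (z, (w, c)) := by
  have hS := contDiffAt_graphMap_dMap hu hw hD
  have hp : ContinuousAt (fun p : VM n × (ℂ × EC n) => (p.1, p.2.1)) (z, (w, c)) := by fun_prop
  have h1 : ContinuousAt (fun p : VM n × (ℂ × EC n) => graphMap (dMap u p.2.1 p.1)) (z, (w, c)) :=
    ContinuousAt.comp (g := fun p : VM n × ℂ => graphMap (dMap u p.2 p.1))
      (f := fun p : VM n × (ℂ × EC n) => (p.1, p.2.1)) (x := (z, (w, c))) hS.continuousAt hp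
  have h2 : ContinuousAt (fun p : VM n × (ℂ × EC n) => graphMapDeriv u p.1 p.2.1)
      (z, (w, c)) := by
    have h3 : ContinuousAt (fun p : VM n × ℂ => graphMapDeriv u p.1 p.2) (z, w) := by
      have h4 := (hS.fderiv_right (m := 0) (by simp)).continuousAt
      exact h4.clm_apply continuousAt_const
    exact ContinuousAt.comp (g := fun p : VM n × ℂ => graphMapDeriv u p.1 p.2)
      (f := fun p : VM n × (ℂ × EC n) => (p.1, p.2.1)) (x := (z, (w, c))) h3 hp
  have hc : ContinuousAt (fun p : VM n × (ℂ × EC n) => p.2.2) (z, (w, c)) := by fun_prop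
  have h5 := h1.clm_apply hc
  have h6 := h2.clm_apply hc
  have h7 : ContinuousAt (fun p : VM n × (ℂ × EC n) => curryForm (Ω p.1)) (z, (w, c)) := by
    have : ContinuousAt (fun p : VM n × (ℂ × EC n) => Ω p.1) (z, (w, c)) :=
      ContinuousAt.comp (g := Ω) (f := Prod.fst) hΩ continuousAt_fst
    exact (curryForm (V := VM n)).continuous.continuousAt.comp this
  have hre := (reE (n := n)).continuous
  have him := (imE (n := n)).continuous
  have hcov := (covE n).continuous
  have a1 := (hre.continuousAt.comp h6).prodMk (continuousAt_const (y := (0 : Covec n)))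
  have a2 := (him.continuousAt.comp h6).prodMk (continuousAt_const (y := (0 : Covec n)))
  have a3 := (him.continuousAt.comp h5).prodMk
    (hcov.continuousAt.comp (him.continuousAt.comp hc))
  have a4 := (hre.continuousAt.comp h5).prodMk
    (hcov.continuousAt.comp (hre.continuousAt.comp hc))
  exact (((h7.clm_apply a1).clm_apply a3).add ((h7.clm_apply a4).clm_apply a2)).const_mul (-2)

/-- Strict positivity at the rest point survives on a neighbourhood uniform over the compact product
of a disk and a unit sphere; homogeneity in `c` makes the sphere sufficient. -/
theorem IsLocalFlow.eventually_positivityDeriv (hu : IsLocalFlow u Y z₀)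
    (h : IsLocalSystem Y Ω z₀ T G b) {ρ : ℝ} (hρ : ρ < 1) :
    ∀ᶠ z in 𝓝 z₀, ∀ p ∈ Metric.closedBall (0 : ℂ) ρ ×ˢ Metric.sphere (0 : EC n) 1,
      0 < positivityDeriv u Ω z p.1 p.2 := by
  refine ((isCompact_closedBall (0 : ℂ) ρ).prod
    (isCompact_sphere (0 : EC n) 1)).eventually_forall_of_forall_eventually ?_
  rintro ⟨w, c⟩ ⟨hw, hc⟩
  have hw1 : ‖w‖ < 1 := by
    have := mem_closedBall_zero_iff.1 hw
    linarith
  have hc0 : c ≠ 0 := by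
    rintro rfl
    simp at hc
  have h2 : IsUnit (horPart (dMap u w z₀)) := by rw [hu.horPart_rest h hw1.le]; exact isUnit_one
  exact (continuousAt_positivityDeriv hu.analytic h.smooth.continuousAt hw1 h2 c).eventually
    (lt_mem_nhds (hu.positivityDeriv_rest h hc0 hw1))

theorem positivityDeriv_smul (z : VM n) (w : ℂ) (r : ℝ) (c : EC n) :
    positivityDeriv u Ω z w (r • c) = r ^ 2 * positivityDeriv u Ω z w c := by
  have h1 : graphMapDeriv u z w (r • c) = r • graphMapDeriv u z w c := ContinuousLinearMap.map_smul_of_tower _ _ _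
  have h2 : graphMap (dMap u w z) (r • c) = r • graphMap (dMap u w z) c := ContinuousLinearMap.map_smul_of_tower _ _ _
  have h3 : ∀ (x : EuclideanSpace ℝ (Fin n)) (q : Covec n), ((r • x, r • q) : VM n) = r • (x, q) :=
    fun _ _ => rfl
  have h4 : ∀ (x : EuclideanSpace ℝ (Fin n)), ((r • x, 0) : VM n) = r • (x, 0) :=
    fun _ => by rw [← h3, smul_zero]
  simp only [positivityDeriv, h1, h2, map_smul, h3, h4, smul_apply, smul_eq_mul]
  ring

/-- The values of `-i ω(Z, Z̄)` along the graph. -/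
def graphForm (u : VM n → L1 (VM n)) (Ω : VM n → (VM n) [⋀^Fin 2]→L[ℝ] ℝ)
    (z : VM n) (w : ℂ) (c : EC n) : ℝ :=
  -2 * curryForm (Ω z) (reE (graphMap (dMap u w z) c), covE n (reE c))
      (imE (graphMap (dMap u w z) c), covE n (imE c))

theorem graphForm_eq (z : VM n) (w : ℂ) (c : EC n) : graphForm u Ω z w c =
    -2 * Ω z ![reC (toTensor (graphMap (dMap u w z) c, c)),
      imC (toTensor (graphMap (dMap u w z) c, c))] := by
  rw [graphForm, curryForm_apply, reC_toTensor, imC_toTensor]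

theorem hasDerivAt_graphForm_vertical {z : VM n} (hu : AnalyticAt ℝ u z) {σ τ : ℝ}
    (hw : ‖(σ + τ * Complex.I : ℂ)‖ < 1)
    (hD : IsUnit (horPart (dMap u (σ + τ * Complex.I) z))) (c : EC n) :
    HasDerivAt (fun t : ℝ => graphForm u Ω z (σ + t * Complex.I) c)
      (positivityDeriv u Ω z (σ + τ * Complex.I) c) τ := by
  have h1 := hasDerivAt_graphMap_vertical hu hw hD c
  have h2 : HasDerivAt (fun t : ℝ => reE (graphMap (dMap u (σ + t * Complex.I) z) c)) _ τ :=
    (reE (n := n)).hasFDerivAt.comp_hasDerivAt τ h1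
  have h3 : HasDerivAt (fun t : ℝ => imE (graphMap (dMap u (σ + t * Complex.I) z) c)) _ τ :=
    (imE (n := n)).hasFDerivAt.comp_hasDerivAt τ h1
  have h4 := h2.prodMk (hasDerivAt_const τ (covE n (reE c)))
  have h5 := h3.prodMk (hasDerivAt_const τ (covE n (imE c)))
  have h6 := (((curryForm (Ω z)).hasFDerivAt.comp_hasDerivAt τ h4).clm_apply h5).const_mul (-2)
  exact h6

/-- Apply the mean value theorem on the vertical segment from `Re w` to `w`: the quantity is zero at
the real end by isotropy, and its derivative along the segment is `Im w` times a positive number. -/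
theorem IsLocalFlow.eventually_graphForm (hu : IsLocalFlow u Y z₀)
    (h : IsLocalSystem Y Ω z₀ T G b) {ρ : ℝ} (hρ : ρ < 1) :
    ∀ᶠ z in 𝓝 z₀, ∀ w ∈ Metric.closedBall (0 : ℂ) ρ, w.im ≠ 0 → ∀ c : EC n, c ≠ 0 →
      0 < w.im * graphForm u Ω z w c := by
  filter_upwards [hu.eventually_isUnit_horPart h hρ, hu.eventually_positivityDeriv h hρ,
    hu.eventually_isotropic_real h, hu.analytic.eventually_analyticAt] with z hz1 hz2 hz3 hz4 w hw
    him c hc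
  have hpos : ∀ w ∈ Metric.closedBall (0 : ℂ) ρ, 0 < positivityDeriv u Ω z w c := by
    intro w hw
    have h1 : c = ‖c‖ • (‖c‖⁻¹ • c) := by
      rw [smul_smul, mul_inv_cancel₀ (norm_ne_zero_iff.2 hc), one_smul]
    have h2 : ‖(‖c‖⁻¹ • c)‖ = 1 := by
      rw [norm_smul, norm_inv, norm_norm, inv_mul_cancel₀ (norm_ne_zero_iff.2 hc)]
    rw [h1, positivityDeriv_smul]
    have := hz2 (w, ‖c‖⁻¹ • c) ⟨hw, by simpa using h2⟩
    have hc' : 0 < ‖c‖ := norm_pos_iff.2 hc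
    positivity
  -- Shrinking the imaginary part decreases the modulus, so the segment stays in the disk.
  have hseg : ∀ x ∈ Icc (0 : ℝ) 1, (w.re + ((x * w.im : ℝ) : ℂ) * Complex.I : ℂ) ∈
      Metric.closedBall (0 : ℂ) ρ := by
    intro x hx
    rw [mem_closedBall_zero_iff] at hw ⊢
    refine le_trans ?_ hw
    rw [← Complex.mk_eq_add_mul_I, ← sq_le_sq₀ (norm_nonneg _) (norm_nonneg _),
      Complex.sq_norm, Complex.sq_norm, Complex.normSq_mk, Complex.normSq_apply]
    have : x * x ≤ 1 := by nlinarith [hx.1, hx.2]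
    nlinarith [mul_self_nonneg w.im]
  have hlt : ∀ x ∈ Icc (0 : ℝ) 1, ‖(w.re + ((x * w.im : ℝ) : ℂ) * Complex.I : ℂ)‖ < 1 :=
    fun x hx => (mem_closedBall_zero_iff.1 (hseg x hx)).trans_lt hρ
  have hder : ∀ x ∈ Icc (0 : ℝ) 1, HasDerivAt
      (fun x : ℝ => graphForm u Ω z (w.re + ((x * w.im : ℝ) : ℂ) * Complex.I) c)
      (w.im * positivityDeriv u Ω z (w.re + ((x * w.im : ℝ) : ℂ) * Complex.I) c) x := by
    intro x hx
    have h1 := hasDerivAt_graphForm_vertical (Ω := Ω) hz4 (hlt x hx) (hz1 _ (hseg x hx)) c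
    have h2 : HasDerivAt (fun x : ℝ => x * w.im) w.im x := by
      simpa using (hasDerivAt_id x).mul_const w.im
    have := h1.scomp x h2
    exact this
  have h0 : graphForm u Ω z (w.re + (((0 : ℝ) * w.im : ℝ) : ℂ) * Complex.I) c = 0 := by
    have hh := hseg 0 (by simp)
    have hh2 := hlt 0 (by simp)
    have e : (w.re + (((0 : ℝ) * w.im : ℝ) : ℂ) * Complex.I : ℂ) = (w.re : ℂ) := by simp
    rw [e] at hh hh2 ⊢
    have ht : |w.re| < 1 := by simpa using hh2
    have hmem := (mem_kerC_iff_graph (hz1 _ hh) _).2 ⟨c, rfl⟩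
    rw [mem_kerC_dMap_ofReal ht.le] at hmem
    rw [graphForm_eq, hz3 _ ht _ _ hmem.1 hmem.2, mul_zero]
  obtain ⟨x, hx, hx2⟩ := exists_hasDerivAt_eq_slope _ _ zero_lt_one
    (fun x hx => (hder x hx).continuousAt.continuousWithinAt)
    (fun x hx => hder x (Ioo_subset_Icc_self hx))
  have h3 : (w.re + (((1 : ℝ) * w.im : ℝ) : ℂ) * Complex.I : ℂ) = w := by
    rw [one_mul, Complex.re_add_im]
  rw [h0, h3] at hx2
  have h4 := hpos _ (hseg x (Ioo_subset_Icc_self hx))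
  have h5 : graphForm u Ω z w c =
    w.im * positivityDeriv u Ω z (w.re + ((x * w.im : ℝ) : ℂ) * Complex.I) c := by
    rw [hx2]; ring
  rw [h5, ← mul_assoc]
  exact mul_pos (mul_self_pos.2 him) h4

theorem differentiableOn_graphMap_dMap {z : VM n} {ρ : ℝ} (hρ : ρ ≤ 1)
    (hD : ∀ w ∈ Metric.ball (0 : ℂ) ρ, IsUnit (horPart (dMap u w z))) :
    DifferentiableOn ℂ (fun w => graphMap (dMap u w z)) (Metric.ball 0 ρ) := by
  intro w hw
  have h1 : DifferentiableAt ℂ (fun w => dMap u w z) w :=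
    (differentiableOn_dMap u z).differentiableAt
      (Metric.isOpen_ball.mem_nhds (Metric.ball_subset_ball hρ hw))
  exact (((contDiffAt_graphMap (hD w hw)).differentiableAt (by simp)).comp w
    h1).differentiableWithinAt

/-- For fixed `c`, `c'` the bilinear form on the two graph vectors is holomorphic in `w` and
vanishes on the real axis. -/
theorem IsLocalFlow.eventually_isotropic (hu : IsLocalFlow u Y z₀)
    (h : IsLocalSystem Y Ω z₀ T G b) {ρ : ℝ} (hρ : ρ < 1) :
    ∀ᶠ z in 𝓝 z₀, ∀ w ∈ Metric.ball (0 : ℂ) ρ,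
      ∀ Z ∈ kerC (dMap u w z).toLinearMap, ∀ Z' ∈ kerC (dMap u w z).toLinearMap,
        formC (Ω z) Z Z' = 0 := by
  filter_upwards [hu.eventually_isUnit_horPart h hρ,
    hu.eventually_isotropic_real h] with z hz1 hz3 w hw Z hZ Z' hZ'
  have hz1' : ∀ w ∈ Metric.ball (0 : ℂ) ρ, IsUnit (horPart (dMap u w z)) := fun w hw =>
    hz1 w (Metric.ball_subset_closedBall hw)
  obtain ⟨c, rfl⟩ := (mem_kerC_iff_graph (hz1' w hw) _).1 hZ
  obtain ⟨c', rfl⟩ := (mem_kerC_iff_graph (hz1' w hw) _).1 hZ'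
  let B : (EC n × EC n) →ₗ[ℂ] (EC n × EC n) →ₗ[ℂ] ℂ :=
    (formCBilin (Ω z)).compl₁₂ toTensor toTensor
  let B' : (EC n × EC n) →L[ℂ] (EC n × EC n) →L[ℂ] ℂ :=
    LinearMap.toContinuousLinearMap
      ((LinearMap.toContinuousLinearMap (𝕜 := ℂ) (E := EC n × EC n) (F' := ℂ)).toLinearMap ∘ₗ B)
  have hB : ∀ p q, B' p q = formC (Ω z) (toTensor p) (toTensor q) := fun _ _ => rfl
  have hS := differentiableOn_graphMap_dMap hρ.le hz1'
  have hf : DifferentiableOn ℂ (fun w => B' (graphMap (dMap u w z) c, c)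
      (graphMap (dMap u w z) c', c')) (Metric.ball 0 ρ) := by
    have h1 : ∀ c, DifferentiableOn ℂ (fun w => (graphMap (dMap u w z) c, c)) (Metric.ball 0 ρ) :=
      fun c => (hS.clm_apply (differentiableOn_const c)).prodMk (differentiableOn_const c)
    have h2 : DifferentiableOn ℂ (fun w => B' (graphMap (dMap u w z) c, c)) (Metric.ball 0 ρ) :=
      B'.differentiable.comp_differentiableOn (h1 c)
    exact h2.clm_apply (h1 c')
  have := eq_zero_of_eq_zero_on_real hf (fun t ht => ?_) hw
  · rwa [hB] at this
  · rw [hB]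
    have ht1 : |t| < 1 := ht.trans hρ
    have hm : (t : ℂ) ∈ Metric.ball (0 : ℂ) ρ := by simpa using ht
    have k1 := (mem_kerC_iff_graph (hz1' t hm) _).2 ⟨c, rfl⟩
    have k2 := (mem_kerC_iff_graph (hz1' t hm) _).2 ⟨c', rfl⟩
    rw [mem_kerC_dMap_ofReal ht1.le] at k1 k2
    have k := hz3 t ht1
    simp only [formC, k _ _ k1.1 k2.1, k _ _ k1.1 k2.2, k _ _ k1.2 k2.1, k _ _ k1.2 k2.2]
    simp

/-- The kernels of the complexified flow derivatives are Lagrangian, and positive or negative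
according to the sign of the imaginary part of the time. -/
theorem IsLocalFlow.eventually_positive (hu : IsLocalFlow u Y z₀)
    (h : IsLocalSystem Y Ω z₀ T G b) {ρ : ℝ} (hρ : ρ < 1) :
    ∀ᶠ z in 𝓝 z₀, ∀ w ∈ Metric.closedBall (0 : ℂ) ρ, w.im ≠ 0 →
      ∀ Z ∈ kerC (dMap u w z).toLinearMap, Z ≠ 0 → 0 < w.im * (-2 * Ω z ![reC Z, imC Z]) := by
  filter_upwards [hu.eventually_isUnit_horPart h hρ, hu.eventually_graphForm h hρ] with z hz1 hz2
    w hw him Z hZ hne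
  obtain ⟨c, rfl⟩ := (mem_kerC_iff_graph (hz1 w hw) _).1 hZ
  have hc : c ≠ 0 := by
    rintro rfl
    exact hne (by rw [map_zero, Prod.mk_zero_zero, map_zero])
  have := hz2 w hw him c hc
  rwa [graphForm_eq] at this

end LocalTheorem

/-! ### Differential forms and their exterior derivative in charts -/

section FormsInCharts

variable {E : Type*} [NormedAddCommGroup E] [NormedSpace ℝ E]
  {H : Type*} [TopologicalSpace H] {I : ModelWithCorners ℝ E H} [I.Boundaryless]
  {N : Type*} [TopologicalSpace N] [ChartedSpace H N] [IsManifold I ω N] {k : ℕ}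

/-- The change of coordinates between two preferred charts. -/
def chartChange (I : ModelWithCorners ℝ E H) {N : Type*} [TopologicalSpace N] [ChartedSpace H N]
    (z₀ z : N) (y : E) : E := extChartAt I z ((extChartAt I z₀).symm y)

theorem contMDiffAt_chartSymm (z₀ : N) {y : E} (hy : y ∈ (extChartAt I z₀).target) :
    ContMDiffAt 𝓘(ℝ, E) I ω (extChartAt I z₀).symm y :=
  (contMDiffOn_extChartAt_symm z₀).contMDiffAt (extChartAt_target_mem_nhds' hy)

theorem contMDiffAt_chart (z₀ : N) {z : N} (hz : z ∈ (extChartAt I z₀).source) :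
    ContMDiffAt I 𝓘(ℝ, E) ω (extChartAt I z₀) z :=
  contMDiffAt_extChartAt' (by rwa [extChartAt_source] at hz)

theorem mdifferentiableAt_chartSymm (z₀ : N) {y : E} (hy : y ∈ (extChartAt I z₀).target) :
    MDifferentiableAt 𝓘(ℝ, E) I (extChartAt I z₀).symm y :=
  (contMDiffAt_chartSymm z₀ hy).mdifferentiableAt (by simp)

theorem mdifferentiableAt_chart (z₀ : N) {z : N} (hz : z ∈ (extChartAt I z₀).source) :
    MDifferentiableAt I 𝓘(ℝ, E) (extChartAt I z₀) z :=
  (contMDiffAt_chart z₀ hz).mdifferentiableAt (by simp)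

theorem contDiffAt_chartChange {z₀ z : N} {y : E} (hy : y ∈ (extChartAt I z₀).target)
    (hz : (extChartAt I z₀).symm y ∈ (extChartAt I z).source) :
    ContDiffAt ℝ ω (chartChange I z₀ z) y := by
  rw [← contMDiffAt_iff_contDiffAt]
  exact (contMDiffAt_chart z hz).comp y (contMDiffAt_chartSymm z₀ hy)

theorem eventually_mem_chart {z₀ z : N} {y : E} (hy : y ∈ (extChartAt I z₀).target)
    (hz : (extChartAt I z₀).symm y ∈ (extChartAt I z).source) :
    ∀ᶠ y' in 𝓝 y, y' ∈ (extChartAt I z₀).target ∧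
      (extChartAt I z₀).symm y' ∈ (extChartAt I z).source := by
  refine (Filter.Eventually.and (extChartAt_target_mem_nhds' hy) ?_)
  exact (contMDiffAt_chartSymm z₀ hy).continuousAt.eventually
    ((isOpen_extChartAt_source z).mem_nhds hz)

/-- The derivative of a preferred chart, as an endomorphism of the model space. -/
def chartDeriv (I : ModelWithCorners ℝ E H) {N : Type*} [TopologicalSpace N] [ChartedSpace H N]
    (z₀ z : N) : E →L[ℝ] E := (mfderiv I 𝓘(ℝ, E) (extChartAt I z₀) z :)

/-- The derivative of the inverse of a preferred chart, as an endomorphism of the model space. -/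
def chartSymmDeriv (I : ModelWithCorners ℝ E H) {N : Type*} [TopologicalSpace N]
    [ChartedSpace H N] (z₀ : N) (y : E) : E →L[ℝ] E :=
  (mfderiv 𝓘(ℝ, E) I (extChartAt I z₀).symm y :)

theorem chartSymmDeriv_chartDeriv (z₀ : N) {z : N} (hz : z ∈ (extChartAt I z₀).source) (v : E) :
    chartSymmDeriv I z₀ (extChartAt I z₀ z) (chartDeriv I z₀ z v) = v := by
  have h1 : ((extChartAt I z₀).symm ∘ (extChartAt I z₀)) =ᶠ[𝓝 z] id := by
    filter_upwards [(isOpen_extChartAt_source z₀).mem_nhds hz] with x hx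
    exact (extChartAt I z₀).left_inv hx
  have h2 := mfderiv_comp z (mdifferentiableAt_chartSymm z₀ ((extChartAt I z₀).map_source hz))
    (mdifferentiableAt_chart z₀ hz)
  rw [h1.mfderiv_eq, mfderiv_id] at h2
  exact (congrArg (fun A : E →L[ℝ] E => A v) h2).symm

theorem chartDeriv_chartSymmDeriv (z₀ : N) {y : E} (hy : y ∈ (extChartAt I z₀).target) (v : E) :
    chartDeriv I z₀ ((extChartAt I z₀).symm y) (chartSymmDeriv I z₀ y v) = v := by
  have h1 : ((extChartAt I z₀) ∘ (extChartAt I z₀).symm) =ᶠ[𝓝 y] id := by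
    filter_upwards [extChartAt_target_mem_nhds' hy] with x hx
    exact (extChartAt I z₀).right_inv hx
  have h2 := mfderiv_comp y (mdifferentiableAt_chart z₀ ((extChartAt I z₀).map_target hy))
    (mdifferentiableAt_chartSymm z₀ hy)
  rw [h1.mfderiv_eq, mfderiv_id] at h2
  exact (congrArg (fun A : E →L[ℝ] E => A v) h2).symm

theorem chartDeriv_self_chartSymmDeriv (z : N) (v : E) :
    chartDeriv I z z (chartSymmDeriv I z (extChartAt I z z) v) = v := by
  have h := chartDeriv_chartSymmDeriv (I := I) z (mem_extChartAt_target z) v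
  rwa [extChartAt_to_inv] at h

/-- The derivative of a chart as an equivalence. -/
def chartEquiv (z₀ : N) {z : N} (hz : z ∈ (extChartAt I z₀).source) : E ≃L[ℝ] E :=
  ContinuousLinearEquiv.equivOfInverse (chartDeriv I z₀ z)
    (chartSymmDeriv I z₀ (extChartAt I z₀ z)) (chartSymmDeriv_chartDeriv z₀ hz) (fun v => by
      have h := chartDeriv_chartSymmDeriv (I := I) z₀ ((extChartAt I z₀).map_source hz) v
      rwa [(extChartAt I z₀).left_inv hz] at h)

theorem chartSymmDeriv_chartChange {z₀ z : N} {y : E} (hy : y ∈ (extChartAt I z₀).target)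
    (hz : (extChartAt I z₀).symm y ∈ (extChartAt I z).source) (v : E) :
    chartSymmDeriv I z (chartChange I z₀ z y) (fderiv ℝ (chartChange I z₀ z) y v) =
      chartSymmDeriv I z₀ y v := by
  have h1 : ((extChartAt I z).symm ∘ (chartChange I z₀ z)) =ᶠ[𝓝 y] (extChartAt I z₀).symm := by
    filter_upwards [eventually_mem_chart hy hz] with x hx
    exact (extChartAt I z).left_inv hx.2
  have h2 := mfderiv_comp y (mdifferentiableAt_chartSymm z ((extChartAt I z).map_source hz))
    ((contDiffAt_chartChange hy hz).differentiableAt (by simp)).mdifferentiableAt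
  rw [h1.mfderiv_eq, mfderiv_eq_fderiv] at h2
  exact (congrArg (fun A : E →L[ℝ] E => A v) h2).symm

/-- The value of a form at a point, as a form on the model space. -/
def DiffForm.val (α : DiffForm I N k) (z : N) : E [⋀^Fin k]→L[ℝ] ℝ := α z

theorem DiffForm.inChart_eq (α : DiffForm I N k) (z₀ : N) (y : E) : α.inChart z₀ y =
    (α.val ((extChartAt I z₀).symm y)).compContinuousLinearMap (chartSymmDeriv I z₀ y) := rfl

theorem DiffForm.d_eq (α : DiffForm I N k) (z : N) : α.d.val z =
    (extDeriv (α.inChart z) (extChartAt I z z)).compContinuousLinearMap (chartDeriv I z z) := rfl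

/-- A form is recovered from its coordinate expression. -/
theorem DiffForm.val_eq_inChart (α : DiffForm I N k) (z₀ : N) {z : N}
    (hz : z ∈ (extChartAt I z₀).source) : α.val z =
      (α.inChart z₀ (extChartAt I z₀ z)).compContinuousLinearMap (chartDeriv I z₀ z) := by
  rw [DiffForm.inChart_eq, (extChartAt I z₀).left_inv hz]
  ext v
  change _ = α.val z fun i => chartSymmDeriv I z₀ (extChartAt I z₀ z) (chartDeriv I z₀ z (v i))
  simp only [chartSymmDeriv_chartDeriv z₀ hz]

theorem DiffForm.inChart_chartChange (α : DiffForm I N k) {z₀ z : N} {y : E}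
    (hy : y ∈ (extChartAt I z₀).target)
    (hz : (extChartAt I z₀).symm y ∈ (extChartAt I z).source) :
    α.inChart z₀ y = (α.inChart z (chartChange I z₀ z y)).compContinuousLinearMap
      (fderiv ℝ (chartChange I z₀ z) y) := by
  have h : (extChartAt I z).symm (chartChange I z₀ z y) = (extChartAt I z₀).symm y :=
    (extChartAt I z).left_inv hz
  rw [DiffForm.inChart_eq, DiffForm.inChart_eq, h]
  ext v
  change _ = α.val _ fun i => chartSymmDeriv I z (chartChange I z₀ z y)
    (fderiv ℝ (chartChange I z₀ z) y (v i))
  simp only [chartSymmDeriv_chartChange hy hz]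
  rfl

/-- The exterior derivative may be computed in any preferred chart. -/
theorem DiffForm.inChart_d (α : DiffForm I N k) {z₀ : N} {y : E}
    (hy : y ∈ (extChartAt I z₀).target)
    (hα : ∀ z : N, DifferentiableOn ℝ (α.inChart z) (extChartAt I z).target) :
    α.d.inChart z₀ y = extDeriv (α.inChart z₀) y := by
  -- `DiffForm.d` at a point is computed in the chart preferred at that very point, so the
  -- comparison is with the change of coordinates to that chart, under which the exterior derivative
  -- is natural.
  obtain ⟨z, hzdef⟩ : ∃ z, z = (extChartAt I z₀).symm y := ⟨_, rfl⟩
  have hz : (extChartAt I z₀).symm y ∈ (extChartAt I z).source := by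
    rw [← hzdef]; exact mem_extChartAt_source z
  have h1 : α.inChart z₀ =ᶠ[𝓝 y] fun y => (α.inChart z
      (chartChange I z₀ z y)).compContinuousLinearMap (fderiv ℝ (chartChange I z₀ z) y) := by
    filter_upwards [eventually_mem_chart hy hz] with x hx
    exact α.inChart_chartChange hx.1 hx.2
  have h2 : chartChange I z₀ z y = extChartAt I z z := by rw [chartChange, ← hzdef]
  have h3 : DifferentiableAt ℝ (α.inChart z) (chartChange I z₀ z y) :=
    (hα z).differentiableAt (extChartAt_target_mem_nhds' ((extChartAt I z).map_source hz))
  rw [h1.extDeriv_eq, extDeriv_pullback (r := ω) h3 (contDiffAt_chartChange hy hz) (by simp),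
    DiffForm.inChart_chartChange _ hy hz, DiffForm.inChart_eq, h2, extChartAt_to_inv,
    DiffForm.d_eq]
  ext v
  change extDeriv (α.inChart z) (extChartAt I z z) (fun i => chartDeriv I z z
    (chartSymmDeriv I z (extChartAt I z z) (fderiv ℝ (chartChange I z₀ z) y (v i)))) = _
  simp only [chartDeriv_self_chartSymmDeriv]
  rfl

theorem DiffForm.eq_zero_of_inChart {α : DiffForm I N k} {z : N}
    (h : α.inChart z (extChartAt I z z) = 0) : α z = 0 := by
  have h1 := α.val_eq_inChart z (mem_extChartAt_source z)
  rw [h] at h1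
  exact h1

end FormsInCharts

/-! ### Charts of the cotangent bundle -/

section CotangentCharts

variable {n : ℕ} {M : Type*} [TopologicalSpace M] [ChartedSpace (EuclideanSpace ℝ (Fin n)) M]
  [IsManifold (𝓡 n) ω M]

theorem cotChart_eq_trivialization (z₀ z : Cot n M) : extChartAt (cotModel n) z₀ z =
    (extChartAt (𝓡 n) z₀.proj z.proj,
      (trivializationAt (Covec n) (fun x : M => TangentSpace (𝓡 n) x →L[ℝ] ℝ) z₀.proj z).2) := by
  rw [FiberBundle.extChartAt]
  rfl

theorem mem_cotChart_source {z₀ : Cot n M} {z : Cot n M} :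
    z ∈ (extChartAt (cotModel n) z₀).source ↔ z.proj ∈ (extChartAt (𝓡 n) z₀.proj).source := by
  rw [extChartAt_source, extChartAt_source, FiberBundle.chartedSpace_chartAt]
  constructor
  · intro h
    simp at h
    exact h.1
  · intro h
    simp
    exact ⟨h, h⟩

theorem cotChart_target (z₀ : Cot n M) :
    (extChartAt (cotModel n) z₀).target = (extChartAt (𝓡 n) z₀.proj).target ×ˢ univ := by
  rw [FiberBundle.extChartAt_target]
  congr 1
  refine inter_eq_left.2 fun y hy => ?_
  have h1 := (extChartAt (𝓡 n) z₀.proj).map_target hy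
  rw [extChartAt_source] at h1
  simpa using h1

/-- The trivialization of the dual bundle is precomposition with the inverse of the one of the
tangent bundle, that is, with the derivative of the inverse base chart. -/
theorem cotChart_apply {z₀ z : Cot n M} (hz : z ∈ (extChartAt (cotModel n) z₀).source) :
    extChartAt (cotModel n) z₀ z = (extChartAt (𝓡 n) z₀.proj z.proj,
      (z.snd : Covec n).comp
        (chartSymmDeriv (𝓡 n) z₀.proj (extChartAt (𝓡 n) z₀.proj z.proj))) := by
  rw [cotChart_eq_trivialization, hom_trivializationAt_apply]
  refine Prod.ext rfl ?_
  rw [mem_cotChart_source, extChartAt_source] at hz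
  have h1 := TangentBundle.symmL_trivializationAt (I := 𝓡 n) hz
  rw [ModelWithCorners.range_eq_univ, mfderivWithin_univ] at h1
  change ContinuousLinearMap.comp _ (z.snd.comp _) = _
  rw [h1]
  ext v
  simp
  rfl

theorem cotChart_symm (z₀ : Cot n M) {y : VM n} (hy : y.1 ∈ (extChartAt (𝓡 n) z₀.proj).target) :
    (extChartAt (cotModel n) z₀).symm y = ⟨(extChartAt (𝓡 n) z₀.proj).symm y.1,
      y.2.comp (chartDeriv (𝓡 n) z₀.proj ((extChartAt (𝓡 n) z₀.proj).symm y.1))⟩ := by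
  have h1 : (extChartAt (𝓡 n) z₀.proj).symm y.1 ∈ (extChartAt (𝓡 n) z₀.proj).source :=
    (extChartAt (𝓡 n) z₀.proj).map_target hy
  set z : Cot n M := ⟨(extChartAt (𝓡 n) z₀.proj).symm y.1,
      y.2.comp (chartDeriv (𝓡 n) z₀.proj ((extChartAt (𝓡 n) z₀.proj).symm y.1))⟩ with hz
  have h2 : z ∈ (extChartAt (cotModel n) z₀).source := mem_cotChart_source.2 h1
  have h3 : extChartAt (cotModel n) z₀ z = y := by
    rw [cotChart_apply h2]
    refine Prod.ext ((extChartAt (𝓡 n) z₀.proj).right_inv hy) ?_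
    have h4 : extChartAt (𝓡 n) z₀.proj z.proj = y.1 := (extChartAt (𝓡 n) z₀.proj).right_inv hy
    rw [h4]
    ext v
    change y.2 (chartDeriv (𝓡 n) z₀.proj _ (chartSymmDeriv (𝓡 n) z₀.proj y.1 v)) = y.2 v
    rw [chartDeriv_chartSymmDeriv _ hy]
  rw [← h3, (extChartAt (cotModel n) z₀).left_inv h2]

theorem proj_cotChart_symm (z₀ : Cot n M) {y : VM n}
    (hy : y ∈ (extChartAt (cotModel n) z₀).target) :
    proj ((extChartAt (cotModel n) z₀).symm y) = (extChartAt (𝓡 n) z₀.proj).symm y.1 := by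
  rw [cotChart_target] at hy
  rw [cotChart_symm z₀ hy.1]; rfl

theorem mdifferentiable_proj : MDifferentiable (cotModel n) (𝓡 n) (proj (n := n) (M := M)) :=
  (contMDiff_proj (n := ω) (IB := 𝓡 n)
    (fun x : M => TangentSpace (𝓡 n) x →L[ℝ] ℝ)).mdifferentiable (by simp)

/-- The derivative of the projection. -/
def projDeriv (z : Cot n M) : VM n →L[ℝ] EuclideanSpace ℝ (Fin n) :=
  (mfderiv (cotModel n) (𝓡 n) proj z :)

theorem projDeriv_chartSymmDeriv (z₀ : Cot n M) {y : VM n}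
    (hy : y ∈ (extChartAt (cotModel n) z₀).target) (ξ : VM n) :
    projDeriv ((extChartAt (cotModel n) z₀).symm y) (chartSymmDeriv (cotModel n) z₀ y ξ) =
      chartSymmDeriv (𝓡 n) z₀.proj y.1 ξ.1 := by
  have hy1 : y.1 ∈ (extChartAt (𝓡 n) z₀.proj).target := by
    rw [cotChart_target] at hy; exact hy.1
  have h1 : (proj ∘ (extChartAt (cotModel n) z₀).symm) =ᶠ[𝓝 y]
      ((extChartAt (𝓡 n) z₀.proj).symm ∘ Prod.fst) := by
    filter_upwards [extChartAt_target_mem_nhds' hy] with x hx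
    exact proj_cotChart_symm z₀ hx
  have h2 := mfderiv_comp y (mdifferentiable_proj _) (mdifferentiableAt_chartSymm z₀ hy)
  have h3 := mfderiv_comp y (f := (Prod.fst : VM n → _))
    (mdifferentiableAt_chartSymm (I := 𝓡 n) z₀.proj hy1)
    (differentiableAt_fst (𝕜 := ℝ)).mdifferentiableAt
  rw [h1.mfderiv_eq] at h2
  have h4 := h2.symm.trans h3
  rw [mfderiv_eq_fderiv, fderiv_fst] at h4
  exact congrArg (fun A : VM n →L[ℝ] EuclideanSpace ℝ (Fin n) => A ξ) h4

end CotangentCharts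

/-! ### The twisted symplectic form in cotangent charts -/

section TwistedForm

variable {n : ℕ} {M : Type*} [TopologicalSpace M] [ChartedSpace (EuclideanSpace ℝ (Fin n)) M]
  [IsManifold (𝓡 n) ω M]

/-- The canonical 1-form of the model space. -/
def canonicalModel : VM n →L[ℝ] (VM n) [⋀^Fin 1]→L[ℝ] ℝ :=
  ((ContinuousAlternatingMap.ofSubsingletonLIE (𝕜 := ℝ) (E := VM n) (F := ℝ) (0 : Fin 1)).toContinuousLinearEquiv :
      (VM n →L[ℝ] ℝ) →L[ℝ] _).comp
    (((ContinuousLinearMap.compL ℝ (VM n) (EuclideanSpace ℝ (Fin n)) ℝ).flip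
      (ContinuousLinearMap.fst ℝ _ _)).comp (ContinuousLinearMap.snd ℝ _ _))

theorem canonicalModel_apply (y : VM n) (v : Fin 1 → VM n) :
    canonicalModel y v = y.2 (v 0).1 := rfl

/-- The coordinate expression of the twisted symplectic form. -/
def modelForm (b : EuclideanSpace ℝ (Fin n) → (EuclideanSpace ℝ (Fin n)) [⋀^Fin 2]→L[ℝ] ℝ)
    (y : VM n) : (VM n) [⋀^Fin 2]→L[ℝ] ℝ :=
  -extDeriv canonicalModel y -
    (b y.1).compContinuousLinearMap (ContinuousLinearMap.fst ℝ _ _)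

theorem extDeriv_canonicalModel (y : VM n) :
    extDeriv canonicalModel y = ContinuousAlternatingMap.alternatizeUncurryFin
      (canonicalModel (n := n)) := by
  rw [extDeriv, ContinuousLinearMap.fderiv]

theorem extDeriv_canonicalModel_apply (y v w : VM n) :
    extDeriv canonicalModel y ![v, w] = v.2 w.1 - w.2 v.1 := by
  rw [extDeriv_canonicalModel, ContinuousAlternatingMap.alternatizeUncurryFin_apply]
  simp [Fin.sum_univ_two, canonicalModel_apply]
  rfl

theorem modelForm_apply (b : EuclideanSpace ℝ (Fin n) → (EuclideanSpace ℝ (Fin n)) [⋀^Fin 2]→L[ℝ] ℝ)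
    (y v w : VM n) : modelForm b y ![v, w] = w.2 v.1 - v.2 w.1 - b y.1 ![v.1, w.1] := by
  have h : (fun i => (![v, w] i).1) = ![v.1, w.1] := by
    ext i : 1
    fin_cases i <;> rfl
  change -(extDeriv canonicalModel y ![v, w]) - b y.1 (fun i => (![v, w] i).1) = _
  rw [h, extDeriv_canonicalModel_apply]
  ring

theorem contDiffAt_modelForm {b : EuclideanSpace ℝ (Fin n) →
      (EuclideanSpace ℝ (Fin n)) [⋀^Fin 2]→L[ℝ] ℝ} {y : VM n} (hb : ContDiffAt ℝ ω b y.1) :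
    ContDiffAt ℝ ω (modelForm b) y := by
  have h1 : ContDiffAt ℝ ω (fun y : VM n => extDeriv canonicalModel y) y := by
    simp only [extDeriv_canonicalModel]
    exact contDiffAt_const
  have h2 : ContDiffAt ℝ ω (fun y : VM n => b y.1) y := hb.comp y contDiffAt_fst
  have h3 := (ContinuousAlternatingMap.compContinuousLinearMapCLM (F := ℝ) (ι := Fin 2)
    (ContinuousLinearMap.fst ℝ (EuclideanSpace ℝ (Fin n)) (Covec n))).contDiff.contDiffAt.comp y h2
  exact h1.neg.sub h3

/-- The first summand is exact, the second is a pullback of a closed form. -/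
theorem extDeriv_modelForm {b : EuclideanSpace ℝ (Fin n) →
      (EuclideanSpace ℝ (Fin n)) [⋀^Fin 2]→L[ℝ] ℝ} {y : VM n} (hb : DifferentiableAt ℝ b y.1)
    (hd : extDeriv b y.1 = 0) : extDeriv (modelForm b) y = 0 := by
  have e1 : extDeriv (fun y : VM n => extDeriv canonicalModel y) y = 0 :=
    extDeriv_extDeriv_apply (canonicalModel (n := n)).contDiff.contDiffAt (r := ω) (by simp)
  have e2 := extDeriv_pullback (r := ω) (x := y) (f := (Prod.fst : VM n → _)) hb
    contDiffAt_fst (by simp)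
  simp only [fderiv_fst] at e2
  have d1 : DifferentiableAt ℝ (fun y : VM n => extDeriv canonicalModel y) y := by
    simp only [extDeriv_canonicalModel]
    exact differentiableAt_const _
  have d2 : DifferentiableAt ℝ (fun y : VM n => (b y.1).compContinuousLinearMap
      (ContinuousLinearMap.fst ℝ (EuclideanSpace ℝ (Fin n)) (Covec n))) y :=
    (ContinuousAlternatingMap.compContinuousLinearMapCLM (F := ℝ) (ι := Fin 2)
      (ContinuousLinearMap.fst ℝ (EuclideanSpace ℝ (Fin n)) (Covec n))).differentiableAt.comp y
      (hb.comp y differentiableAt_fst)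
  have e3 : modelForm b = ((-1 : ℝ) • fun y : VM n => extDeriv canonicalModel y) +
      ((-1 : ℝ) • fun y : VM n => (b y.1).compContinuousLinearMap
      (ContinuousLinearMap.fst ℝ (EuclideanSpace ℝ (Fin n)) (Covec n))) := by
    ext y v
    change -(extDeriv canonicalModel y v) - b y.1 _ =
      (-1 : ℝ) * extDeriv canonicalModel y v + (-1 : ℝ) * b y.1 _
    ring
  rw [e3, extDeriv_add (d1.const_smul _) (d2.const_smul _), extDeriv_smul,
    extDeriv_smul, e1, e2, hd]
  ext v
  simp

/-- The canonical form is natural: a cotangent chart pulls covectors back along the base chart, and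
the two derivatives of that chart cancel. -/
theorem inChart_canonicalForm (z₀ : Cot n M) {y : VM n}
    (hy : y ∈ (extChartAt (cotModel n) z₀).target) :
    (canonicalForm : DiffForm (cotModel n) (Cot n M) 1).inChart z₀ y = canonicalModel y := by
  ext v
  rw [canonicalModel_apply]
  have hy1 : y.1 ∈ (extChartAt (𝓡 n) z₀.proj).target := by
    rw [cotChart_target] at hy; exact hy.1
  change (((extChartAt (cotModel n) z₀).symm y).snd : Covec n)
    (projDeriv ((extChartAt (cotModel n) z₀).symm y)
      (chartSymmDeriv (cotModel n) z₀ y (v 0))) = _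
  rw [projDeriv_chartSymmDeriv z₀ hy, cotChart_symm z₀ hy1]
  change y.2 (chartDeriv (𝓡 n) z₀.proj _ (chartSymmDeriv (𝓡 n) z₀.proj y.1 _)) = _
  rw [chartDeriv_chartSymmDeriv _ hy1]

theorem inChart_pullbackForm (β : DiffForm (𝓡 n) M 2) (z₀ : Cot n M) {y : VM n}
    (hy : y ∈ (extChartAt (cotModel n) z₀).target) :
    (pullbackForm β).inChart z₀ y = (β.inChart z₀.proj y.1).compContinuousLinearMap
      (ContinuousLinearMap.fst ℝ _ _) := by
  ext v
  change β.val (proj ((extChartAt (cotModel n) z₀).symm y)) (fun i =>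
    projDeriv ((extChartAt (cotModel n) z₀).symm y)
      (chartSymmDeriv (cotModel n) z₀ y (v i))) = _
  simp only [projDeriv_chartSymmDeriv z₀ hy]
  rw [proj_cotChart_symm z₀ hy]
  rfl

theorem differentiableOn_inChart_canonicalForm (z₀ : Cot n M) : DifferentiableOn ℝ
    ((canonicalForm : DiffForm (cotModel n) (Cot n M) 1).inChart z₀)
      (extChartAt (cotModel n) z₀).target :=
  (canonicalModel (n := n)).differentiable.differentiableOn.congr
    fun _ hy => inChart_canonicalForm z₀ hy

theorem inChart_twistedForm (β : DiffForm (𝓡 n) M 2) (z₀ : Cot n M) {y : VM n}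
    (hy : y ∈ (extChartAt (cotModel n) z₀).target) :
    (twistedForm β).inChart z₀ y = modelForm (β.inChart z₀.proj) y := by
  have h1 : (twistedForm β).inChart z₀ y = -(DiffForm.d canonicalForm).inChart z₀ y -
    (pullbackForm β).inChart z₀ y := by
    ext v; rfl
  have h2 : (canonicalForm : DiffForm (cotModel n) (Cot n M) 1).inChart z₀ =ᶠ[𝓝 y]
      canonicalModel := by
    filter_upwards [extChartAt_target_mem_nhds' hy] with x hx
    exact inChart_canonicalForm z₀ hx
  rw [h1, inChart_pullbackForm β z₀ hy,
    DiffForm.inChart_d _ hy differentiableOn_inChart_canonicalForm, h2.extDeriv_eq]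
  rfl

theorem contDiffAt_inChart_form {β : DiffForm (𝓡 n) M 2} (hβ : β.IsCk ω) (x₀ : M)
    {y : EuclideanSpace ℝ (Fin n)} (hy : y ∈ (extChartAt (𝓡 n) x₀).target) :
    ContDiffAt ℝ ω (β.inChart x₀) y :=
  (hβ x₀).contDiffAt (extChartAt_target_mem_nhds' hy)

theorem extDeriv_inChart_form {β : DiffForm (𝓡 n) M 2} (hβ : β.IsCk ω) (hd : β.d = 0) (x₀ : M)
    {y : EuclideanSpace ℝ (Fin n)} (hy : y ∈ (extChartAt (𝓡 n) x₀).target) :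
    extDeriv (β.inChart x₀) y = 0 := by
  rw [← DiffForm.inChart_d β hy fun z => (hβ z).differentiableOn (by simp), hd]
  ext v
  rfl

theorem isCk_twistedForm {β : DiffForm (𝓡 n) M 2} (hβ : β.IsCk ω) : (twistedForm β).IsCk ω := by
  intro z₀ y hy
  have hy1 : y.1 ∈ (extChartAt (𝓡 n) z₀.proj).target := by
    rw [cotChart_target] at hy; exact hy.1
  have h2 : (twistedForm β).inChart z₀ =ᶠ[𝓝 y] modelForm (β.inChart z₀.proj) := by
    filter_upwards [extChartAt_target_mem_nhds' hy] with x hx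
    exact inChart_twistedForm β z₀ hx
  exact ((contDiffAt_modelForm (contDiffAt_inChart_form hβ _ hy1)).congr_of_eventuallyEq
    h2).contDiffWithinAt

theorem d_twistedForm {β : DiffForm (𝓡 n) M 2} (hβ : β.IsCk ω) (hd : β.d = 0) (z : Cot n M) :
    (twistedForm β).d z = 0 := by
  refine DiffForm.eq_zero_of_inChart ?_
  have hy := mem_extChartAt_target (I := cotModel n) z
  have hy1 : (extChartAt (cotModel n) z z).1 ∈ (extChartAt (𝓡 n) z.proj).target := by
    rw [cotChart_target] at hy; exact hy.1
  have h2 : (twistedForm β).inChart z =ᶠ[𝓝 (extChartAt (cotModel n) z z)]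
      modelForm (β.inChart z.proj) := by
    filter_upwards [extChartAt_target_mem_nhds' hy] with x hx
    exact inChart_twistedForm β z hx
  rw [DiffForm.inChart_d _ hy fun z => (isCk_twistedForm hβ z).differentiableOn (by simp),
    h2.extDeriv_eq]
  exact extDeriv_modelForm ((contDiffAt_inChart_form hβ _ hy1).differentiableAt (by simp))
    (extDeriv_inChart_form hβ hd _ hy1)

end TwistedForm

/-! ### The metric, its dual and the energy in charts -/

section Metric

variable {n : ℕ} {M : Type*} [TopologicalSpace M] [ChartedSpace (EuclideanSpace ℝ (Fin n)) M]
  [IsManifold (𝓡 n) ω M]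

/-- The metric at a point, as a bilinear form on the model space. -/
def metricVal (g : AnalyticMetric n M) (x : M) : EuclideanSpace ℝ (Fin n) →L[ℝ] Covec n := g.inner x

/-- The metric in a preferred chart. -/
def metricChart (g : AnalyticMetric n M) (x₀ : M) (y : EuclideanSpace ℝ (Fin n)) :
    EuclideanSpace ℝ (Fin n) →L[ℝ] Covec n :=
  (metricVal g ((extChartAt (𝓡 n) x₀).symm y)).bilinearComp (chartSymmDeriv (𝓡 n) x₀ y)
    (chartSymmDeriv (𝓡 n) x₀ y)

theorem metricChart_apply (g : AnalyticMetric n M) (x₀ : M) (y v w : EuclideanSpace ℝ (Fin n)) :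
    metricChart g x₀ y v w = metricVal g ((extChartAt (𝓡 n) x₀).symm y)
      (chartSymmDeriv (𝓡 n) x₀ y v) (chartSymmDeriv (𝓡 n) x₀ y w) := rfl

theorem metricVal_pos (g : AnalyticMetric n M) (x : M) {v : EuclideanSpace ℝ (Fin n)} (hv : v ≠ 0) :
    0 < metricVal g x v v := g.pos x v hv

theorem metricVal_symm (g : AnalyticMetric n M) (x : M) (v w : EuclideanSpace ℝ (Fin n)) :
    metricVal g x v w = metricVal g x w v := g.symm x v w

theorem metricVal_injective (g : AnalyticMetric n M) (x : M) :
    Function.Injective (metricVal g x) := by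
  refine (injective_iff_map_eq_zero _).2 fun v hv => ?_
  by_contra hne
  have h1 := metricVal_pos g x hne
  rw [hv] at h1
  exact lt_irrefl _ h1

theorem chartSymmDeriv_ne_zero (x₀ : M) {y : EuclideanSpace ℝ (Fin n)}
    (hy : y ∈ (extChartAt (𝓡 n) x₀).target) {v : EuclideanSpace ℝ (Fin n)} (hv : v ≠ 0) :
    chartSymmDeriv (𝓡 n) x₀ y v ≠ 0 := fun h => hv (by
  rw [← chartDeriv_chartSymmDeriv (I := 𝓡 n) x₀ hy v, h, map_zero])

theorem metricChart_pos (g : AnalyticMetric n M) (x₀ : M) {y : EuclideanSpace ℝ (Fin n)}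
    (hy : y ∈ (extChartAt (𝓡 n) x₀).target) {v : EuclideanSpace ℝ (Fin n)} (hv : v ≠ 0) :
    0 < metricChart g x₀ y v v := by
  rw [metricChart_apply]
  exact metricVal_pos g _ (chartSymmDeriv_ne_zero x₀ hy hv)

theorem metricChart_symm (g : AnalyticMetric n M) (x₀ : M) (y v w : EuclideanSpace ℝ (Fin n)) :
    metricChart g x₀ y v w = metricChart g x₀ y w v := by
  rw [metricChart_apply, metricChart_apply]
  exact metricVal_symm g _ _ _

theorem exists_metricChart_equiv (g : AnalyticMetric n M) (x₀ : M) {y : EuclideanSpace ℝ (Fin n)}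
    (hy : y ∈ (extChartAt (𝓡 n) x₀).target) :
    ∃ e : EuclideanSpace ℝ (Fin n) ≃L[ℝ] Covec n,
      (e : EuclideanSpace ℝ (Fin n) →L[ℝ] Covec n) = metricChart g x₀ y := by
  have hinj : Function.Injective (metricChart g x₀ y).toLinearMap := by
    refine (injective_iff_map_eq_zero _).2 fun v hv => ?_
    by_contra hne
    have h1 := metricChart_pos g x₀ hy hne
    have h2 : metricChart g x₀ y v = 0 := hv
    rw [h2] at h1
    exact lt_irrefl _ h1
  have : FiniteDimensional ℝ (Covec n) := (covE n).toLinearEquiv.finiteDimensional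
  refine ⟨(LinearMap.linearEquivOfInjective _ hinj
    (covE n).toLinearEquiv.finrank_eq).toContinuousLinearEquiv, ?_⟩
  ext v w
  rfl

/-- The dual metric in a preferred chart. -/
def sharpChart (g : AnalyticMetric n M) (x₀ : M) (y : EuclideanSpace ℝ (Fin n)) :
    Covec n →L[ℝ] EuclideanSpace ℝ (Fin n) := (metricChart g x₀ y).inverse

theorem metricChart_sharpChart (g : AnalyticMetric n M) (x₀ : M) {y : EuclideanSpace ℝ (Fin n)}
    (hy : y ∈ (extChartAt (𝓡 n) x₀).target) (p : Covec n) :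
    metricChart g x₀ y (sharpChart g x₀ y p) = p := by
  obtain ⟨e, he⟩ := exists_metricChart_equiv g x₀ hy
  rw [sharpChart, ← he, ContinuousLinearMap.inverse_equiv]
  exact e.apply_symm_apply p

theorem sharpChart_pos (g : AnalyticMetric n M) (x₀ : M) {y : EuclideanSpace ℝ (Fin n)}
    (hy : y ∈ (extChartAt (𝓡 n) x₀).target) {p : Covec n} (hp : p ≠ 0) :
    0 < p (sharpChart g x₀ y p) := by
  have h1 := metricChart_sharpChart g x₀ hy p
  have h2 : sharpChart g x₀ y p ≠ 0 := fun h => hp (by rw [← h1, h, map_zero])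
  have h3 := metricChart_pos g x₀ hy h2
  rwa [h1] at h3

theorem sharpChart_symm (g : AnalyticMetric n M) (x₀ : M) {y : EuclideanSpace ℝ (Fin n)}
    (hy : y ∈ (extChartAt (𝓡 n) x₀).target) (p q : Covec n) :
    p (sharpChart g x₀ y q) = q (sharpChart g x₀ y p) := by
  conv_lhs => rw [← metricChart_sharpChart g x₀ hy p, metricChart_symm,
    metricChart_sharpChart g x₀ hy q]

/-- Analyticity of `g` is that of a section of a bundle of bilinear maps. Its trivialization inserts
the derivative of the inverse chart in both arguments, which gives exactly the coordinate
expression. -/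
theorem contDiffAt_metricChart (g : AnalyticMetric n M) (x₀ : M) {y : EuclideanSpace ℝ (Fin n)}
    (hy : y ∈ (extChartAt (𝓡 n) x₀).target) : ContDiffAt ℝ ω (metricChart g x₀) y := by
  let e := trivializationAt (EuclideanSpace ℝ (Fin n) →L[ℝ] EuclideanSpace ℝ (Fin n) →L[ℝ] ℝ)
    (fun x : M => TangentSpace (𝓡 n) x →L[ℝ] TangentSpace (𝓡 n) x →L[ℝ] ℝ) x₀
  let s : M → TotalSpace (EuclideanSpace ℝ (Fin n) →L[ℝ] EuclideanSpace ℝ (Fin n) →L[ℝ] ℝ)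
    (fun x : M => TangentSpace (𝓡 n) x →L[ℝ] TangentSpace (𝓡 n) x →L[ℝ] ℝ) :=
    fun x => TotalSpace.mk' _ x (g.inner x)
  have hsrc : ∀ y ∈ (extChartAt (𝓡 n) x₀).target, (extChartAt (𝓡 n) x₀).symm y ∈
      (chartAt (EuclideanSpace ℝ (Fin n)) x₀).source := fun y hy => by
    have := (extChartAt (𝓡 n) x₀).map_target hy
    rwa [extChartAt_source] at this
  have hmem : s ((extChartAt (𝓡 n) x₀).symm y) ∈ e.source := by
    rw [e.mem_source]
    change _ ∈ (trivializationAt _ (TangentSpace (𝓡 n)) x₀).baseSet ∩ _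
    simpa [s] using hsrc y hy
  have h1 := ((e.contMDiffAt_iff (IB := 𝓡 n) (IM := 𝓡 n) (n := ω) hmem).1
    (g.contMDiff ((extChartAt (𝓡 n) x₀).symm y))).2
  have h2 := h1.comp y (contMDiffAt_chartSymm x₀ hy)
  rw [contMDiffAt_iff_contDiffAt] at h2
  refine h2.congr_of_eventuallyEq ?_
  filter_upwards [extChartAt_target_mem_nhds' hy] with y' hy'
  have h3 := TangentBundle.symmL_trivializationAt (I := 𝓡 n) (hsrc y' hy')
  rw [ModelWithCorners.range_eq_univ, mfderivWithin_univ, (extChartAt (𝓡 n) x₀).right_inv hy'] at h3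
  ext v w
  change metricVal g ((extChartAt (𝓡 n) x₀).symm y')
      (chartSymmDeriv (𝓡 n) x₀ y' v) (chartSymmDeriv (𝓡 n) x₀ y' w) =
      (e (s ((extChartAt (𝓡 n) x₀).symm y'))).2 v w
  set x := (extChartAt (𝓡 n) x₀).symm y' with hx
  have hxs : x ∈ (chartAt (EuclideanSpace ℝ (Fin n)) x₀).source := hsrc y' hy'
  have h4 : ∀ v, (trivializationAt (EuclideanSpace ℝ (Fin n)) (TangentSpace (𝓡 n)) x₀).symmL ℝ x v
      = chartSymmDeriv (𝓡 n) x₀ y' v := fun v =>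
    congrArg (fun A : EuclideanSpace ℝ (Fin n) →L[ℝ] EuclideanSpace ℝ (Fin n) => A v) h3
  have h5 : ∀ p : TangentSpace (𝓡 n) x →L[ℝ] ℝ,
      (trivializationAt (Covec n) (fun x : M => TangentSpace (𝓡 n) x →L[ℝ] ℝ)
        x₀).continuousLinearMapAt ℝ x p w = (p : Covec n) (chartSymmDeriv (𝓡 n) x₀ y' w) := by
    intro p
    rw [Trivialization.continuousLinearMapAt_apply,
      Trivialization.linearMapAt_apply, if_pos (by simpa using hxs),
      hom_trivializationAt_apply]
    simp only [ContinuousLinearMap.inCoordinates, ContinuousLinearMap.comp_apply]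
    rw [h4]
    simp
  have h6 : (e (s x)).2 v = (trivializationAt (Covec n)
      (fun x : M => TangentSpace (𝓡 n) x →L[ℝ] ℝ) x₀).continuousLinearMapAt ℝ x
        (g.inner x ((trivializationAt (EuclideanSpace ℝ (Fin n)) (TangentSpace (𝓡 n))
          x₀).symmL ℝ x v)) := rfl
  rw [h6, h5, h4]
  rfl

theorem contDiffAt_sharpChart (g : AnalyticMetric n M) (x₀ : M) {y : EuclideanSpace ℝ (Fin n)}
    (hy : y ∈ (extChartAt (𝓡 n) x₀).target) : ContDiffAt ℝ ω (sharpChart g x₀) y := by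
  obtain ⟨e, he⟩ := exists_metricChart_equiv g x₀ hy
  have h1 := contDiffAt_map_inverse (𝕜 := ℝ) (n := ω) e
  rw [he] at h1
  exact h1.comp y (contDiffAt_metricChart g x₀ hy)

theorem normSq_eq (g : AnalyticMetric n M) (z : Cot n M) {v : EuclideanSpace ℝ (Fin n)}
    (hv : metricVal g z.proj v = z.snd) : normSq g z = (z.snd : Covec n) v := by
  have h1 : metricVal g z.proj (sharp g z.proj z.snd) = z.snd :=
    (exists_sharp g z.proj z.snd).choose_spec
  have h2 : sharp g z.proj z.snd = v := metricVal_injective g _ (h1.trans hv.symm)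
  rw [normSq, h2]

theorem normSq_cotChart_symm (g : AnalyticMetric n M) (z₀ : Cot n M) {y : VM n}
    (hy : y ∈ (extChartAt (cotModel n) z₀).target) :
    normSq g ((extChartAt (cotModel n) z₀).symm y) = y.2 (sharpChart g z₀.proj y.1 y.2) := by
  have hy1 : y.1 ∈ (extChartAt (𝓡 n) z₀.proj).target := by
    rw [cotChart_target] at hy; exact hy.1
  have hx := (extChartAt (𝓡 n) z₀.proj).map_target hy1
  have hinv := (extChartAt (𝓡 n) z₀.proj).right_inv hy1
  rw [cotChart_symm z₀ hy1, normSq_eq g _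
    (v := chartSymmDeriv (𝓡 n) z₀.proj y.1 (sharpChart g z₀.proj y.1 y.2))]
  · change y.2 (chartDeriv (𝓡 n) z₀.proj _ (chartSymmDeriv (𝓡 n) z₀.proj y.1 _)) = _
    rw [chartDeriv_chartSymmDeriv _ hy1]
  · ext w
    have h1 := chartSymmDeriv_chartDeriv (I := 𝓡 n) z₀.proj hx w
    rw [hinv] at h1
    change metricVal g ((extChartAt (𝓡 n) z₀.proj).symm y.1) _ w =
      y.2 (chartDeriv (𝓡 n) z₀.proj ((extChartAt (𝓡 n) z₀.proj).symm y.1) w)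
    conv_lhs => rw [← h1]
    rw [← metricChart_apply, metricChart_sharpChart g _ hy1]

/-- The energy in coordinates. -/
def energyModel (G : EuclideanSpace ℝ (Fin n) → Covec n →L[ℝ] EuclideanSpace ℝ (Fin n))
    (y : VM n) : ℝ := y.2 (G y.1 y.2) / 2

theorem energy_cotChart_symm (g : AnalyticMetric n M) (z₀ : Cot n M) {y : VM n}
    (hy : y ∈ (extChartAt (cotModel n) z₀).target) :
    energy g ((extChartAt (cotModel n) z₀).symm y) = energyModel (sharpChart g z₀.proj) y := by
  rw [energy, normSq_cotChart_symm g z₀ hy, energyModel]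

end Metric

/-! ### The Hamiltonian field in coordinates and its linearization on the zero section -/

section HamiltonianModel

theorem extDeriv_two_apply {V : Type*} [NormedAddCommGroup V] [NormedSpace ℝ V]
    (Ω : V → V [⋀^Fin 2]→L[ℝ] ℝ) (y v₀ v₁ v₂ : V) : extDeriv Ω y ![v₀, v₁, v₂] =
      fderiv ℝ Ω y v₀ ![v₁, v₂] - fderiv ℝ Ω y v₁ ![v₀, v₂] + fderiv ℝ Ω y v₂ ![v₀, v₁] := by
  have h0 : Fin.removeNth (0 : Fin 3) ![v₀, v₁, v₂] = ![v₁, v₂] := by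
    ext i : 1; fin_cases i <;> rfl
  have h1 : Fin.removeNth (1 : Fin 3) ![v₀, v₁, v₂] = ![v₀, v₂] := by
    ext i : 1; fin_cases i <;> rfl
  have h2 : Fin.removeNth (2 : Fin 3) ![v₀, v₁, v₂] = ![v₀, v₁] := by
    ext i : 1; fin_cases i <;> rfl
  rw [extDeriv, ContinuousAlternatingMap.alternatizeUncurryFin_apply, Fin.sum_univ_three, h0, h1,
    h2]
  simp
  ring

variable {n : ℕ}

instance instNormedAddCommGroupCovecHom :
    NormedAddCommGroup (Covec n →L[ℝ] EuclideanSpace ℝ (Fin n)) :=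
  ContinuousLinearMap.toNormedAddCommGroup

instance instNormedSpaceCovecHom : NormedSpace ℝ (Covec n →L[ℝ] EuclideanSpace ℝ (Fin n)) :=
  ContinuousLinearMap.toNormedSpace

instance instNormedAddCommGroupCovecHomHom : NormedAddCommGroup
    (EuclideanSpace ℝ (Fin n) →L[ℝ] Covec n →L[ℝ] EuclideanSpace ℝ (Fin n)) :=
  ContinuousLinearMap.toNormedAddCommGroup

instance instNormedSpaceCovecHomHom : NormedSpace ℝ
    (EuclideanSpace ℝ (Fin n) →L[ℝ] Covec n →L[ℝ] EuclideanSpace ℝ (Fin n)) :=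
  ContinuousLinearMap.toNormedSpace

/-- The Lie derivative of a closed form along a Hamiltonian vector field vanishes. -/
theorem lie_hamiltonian {Ω : VM n → (VM n) [⋀^Fin 2]→L[ℝ] ℝ} {f : VM n → ℝ} {Y : VM n → VM n}
    {c : ℝ} {y : VM n}
    (hΩ : DifferentiableAt ℝ Ω y) (hY : DifferentiableAt ℝ Y y) (hf : ContDiffAt ℝ ω f y)
    (hd : extDeriv Ω y = 0) (hh : ∀ᶠ y' in 𝓝 y, ∀ η, Ω y' ![Y y', η] = c * fderiv ℝ f y' η)
    (ξ η : VM n) : fderiv ℝ Ω y (Y y) ![ξ, η] + Ω y ![fderiv ℝ Y y ξ, η] +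
      Ω y ![ξ, fderiv ℝ Y y η] = 0 := by
  have hdf : DifferentiableAt ℝ (fderiv ℝ f) y :=
    (hf.fderiv_right (m := ω) (by simp)).differentiableAt (by simp)
  -- Differentiate the defining relation `Ω(Y, η) = c df(η)` in the direction `ξ`. Antisymmetrizing
  -- in `ξ` and `η` removes the Hessian, and closedness of `Ω` turns the remaining derivatives of
  -- `Ω` into the one along `Y`.
  have key : ∀ ξ η : VM n, fderiv ℝ Ω y ξ ![Y y, η] + Ω y ![fderiv ℝ Y y ξ, η] =
      c * fderiv ℝ (fderiv ℝ f) y ξ η := by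
    intro ξ η
    have h1 : HasFDerivAt (fun y' => curryForm (Ω y')) (curryForm.comp (fderiv ℝ Ω y)) y :=
      (curryForm (V := VM n)).hasFDerivAt.comp y hΩ.hasFDerivAt
    have h2 := (h1.clm_apply hY.hasFDerivAt).clm_apply (hasFDerivAt_const η y)
    have h3 := (hdf.hasFDerivAt.clm_apply (hasFDerivAt_const η y)).const_mul c
    have h4 := (h2.congr_of_eventuallyEq (f₁ := fun y' => c * fderiv ℝ f y' η) (by
      filter_upwards [hh] with y' hy'
      rw [curryForm_apply, hy'])).unique h3
    have h5 := congrArg (fun A : VM n →L[ℝ] ℝ => A ξ) h4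
    simp [curryForm_apply] at h5
    linarith
  have hsymm : fderiv ℝ (fderiv ℝ f) y ξ η = fderiv ℝ (fderiv ℝ f) y η ξ :=
    (hf.isSymmSndFDerivAt (by simp)).eq ξ η
  have h1 := key ξ η
  have h2 := key η ξ
  have h3 := extDeriv_two_apply Ω y (Y y) ξ η
  have h0 : (0 : (VM n) [⋀^Fin 3]→L[ℝ] ℝ) ![Y y, ξ, η] = 0 := rfl
  rw [hd, h0] at h3
  have h4 := form_swap (Ω y) ξ (fderiv ℝ Y y η)
  rw [hsymm] at h1
  linarith


/-- Nondegeneracy of a 2-form. -/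
def FormNondegenerate {V : Type*} [AddCommGroup V] [Module ℝ V] [TopologicalSpace V]
    (w : V [⋀^Fin 2]→L[ℝ] ℝ) : Prop := ∀ X, (∀ η, w ![X, η] = 0) → X = 0

theorem FormNondegenerate.exists_equiv {w : (VM n) [⋀^Fin 2]→L[ℝ] ℝ} (hw : FormNondegenerate w) :
    ∃ e : VM n ≃L[ℝ] (VM n →L[ℝ] ℝ), (e : VM n →L[ℝ] VM n →L[ℝ] ℝ) = curryForm w := by
  have hinj : Function.Injective (curryForm w).toLinearMap := by
    refine (injective_iff_map_eq_zero _).2 fun X hX => hw X fun η => ?_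
    rw [← curryForm_apply]
    exact congrArg (fun A : VM n →L[ℝ] ℝ => A η) hX
  have : FiniteDimensional ℝ (Covec n) := (covE n).toLinearEquiv.finiteDimensional
  have hfd : FiniteDimensional ℝ (VM n) := inferInstance
  have e1 : (VM n →ₗ[ℝ] ℝ) ≃ₗ[ℝ] (VM n →L[ℝ] ℝ) := LinearMap.toContinuousLinearMap
  have : FiniteDimensional ℝ (VM n →L[ℝ] ℝ) := e1.finiteDimensional
  have hrank : Module.finrank ℝ (VM n) = Module.finrank ℝ (VM n →L[ℝ] ℝ) := by
    rw [← e1.finrank_eq]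
    exact (Subspace.dual_finrank_eq (K := ℝ) (V := VM n)).symm
  refine ⟨(LinearMap.linearEquivOfInjective _ hinj hrank).toContinuousLinearEquiv, ?_⟩
  refine ContinuousLinearMap.ext fun X => ?_
  rfl

/-- Testing against vertical vectors kills the horizontal component, which removes the magnetic
term; horizontal vectors then kill the covector. -/
theorem modelForm_nondegenerate
    (b : EuclideanSpace ℝ (Fin n) → (EuclideanSpace ℝ (Fin n)) [⋀^Fin 2]→L[ℝ] ℝ) (y : VM n) :
    FormNondegenerate (modelForm b y) := by
  intro X hX
  have h1 : X.1 = 0 := by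
    have h2 : ∀ q : Covec n, q X.1 = 0 := fun q => by
      have := hX (0, q)
      rw [modelForm_apply, form_zero_right] at this
      simpa using this
    have h3 := h2 (innerSL ℝ X.1)
    simpa using h3
  refine Prod.ext h1 ?_
  ext v
  have := hX (v, 0)
  rw [modelForm_apply, h1, form_zero_left] at this
  simpa using this

/-- The Hamiltonian vector field in coordinates. -/
def hamiltonianModel
    (b : EuclideanSpace ℝ (Fin n) → (EuclideanSpace ℝ (Fin n)) [⋀^Fin 2]→L[ℝ] ℝ)
    (G : EuclideanSpace ℝ (Fin n) → Covec n →L[ℝ] EuclideanSpace ℝ (Fin n)) (y : VM n) : VM n :=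
  (curryForm (modelForm b y)).inverse (fderiv ℝ (energyModel G) y)

variable {b : EuclideanSpace ℝ (Fin n) → (EuclideanSpace ℝ (Fin n)) [⋀^Fin 2]→L[ℝ] ℝ}
  {G : EuclideanSpace ℝ (Fin n) → Covec n →L[ℝ] EuclideanSpace ℝ (Fin n)}

theorem curryForm_hamiltonianModel (y : VM n) :
    curryForm (modelForm b y) (hamiltonianModel b G y) = fderiv ℝ (energyModel G) y := by
  obtain ⟨e, he⟩ := (modelForm_nondegenerate b y).exists_equiv
  rw [hamiltonianModel, ← he, ContinuousLinearMap.inverse_equiv]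
  exact e.apply_symm_apply _

theorem modelForm_hamiltonianModel (y η : VM n) :
    modelForm b y ![hamiltonianModel b G y, η] = fderiv ℝ (energyModel G) y η := by
  rw [← curryForm_hamiltonianModel (b := b), curryForm_apply]

theorem contDiffAt_energyModel {y : VM n} (hG : ContDiffAt ℝ ω G y.1) :
    ContDiffAt ℝ ω (energyModel G) y := by
  have h1 : ContDiffAt ℝ ω (fun y : VM n => G y.1) y := hG.comp y contDiffAt_fst
  have h2 : ContDiffAt ℝ ω (fun y : VM n => y.2) y := contDiffAt_snd
  exact (h2.clm_apply (h1.clm_apply h2)).div_const 2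

theorem contDiffAt_hamiltonianModel {y : VM n} (hb : ContDiffAt ℝ ω b y.1)
    (hG : ContDiffAt ℝ ω G y.1) : ContDiffAt ℝ ω (hamiltonianModel b G) y := by
  obtain ⟨e, he⟩ := (modelForm_nondegenerate b y).exists_equiv
  have h1 := contDiffAt_map_inverse (𝕜 := ℝ) (n := ω) e
  rw [he] at h1
  have h2 : ContDiffAt ℝ ω (fun y => curryForm (modelForm b y)) y :=
    (curryForm (V := VM n)).contDiff.contDiffAt.comp y (contDiffAt_modelForm hb)
  have h3 := h1.comp y h2
  exact h3.clm_apply ((contDiffAt_energyModel hG).fderiv_right (by simp))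

theorem fderiv_energyModel_apply {y : VM n} (hG : ContDiffAt ℝ ω G y.1) (η : VM n) :
    fderiv ℝ (energyModel G) y η = (η.2 (G y.1 y.2) + y.2 (fderiv ℝ G y.1 η.1 y.2) +
      y.2 (G y.1 η.2)) / 2 := by
  have h1 : HasFDerivAt (fun y : VM n => G y.1) _ y :=
    (hG.differentiableAt (by simp)).hasFDerivAt.comp y hasFDerivAt_fst
  have h2 : HasFDerivAt (fun y : VM n => y.2) _ y := hasFDerivAt_snd (𝕜 := ℝ)
  have h3 := (h2.clm_apply (h1.clm_apply h2)).mul_const (2⁻¹ : ℝ)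
  have h4 : energyModel G = fun y => y.2 (G y.1 y.2) * (2⁻¹ : ℝ) := by
    ext1 y; rw [energyModel, div_eq_mul_inv]
  rw [h4, h3.fderiv]
  simp
  ring

/-- The energy is quadratic in the covector, so on the zero section only the covector block of its
Hessian survives. -/
theorem hasFDerivAt_fderiv_energyModel {a : EuclideanSpace ℝ (Fin n)} (hG : ContDiffAt ℝ ω G a)
    (hsymm : ∀ p q : Covec n, p (G a q) = q (G a p)) (ξ η : VM n) :
    fderiv ℝ (fderiv ℝ (energyModel G)) (a, 0) ξ η = η.2 (G a ξ.2) := by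
  have hev : ∀ᶠ y : VM n in 𝓝 (a, 0), ContDiffAt ℝ ω G y.1 := by
    have h1 : ∀ᶠ y in 𝓝 a, ContDiffAt ℝ ω G y := hG.eventually (by simp)
    exact (continuous_fst.tendsto (a, (0 : Covec n))).eventually h1
  have hGd : DifferentiableAt ℝ G a := hG.differentiableAt (by simp)
  have hGd2 : DifferentiableAt ℝ (fderiv ℝ G) a :=
    (hG.fderiv_right (m := ω) (by simp)).differentiableAt (by simp)
  have hdE : DifferentiableAt ℝ (fderiv ℝ (energyModel G)) (a, 0) :=
    ((contDiffAt_energyModel (y := (a, 0)) hG).fderiv_right (m := ω) (by simp)).differentiableAt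
      (by simp)
  have h1 : HasFDerivAt (fun y : VM n => G y.1) _ (a, 0) :=
    HasFDerivAt.comp (a, (0 : Covec n)) (f := Prod.fst) hGd.hasFDerivAt hasFDerivAt_fst
  have h2 : HasFDerivAt (fun y : VM n => y.2) _ (a, 0) := hasFDerivAt_snd (𝕜 := ℝ)
  have h5 : HasFDerivAt (fun y : VM n => fderiv ℝ G y.1) _ (a, 0) :=
    HasFDerivAt.comp (a, (0 : Covec n)) (f := Prod.fst) hGd2.hasFDerivAt hasFDerivAt_fst
  have h6 := h5.clm_apply (hasFDerivAt_const η.1 ((a, 0) : VM n))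
  have t1 := (hasFDerivAt_const η.2 ((a, 0) : VM n)).clm_apply (h1.clm_apply h2)
  have t2 := h2.clm_apply (h6.clm_apply h2)
  have t3 := h2.clm_apply (h1.clm_apply (hasFDerivAt_const η.2 ((a, 0) : VM n)))
  have t := ((t1.add t2).add t3).mul_const (2⁻¹ : ℝ)
  have s := hdE.hasFDerivAt.clm_apply (hasFDerivAt_const η ((a, 0) : VM n))
  have heq := (t.congr_of_eventuallyEq (f₁ := fun y => fderiv ℝ (energyModel G) y η) (by
    filter_upwards [hev] with y hy
    rw [fderiv_energyModel_apply hy, div_eq_mul_inv]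
    rfl)).unique s
  have h7 := congrArg (fun A : VM n →L[ℝ] ℝ => A ξ) heq
  simp at h7
  have h8 := hsymm ξ.2 η.2
  linarith

theorem fderiv_energyModel_rest {a : EuclideanSpace ℝ (Fin n)} (hG : ContDiffAt ℝ ω G a) :
    fderiv ℝ (energyModel G) (a, 0) = 0 := by
  refine ContinuousLinearMap.ext fun η => ?_
  rw [fderiv_energyModel_apply (y := (a, 0)) hG]
  simp

theorem hamiltonianModel_rest {a : EuclideanSpace ℝ (Fin n)} (hG : ContDiffAt ℝ ω G a) :
    hamiltonianModel b G (a, 0) = 0 := by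
  rw [hamiltonianModel, fderiv_energyModel_rest hG, map_zero]

/-- Differentiate `Ω(X, ·) = dE` on the zero section. The derivative of `Ω` drops out because `X`
vanishes there, leaving the Hessian. -/
theorem modelForm_fderiv_hamiltonianModel {a : EuclideanSpace ℝ (Fin n)} (hb : ContDiffAt ℝ ω b a)
    (hG : ContDiffAt ℝ ω G a) (hsymm : ∀ p q : Covec n, p (G a q) = q (G a p)) (ξ η : VM n) :
    modelForm b (a, 0) ![fderiv ℝ (hamiltonianModel b G) (a, 0) ξ, η] = η.2 (G a ξ.2) := by
  have h1 : HasFDerivAt (fun y => curryForm (modelForm b y)) _ (a, 0) :=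
    (curryForm (V := VM n)).hasFDerivAt.comp (a, 0)
      ((contDiffAt_modelForm (y := (a, 0)) hb).differentiableAt (by simp)).hasFDerivAt
  have h2 := ((contDiffAt_hamiltonianModel (y := (a, 0)) hb hG).differentiableAt
    (by simp)).hasFDerivAt
  have h3 := h1.clm_apply h2
  have hdE : DifferentiableAt ℝ (fderiv ℝ (energyModel G)) (a, 0) :=
    ((contDiffAt_energyModel (y := (a, 0)) hG).fderiv_right (m := ω) (by simp)).differentiableAt
      (by simp)
  have h4 := (h3.congr_of_eventuallyEq (f₁ := fderiv ℝ (energyModel G))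
    (Filter.Eventually.of_forall fun y =>
      (curryForm_hamiltonianModel y).symm)).unique hdE.hasFDerivAt
  have h5 := congrArg (fun A : VM n →L[ℝ] VM n →L[ℝ] ℝ => A ξ η) h4
  rw [hamiltonianModel_rest hG] at h5
  simp [curryForm_apply] at h5
  rw [h5, hasFDerivAt_fderiv_energyModel hG hsymm]

theorem fderiv_hamiltonianModel_rest {a : EuclideanSpace ℝ (Fin n)} (hb : ContDiffAt ℝ ω b a)
    (hG : ContDiffAt ℝ ω G a) (hsymm : ∀ p q : Covec n, p (G a q) = q (G a p)) (ξ : VM n) :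
    (fderiv ℝ (hamiltonianModel b G) (a, 0) ξ).1 = G a ξ.2 ∧
      ∀ v', (fderiv ℝ (hamiltonianModel b G) (a, 0) ξ).2 v' = -b a ![G a ξ.2, v'] := by
  have key := modelForm_fderiv_hamiltonianModel hb hG hsymm ξ
  generalize fderiv ℝ (hamiltonianModel b G) (a, 0) ξ = D at key ⊢
  have h1 : D.1 = G a ξ.2 := by
    have h2 : ∀ q' : Covec n, q' (D.1 - G a ξ.2) = 0 := fun q' => by
      have h := key (0, q')
      rw [modelForm_apply, form_zero_right, map_zero, sub_zero, sub_zero] at h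
      rw [map_sub, h, sub_self]
    have h3 := h2 (innerSL ℝ (D.1 - G a ξ.2))
    rw [innerSL_apply_apply, inner_self_eq_zero, sub_eq_zero] at h3
    exact h3
  refine ⟨h1, fun v' => ?_⟩
  have h := key (v', 0)
  rw [modelForm_apply, h1, zero_apply] at h
  have h' : 0 - D.2 v' - b a ![G a ξ.2, v'] = 0 := h
  linarith

theorem contDiffAt_smul_hamiltonianModel {y : VM n} (hb : ContDiffAt ℝ ω b y.1)
    (hG : ContDiffAt ℝ ω G y.1) (c : ℝ) :
    ContDiffAt ℝ ω (fun y => c • hamiltonianModel b G y) y :=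
  (contDiffAt_hamiltonianModel hb hG).const_smul c

theorem fderiv_smul_hamiltonianModel {y : VM n} (hb : ContDiffAt ℝ ω b y.1)
    (hG : ContDiffAt ℝ ω G y.1) (c : ℝ) (ξ : VM n) :
    fderiv ℝ (fun y => c • hamiltonianModel b G y) y ξ =
      c • fderiv ℝ (hamiltonianModel b G) y ξ := by
  have h := (((contDiffAt_hamiltonianModel hb hG).differentiableAt
    (by simp)).hasFDerivAt.const_smul c).fderiv
  exact congrArg (fun A : VM n →L[ℝ] VM n => A ξ) h

/-- The factor `T` makes the unit disk of the power series cover the times of modulus less than `T`;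
the minus sign is there because `P_z(σ)` is read off from `Φ_{-σ}`. -/
theorem isLocalSystem_hamiltonianModel {U : Set (EuclideanSpace ℝ (Fin n))} (hU : IsOpen U)
    (hb : ∀ x ∈ U, ContDiffAt ℝ ω b x) (hd : ∀ x ∈ U, extDeriv b x = 0)
    (hG : ∀ x ∈ U, ContDiffAt ℝ ω G x) {a : EuclideanSpace ℝ (Fin n)} (ha : a ∈ U)
    (hsymm : ∀ p q : Covec n, p (G a q) = q (G a p))
    (hpos : ∀ p : Covec n, p ≠ 0 → 0 < p (G a p)) {T : ℝ} (hT : 0 < T) :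
    IsLocalSystem (fun y => -T • hamiltonianModel b G y) (modelForm b) (a, 0) T (G a) (b a) where
  analytic := (contDiffAt_smul_hamiltonianModel (y := (a, 0)) (hb a ha) (hG a ha) (-T)).analyticAt
  rest := by rw [hamiltonianModel_rest (hG a ha), smul_zero]
  smooth := contDiffAt_modelForm (hb a ha)
  lie := by
    have hev : ∀ᶠ y : VM n in 𝓝 (a, 0), y.1 ∈ U :=
      (continuous_fst.tendsto (a, (0 : Covec n))).eventually (hU.mem_nhds ha)
    filter_upwards [hev] with y hy ξ η
    refine lie_hamiltonian (c := -T) (f := energyModel G)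
      ((contDiffAt_modelForm (hb _ hy)).differentiableAt (by simp))
      ((contDiffAt_smul_hamiltonianModel (hb _ hy) (hG _ hy) (-T)).differentiableAt (by simp))
      (contDiffAt_energyModel (hG _ hy))
      (extDeriv_modelForm ((hb _ hy).differentiableAt (by simp)) (hd _ hy)) ?_ ξ η
    refine Filter.Eventually.of_forall fun y' η' => ?_
    rw [form_smul_left, modelForm_hamiltonianModel]
  vert := Filter.Eventually.of_forall fun y q q' => by
    rw [modelForm_apply, form_zero_left, map_zero, map_zero, sub_zero, sub_zero]
  deriv_fst := fun v q => by
    rw [fderiv_smul_hamiltonianModel (hb a ha) (hG a ha), Prod.smul_fst,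
      (fderiv_hamiltonianModel_rest (hb a ha) (hG a ha) hsymm (v, q)).1, neg_smul]
  deriv_snd := fun v q v' => by
    rw [fderiv_smul_hamiltonianModel (hb a ha) (hG a ha), Prod.smul_snd, smul_apply,
      (fderiv_hamiltonianModel_rest (hb a ha) (hG a ha) hsymm (v, q)).2, smul_eq_mul]
    ring
  form := fun v q v' q' => by rw [modelForm_apply]
  pos := hpos
  time_pos := hT

end HamiltonianModel

/-! ### Vector fields on manifolds and completeness -/

section VectorFields

variable {E : Type*} [NormedAddCommGroup E] [NormedSpace ℝ E]
  {H : Type*} [TopologicalSpace H] {I : ModelWithCorners ℝ E H} [I.Boundaryless]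
  {N : Type*} [TopologicalSpace N] [ChartedSpace H N] [IsManifold I ω N]

/-- A map into the tangent bundle is as regular as its coordinate expression. -/
theorem contMDiffAt_tangent_of_chart {E' : Type*} [NormedAddCommGroup E'] [NormedSpace ℝ E']
    {H' : Type*} [TopologicalSpace H'] {I' : ModelWithCorners ℝ E' H'} {N' : Type*}
    [TopologicalSpace N'] [ChartedSpace H' N'] {m : WithTop ℕ∞}
    {b : N' → N} {X : N' → E} {q : N'} (z₀ : N) (hb : ContMDiffAt I' I m b q)
    (hz : b q ∈ (extChartAt I z₀).source)
    (hX : ContMDiffAt I' 𝓘(ℝ, E) m (fun q => chartDeriv I z₀ (b q) (X q)) q) :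
    ContMDiffAt I' I.tangent m (fun q => (⟨b q, X q⟩ : TangentBundle I N)) q := by
  have : IsManifold I (m + 1) N := IsManifold.of_le (n := ω) le_top
  have hmem : (⟨b q, X q⟩ : TangentBundle I N) ∈
      (trivializationAt E (TangentSpace I) z₀).source := by
    rw [Trivialization.mem_source, TangentBundle.trivializationAt_baseSet]
    rwa [extChartAt_source] at hz
  rw [Trivialization.contMDiffAt_iff (IB := I) (e := trivializationAt E (TangentSpace I) z₀)
    (f := fun q => (⟨b q, X q⟩ : TangentBundle I N)) hmem]
  refine ⟨hb, hX.congr_of_eventuallyEq ?_⟩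
  filter_upwards [hb.continuousAt.eventually ((isOpen_extChartAt_source z₀).mem_nhds hz)] with x hx
  rw [extChartAt_source] at hx
  have h1 := TangentBundle.continuousLinearMapAt_trivializationAt (I := I) hx
  have h2 : chartDeriv I z₀ (b x) (X x) =
    (trivializationAt E (TangentSpace I) z₀).continuousLinearMapAt ℝ (b x) (X x) :=
    (congrArg (fun A : E →L[ℝ] E => A (X x)) h1).symm
  have h3 : ∀ v : TangentSpace I (b x),
      (trivializationAt E (TangentSpace I) z₀).continuousLinearMapAt ℝ (b x) v =
        (trivializationAt E (TangentSpace I) z₀ ⟨b x, v⟩).2 := by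
    intro v
    rw [Trivialization.continuousLinearMapAt_apply, Trivialization.linearMapAt_apply, if_pos]
    rwa [TangentBundle.trivializationAt_baseSet]
  exact (h2.trans (h3 (X x))).symm

/-- The coordinate expression of a vector field. -/
def fieldChart (X : (z : N) → TangentSpace I z) (z₀ : N) (y : E) : E :=
  chartDeriv I z₀ ((extChartAt I z₀).symm y) (X ((extChartAt I z₀).symm y))

theorem fieldChart_chart (X : (z : N) → TangentSpace I z) (z₀ : N) {z : N}
    (hz : z ∈ (extChartAt I z₀).source) :
    fieldChart X z₀ (extChartAt I z₀ z) = chartDeriv I z₀ z (X z) := by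
  rw [fieldChart, (extChartAt I z₀).left_inv hz]

theorem contMDiff_of_fieldChart {m : WithTop ℕ∞} {X : (z : N) → TangentSpace I z}
    (h : ∀ z, ContDiffAt ℝ m (fieldChart X z) (extChartAt I z z)) :
    ContMDiff I I.tangent m (fun z => (⟨z, X z⟩ : TangentBundle I N)) := by
  intro z
  refine contMDiffAt_tangent_of_chart (b := fun z => z) z contMDiffAt_id
    (mem_extChartAt_source z) ?_
  have h1 : ContMDiffAt I 𝓘(ℝ, E) m (fun x => fieldChart (I := I) X z (extChartAt I z x)) z :=
    ContMDiffAt.comp z (contMDiffAt_iff_contDiffAt.2 (h z))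
      ((contMDiffAt_chart z (mem_extChartAt_source z)).of_le le_top)
  refine h1.congr_of_eventuallyEq ?_
  filter_upwards [(isOpen_extChartAt_source z).mem_nhds (mem_extChartAt_source (I := I) z)] with x hx
  rw [fieldChart_chart X z hx]

theorem hasMFDerivAt_of_hasDerivAt_chart {X : (z : N) → TangentSpace I z} {z₀ : N} {c : ℝ → E}
    {t : ℝ} (hc : HasDerivAt c (fieldChart X z₀ (c t)) t) (ht : c t ∈ (extChartAt I z₀).target) :
    HasMFDerivAt 𝓘(ℝ, ℝ) I (fun t => (extChartAt I z₀).symm (c t)) t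
      ((1 : ℝ →L[ℝ] ℝ).smulRight (X ((extChartAt I z₀).symm (c t)))) := by
  have h1 : HasMFDerivAt 𝓘(ℝ, ℝ) 𝓘(ℝ, E) c t
      ((1 : ℝ →L[ℝ] ℝ).smulRight (fieldChart X z₀ (c t) : E) : ℝ →L[ℝ] E) := by
    have h0 : HasFDerivAt c ((1 : ℝ →L[ℝ] ℝ).smulRight (fieldChart X z₀ (c t)) : ℝ →L[ℝ] E) t :=
      hc.hasFDerivAt
    exact h0.hasMFDerivAt
  have h2 := (mdifferentiableAt_chartSymm (I := I) z₀ ht).hasMFDerivAt.comp t h1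
  have h3 : ((chartSymmDeriv I z₀ (c t)).comp
      ((1 : ℝ →L[ℝ] ℝ).smulRight (fieldChart X z₀ (c t))) : ℝ →L[ℝ] E) =
      (1 : ℝ →L[ℝ] ℝ).smulRight (X ((extChartAt I z₀).symm (c t)) : E) := by
    refine ContinuousLinearMap.ext fun s => ?_
    have h4 := chartSymmDeriv_chartDeriv (I := I) z₀ ((extChartAt I z₀).map_target ht)
      (X ((extChartAt I z₀).symm (c t)))
    rw [(extChartAt I z₀).right_inv ht] at h4
    change chartSymmDeriv I z₀ (c t) (s • fieldChart X z₀ (c t)) = s • (X _ : E)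
    rw [map_smul, fieldChart, h4]
    rfl
  have h5 : HasMFDerivAt 𝓘(ℝ, ℝ) I (fun t => (extChartAt I z₀).symm (c t)) t
      ((chartSymmDeriv I z₀ (c t)).comp
        ((1 : ℝ →L[ℝ] ℝ).smulRight (fieldChart X z₀ (c t))) : ℝ →L[ℝ] E) := h2
  rw [h3] at h5
  exact h5

/-- Local existence of integral curves, uniform in the initial point. -/
theorem exists_uniform_isMIntegralCurveOn [CompleteSpace E] {X : (z : N) → TangentSpace I z}
    {z₀ : N} (h : ContDiffAt ℝ 1 (fieldChart X z₀) (extChartAt I z₀ z₀)) :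
    ∃ ε > 0, ∀ᶠ z in 𝓝 z₀, ∃ γ : ℝ → N, γ 0 = z ∧ IsMIntegralCurveOn γ X (Ioo (-ε) ε) := by
  obtain ⟨ε, hε, a, r, L, K, hr, hpl⟩ := IsPicardLindelof.of_contDiffAt_one h
  obtain ⟨α, hα, hcont⟩ := (hpl 0).exists_forall_mem_closedBall_eq_hasDerivWithinAt_continuousOn
  set y₀ := extChartAt I z₀ z₀ with hy₀
  have hrr : (0 : ℝ) < r := hr
  have hmem : Metric.closedBall y₀ r ×ˢ Icc (0 - ε) (0 + ε) ∈ 𝓝 (y₀, (0 : ℝ)) :=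
    prod_mem_nhds (Metric.closedBall_mem_nhds _ hrr) (Icc_mem_nhds (by linarith) (by linarith))
  have h1 : ∀ᶠ p in 𝓝 (y₀, (0 : ℝ)), α p ∈ (extChartAt I z₀).target := by
    refine (hcont.continuousAt hmem).eventually ?_
    rw [(hα y₀ (Metric.mem_closedBall_self hrr.le)).1]
    exact extChartAt_target_mem_nhds z₀
  rw [nhds_prod_eq] at h1
  obtain ⟨p, hp, q, hq, hpq⟩ := Filter.eventually_prod_iff.1 h1
  obtain ⟨δ, hδ, hδq⟩ := Metric.eventually_nhds_iff.1 hq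
  refine ⟨min ε δ, lt_min hε hδ, ?_⟩
  have hcz : ContinuousAt (extChartAt I z₀) z₀ := continuousAt_extChartAt z₀
  filter_upwards [hcz.eventually hp, hcz.eventually (Metric.closedBall_mem_nhds _ hrr),
    (isOpen_extChartAt_source (I := I) z₀).mem_nhds (mem_extChartAt_source z₀)] with z hz hz1 hz2
  refine ⟨fun t => (extChartAt I z₀).symm (α (extChartAt I z₀ z, t)), ?_, fun t ht => ?_⟩
  · change (extChartAt I z₀).symm (α (extChartAt I z₀ z, 0)) = z
    rw [(hα _ hz1).1, (extChartAt I z₀).left_inv hz2]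
  · have ht1 : |t| < ε := (abs_lt.2 ht).trans_le (min_le_left _ _)
    have ht2 : |t| < δ := (abs_lt.2 ht).trans_le (min_le_right _ _)
    have ht3 := abs_lt.1 ht1
    have htt : t ∈ Ioo (0 - ε) (0 + ε) := ⟨by linarith [ht3.1], by linarith [ht3.2]⟩
    have hd := ((hα _ hz1).2 t (Ioo_subset_Icc_self htt)).hasDerivAt (Icc_mem_nhds htt.1 htt.2)
    exact (hasMFDerivAt_of_hasDerivAt_chart hd
      (hpq hz (hδq (by simpa using ht2)))).hasMFDerivWithinAt

theorem exists_uniform_isMIntegralCurveOn_of_compact [CompleteSpace E]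
    {X : (z : N) → TangentSpace I z}
    (h : ∀ z, ContDiffAt ℝ 1 (fieldChart X z) (extChartAt I z z)) {K : Set N} (hK : IsCompact K) :
    ∃ ε > 0, ∀ z ∈ K, ∃ γ : ℝ → N, γ 0 = z ∧ IsMIntegralCurveOn γ X (Ioo (-ε) ε) := by
  refine hK.induction_on (p := fun S => ∃ ε > 0, ∀ z ∈ S, ∃ γ : ℝ → N, γ 0 = z ∧
    IsMIntegralCurveOn γ X (Ioo (-ε) ε)) ⟨1, one_pos, by simp⟩ ?_ ?_ ?_
  · rintro s t hst ⟨ε, hε, ht⟩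
    exact ⟨ε, hε, fun z hz => ht z (hst hz)⟩
  · rintro s t ⟨ε, hε, hs⟩ ⟨δ, hδ, ht⟩
    refine ⟨min ε δ, lt_min hε hδ, fun z hz => ?_⟩
    rcases hz with hz | hz
    · obtain ⟨γ, h0, hγ⟩ := hs z hz
      exact ⟨γ, h0, hγ.mono (Ioo_subset_Ioo (neg_le_neg (min_le_left _ _)) (min_le_left _ _))⟩
    · obtain ⟨γ, h0, hγ⟩ := ht z hz
      exact ⟨γ, h0, hγ.mono (Ioo_subset_Ioo (neg_le_neg (min_le_right _ _)) (min_le_right _ _))⟩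
  · intro z _
    obtain ⟨ε, hε, hz⟩ := exists_uniform_isMIntegralCurveOn (h z)
    exact ⟨_, nhdsWithin_le_nhds hz, ε, hε, fun z hz => hz⟩

/-- A conserved function is constant along integral curves. -/
theorem IsMIntegralCurve.conserved {X : (z : N) → TangentSpace I z} {f : N → ℝ}
    (hf : MDifferentiable I 𝓘(ℝ, ℝ) f) (hX : ∀ z, mfderiv I 𝓘(ℝ, ℝ) f z (X z) = 0) {γ : ℝ → N}
    (hγ : IsMIntegralCurve γ X) (t : ℝ) : f (γ t) = f (γ 0) := by
  have h1 : ∀ t, HasDerivAt (fun t => f (γ t)) 0 t := by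
    intro t
    have h2 : ∀ (A : E →L[ℝ] ℝ) (v : E), HasFDerivAt (fun t => f (γ t))
        (A.comp ((1 : ℝ →L[ℝ] ℝ).smulRight v) : ℝ →L[ℝ] ℝ) t → A v = 0 →
        HasDerivAt (fun t => f (γ t)) 0 t := by
      intro A v h hA
      refine h.hasDerivAt.congr_deriv ?_
      change A ((1 : ℝ) • v) = 0
      rw [one_smul, hA]
    exact h2 _ _ ((hf (γ t)).hasMFDerivAt.comp t (hγ t)).hasFDerivAt (hX (γ t))
  exact is_const_of_deriv_eq_zero (fun t => (h1 t).differentiableAt) (fun t => (h1 t).deriv) t 0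

/-- A smooth vector field with a proper conserved function is complete. -/
theorem exists_isMIntegralCurve_of_conserved [CompleteSpace E] [T2Space N]
    {X : (z : N) → TangentSpace I z} {f : N → ℝ}
    (hX : ∀ z, ContDiffAt ℝ ω (fieldChart X z) (extChartAt I z z)) (hf : ContMDiff I 𝓘(ℝ, ℝ) ω f)
    (hfX : ∀ z, mfderiv I 𝓘(ℝ, ℝ) f z (X z) = 0) (hc : ∀ c, IsCompact {z | f z ≤ c}) (z : N) :
    ∃ γ : ℝ → N, γ 0 = z ∧ IsMIntegralCurve γ X := by
  -- A cut-off depending only on the conserved function: it is `1` where `f ≤ f z` and `0` where `f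
  -- ≥ f z + 1`. The field `χ X` still conserves `f` and is supported in a compact sublevel set, so
  -- it has a uniform existence time.
  let χ : N → ℝ := fun x => Real.smoothTransition (f z + 1 - f x)
  let v : (x : N) → TangentSpace I x := fun x => χ x • X x
  have hv : ∀ z₀, ContDiffAt ℝ 1 (fieldChart v z₀) (extChartAt I z₀ z₀) := by
    intro z₀
    have h1 : fieldChart v z₀ = fun y => χ ((extChartAt I z₀).symm y) • fieldChart X z₀ y := by
      ext1 y
      exact map_smul (chartDeriv I z₀ ((extChartAt I z₀).symm y)) _ _
    rw [h1]
    have h2 : ContDiffAt ℝ 1 (fun y => f ((extChartAt I z₀).symm y)) (extChartAt I z₀ z₀) := by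
      rw [← contMDiffAt_iff_contDiffAt]
      exact ((hf _).of_le le_top).comp _
        ((contMDiffAt_chartSymm z₀ (mem_extChartAt_target z₀)).of_le le_top)
    have h3 : ContDiffAt ℝ 1 (fun y => χ ((extChartAt I z₀).symm y)) (extChartAt I z₀ z₀) :=
      Real.smoothTransition.contDiff.contDiffAt.comp _ (contDiffAt_const.sub h2)
    exact h3.smul ((hX z₀).of_le le_top)
  obtain ⟨ε, hε, hK⟩ := exists_uniform_isMIntegralCurveOn_of_compact hv (hc (f z + 1))
  have : IsManifold I 1 N := IsManifold.of_le (n := ω) le_top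
  have huni : ∀ x, ∃ γ : ℝ → N, γ 0 = x ∧ IsMIntegralCurveOn γ v (Ioo (-ε) ε) := by
    intro x
    by_cases hx : f x ≤ f z + 1
    · exact hK x hx
    -- Outside the sublevel set the cut-off field vanishes and constant curves are integral curves.
    · refine ⟨fun _ => x, rfl, (isMIntegralCurve_const ?_).isMIntegralCurveOn _⟩
      have : χ x = 0 := Real.smoothTransition.zero_of_nonpos (by linarith)
      change χ x • X x = 0
      rw [this, zero_smul]
  obtain ⟨γ, h0, hγ⟩ := exists_isMIntegralCurve_of_isMIntegralCurveOn
    (contMDiff_of_fieldChart hv) hε huni z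
  have hcons := IsMIntegralCurve.conserved (X := v) (hf.mdifferentiable (by simp))
    (fun x => by
      change mfderiv I 𝓘(ℝ, ℝ) f x (χ x • X x) = 0
      rw [map_smul, hfX, smul_zero]) hγ
  refine ⟨γ, h0, fun t => ?_⟩
  have h1 := hγ t
  -- By conservation the curve stays on the level of `z`, where the cut-off is `1`; hence it is an
  -- integral curve of `X` itself.
  have h2 : χ (γ t) = 1 :=
    Real.smoothTransition.one_of_one_le (by rw [hcons, h0]; linarith)
  have h3 : v (γ t) = X (γ t) := by
    change χ (γ t) • X (γ t) = _
    rw [h2, one_smul]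
  rwa [h3] at h1

end VectorFields

/-! ### Completeness of the magnetic flow -/

section GlobalFlow

variable {n : ℕ} {M : Type*} [TopologicalSpace M] [ChartedSpace (EuclideanSpace ℝ (Fin n)) M]
  [IsManifold (𝓡 n) ω M]

theorem continuous_proj : Continuous (proj (n := n) (M := M)) :=
  mdifferentiable_proj.continuous

/-- Points over different base points are separated by open sets pulled back from `M`; points of one
fibre lie in a common chart. -/
instance instT2SpaceCot [T2Space M] : T2Space (Cot n M) := by
  refine t2Space_iff_disjoint_nhds.2 fun z z' hne => ?_
  by_cases h : proj z = proj z'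
  · have hz : z ∈ (extChartAt (cotModel n) z).source := mem_extChartAt_source z
    have hz' : z' ∈ (extChartAt (cotModel n) z).source := by
      rw [mem_cotChart_source]
      change proj z' ∈ _
      rw [← h]
      exact mem_extChartAt_source _
    have h1 : extChartAt (cotModel n) z z ≠ extChartAt (cotModel n) z z' := fun he =>
      hne ((extChartAt (cotModel n) z).injOn hz hz' he)
    refine (Filter.disjoint_comap (m := extChartAt (cotModel n) z)
      (disjoint_nhds_nhds.2 h1)).mono ?_ ?_
    · exact (continuousAt_extChartAt' hz).tendsto.le_comap
    · exact (continuousAt_extChartAt' hz').tendsto.le_comap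
  · exact (Filter.disjoint_comap (m := proj) (disjoint_nhds_nhds.2 h)).mono
      (continuous_proj.tendsto z).le_comap (continuous_proj.tendsto z').le_comap

theorem contDiffAt_energyModel_sharpChart (g : AnalyticMetric n M) (z₀ : Cot n M) {y : VM n}
    (hy : y ∈ (extChartAt (cotModel n) z₀).target) :
    ContDiffAt ℝ ω (energyModel (sharpChart g z₀.proj)) y := by
  rw [cotChart_target] at hy
  exact contDiffAt_energyModel (contDiffAt_sharpChart g z₀.proj hy.1)

theorem energy_eventuallyEq (g : AnalyticMetric n M) (z₀ : Cot n M) {z : Cot n M}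
    (hz : z ∈ (extChartAt (cotModel n) z₀).source) : energy g =ᶠ[𝓝 z]
      fun z => energyModel (sharpChart g z₀.proj) (extChartAt (cotModel n) z₀ z) := by
  filter_upwards [(isOpen_extChartAt_source z₀).mem_nhds hz] with x hx
  rw [← energy_cotChart_symm g z₀ ((extChartAt (cotModel n) z₀).map_source hx),
    (extChartAt (cotModel n) z₀).left_inv hx]

theorem contMDiff_energy (g : AnalyticMetric n M) :
    ContMDiff (cotModel n) 𝓘(ℝ, ℝ) ω (energy g) := by
  intro z
  have hz := mem_extChartAt_source (I := cotModel n) z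
  refine ContMDiffAt.congr_of_eventuallyEq ?_ (energy_eventuallyEq g z hz)
  exact (contDiffAt_energyModel_sharpChart g z (mem_extChartAt_target z)).contMDiffAt.comp z
    (contMDiffAt_chart z hz)

theorem normSq_eq_energy (g : AnalyticMetric n M) (z : Cot n M) : normSq g z = 2 * energy g z := by
  rw [energy]; ring

theorem continuous_normSq (g : AnalyticMetric n M) : Continuous (normSq g) := by
  have h : normSq g = fun z => 2 * energy g z := funext (normSq_eq_energy g)
  rw [h]
  exact continuous_const.mul (contMDiff_energy g).continuous

theorem isOpen_tube (g : AnalyticMetric n M) (R : ℝ) : IsOpen (tube g R) :=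
  isOpen_lt (continuous_normSq g) continuous_const

/-- The differential of the energy. -/
def energyDeriv (g : AnalyticMetric n M) (z : Cot n M) : VM n →L[ℝ] ℝ :=
  (mfderiv (cotModel n) 𝓘(ℝ, ℝ) (energy g) z :)

theorem energyDeriv_eq (g : AnalyticMetric n M) (z₀ : Cot n M) {z : Cot n M}
    (hz : z ∈ (extChartAt (cotModel n) z₀).source) (ξ : VM n) :
    energyDeriv g z ξ = fderiv ℝ (energyModel (sharpChart g z₀.proj))
      (extChartAt (cotModel n) z₀ z) (chartDeriv (cotModel n) z₀ z ξ) := by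
  have h1 : HasMFDerivAt 𝓘(ℝ, VM n) 𝓘(ℝ, ℝ) (energyModel (sharpChart g z₀.proj))
      (extChartAt (cotModel n) z₀ z) (fderiv ℝ (energyModel (sharpChart g z₀.proj))
      (extChartAt (cotModel n) z₀ z)) :=
    ((contDiffAt_energyModel_sharpChart g z₀ ((extChartAt (cotModel n) z₀).map_source hz)
      ).differentiableAt (by simp)).hasFDerivAt.hasMFDerivAt
  have h2 := (h1.comp z (mdifferentiableAt_chart (I := cotModel n) z₀ hz).hasMFDerivAt
    ).congr_of_eventuallyEq (energy_eventuallyEq g z₀ hz)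
  exact congrArg (fun A : VM n →L[ℝ] ℝ => A ξ) h2.mfderiv

theorem twistedForm_val (β : DiffForm (𝓡 n) M 2) (z₀ : Cot n M) {z : Cot n M}
    (hz : z ∈ (extChartAt (cotModel n) z₀).source) (ξ η : VM n) :
    (twistedForm β).val z ![ξ, η] = modelForm (β.inChart z₀.proj) (extChartAt (cotModel n) z₀ z)
      ![chartDeriv (cotModel n) z₀ z ξ, chartDeriv (cotModel n) z₀ z η] := by
  rw [DiffForm.val_eq_inChart (twistedForm β) z₀ hz,
    inChart_twistedForm β z₀ ((extChartAt (cotModel n) z₀).map_source hz),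
    ContinuousAlternatingMap.compContinuousLinearMap_apply]
  congr 1
  ext1 i
  fin_cases i <;> rfl

theorem IsHamiltonianField.fieldChart_eq {g : AnalyticMetric n M} {β : DiffForm (𝓡 n) M 2}
    {X : (z : Cot n M) → TCot z} (hX : IsHamiltonianField g β X) (z₀ : Cot n M) {y : VM n}
    (hy : y ∈ (extChartAt (cotModel n) z₀).target) :
    fieldChart X z₀ y = hamiltonianModel (β.inChart z₀.proj) (sharpChart g z₀.proj) y := by
  set z := (extChartAt (cotModel n) z₀).symm y with hz
  have hzs : z ∈ (extChartAt (cotModel n) z₀).source := (extChartAt (cotModel n) z₀).map_target hy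
  have hzy : extChartAt (cotModel n) z₀ z = y := (extChartAt (cotModel n) z₀).right_inv hy
  obtain ⟨e, he⟩ := (modelForm_nondegenerate (β.inChart z₀.proj) y).exists_equiv
  refine e.injective (ContinuousLinearMap.ext fun η => ?_)
  have h1 : ∀ v : VM n, e v = curryForm (modelForm (β.inChart z₀.proj) y) v := fun v =>
    congrArg (fun A : VM n →L[ℝ] VM n →L[ℝ] ℝ => A v) he
  rw [h1, h1, curryForm_apply, curryForm_apply, modelForm_hamiltonianModel]
  have h2 : modelForm (β.inChart z₀.proj) (extChartAt (cotModel n) z₀ z)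
      ![fieldChart X z₀ y, chartDeriv (cotModel n) z₀ z (chartSymmDeriv (cotModel n) z₀ y η)] =
      fderiv ℝ (energyModel (sharpChart g z₀.proj)) (extChartAt (cotModel n) z₀ z)
        (chartDeriv (cotModel n) z₀ z (chartSymmDeriv (cotModel n) z₀ y η)) :=
    ((twistedForm_val β z₀ hzs (X z) _).symm.trans (hX z _)).trans (energyDeriv_eq g z₀ hzs _)
  rw [hzy, hz, chartDeriv_chartSymmDeriv z₀ hy] at h2
  exact h2

theorem exists_isHamiltonianField (g : AnalyticMetric n M) (β : DiffForm (𝓡 n) M 2) :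
    ∃ X, IsHamiltonianField g β X := by
  refine ⟨fun z => chartSymmDeriv (cotModel n) z (extChartAt (cotModel n) z z)
    (hamiltonianModel (β.inChart z.proj) (sharpChart g z.proj) (extChartAt (cotModel n) z z)),
    fun z ξ => ?_⟩
  have hz := mem_extChartAt_source (I := cotModel n) z
  have h1 := twistedForm_val β z hz (chartSymmDeriv (cotModel n) z (extChartAt (cotModel n) z z)
    (hamiltonianModel (β.inChart z.proj) (sharpChart g z.proj) (extChartAt (cotModel n) z z))) ξ
  rw [chartDeriv_self_chartSymmDeriv, modelForm_hamiltonianModel] at h1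
  exact h1.trans (energyDeriv_eq g z hz ξ).symm

theorem contDiffAt_fieldChart {g : AnalyticMetric n M} {β : DiffForm (𝓡 n) M 2} (hβ : β.IsCk ω)
    {X : (z : Cot n M) → TCot z} (hX : IsHamiltonianField g β X) (z₀ : Cot n M) {y : VM n}
    (hy : y ∈ (extChartAt (cotModel n) z₀).target) : ContDiffAt ℝ ω (fieldChart X z₀) y := by
  have hy1 := hy
  rw [cotChart_target] at hy1
  refine (contDiffAt_hamiltonianModel (contDiffAt_inChart_form hβ z₀.proj hy1.1)
    (contDiffAt_sharpChart g z₀.proj hy1.1)).congr_of_eventuallyEq ?_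
  filter_upwards [(isOpen_extChartAt_target z₀).mem_nhds hy] with y' hy'
  exact hX.fieldChart_eq z₀ hy'

theorem IsHamiltonianField.contMDiff {g : AnalyticMetric n M} {β : DiffForm (𝓡 n) M 2}
    (hβ : β.IsCk ω) {X : (z : Cot n M) → TCot z} (hX : IsHamiltonianField g β X) :
    ContMDiff (cotModel n) (cotModel n).tangent ω
      (fun z => (⟨z, X z⟩ : TangentBundle (cotModel n) (Cot n M))) :=
  contMDiff_of_fieldChart fun z => contDiffAt_fieldChart hβ hX z (mem_extChartAt_target z)

theorem IsHamiltonianField.unique {g : AnalyticMetric n M} {β : DiffForm (𝓡 n) M 2}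
    {X X' : (z : Cot n M) → TCot z} (hX : IsHamiltonianField g β X)
    (hX' : IsHamiltonianField g β X') : X = X' := by
  funext z
  have hz := mem_extChartAt_source (I := cotModel n) z
  have ht := mem_extChartAt_target (I := cotModel n) z
  have h1 := (hX.fieldChart_eq z ht).trans (hX'.fieldChart_eq z ht).symm
  rw [fieldChart_chart X z hz, fieldChart_chart X' z hz] at h1
  have h2 := congrArg (chartSymmDeriv (cotModel n) z (extChartAt (cotModel n) z z)) h1
  exact ((chartSymmDeriv_chartDeriv z hz (X z)).symm.trans h2).trans
    (chartSymmDeriv_chartDeriv z hz (X' z))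

/-- Minimize over the compact set `K` times the unit sphere and rescale. The form of the minimum
used here also covers an empty sphere. -/
theorem exists_norm_sq_le_sharpChart (g : AnalyticMetric n M) (x₀ : M)
    {K : Set (EuclideanSpace ℝ (Fin n))} (hK : IsCompact K)
    (hKt : K ⊆ (extChartAt (𝓡 n) x₀).target) :
    ∃ m > 0, ∀ y ∈ K, ∀ p : Covec n, m * ‖p‖ ^ 2 ≤ p (sharpChart g x₀ y p) := by
  have hc : ContinuousOn (fun q : EuclideanSpace ℝ (Fin n) × Covec n =>
      q.2 (sharpChart g x₀ q.1 q.2)) (K ×ˢ Metric.sphere (0 : Covec n) 1) := by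
    intro q hq
    have h1 : ContinuousAt (fun q : EuclideanSpace ℝ (Fin n) × Covec n => sharpChart g x₀ q.1) q :=
      ContinuousAt.comp (g := sharpChart g x₀)
        (contDiffAt_sharpChart g x₀ (hKt hq.1)).continuousAt continuousAt_fst
    exact (continuousAt_snd.clm_apply (h1.clm_apply continuousAt_snd)).continuousWithinAt
  have : FiniteDimensional ℝ (Covec n) := inferInstance
  obtain ⟨m, hm, hle⟩ := (hK.prod (isCompact_sphere (0 : Covec n) 1)).exists_forall_le' hc
    (a := 0) fun q hq => sharpChart_pos g x₀ (hKt hq.1) (by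
      rintro h
      have := hq.2
      rw [h] at this
      simp at this)
  refine ⟨m, hm, fun y hy p => ?_⟩
  by_cases hp : p = 0
  · simp [hp]
  have hp' : ‖p‖ ≠ 0 := norm_ne_zero_iff.2 hp
  have h1 := hle (y, ‖p‖⁻¹ • p) ⟨hy, by simp [norm_smul, hp']⟩
  simp only [map_smul, smul_apply, smul_eq_mul] at h1
  have h2 : 0 < ‖p‖ ^ 2 := by positivity
  calc m * ‖p‖ ^ 2 ≤ (‖p‖⁻¹ * (‖p‖⁻¹ * p (sharpChart g x₀ y p))) * ‖p‖ ^ 2 :=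
        mul_le_mul_of_nonneg_right h1 h2.le
    _ = p (sharpChart g x₀ y p) := by field_simp

/-- Over a small compact piece of `M` the covectors of bounded length lie in the image of a compact
set under an inverse chart; finitely many pieces cover `M`. -/
theorem isCompact_normSq_le [CompactSpace M] [T2Space M] (g : AnalyticMetric n M) (c : ℝ) :
    IsCompact {z : Cot n M | normSq g z ≤ c} := by
  have key : ∃ C : Set (Cot n M), IsCompact C ∧ ∀ z : Cot n M, proj z ∈ (univ : Set M) →
      normSq g z ≤ c → z ∈ C := by
    refine isCompact_univ.induction_on (p := fun S => ∃ C : Set (Cot n M), IsCompact C ∧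
      ∀ z : Cot n M, proj z ∈ S → normSq g z ≤ c → z ∈ C) ⟨∅, isCompact_empty, by simp⟩ ?_ ?_ ?_
    · rintro s t hst ⟨C, hC, h⟩
      exact ⟨C, hC, fun z hz => h z (hst hz)⟩
    · rintro s t ⟨C, hC, h⟩ ⟨C', hC', h'⟩
      refine ⟨C ∪ C', hC.union hC', fun z hz hn => ?_⟩
      rcases hz with hz | hz
      · exact Or.inl (h z hz hn)
      · exact Or.inr (h' z hz hn)
    · intro x _
      obtain ⟨K, hKx, hKs, hK⟩ := local_compact_nhds
        ((isOpen_extChartAt_source (I := 𝓡 n) x).mem_nhds (mem_extChartAt_source x))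
      refine ⟨K, nhdsWithin_le_nhds hKx, ?_⟩
      have hK' : IsCompact (extChartAt (𝓡 n) x '' K) :=
        hK.image_of_continuousOn ((continuousOn_extChartAt x).mono hKs)
      have hKt : extChartAt (𝓡 n) x '' K ⊆ (extChartAt (𝓡 n) x).target := by
        rintro _ ⟨y, hy, rfl⟩
        exact (extChartAt (𝓡 n) x).map_source (hKs hy)
      obtain ⟨m, hm, hle⟩ := exists_norm_sq_le_sharpChart g x hK' hKt
      have : FiniteDimensional ℝ (Covec n) := inferInstance
      let z₀ : Cot n M := zeroSec x
      refine ⟨(extChartAt (cotModel n) z₀).symm ''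
        ((extChartAt (𝓡 n) x '' K) ×ˢ Metric.closedBall (0 : Covec n) (c / m + 1)),
        (hK'.prod (isCompact_closedBall _ _)).image_of_continuousOn
          ((continuousOn_extChartAt_symm z₀).mono ?_), fun z hz hn => ?_⟩
      · rw [cotChart_target]
        exact prod_mono hKt (subset_univ _)
      · have hzs : z ∈ (extChartAt (cotModel n) z₀).source := mem_cotChart_source.2 (hKs hz)
        have hzt := (extChartAt (cotModel n) z₀).map_source hzs
        refine ⟨extChartAt (cotModel n) z₀ z, ⟨?_, ?_⟩, (extChartAt (cotModel n) z₀).left_inv hzs⟩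
        · rw [cotChart_eq_trivialization]
          exact ⟨_, hz, rfl⟩
        · have h1 : (extChartAt (cotModel n) z₀ z).1 ∈ extChartAt (𝓡 n) x '' K := by
            rw [cotChart_eq_trivialization]
            exact ⟨_, hz, rfl⟩
          have h2 := hle _ h1 (extChartAt (cotModel n) z₀ z).2
          have h3 := normSq_cotChart_symm g z₀ hzt
          rw [(extChartAt (cotModel n) z₀).left_inv hzs] at h3
          have h4 : m * ‖(extChartAt (cotModel n) z₀ z).2‖ ^ 2 ≤ c := h2.trans (h3.symm.le.trans hn)
          rw [mem_closedBall_zero_iff]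
          have h5 : ‖(extChartAt (cotModel n) z₀ z).2‖ ^ 2 ≤ c / m := by
            rw [le_div_iff₀ hm]; linarith
          -- The radius `c / m + 1` comes from `s ≤ s ^ 2 + 1`, which avoids square roots.
          nlinarith [sq_nonneg (‖(extChartAt (cotModel n) z₀ z).2‖ - 1)]
  obtain ⟨C, hC, h⟩ := key
  exact hC.of_isClosed_subset (isClosed_le (continuous_normSq g) continuous_const)
    fun z hz => h z (mem_univ _) hz

theorem energyDeriv_hamiltonianField {g : AnalyticMetric n M} {β : DiffForm (𝓡 n) M 2}
    {X : (z : Cot n M) → TCot z} (hX : IsHamiltonianField g β X) (z : Cot n M) :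
    mfderiv (cotModel n) 𝓘(ℝ, ℝ) (energy g) z (X z) = 0 := by
  rw [← hX z (X z)]
  exact form_self ((twistedForm β).val z) (X z)

variable [CompactSpace M] [T2Space M]

/-- The energy is conserved, since `dE(X) = ω^β(X, X) = 0`, and its sublevel sets are compact
because `M` is. -/
theorem isMagneticFlow_magneticFlow (g : AnalyticMetric n M) {β : DiffForm (𝓡 n) M 2}
    (hβ : β.IsCk ω) : IsMagneticFlow g β (magneticFlow g β) := by
  have h : ∃ Φ, IsMagneticFlow g β Φ := by
    obtain ⟨X, hX⟩ := exists_isHamiltonianField g β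
    have h1 : ∀ z, ∃ γ : ℝ → Cot n M, γ 0 = z ∧ IsMIntegralCurve (I := cotModel n) γ X := by
      refine exists_isMIntegralCurve_of_conserved
        (fun z => contDiffAt_fieldChart hβ hX z (mem_extChartAt_target z)) (contMDiff_energy g)
        (energyDeriv_hamiltonianField hX) fun c => ?_
      have h2 : {z : Cot n M | energy g z ≤ c} = {z | normSq g z ≤ 2 * c} := by
        ext z
        rw [mem_ofPred_eq, mem_ofPred_eq, normSq_eq_energy]
        constructor <;> intro h <;> linarith
      rw [h2]
      exact isCompact_normSq_le g _
    choose γ h0 hγ using h1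
    exact ⟨fun t z => γ z t, X, hX, fun z => ⟨h0 z, hγ z⟩⟩
  have h1 : magneticFlow g β = h.choose := by
    rw [magneticFlow, dif_pos h]
  rw [h1]
  exact h.choose_spec

end GlobalFlow

/-! ### From the global flow to the power series flow in a chart -/

section FlowTransfer

theorem mem_map_baseChange_of_inverse {V W : Type*} [AddCommGroup V] [Module ℝ V] [AddCommGroup W]
    [Module ℝ W] {B : V →ₗ[ℝ] W} {A : W →ₗ[ℝ] V} (hBA : ∀ v, B (A v) = v) (hAB : ∀ v, A (B v) = v)
    (p : Submodule ℝ V) (Z : ℂ ⊗[ℝ] W) :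
    Z ∈ (p.baseChange ℂ).map (B.baseChange ℂ) ↔ A (reC Z) ∈ p ∧ A (imC Z) ∈ p := by
  have h := mem_map_baseChange_iff (LinearEquiv.ofLinearMap B A (LinearMap.ext hBA)
    (LinearMap.ext hAB)) (p.baseChange ℂ) Z
  refine Iff.trans h ?_
  rw [mem_baseChange_iff, reC_baseChange, imC_baseChange]
  rfl

variable {n : ℕ} {M : Type*} [TopologicalSpace M] [ChartedSpace (EuclideanSpace ℝ (Fin n)) M]
  [IsManifold (𝓡 n) ω M] [CompactSpace M] [T2Space M]
  {g : AnalyticMetric n M} {β : DiffForm (𝓡 n) M 2}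

theorem magneticFlow_isMIntegralCurve (hβ : β.IsCk ω) {X : (z : Cot n M) → TCot z}
    (hX : IsHamiltonianField g β X) (z : Cot n M) :
    IsMIntegralCurve (I := cotModel n) (fun σ => magneticFlow g β σ z) X := by
  obtain ⟨X', hX', h⟩ := isMagneticFlow_magneticFlow g hβ
  rw [hX.unique hX']
  exact (h z).2

theorem magneticFlow_zero (hβ : β.IsCk ω) (z : Cot n M) : magneticFlow g β 0 z = z := by
  obtain ⟨X', hX', h⟩ := isMagneticFlow_magneticFlow g hβ
  exact (h z).1

theorem magneticFlow_eq_of_isMIntegralCurveOn (hβ : β.IsCk ω) {X : (z : Cot n M) → TCot z}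
    (hX : IsHamiltonianField g β X) {γ : ℝ → Cot n M} {a : ℝ} (ha : 0 < a)
    (hγ : IsMIntegralCurveOn (I := cotModel n) γ X (Ioo (-a) a)) {t : ℝ} (ht : |t| < a) :
    magneticFlow g β t (γ 0) = γ t := by
  have : IsManifold (cotModel n) 1 (Cot n M) := IsManifold.of_le (n := ω) le_top
  exact isMIntegralCurveOn_Ioo_eqOn_of_contMDiff_boundaryless (t₀ := 0) ⟨by linarith, ha⟩
    ((hX.contMDiff hβ).of_le le_top)
    ((magneticFlow_isMIntegralCurve hβ hX (γ 0)).isMIntegralCurveOn _) hγ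
    (magneticFlow_zero hβ _) (abs_lt.1 ht)

theorem magneticFlow_eq_of_isMIntegralCurve (hβ : β.IsCk ω) {X : (z : Cot n M) → TCot z}
    (hX : IsHamiltonianField g β X) {γ : ℝ → Cot n M}
    (hγ : IsMIntegralCurve (I := cotModel n) γ X) (t : ℝ) :
    magneticFlow g β t (γ 0) = γ t :=
  magneticFlow_eq_of_isMIntegralCurveOn hβ hX (a := |t| + 1) (by positivity)
    (hγ.isMIntegralCurveOn _) (by linarith)

theorem magneticFlow_add (hβ : β.IsCk ω) (s t : ℝ) (z : Cot n M) :
    magneticFlow g β s (magneticFlow g β t z) = magneticFlow g β (s + t) z := by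
  obtain ⟨X, hX⟩ := exists_isHamiltonianField g β
  have h := magneticFlow_eq_of_isMIntegralCurve hβ hX
    ((magneticFlow_isMIntegralCurve hβ hX z).comp_add t) s
  simpa using h

theorem magneticFlow_neg_cancel (hβ : β.IsCk ω) (s : ℝ) (z : Cot n M) :
    magneticFlow g β s (magneticFlow g β (-s) z) = z := by
  rw [magneticFlow_add hβ, add_neg_cancel, magneticFlow_zero hβ]

theorem magneticFlow_cancel_neg (hβ : β.IsCk ω) (s : ℝ) (z : Cot n M) :
    magneticFlow g β (-s) (magneticFlow g β s z) = z := by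
  rw [magneticFlow_add hβ, neg_add_cancel, magneticFlow_zero hβ]

/-- The differential of `Φ_σ` at `z`, as an endomorphism of the model space. -/
def flowD (g : AnalyticMetric n M) (β : DiffForm (𝓡 n) M 2) (σ : ℝ) (z : Cot n M) :
    VM n →L[ℝ] VM n :=
  (mfderiv (cotModel n) (cotModel n) (magneticFlow g β σ) z :)

theorem flowD_comp (hβ : β.IsCk ω) {s t : ℝ} (hst : s + t = 0) {z : Cot n M}
    (h1 : MDifferentiableAt (cotModel n) (cotModel n) (magneticFlow g β t) z)
    (h2 : MDifferentiableAt (cotModel n) (cotModel n) (magneticFlow g β s) (magneticFlow g β t z))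
    (v : VM n) : flowD g β s (magneticFlow g β t z) (flowD g β t z v) = v := by
  have h3 := h2.hasMFDerivAt.comp z h1.hasMFDerivAt
  have h4 : magneticFlow g β s ∘ magneticFlow g β t = id := by
    ext1 z
    rw [Function.comp_apply, magneticFlow_add hβ, hst, magneticFlow_zero hβ, id]
  rw [h4] at h3
  exact congrArg (fun A : VM n →L[ℝ] VM n => A v)
    (hasMFDerivAt_unique h3 (hasMFDerivAt_id (I := cotModel n) z))

/-- The family `P_z(σ)`, as a subspace of the complexified model space. -/
def PVal (g : AnalyticMetric n M) (β : DiffForm (𝓡 n) M 2) (z : Cot n M) (σ : ℝ) :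
    Submodule ℂ (ℂ ⊗[ℝ] (VM n)) := P g β z σ

/-- Pushing `ker π_*` forward by `Φ_σ` is the same as taking the kernel of `π_*` after the inverse
`Φ_{-σ}`. In the latter form the space can be continued to complex time. Differentiability of both
maps is what makes their derivatives mutually inverse. -/
theorem mem_PVal_iff (hβ : β.IsCk ω) {σ : ℝ} {z : Cot n M}
    (h1 : MDifferentiableAt (cotModel n) (cotModel n) (magneticFlow g β (-σ)) z)
    (h2 : MDifferentiableAt (cotModel n) (cotModel n) (magneticFlow g β σ)
      (magneticFlow g β (-σ) z)) (Z : ℂ ⊗[ℝ] (VM n)) : Z ∈ PVal g β z σ ↔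
    projDeriv (magneticFlow g β (-σ) z) (flowD g β (-σ) z (reC Z)) = 0 ∧
      projDeriv (magneticFlow g β (-σ) z) (flowD g β (-σ) z (imC Z)) = 0 := by
  have h3 := magneticFlow_neg_cancel (g := g) hβ σ z
  have h4 : ∀ v, flowD g β σ (magneticFlow g β (-σ) z) (flowD g β (-σ) z v) = v :=
    flowD_comp hβ (add_neg_cancel σ) h1 h2
  have h5 : ∀ v, flowD g β (-σ) z (flowD g β σ (magneticFlow g β (-σ) z) v) = v := by
    have h6 := flowD_comp (g := g) hβ (neg_add_cancel σ) h2 (by rw [h3]; exact h1)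
    rwa [h3] at h6
  exact mem_map_baseChange_of_inverse (B := (flowD g β σ (magneticFlow g β (-σ) z)).toLinearMap)
    (A := (flowD g β (-σ) z).toLinearMap) h4 h5
    (LinearMap.ker (projDeriv (magneticFlow g β (-σ) z)).toLinearMap) Z

/-- The rescaled Hamiltonian field in the chart around a point of the zero-section. -/
def chartField (g : AnalyticMetric n M) (β : DiffForm (𝓡 n) M 2) (T : ℝ) (x : M) :
    VM n → VM n := fun y => -T • hamiltonianModel (β.inChart x) (sharpChart g x) y

theorem cotChart_zeroSec (x : M) : extChartAt (cotModel n) (zeroSec (n := n) x) (zeroSec x) =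
    (extChartAt (𝓡 n) x x, 0) := by
  rw [cotChart_apply (mem_extChartAt_source _)]
  refine Prod.ext rfl ?_
  exact ContinuousLinearMap.zero_comp _

theorem isLocalSystem_chartField (hβ : β.IsCk ω) (hd : β.d = 0) {T : ℝ} (hT : 0 < T) (x : M) :
    IsLocalSystem (chartField g β T x) (modelForm (β.inChart x))
      (extChartAt (cotModel n) (zeroSec (n := n) x) (zeroSec x)) T
      (sharpChart g x (extChartAt (𝓡 n) x x)) (β.inChart x (extChartAt (𝓡 n) x x)) := by
  rw [cotChart_zeroSec]
  exact isLocalSystem_hamiltonianModel (isOpen_extChartAt_target x)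
    (fun y hy => contDiffAt_inChart_form hβ x hy) (fun y hy => extDeriv_inChart_form hβ hd x hy)
    (fun y hy => contDiffAt_sharpChart g x hy) (mem_extChartAt_target x)
    (fun p q => sharpChart_symm g x (mem_extChartAt_target x) p q)
    (fun p hp => sharpChart_pos g x (mem_extChartAt_target x) hp) hT

variable {T : ℝ} {x : M} {u : VM n → L1 (VM n)}

/-- After undoing the rescaling, the series is an integral curve of the Hamiltonian field on `(-T,
T)`; integral curves are unique. -/
theorem IsLocalFlow.eventually_magneticFlow (hβ : β.IsCk ω) (hT : 0 < T)
    (hu : IsLocalFlow u (chartField g β T x)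
      (extChartAt (cotModel n) (zeroSec (n := n) x) (zeroSec x))) :
    ∀ᶠ y in 𝓝 (extChartAt (cotModel n) (zeroSec (n := n) x) (zeroSec x)), ∀ t : ℝ, |t| < 1 →
      magneticFlow g β (-(T * t)) ((extChartAt (cotModel n) (zeroSec (n := n) x)).symm y) =
        (extChartAt (cotModel n) (zeroSec (n := n) x)).symm (L1.eval t (u y)) := by
  obtain ⟨X, hX⟩ := exists_isHamiltonianField g β
  filter_upwards [hu.flow, hu.eventually_eval
    ((isOpen_extChartAt_target (I := cotModel n) (zeroSec (n := n) x)).mem_nhds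
      (mem_extChartAt_target _))] with y hy hyt t ht
  -- Time `s` of the Hamiltonian flow is series time `-s / T`, because the series solves the
  -- equation of `-T X`.
  set c : ℝ → VM n := fun s => L1.eval (-(s / T)) (u y) with hc
  have hlt : ∀ s : ℝ, |s| < T → |-(s / T)| < 1 := fun s hs => by
    rw [abs_neg, abs_div, abs_of_pos hT, div_lt_one hT]; exact hs
  have h1 : ∀ s, |s| < T → HasDerivAt c (fieldChart X (zeroSec (n := n) x) (c s)) s := by
    intro s hs
    have h2 : HasDerivAt (fun s : ℝ => -(s / T)) (-(1 / T)) s :=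
      ((hasDerivAt_id s).div_const T).neg
    have h3 := (hy.2 _ (hlt s hs)).scomp s h2
    refine h3.congr_deriv ?_
    rw [hX.fieldChart_eq (zeroSec (n := n) x) (hyt _ (hlt s hs).le)]
    change (-(1 / T)) • (-T) • hamiltonianModel (β.inChart x) (sharpChart g x) (c s) = _
    rw [smul_smul]
    have : -(1 / T) * -T = 1 := by field_simp
    rw [this, one_smul]
    rfl
  have h2 : IsMIntegralCurveOn (I := cotModel n)
      (fun s => (extChartAt (cotModel n) (zeroSec (n := n) x)).symm (c s)) X (Ioo (-T) T) :=
    fun s hs => (hasMFDerivAt_of_hasDerivAt_chart (h1 s (abs_lt.2 hs))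
      (hyt _ (hlt s (abs_lt.2 hs)).le)).hasMFDerivWithinAt
  have h3 := magneticFlow_eq_of_isMIntegralCurveOn hβ hX hT h2 (t := -(T * t)) (by
    rw [abs_neg, abs_mul, abs_of_pos hT]
    nlinarith)
  have h4 : c 0 = y := by
    have h5 := L1.eval_zero (u y)
    simp only [hc, zero_div, neg_zero]
    rw [h5]
    exact hy.1
  have h6 : c (-(T * t)) = L1.eval t (u y) := by
    simp only [hc]
    congr 2
    field_simp
  simp only [h4, h6] at h3
  exact h3

/-- The complexified differential of the horizontal position of `Φ_{-T w}`. -/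
def dChart (u : VM n → L1 (VM n)) (z₀ : Cot n M) (w : ℂ) (z : Cot n M) : VM n →L[ℝ] EC n :=
  (dMap u w (extChartAt (cotModel n) z₀ z)).comp (chartDeriv (cotModel n) z₀ z)

theorem hasMFDerivAt_of_chart {N : Type*} [TopologicalSpace N] {H E : Type*} [NormedAddCommGroup E]
    [NormedSpace ℝ E] [TopologicalSpace H] {I : ModelWithCorners ℝ E H} [I.Boundaryless]
    [ChartedSpace H N] [IsManifold I ω N]
    {f : N → N} {F : E → E} {F' : E →L[ℝ] E} {z₀ z : N} (hz : z ∈ (extChartAt I z₀).source)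
    (hF : HasFDerivAt F F' (extChartAt I z₀ z))
    (ht : F (extChartAt I z₀ z) ∈ (extChartAt I z₀).target)
    (hf : ∀ᶠ y in 𝓝 (extChartAt I z₀ z), f ((extChartAt I z₀).symm y) =
      (extChartAt I z₀).symm (F y)) :
    HasMFDerivAt I I f z ((chartSymmDeriv I z₀ (F (extChartAt I z₀ z))).comp
      (F'.comp (chartDeriv I z₀ z)) : E →L[ℝ] E) := by
  have h1 := (hF.hasMFDerivAt.comp z (mdifferentiableAt_chart (I := I) z₀ hz).hasMFDerivAt)
  have h2 := (mdifferentiableAt_chartSymm (I := I) z₀ ht).hasMFDerivAt.comp z h1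
  refine h2.congr_of_eventuallyEq ?_
  filter_upwards [(continuousAt_extChartAt' hz).eventually hf,
    (isOpen_extChartAt_source z₀).mem_nhds hz] with z' hz' hs
  rw [(extChartAt I z₀).left_inv hs] at hz'
  exact hz'

/-- In the chart, `π ∘ Φ_{-σ}` is the horizontal part of the series at time `σ / T`, up to an
invertible derivative of a base chart, which does not affect the kernel. -/
theorem IsLocalFlow.eventually_PVal (hβ : β.IsCk ω) (hT : 0 < T)
    (hu : IsLocalFlow u (chartField g β T x)
      (extChartAt (cotModel n) (zeroSec (n := n) x) (zeroSec x))) :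
    ∀ᶠ z in 𝓝 (zeroSec (n := n) x), ∀ σ : ℝ, |σ| < T →
      PVal g β z σ = kerC (dChart u (zeroSec (n := n) x) (σ / T : ℝ) z).toLinearMap := by
  set z₀ : Cot n M := zeroSec x with hz₀
  have hG0 : ∀ᶠ y in 𝓝 (extChartAt (cotModel n) z₀ z₀), y ∈ (extChartAt (cotModel n) z₀).target :=
    (isOpen_extChartAt_target (I := cotModel n) z₀).mem_nhds (mem_extChartAt_target z₀)
  have hG := (hG0.and (hu.analytic.eventually_analyticAt.and
      (hu.eventually_magneticFlow hβ hT))).and (hu.eventually_eval hG0)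
  -- The local description of the flow is needed near `z` and again near `Φ_{-σ}(z)`, where `Φ_σ`
  -- must be differentiable; hence the neighbourhoods are also required along whole trajectories.
  have hG2 := hG.eventually_nhds
  have hG3 := hG2.and (hu.eventually_eval hG2)
  filter_upwards [(continuousAt_extChartAt (I := cotModel n) z₀).eventually hG3,
    (isOpen_extChartAt_source (I := cotModel n) z₀).mem_nhds (mem_extChartAt_source z₀)]
    with z hz hzs σ hσ
  have key : ∀ z : Cot n M, z ∈ (extChartAt (cotModel n) z₀).source →
      (∀ᶠ y in 𝓝 (extChartAt (cotModel n) z₀ z), ((y ∈ (extChartAt (cotModel n) z₀).target) ∧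
        AnalyticAt ℝ u y ∧ ∀ t : ℝ, |t| < 1 →
        magneticFlow g β (-(T * t)) ((extChartAt (cotModel n) z₀).symm y) =
        (extChartAt (cotModel n) z₀).symm (L1.eval t (u y))) ∧
        ∀ t : ℝ, |t| ≤ 1 → L1.eval t (u y) ∈ (extChartAt (cotModel n) z₀).target) →
      ∀ t : ℝ, |t| < 1 → HasMFDerivAt (cotModel n) (cotModel n) (magneticFlow g β (-(T * t))) z
        ((chartSymmDeriv (cotModel n) z₀ (L1.eval t (u (extChartAt (cotModel n) z₀ z)))).comp
          (((L1.eval t).comp (fderiv ℝ u (extChartAt (cotModel n) z₀ z))).comp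
            (chartDeriv (cotModel n) z₀ z)) : VM n →L[ℝ] VM n) := by
    intro z hzs h t ht
    exact hasMFDerivAt_of_chart (I := cotModel n) (F := fun y => L1.eval t (u y)) hzs
      ((L1.eval t).hasFDerivAt.comp _ h.self_of_nhds.1.2.1.differentiableAt.hasFDerivAt)
      (h.self_of_nhds.2 t ht.le) (h.mono fun y hy => hy.1.2.2 t ht)
  set t : ℝ := σ / T with ht
  have hTt : T * t = σ := by rw [ht]; field_simp
  have ht1 : |t| < 1 := by rw [ht, abs_div, abs_of_pos hT, div_lt_one hT]; exact hσ
  set y := extChartAt (cotModel n) z₀ z with hy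
  have h1 := key z hzs hz.1 t ht1
  rw [hTt] at h1
  have hmem := hz.1.self_of_nhds.2 t ht1.le
  have hz' : magneticFlow g β (-σ) z = (extChartAt (cotModel n) z₀).symm (L1.eval t (u y)) := by
    have h2 := hz.1.self_of_nhds.1.2.2 t ht1
    rwa [hTt, (extChartAt (cotModel n) z₀).left_inv hzs] at h2
  have hy' : extChartAt (cotModel n) z₀ (magneticFlow g β (-σ) z) = L1.eval t (u y) := by
    rw [hz', (extChartAt (cotModel n) z₀).right_inv hmem]
  -- The return flow `Φ_σ` is the same series flow at series time `-t`, started at the image point.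
  have h2 := key (magneticFlow g β (-σ) z) (by
    rw [hz']; exact (extChartAt (cotModel n) z₀).map_target hmem)
    (by rw [hy']; exact hz.2 t ht1.le) (-t) (by rwa [abs_neg])
  have hTt' : -(T * -t) = σ := by rw [mul_neg, neg_neg, hTt]
  rw [hTt'] at h2
  have hfd : ∀ v : VM n, projDeriv (magneticFlow g β (-σ) z) (flowD g β (-σ) z v) = 0 ↔
      dChart u z₀ (t : ℝ) z v = 0 := by
    intro v
    have h3 : flowD g β (-σ) z v = chartSymmDeriv (cotModel n) z₀ (L1.eval t (u y))
        (L1.eval t (fderiv ℝ u y (chartDeriv (cotModel n) z₀ z v))) :=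
      congrArg (fun A : VM n →L[ℝ] VM n => A v) h1.mfderiv
    rw [h3, hz', projDeriv_chartSymmDeriv z₀ hmem]
    have hm1 := hmem
    rw [cotChart_target] at hm1
    have h4 : dChart u z₀ (t : ℝ) z v =
        ofRealE (L1.eval t (fderiv ℝ u y (chartDeriv (cotModel n) z₀ z v))).1 :=
      dMap_ofReal u ht1.le y _
    rw [h4]
    constructor
    · intro h5
      have h6 := chartDeriv_chartSymmDeriv (I := 𝓡 n) z₀.proj hm1.1
        (L1.eval t (fderiv ℝ u y (chartDeriv (cotModel n) z₀ z v))).1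
      rw [h5, map_zero] at h6
      rw [← h6, map_zero]
    · intro h5
      have h6 := congrArg reE h5
      rw [reE_ofRealE, map_zero] at h6
      rw [h6, map_zero]
  ext Z
  rw [mem_PVal_iff hβ h1.mdifferentiableAt h2.mdifferentiableAt, hfd, hfd]
  have h7 : ∀ v, imE (dChart u z₀ (t : ℝ) z v) = 0 := by
    intro v
    have h4 : dChart u z₀ (t : ℝ) z v =
        ofRealE (L1.eval t (fderiv ℝ u y (chartDeriv (cotModel n) z₀ z v))).1 :=
      dMap_ofReal u ht1.le y _
    rw [h4, imE_ofRealE]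
  rw [mem_kerC]
  constructor
  · rintro ⟨h8, h9⟩
    change dChart u z₀ (t : ℝ) z (reC Z) + Complex.I • dChart u z₀ (t : ℝ) z (imC Z) = 0
    rw [h8, h9, smul_zero, add_zero]
  · intro h8
    change dChart u z₀ (t : ℝ) z (reC Z) + Complex.I • dChart u z₀ (t : ℝ) z (imC Z) = 0 at h8
    have h9 := congrArg reE h8
    have h10 := congrArg imE h8
    simp only [map_add, reE_I_smul, imE_I_smul, h7, map_zero, neg_zero, add_zero, zero_add]
      at h9 h10
    exact ⟨extE (by rw [h9, map_zero]) (by rw [h7, map_zero]),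
      extE (by rw [h10, map_zero]) (by rw [h7, map_zero])⟩

end FlowTransfer

/-! ### Holomorphic maps into Grassmannians -/

section Grassmann

variable {W : Type*} [AddCommGroup W] [Module ℂ W] {n : ℕ}

/-- Dual functionals extended from the span give the identity matrix. Independence thus becomes the
nonvanishing of a scalar determinant, to which the one-variable identity theorem applies. -/
theorem exists_det_ne_zero_of_linearIndependent {m : ℕ} {v : Fin m → W}
    (hv : LinearIndependent ℂ v) :
    ∃ φ : Fin m → Module.Dual ℂ W, (Matrix.of fun i j => φ j (v i)).det ≠ 0 := by
  obtain ⟨f, hf⟩ := LinearMap.exists_extend (hv.repr : Submodule.span ℂ (range v) →ₗ[ℂ] Fin m →₀ ℂ)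
  refine ⟨fun j => (Finsupp.lapply j).comp f, ?_⟩
  have h1 : (Matrix.of fun i j => ((Finsupp.lapply j).comp f) (v i)) =
      (1 : Matrix (Fin m) (Fin m) ℂ) := by
    ext i j
    have h2 : f (v i) = Finsupp.single i 1 := by
      have h3 := LinearMap.congr_fun hf ⟨v i, Submodule.subset_span (mem_range_self i)⟩
      rw [LinearMap.comp_apply, Submodule.subtype_apply] at h3
      rw [h3]
      exact hv.repr_eq_single i _ rfl
    change f (v i) j = _
    rw [h2, Finsupp.single_apply, Matrix.one_apply]
  rw [h1, Matrix.det_one]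
  exact one_ne_zero

theorem linearIndependent_of_det_ne_zero {m : ℕ} {v : Fin m → W} {φ : Fin m → Module.Dual ℂ W}
    (h : (Matrix.of fun i j => φ j (v i)).det ≠ 0) : LinearIndependent ℂ v := by
  have h1 : LinearIndependent ℂ (Matrix.of fun i j => φ j (v i)).row :=
    Matrix.linearIndependent_rows_iff_isUnit.2 ((Matrix.isUnit_iff_isUnit_det _).2 h.isUnit)
  exact LinearIndependent.of_comp (LinearMap.pi φ) h1

theorem differentiableOn_det {m : ℕ} {A : ℂ → Matrix (Fin m) (Fin m) ℂ} {U : Set ℂ}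
    (hA : ∀ i j, DifferentiableOn ℂ (fun w => A w i j) U) :
    DifferentiableOn ℂ (fun w => (A w).det) U := by
  simp only [Matrix.det_apply']
  refine DifferentiableOn.fun_sum fun σ _ => ?_
  exact (differentiableOn_const _).mul (DifferentiableOn.fun_finsetProd fun i _ => hA _ _)

/-- If a vector of `v` left the span of `v'` at some `w`, the two together would be independent
there and some determinant of functionals nonzero. That determinant is holomorphic in `w` and
vanishes frequently near `w₁`, hence identically. -/
theorem span_frame_le {U : Set ℂ} (hU : IsOpen U) (hc : IsPreconnected U) {v v' : Fin n → ℂ → W}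
    (hv : ∀ j, ∀ φ : Module.Dual ℂ W, DifferentiableOn ℂ (fun w => φ (v j w)) U)
    (hv' : ∀ j, ∀ φ : Module.Dual ℂ W, DifferentiableOn ℂ (fun w => φ (v' j w)) U)
    (hi : ∀ w ∈ U, LinearIndependent ℂ (fun j => v' j w)) {w₁ : ℂ} (hw₁ : w₁ ∈ U)
    (hf : ∃ᶠ w in 𝓝[≠] w₁, Submodule.span ℂ (range fun j => v j w) ≤
      Submodule.span ℂ (range fun j => v' j w)) {w : ℂ} (hw : w ∈ U) :
    Submodule.span ℂ (range fun j => v j w) ≤ Submodule.span ℂ (range fun j => v' j w) := by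
  rw [Submodule.span_le]
  rintro _ ⟨j, rfl⟩
  by_contra hn
  have h1 : LinearIndependent ℂ (Fin.cons (v j w) (fun j => v' j w) : Fin (n + 1) → W) :=
    linearIndependent_finCons.2 ⟨hi w hw, hn⟩
  obtain ⟨φ, hφ⟩ := exists_det_ne_zero_of_linearIndependent h1
  have h2 : DifferentiableOn ℂ (fun w => (Matrix.of fun i k =>
      φ k ((Fin.cons (v j w) (fun j => v' j w) : Fin (n + 1) → W) i)).det) U := by
    refine differentiableOn_det fun i k => ?_
    refine Fin.cases ?_ (fun i => ?_) i
    · exact hv j (φ k)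
    · exact hv' i (φ k)
  refine hφ ((h2.analyticOnNhd hU).eqOn_zero_of_preconnected_of_frequently_eq_zero hc hw₁
    ((hf.and_eventually (nhdsWithin_le_nhds (hU.mem_nhds hw₁))).mono ?_) hw)
  rintro w' ⟨hle, hw'⟩
  by_contra hne
  have h3 := linearIndependent_of_det_ne_zero hne
  exact (linearIndependent_finCons.1 h3).2 (hle (Submodule.subset_span (mem_range_self j)))

/-- Identity theorem for holomorphic maps into a Grassmannian. -/
theorem IsHolomorphicGrassmann.eqOn {S S' : ℂ → Submodule ℂ W} {D : Set ℂ}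
    (hD : IsPreconnected D) (hS : IsHolomorphicGrassmann n S D)
    (hS' : IsHolomorphicGrassmann n S' D) {w₁ : ℂ} (hw₁ : w₁ ∈ D)
    (hf : ∃ᶠ w in 𝓝[≠] w₁, S w = S' w) {w : ℂ} (hw : w ∈ D) : S w = S' w := by
  have key : ∀ w₀ ∈ D, ∃ U, IsOpen U ∧ w₀ ∈ U ∧ ∀ w₂ ∈ U, (∃ᶠ w in 𝓝[≠] w₂, S w = S' w) →
      ∀ w ∈ U, S w = S' w := by
    intro w₀ hw₀
    obtain ⟨U, hU, v, hv, hvs⟩ := hS w₀ hw₀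
    obtain ⟨U', hU', v', hv', hvs'⟩ := hS' w₀ hw₀
    obtain ⟨r, hr, hball⟩ := Metric.mem_nhds_iff.1 (Filter.inter_mem hU hU')
    have hB : Metric.ball w₀ r ⊆ U := fun w hw => (hball hw).1
    have hB' : Metric.ball w₀ r ⊆ U' := fun w hw => (hball hw).2
    have hpre : IsPreconnected (Metric.ball w₀ r) := (convex_ball w₀ r).isPreconnected
    refine ⟨Metric.ball w₀ r, Metric.isOpen_ball, Metric.mem_ball_self hr,
      fun w₂ hw₂ hfr w hw => ?_⟩
    have hfr' := hfr.and_eventually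
      (nhdsWithin_le_nhds (Metric.isOpen_ball.mem_nhds hw₂) : ∀ᶠ w in 𝓝[≠] w₂, w ∈ Metric.ball w₀ r)
    refine le_antisymm ?_ ?_
    · rw [← (hvs w (hB hw)).2, ← (hvs' w (hB' hw)).2]
      refine span_frame_le Metric.isOpen_ball hpre (fun j φ => (hv j φ).mono hB)
        (fun j φ => (hv' j φ).mono hB') (fun w hw => (hvs' w (hB' hw)).1) hw₂ (hfr'.mono ?_) hw
      rintro w' ⟨he, hm⟩
      rw [(hvs w' (hB hm)).2, (hvs' w' (hB' hm)).2, he]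
    · rw [← (hvs w (hB hw)).2, ← (hvs' w (hB' hw)).2]
      refine span_frame_le Metric.isOpen_ball hpre (fun j φ => (hv' j φ).mono hB')
        (fun j φ => (hv j φ).mono hB) (fun w hw => (hvs w (hB hw)).1) hw₂ (hfr'.mono ?_) hw
      rintro w' ⟨he, hm⟩
      rw [(hvs w' (hB hm)).2, (hvs' w' (hB' hm)).2, he]
  -- Connectedness argument: the open set of local agreement meets `D` and contains its limit points
  -- in `D`, because on a ball carrying both frames agreement propagates from any accumulation.
  have h1 : D ⊆ interior {w | S w = S' w} := by
    refine hD.subset_of_closure_inter_subset isOpen_interior ?_ ?_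
    · obtain ⟨U, hU, hm, h⟩ := key w₁ hw₁
      exact ⟨w₁, hw₁, interior_maximal (fun w hw => h w₁ hm hf w hw) hU hm⟩
    · rintro w₀ ⟨hcl, hw₀⟩
      obtain ⟨U, hU, hm, h⟩ := key w₀ hw₀
      obtain ⟨w₂, hw₂U, hw₂⟩ := mem_closure_iff.1 hcl U hU hm
      refine interior_maximal (fun w hw => h w₂ hw₂U ?_ w hw) hU hm
      have h2 : ∀ᶠ w in 𝓝[≠] w₂, S w = S' w :=
        nhdsWithin_le_nhds (mem_interior_iff_mem_nhds.1 hw₂)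
      exact h2.frequently
  have h2 : w ∈ {w | S w = S' w} := interior_subset (h1 hw)
  exact h2

theorem IsHolomorphicGrassmann.mono {S : ℂ → Submodule ℂ W} {D D' : Set ℂ} (h : D ⊆ D')
    (hS : IsHolomorphicGrassmann n S D') : IsHolomorphicGrassmann n S D :=
  fun w hw => hS w (h hw)

/-- Two continuations that agree on the real axis agree. -/
theorem IsHolomorphicGrassmann.eq_of_real {S S' : ℂ → Submodule ℂ W} {ρ ρ' : ℝ}
    (hS : IsHolomorphicGrassmann n S (Metric.ball 0 ρ))
    (hS' : IsHolomorphicGrassmann n S' (Metric.ball 0 ρ'))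
    (h : ∀ σ : ℝ, |σ| < ρ → |σ| < ρ' → S σ = S' σ) {w : ℂ} (hw : w ∈ Metric.ball (0 : ℂ) ρ)
    (hw' : w ∈ Metric.ball (0 : ℂ) ρ') : S w = S' w := by
  have hρ : 0 < ρ := dist_nonneg.trans_lt hw
  have hρ' : 0 < ρ' := dist_nonneg.trans_lt hw'
  have hmin : 0 < min ρ ρ' := lt_min hρ hρ'
  refine IsHolomorphicGrassmann.eqOn (D := Metric.ball 0 (min ρ ρ'))
    (convex_ball _ _).isPreconnected (hS.mono (Metric.ball_subset_ball (min_le_left _ _)))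
    (hS'.mono (Metric.ball_subset_ball (min_le_right _ _))) (Metric.mem_ball_self hmin) ?_
    (Metric.mem_ball.2 (lt_min hw hw'))
  have h1 : Filter.Tendsto (fun σ : ℝ => (σ : ℂ)) (𝓝[≠] 0) (𝓝[≠] 0) := by
    refine tendsto_nhdsWithin_iff.2 ⟨?_, ?_⟩
    · have : Filter.Tendsto (fun σ : ℝ => (σ : ℂ)) (𝓝 0) (𝓝 ((0 : ℝ) : ℂ)) :=
        Complex.continuous_ofReal.tendsto 0
      rw [Complex.ofReal_zero] at this
      exact this.mono_left nhdsWithin_le_nhds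
    · filter_upwards [self_mem_nhdsWithin] with σ hσ
      simpa using hσ
  refine h1.frequently (Filter.Eventually.frequently ?_)
  refine nhdsWithin_le_nhds ?_
  filter_upwards [Metric.ball_mem_nhds (0 : ℝ) hmin] with σ hσ
  rw [Metric.mem_ball, dist_zero_right, Real.norm_eq_abs] at hσ
  exact h σ (hσ.trans_le (min_le_left _ _)) (hσ.trans_le (min_le_right _ _))

theorem IsHolomorphicGrassmann.map {W' : Type*} [AddCommGroup W'] [Module ℂ W']
    {S : ℂ → Submodule ℂ W} {D : Set ℂ} (hS : IsHolomorphicGrassmann n S D) (e : W ≃ₗ[ℂ] W') :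
    IsHolomorphicGrassmann n (fun w => (S w).map e.toLinearMap) D := by
  intro w₀ hw₀
  obtain ⟨U, hU, v, hv, hvs⟩ := hS w₀ hw₀
  refine ⟨U, hU, fun j w => e (v j w), fun j φ => hv j (φ.comp e.toLinearMap), fun w hw =>
    ⟨(hvs w hw).1.map' e.toLinearMap e.ker, ?_⟩⟩
  change _ = (S w).map e.toLinearMap
  rw [← (hvs w hw).2, Submodule.map_span, ← range_comp]
  rfl

theorem IsHolomorphicGrassmann.comp {S : ℂ → Submodule ℂ W} {D D' : Set ℂ} {f : ℂ → ℂ}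
    (hS : IsHolomorphicGrassmann n S D) (hf : Differentiable ℂ f) (hm : MapsTo f D' D) :
    IsHolomorphicGrassmann n (fun w => S (f w)) D' := by
  intro w₀ hw₀
  obtain ⟨U, hU, v, hv, hvs⟩ := hS (f w₀) (hm hw₀)
  refine ⟨f ⁻¹' U, hf.continuous.continuousAt hU, fun j w => v j (f w), fun j φ => ?_,
    fun w hw => hvs (f w) hw⟩
  exact (hv j φ).comp hf.differentiableOn (mapsTo_preimage f U)

variable {V : Type*} [AddCommGroup V] [Module ℝ V]

/-- Conjugating both the time and the frame vectors preserves holomorphy. -/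
theorem IsHolomorphicGrassmann.conj {S : ℂ → Submodule ℂ (ℂ ⊗[ℝ] V)} {ρ : ℝ}
    (hS : IsHolomorphicGrassmann n S (Metric.ball 0 ρ)) :
    IsHolomorphicGrassmann n (fun w => conjSubmodule (S (starRingEnd ℂ w))) (Metric.ball 0 ρ) := by
  intro w₀ hw₀
  have hw₀' : starRingEnd ℂ w₀ ∈ Metric.ball (0 : ℂ) ρ := by
    simpa [Metric.mem_ball, dist_zero_right] using hw₀
  obtain ⟨U, hU, v, hv, hvs⟩ := hS _ hw₀'
  refine ⟨starRingEnd ℂ ⁻¹' interior U, ?_, fun j w => conjC (v j (starRingEnd ℂ w)), ?_, ?_⟩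
  · exact (Complex.continuous_conj.continuousAt (x := w₀)) (interior_mem_nhds.2 hU)
  · intro j φ w hw
    -- Conjugating `φ` on both sides makes it complex linear again, so the hypothesis on the frame
    -- applies to it.
    let ψ : Module.Dual ℂ (ℂ ⊗[ℝ] V) :=
      { toFun := fun Z => starRingEnd ℂ (φ (conjC Z))
        map_add' := fun Z Z' => by simp
        map_smul' := fun a Z => by simp [conjC_smul] }
    have h1 : DifferentiableAt ℂ (fun w => ψ (v j w)) (starRingEnd ℂ w) :=
      ((hv j ψ).mono interior_subset).differentiableAt (isOpen_interior.mem_nhds hw)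
    have h2 := h1.conj_conj
    rw [Complex.conj_conj] at h2
    refine (h2.congr_of_eventuallyEq (Filter.Eventually.of_forall fun w' => ?_)
      ).differentiableWithinAt
    simp [ψ]
  · intro w hw
    have hw' : starRingEnd ℂ w ∈ U := interior_subset hw
    obtain ⟨h1, h2⟩ := hvs _ hw'
    constructor
    · rw [Fintype.linearIndependent_iff] at h1 ⊢
      intro a ha
      have h3 := congrArg conjC ha
      rw [map_sum, map_zero] at h3
      simp only [conjC_smul, conjC_conjC] at h3
      intro i
      simpa using h1 (fun j => starRingEnd ℂ (a j)) h3 i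
    · refine le_antisymm ?_ ?_
      · rw [Submodule.span_le]
        rintro _ ⟨j, rfl⟩
        change conjC (conjC (v j (starRingEnd ℂ w))) ∈ S (starRingEnd ℂ w)
        rw [conjC_conjC, ← h2]
        exact Submodule.subset_span (mem_range_self j)
      · intro Z hZ
        have hZ' : conjC Z ∈ S (starRingEnd ℂ w) := hZ
        rw [← h2, Submodule.mem_span_range_iff_exists_fun] at hZ'
        obtain ⟨a, ha⟩ := hZ'
        rw [Submodule.mem_span_range_iff_exists_fun]
        refine ⟨fun j => starRingEnd ℂ (a j), ?_⟩
        have h3 := congrArg conjC ha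
        rw [map_sum, conjC_conjC] at h3
        simpa only [conjC_smul] using h3

/-- Schwarz reflection: both sides are holomorphic in `w` and agree on the real axis. -/
theorem IsHolomorphicGrassmann.conj_eq {S : ℂ → Submodule ℂ (ℂ ⊗[ℝ] V)} {ρ : ℝ}
    (hS : IsHolomorphicGrassmann n S (Metric.ball 0 ρ))
    (h : ∀ σ : ℝ, |σ| < ρ → conjSubmodule (S σ) = S σ) {w : ℂ} (hw : w ∈ Metric.ball (0 : ℂ) ρ) :
    conjSubmodule (S (starRingEnd ℂ w)) = S w :=
  hS.conj.eq_of_real hS (fun σ h1 _ => by rw [Complex.conj_ofReal, h σ h1]) hw hw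

end Grassmann

/-! ### The continuation of `P_z` near the zero section -/

section LocalContinuation

theorem mem_kerC_comp {V V' F : Type*} [AddCommGroup V] [Module ℝ V] [AddCommGroup V'] [Module ℝ V']
    [AddCommGroup F] [Module ℂ F] [Module ℝ F] [IsScalarTower ℝ ℂ F] (D : V →ₗ[ℝ] F)
    (L : V' →ₗ[ℝ] V) (Z : ℂ ⊗[ℝ] V') : Z ∈ kerC (D ∘ₗ L) ↔ L.baseChange ℂ Z ∈ kerC D := by
  rw [mem_kerC, mem_kerC, reC_baseChange, imC_baseChange]
  rfl

theorem map_kerC {V V' F : Type*} [AddCommGroup V] [Module ℝ V] [AddCommGroup V'] [Module ℝ V']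
    [AddCommGroup F] [Module ℂ F] [Module ℝ F] [IsScalarTower ℝ ℂ F] (D : V →ₗ[ℝ] F)
    (e : V' ≃ₗ[ℝ] V) :
    (kerC D).map (e.symm.baseChange ℝ ℂ V V').toLinearMap = kerC (D ∘ₗ e.toLinearMap) := by
  ext Z
  rw [mem_kerC_comp]
  exact mem_map_baseChange_iff e.symm (kerC D) Z

variable {n : ℕ}

theorem finrank_VM : Module.finrank ℝ (VM n) = 2 * n := by
  have h1 : Module.finrank ℝ (Covec n) = n := by
    rw [← LinearEquiv.finrank_eq (covE n).toLinearEquiv, finrank_euclideanSpace_fin]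
  rw [Module.finrank_prod, h1, finrank_euclideanSpace_fin]
  ring

theorem isHolomorphicGrassmann_kerC_dMap {u : VM n → L1 (VM n)} {z : VM n} {ρ : ℝ} (hρ : ρ ≤ 1)
    (hD : ∀ w ∈ Metric.ball (0 : ℂ) ρ, IsUnit (horPart (dMap u w z))) :
    IsHolomorphicGrassmann n (fun w => kerC (dMap u w z).toLinearMap) (Metric.ball 0 ρ) := by
  intro w₀ hw₀
  refine ⟨Metric.ball 0 ρ, Metric.isOpen_ball.mem_nhds hw₀,
    fun j w => graphFrame (dMap u w z) j, fun j φ => ?_, fun w hw =>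
      ⟨linearIndependent_graphFrame _, span_graphFrame (hD w hw)⟩⟩
  have h1 := differentiableOn_graphMap_dMap (n := n) hρ hD
  have h2 : DifferentiableOn ℂ (fun w => ((graphMap (dMap u w z) (EuclideanSpace.single j 1) : EC n),
      (EuclideanSpace.single j 1 : EC n))) (Metric.ball 0 ρ) :=
    (h1.clm_apply (differentiableOn_const _)).prodMk (differentiableOn_const _)
  exact (LinearMap.toContinuousLinearMap (φ.comp toTensor)).differentiable.comp_differentiableOn h2

variable {M : Type*} [TopologicalSpace M] [ChartedSpace (EuclideanSpace ℝ (Fin n)) M]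
  [IsManifold (𝓡 n) ω M]

/-- The analytic continuation of `P_z` near the zero-section, in terms of a power series flow. -/
def localP (u : VM n → L1 (VM n)) (T : ℝ) (z₀ z : Cot n M) (w : ℂ) : Submodule ℂ (ℂ ⊗[ℝ] (VM n)) :=
  kerC (dChart u z₀ (w / T) z).toLinearMap

/-- The power series flow `u` around `(x, 0)` describes `P_z` on the disk of radius `ρ`. -/
structure IsAdaptedAt (g : AnalyticMetric n M) (β : DiffForm (𝓡 n) M 2) (T ρ : ℝ) (x : M)
    (u : VM n → L1 (VM n)) (z : Cot n M) : Prop where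
  mem : z ∈ (extChartAt (cotModel n) (zeroSec (n := n) x)).source
  analytic : AnalyticAt ℝ u (extChartAt (cotModel n) (zeroSec (n := n) x) z)
  unit : ∀ w ∈ Metric.closedBall (0 : ℂ) (ρ / T),
    IsUnit (horPart (dMap u w (extChartAt (cotModel n) (zeroSec (n := n) x) z)))
  real : ∀ σ : ℝ, |σ| < T →
    PVal g β z σ = kerC (dChart u (zeroSec (n := n) x) (σ / T : ℝ) z).toLinearMap
  isotropic : ∀ w ∈ Metric.ball (0 : ℂ) (ρ / T),
    ∀ Z ∈ kerC (dMap u w (extChartAt (cotModel n) (zeroSec (n := n) x) z)).toLinearMap,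
    ∀ Z' ∈ kerC (dMap u w (extChartAt (cotModel n) (zeroSec (n := n) x) z)).toLinearMap,
      formC (modelForm (β.inChart x) (extChartAt (cotModel n) (zeroSec (n := n) x) z)) Z Z' = 0
  positive : ∀ w ∈ Metric.closedBall (0 : ℂ) (ρ / T), w.im ≠ 0 →
    ∀ Z ∈ kerC (dMap u w (extChartAt (cotModel n) (zeroSec (n := n) x) z)).toLinearMap, Z ≠ 0 →
      0 < w.im * (-2 * modelForm (β.inChart x) (extChartAt (cotModel n) (zeroSec (n := n) x) z)
        ![reC Z, imC Z])

section Existence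

variable [CompactSpace M] [T2Space M] {g : AnalyticMetric n M} {β : DiffForm (𝓡 n) M 2}

/-- One power series flow per base point serves all the local conclusions; only the neighbourhood
shrinks with `T` and `ρ`. -/
theorem exists_eventually_isAdaptedAt (g : AnalyticMetric n M) (hβ : β.IsCk ω) (hd : β.d = 0)
    {T ρ : ℝ} (hT : 0 < T) (hρ : ρ < T) (x : M) :
    ∃ u, ∀ᶠ z in 𝓝 (zeroSec (n := n) x), IsAdaptedAt g β T ρ x u z := by
  have h := isLocalSystem_chartField (g := g) hβ hd hT x
  obtain ⟨u, hu⟩ := h.exists_flow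
  have hlt : ρ / T < 1 := (div_lt_one hT).2 hρ
  have hc := continuousAt_extChartAt (I := cotModel n) (zeroSec (n := n) x)
  refine ⟨u, ?_⟩
  filter_upwards [(isOpen_extChartAt_source (I := cotModel n) (zeroSec (n := n) x)).mem_nhds
    (mem_extChartAt_source _), hc.eventually hu.analytic.eventually_analyticAt,
    hc.eventually (hu.eventually_isUnit_horPart h hlt), hu.eventually_PVal hβ hT,
    hc.eventually (hu.eventually_isotropic h hlt), hc.eventually (hu.eventually_positive h hlt)]
    with z h1 h2 h3 h4 h5 h6
  exact ⟨h1, h2, h3, h4, h5, h6⟩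

end Existence

variable {g : AnalyticMetric n M} {β : DiffForm (𝓡 n) M 2} {T ρ : ℝ} {x : M}
  {u : VM n → L1 (VM n)} {z : Cot n M}

theorem norm_div_lt (hT : 0 < T) {w : ℂ} (hw : w ∈ Metric.ball (0 : ℂ) ρ) :
    w / T ∈ Metric.ball (0 : ℂ) (ρ / T) := by
  rw [mem_ball_zero_iff] at hw ⊢
  rw [norm_div, Complex.norm_real, Real.norm_eq_abs, abs_of_pos hT]
  exact div_lt_div_of_pos_right hw hT

theorem formC_twistedForm (β : DiffForm (𝓡 n) M 2) (z₀ : Cot n M) {z : Cot n M}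
    (hz : z ∈ (extChartAt (cotModel n) z₀).source) (Z Z' : ℂ ⊗[ℝ] (VM n)) :
    formC ((twistedForm β).val z) Z Z' =
      formC (modelForm (β.inChart z₀.proj) (extChartAt (cotModel n) z₀ z))
        ((chartDeriv (cotModel n) z₀ z).toLinearMap.baseChange ℂ Z)
        ((chartDeriv (cotModel n) z₀ z).toLinearMap.baseChange ℂ Z') := by
  simp only [formC, twistedForm_val β z₀ hz, reC_baseChange, imC_baseChange]
  rfl

theorem mem_localP {w : ℂ} {z₀ : Cot n M} {Z : ℂ ⊗[ℝ] (VM n)} : Z ∈ localP u T z₀ z w ↔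
    (chartDeriv (cotModel n) z₀ z).toLinearMap.baseChange ℂ Z ∈
      kerC (dMap u (w / T) (extChartAt (cotModel n) z₀ z)).toLinearMap :=
  mem_kerC_comp _ (chartDeriv (cotModel n) z₀ z).toLinearMap Z

theorem localP_eq_map (hz : z ∈ (extChartAt (cotModel n) (zeroSec (n := n) x)).source) (w : ℂ) :
    localP u T (zeroSec x) z w =
      (kerC (dMap u (w / T) (extChartAt (cotModel n) (zeroSec (n := n) x) z)).toLinearMap).map
        ((chartEquiv (I := cotModel n) (zeroSec (n := n) x) hz).toLinearEquiv.symm.baseChange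
          ℝ ℂ (VM n) (VM n)).toLinearMap :=
  (map_kerC (dMap u (w / T) (extChartAt (cotModel n) (zeroSec (n := n) x) z)).toLinearMap
    (chartEquiv (I := cotModel n) (zeroSec (n := n) x) hz).toLinearEquiv).symm

theorem IsAdaptedAt.isHolomorphicGrassmann (h : IsAdaptedAt g β T ρ x u z) (hT : 0 < T)
    (hρ : ρ < T) : IsHolomorphicGrassmann n (localP u T (zeroSec x) z) (Metric.ball 0 ρ) := by
  have h1 := isHolomorphicGrassmann_kerC_dMap (n := n) (ρ := ρ / T) ((div_lt_one hT).2 hρ).le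
    fun w hw => h.unit w (Metric.ball_subset_closedBall hw)
  have h2 : localP u T (zeroSec x) z = fun w =>
      (kerC (dMap u (w / T) (extChartAt (cotModel n) (zeroSec (n := n) x) z)).toLinearMap).map
        ((chartEquiv (I := cotModel n) (zeroSec (n := n) x) h.mem).toLinearEquiv.symm.baseChange
          ℝ ℂ (VM n) (VM n)).toLinearMap := funext (localP_eq_map h.mem)
  rw [h2]
  exact (h1.comp (f := fun w => w / T) (by fun_prop) fun w hw => norm_div_lt hT hw).map _

theorem IsAdaptedAt.localP_real (h : IsAdaptedAt g β T ρ x u z) {σ : ℝ} (hσ : |σ| < T) :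
    localP u T (zeroSec x) z σ = PVal g β z σ := by
  rw [h.real σ hσ, localP, Complex.ofReal_div]

theorem IsAdaptedAt.isContinuationAt (h : IsAdaptedAt g β T ρ x u z) (hT : 0 < T) (hρ : ρ < T) :
    IsContinuationAt g β z ρ (localP u T (zeroSec x) z) :=
  ⟨h.isHolomorphicGrassmann hT hρ, fun σ hσ => h.localP_real (hσ.trans hρ)⟩

theorem IsAdaptedAt.finrank_localP (h : IsAdaptedAt g β T ρ x u z) (hT : 0 < T) {w : ℂ}
    (hw : w ∈ Metric.ball (0 : ℂ) ρ) : Module.finrank ℂ (localP u T (zeroSec x) z w) = n := by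
  rw [localP_eq_map h.mem, LinearEquiv.finrank_map_eq]
  exact finrank_kerC (h.unit _ (Metric.ball_subset_closedBall (norm_div_lt hT hw)))

theorem IsAdaptedAt.isLagrangian (h : IsAdaptedAt g β T ρ x u z) (hT : 0 < T) {w : ℂ}
    (hw : w ∈ Metric.ball (0 : ℂ) ρ) :
    IsLagrangian ((twistedForm β).val z) (localP u T (zeroSec x) z w) := by
  refine ⟨fun Z hZ Z' hZ' => ?_, ?_⟩
  · rw [formC_twistedForm β (zeroSec (n := n) x) h.mem]
    exact h.isotropic _ (norm_div_lt hT hw) _ (mem_localP.1 hZ) _ (mem_localP.1 hZ')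
  · rw [h.finrank_localP hT hw, Module.finrank_baseChange, finrank_VM]

theorem IsAdaptedAt.pos (h : IsAdaptedAt g β T ρ x u z) (hT : 0 < T) {w : ℂ}
    (hw : w ∈ Metric.ball (0 : ℂ) ρ) (hi : w.im ≠ 0) {Z : ℂ ⊗[ℝ] (VM n)}
    (hZ : Z ∈ localP u T (zeroSec x) z w) (hne : Z ≠ 0) :
    0 < w.im * (-2 * (twistedForm β).val z ![reC Z, imC Z]) := by
  have him : (w / T).im = w.im / T := by
    rw [Complex.div_ofReal_im]
  have h1 := h.positive _ (Metric.ball_subset_closedBall (norm_div_lt hT hw))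
    (by rw [him]; exact div_ne_zero hi hT.ne') _ (mem_localP.1 hZ) (by
      intro h0
      refine hne (eq_zero_iffC.2 ?_)
      have h2 := eq_zero_iffC.1 h0
      rw [reC_baseChange, imC_baseChange] at h2
      exact ⟨(chartEquiv (I := cotModel n) _ h.mem).map_eq_zero_iff.1 h2.1,
        (chartEquiv (I := cotModel n) _ h.mem).map_eq_zero_iff.1 h2.2⟩)
  rw [reC_baseChange, imC_baseChange, him] at h1
  have h2 := twistedForm_val β (zeroSec (n := n) x) h.mem (reC Z) (imC Z)
  rw [h2]
  have h3 := mul_pos hT h1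
  have h4 : T * (w.im / T * (-2 * modelForm (β.inChart x)
      (extChartAt (cotModel n) (zeroSec (n := n) x) z)
      ![(chartDeriv (cotModel n) (zeroSec (n := n) x) z).toLinearMap (reC Z),
        (chartDeriv (cotModel n) (zeroSec (n := n) x) z).toLinearMap (imC Z)])) =
      w.im * (-2 * modelForm (β.inChart x)
      (extChartAt (cotModel n) (zeroSec (n := n) x) z)
      ![(chartDeriv (cotModel n) (zeroSec (n := n) x) z).toLinearMap (reC Z),
        (chartDeriv (cotModel n) (zeroSec (n := n) x) z).toLinearMap (imC Z)]) := by
    field_simp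
  rw [h4] at h3
  exact h3

theorem IsAdaptedAt.isPositiveLagrangian (h : IsAdaptedAt g β T ρ x u z) (hT : 0 < T) {w : ℂ}
    (hw : w ∈ Metric.ball (0 : ℂ) ρ) (hi : 0 < w.im) :
    IsPositiveLagrangian ((twistedForm β).val z) (localP u T (zeroSec x) z w) := by
  refine ⟨h.isLagrangian hT hw, fun Z hZ hne => ?_⟩
  rw [formC_conjC, Complex.ofReal_re, Complex.ofReal_im]
  exact ⟨pos_of_mul_pos_right (h.pos hT hw hi.ne' hZ hne) hi.le, rfl⟩

/-- If `Z` and `Z̄` lie in the same isotropic space then `ω(Z, Z̄) = 0`, against definiteness for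
`Im w ≠ 0`. -/
theorem IsAdaptedAt.transverse (h : IsAdaptedAt g β T ρ x u z) (hT : 0 < T) {w : ℂ}
    (hw : w ∈ Metric.ball (0 : ℂ) ρ) (hi : w.im ≠ 0) {Z : ℂ ⊗[ℝ] (VM n)}
    (hZ : Z ∈ localP u T (zeroSec x) z w) (hZ' : conjC Z ∈ localP u T (zeroSec x) z w) :
    Z = 0 := by
  by_contra hne
  have h1 := h.pos hT hw hi hZ hne
  have h2 := formC_conjC ((twistedForm β).val z) Z
  rw [(h.isLagrangian hT hw).1 Z hZ _ hZ', mul_zero] at h2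
  have h3 : -2 * (twistedForm β).val z ![reC Z, imC Z] = 0 := by exact_mod_cast h2.symm
  rw [h3, mul_zero] at h1
  exact lt_irrefl _ h1

/-- The local frame of the continuation of `P_z`. -/
def localFrame (u : VM n → L1 (VM n)) (T : ℝ) (z₀ : Cot n M) (j : Fin n) (z : Cot n M) (w : ℂ) :
    ℂ ⊗[ℝ] (VM n) :=
  (chartSymmDeriv (cotModel n) z₀ (extChartAt (cotModel n) z₀ z)).toLinearMap.baseChange ℂ
    (graphFrame (dMap u (w / T) (extChartAt (cotModel n) z₀ z)) j)

theorem chartDeriv_reC_localFrame {z₀ : Cot n M} (hz : z ∈ (extChartAt (cotModel n) z₀).source)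
    (j : Fin n) (w : ℂ) :
    chartDeriv (cotModel n) z₀ z (reC (localFrame u T z₀ j z w)) =
      (reE (graphMap (dMap u (w / T) (extChartAt (cotModel n) z₀ z)) (EuclideanSpace.single j 1)),
        covE n (reE (EuclideanSpace.single j 1))) := by
  rw [localFrame, reC_baseChange]
  refine ((chartEquiv (I := cotModel n) z₀ hz).apply_symm_apply
    (reC (graphFrame (dMap u (w / T) (extChartAt (cotModel n) z₀ z)) j))).trans ?_
  rw [graphFrame, reC_toTensor]

theorem chartDeriv_imC_localFrame {z₀ : Cot n M} (hz : z ∈ (extChartAt (cotModel n) z₀).source)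
    (j : Fin n) (w : ℂ) :
    chartDeriv (cotModel n) z₀ z (imC (localFrame u T z₀ j z w)) =
      (imE (graphMap (dMap u (w / T) (extChartAt (cotModel n) z₀ z)) (EuclideanSpace.single j 1)),
        covE n (imE (EuclideanSpace.single j 1))) := by
  rw [localFrame, imC_baseChange]
  refine ((chartEquiv (I := cotModel n) z₀ hz).apply_symm_apply
    (imC (graphFrame (dMap u (w / T) (extChartAt (cotModel n) z₀ z)) j))).trans ?_
  rw [graphFrame, imC_toTensor]

theorem IsAdaptedAt.localFrame_spec (h : IsAdaptedAt g β T ρ x u z) (hT : 0 < T) {w : ℂ}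
    (hw : w ∈ Metric.ball (0 : ℂ) ρ) :
    LinearIndependent ℂ (fun j => localFrame u T (zeroSec x) j z w) ∧
      Submodule.span ℂ (range fun j => localFrame u T (zeroSec x) j z w) =
        localP u T (zeroSec x) z w := by
  set e := ((chartEquiv (I := cotModel n) (zeroSec (n := n) x) h.mem).toLinearEquiv.symm.baseChange
          ℝ ℂ (VM n) (VM n))
  refine ⟨(linearIndependent_graphFrame (dMap u (w / T)
    (extChartAt (cotModel n) (zeroSec (n := n) x) z))).map' e.toLinearMap e.ker, ?_⟩
  rw [localP_eq_map h.mem, ← span_graphFrame (h.unit _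
    (Metric.ball_subset_closedBall (norm_div_lt hT hw))), Submodule.map_span, ← range_comp]
  rfl

/-- In the chart the frame consists of values of `graphMap` next to constant covectors, and
`graphMap` is jointly analytic in point and time. -/
theorem IsAdaptedAt.contMDiffAt_localFrame (h : IsAdaptedAt g β T ρ x u z) (hT : 0 < T)
    (hρ : ρ < T) {w : ℂ} (hw : w ∈ Metric.ball (0 : ℂ) ρ) (j : Fin n) :
    ContMDiffAt ((cotModel n).prod 𝓘(ℝ, ℂ)) (cotModel n).tangent ω
      (fun q : Cot n M × ℂ => (⟨q.1, reC (localFrame u T (zeroSec x) j q.1 q.2)⟩ :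
        TangentBundle (cotModel n) (Cot n M))) (z, w) ∧
    ContMDiffAt ((cotModel n).prod 𝓘(ℝ, ℂ)) (cotModel n).tangent ω
      (fun q : Cot n M × ℂ => (⟨q.1, imC (localFrame u T (zeroSec x) j q.1 q.2)⟩ :
        TangentBundle (cotModel n) (Cot n M))) (z, w) := by
  have hwT := norm_div_lt hT hw
  have h1 : ContDiffAt ℝ ω (fun p : VM n × ℂ => graphMap (dMap u p.2 p.1))
      (extChartAt (cotModel n) (zeroSec (n := n) x) z, w / T) :=
    contDiffAt_graphMap_dMap h.analytic
      ((mem_ball_zero_iff.1 hwT).trans ((div_lt_one hT).2 hρ))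
      (h.unit _ (Metric.ball_subset_closedBall hwT))
  have h2 : ContMDiffAt ((cotModel n).prod 𝓘(ℝ, ℂ)) (𝓘(ℝ, VM n).prod 𝓘(ℝ, ℂ)) ω
      (fun q : Cot n M × ℂ => (extChartAt (cotModel n) (zeroSec (n := n) x) q.1, q.2 / T)) (z, w) := by
    refine ContMDiffAt.prodMk ((contMDiffAt_chart (zeroSec (n := n) x) h.mem).comp (z, w)
      contMDiffAt_fst) ?_
    have h3 : ContMDiff 𝓘(ℝ, ℂ) 𝓘(ℝ, ℂ) ω (fun w : ℂ => w / T) :=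
      contMDiff_iff_contDiff.2 (contDiff_id.div_const _)
    exact h3.contMDiffAt.comp (z, w) contMDiffAt_snd
  have key : ∀ (A : EC n →L[ℝ] EuclideanSpace ℝ (Fin n)) (q : Covec n),
      ContMDiffAt ((cotModel n).prod 𝓘(ℝ, ℂ)) 𝓘(ℝ, VM n) ω (fun q' : Cot n M × ℂ =>
        ((A (graphMap (dMap u (q'.2 / T) (extChartAt (cotModel n) (zeroSec (n := n) x) q'.1))
          (EuclideanSpace.single j 1)), q) : VM n)) (z, w) := by
    intro A q
    have h3 : ContDiffAt ℝ ω (fun p : VM n × ℂ => ((A (graphMap (dMap u p.2 p.1)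
        (EuclideanSpace.single j 1)), q) : VM n))
        (extChartAt (cotModel n) (zeroSec (n := n) x) z, w / T) := by
      refine ContDiffAt.prodMk ?_ contDiffAt_const
      refine A.contDiff.contDiffAt.comp _ ?_
      let ev : (EC n →L[ℂ] EC n) →L[ℝ] EC n :=
        (ContinuousLinearMap.apply ℂ (EC n) (EuclideanSpace.single j 1 : EC n)).restrictScalars ℝ
      exact ev.contDiff.contDiffAt.comp _ h1
    have h4 := h3.contMDiffAt
    rw [modelWithCornersSelf_prod, ← chartedSpaceSelf_prod] at h4
    exact h4.comp (z, w) h2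
  have hsrc : ∀ᶠ q in 𝓝 (z, w), (q : Cot n M × ℂ).1 ∈
      (extChartAt (cotModel n) (zeroSec (n := n) x)).source :=
    continuousAt_fst.eventually ((isOpen_extChartAt_source _).mem_nhds h.mem)
  constructor
  · refine contMDiffAt_tangent_of_chart (I := cotModel n) (b := fun q : Cot n M × ℂ => q.1)
      (zeroSec (n := n) x) contMDiffAt_fst h.mem ?_
    refine (key reE (covE n (reE (EuclideanSpace.single j 1)))).congr_of_eventuallyEq ?_
    filter_upwards [hsrc] with q hq
    exact chartDeriv_reC_localFrame hq j q.2
  · refine contMDiffAt_tangent_of_chart (I := cotModel n) (b := fun q : Cot n M × ℂ => q.1)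
      (zeroSec (n := n) x) contMDiffAt_fst h.mem ?_
    refine (key imE (covE n (imE (EuclideanSpace.single j 1)))).congr_of_eventuallyEq ?_
    filter_upwards [hsrc] with q hq
    exact chartDeriv_imC_localFrame hq j q.2

/-- Continuations of `P_z` are unique. -/
theorem IsContinuationAt.eq {z : Cot n M} {ρ ρ' : ℝ} {S S' : ℂ → Submodule ℂ (TCotC z)}
    (h : IsContinuationAt g β z ρ S) (h' : IsContinuationAt g β z ρ' S') {w : ℂ}
    (hw : w ∈ Metric.ball (0 : ℂ) ρ) (hw' : w ∈ Metric.ball (0 : ℂ) ρ') : S w = S' w :=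
  h.1.eq_of_real h'.1 (fun σ hσ hσ' => (h.2 σ hσ).trans (h'.2 σ hσ').symm) hw hw'

end LocalContinuation

/-! ### Passing to tubes by compactness -/

section Tubes

variable {n : ℕ} {M : Type*} [TopologicalSpace M] [ChartedSpace (EuclideanSpace ℝ (Fin n)) M]
  [IsManifold (𝓡 n) ω M] {g : AnalyticMetric n M} {β : DiffForm (𝓡 n) M 2}

theorem eq_zeroSec_or_normSq_pos (g : AnalyticMetric n M) (z : Cot n M) :
    z = zeroSec z.proj ∨ 0 < normSq g z := by
  by_cases h : (z.snd : Covec n) = 0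
  · left
    obtain ⟨x, p⟩ := z
    exact congrArg (fun q : Covec n => (⟨x, q⟩ : Cot n M)) h
  · right
    obtain ⟨v, hv⟩ := exists_sharp g z.proj z.snd
    have hv' : metricVal g z.proj v = z.snd := hv
    rw [normSq_eq g z hv', ← hv']
    refine metricVal_pos g z.proj fun h0 => h ?_
    rw [← hv', h0, map_zero]
    rfl

theorem normSq_zeroSec (g : AnalyticMetric n M) (x : M) : normSq g (zeroSec x) = 0 := rfl

theorem zeroSec_mem_tube (g : AnalyticMetric n M) {R : ℝ} (hR : 0 < R) (x : M) :
    zeroSec x ∈ tube g R := by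
  change normSq g (zeroSec x) < R ^ 2
  rw [normSq_zeroSec]
  positivity

theorem tube_subset_tube (g : AnalyticMetric n M) {r R : ℝ} (hr : 0 < r) (h : r ≤ R) :
    tube g r ⊆ tube g R := fun z hz => lt_of_lt_of_le hz (pow_le_pow_left₀ hr.le h 2)

section Compact

variable [CompactSpace M] [T2Space M]

/-- A neighbourhood of the zero-section contains a tube. -/
theorem exists_tube_of_eventually (g : AnalyticMetric n M) {p : Cot n M → Prop}
    (hp : ∀ x : M, ∀ᶠ z in 𝓝 (zeroSec (n := n) x), p z) : ∃ r > 0, ∀ z ∈ tube g r, p z := by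
  -- What is left of the unit disk bundle outside the neighbourhood is compact and misses the zero
  -- section, so the squared length has a positive lower bound `m` on it.
  have hK : IsCompact ({z : Cot n M | normSq g z ≤ 1} \ interior {z | p z}) :=
    (isCompact_normSq_le g 1).diff isOpen_interior
  obtain ⟨m, hm, hle⟩ := hK.exists_forall_le' (continuous_normSq g).continuousOn (a := 0) (by
    rintro z ⟨-, hz⟩
    rcases eq_zeroSec_or_normSq_pos g z with h | h
    · exact absurd (by rw [h]; exact mem_interior_iff_mem_nhds.2 (hp z.proj)) hz
    · exact h)
  -- With `r = min 1 m` one has `r ^ 2 ≤ r ≤ m`.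
  refine ⟨min 1 m, lt_min one_pos hm, fun z hz => ?_⟩
  have hz' : normSq g z < (min 1 m) ^ 2 := hz
  have h0 : 0 < min 1 m := lt_min one_pos hm
  have h1 : min 1 m ≤ 1 := min_le_left _ _
  have h2 : min 1 m ≤ m := min_le_right _ _
  by_contra hn
  have h3 := hle z ⟨show normSq g z ≤ 1 by nlinarith, fun h => hn (interior_subset h)⟩
  nlinarith

theorem exists_tube_adapted (g : AnalyticMetric n M) (hβ : β.IsCk ω) (hd : β.d = 0)
    {T ρ : ℝ} (hT : 0 < T) (hρ : ρ < T) : ∃ r > 0, ∀ z ∈ tube g r, ∃ x u,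
      ∀ᶠ z' in 𝓝 z, IsAdaptedAt g β T ρ x u z' := by
  refine exists_tube_of_eventually g fun x => ?_
  obtain ⟨u, hu⟩ := exists_eventually_isAdaptedAt g hβ hd hT hρ x
  exact hu.eventually_nhds.mono fun z hz => ⟨x, u, hz⟩

end Compact

/-- Joint analyticity is automatic: by uniqueness any pointwise continuation coincides with the
local families, whose frames are analytic. -/
theorem isContinuation_of_adapted {r T ε : ℝ} (hT : 0 < T) (hε : 1 + ε < T)
    {Q : (z : Cot n M) → ℂ → Submodule ℂ (TCotC z)}
    (hQ : ∀ z ∈ tube g r, IsContinuationAt g β z (1 + ε) (Q z))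
    (h : ∀ z ∈ tube g r, ∃ x u, ∀ᶠ z' in 𝓝 z, IsAdaptedAt g β T (1 + ε) x u z') :
    IsContinuation g β r ε Q := by
  refine ⟨hQ, ?_⟩
  rintro ⟨z, w⟩ ⟨hz, hw⟩
  obtain ⟨x, u, hu⟩ := h z hz
  obtain ⟨O, hOs, hO, hzO⟩ := mem_nhds_iff.1 (Filter.inter_mem hu ((isOpen_tube g r).mem_nhds hz))
  refine ⟨O ×ˢ Metric.ball 0 (1 + ε), (hO.prod Metric.isOpen_ball).mem_nhds ⟨hzO, hw⟩,
    fun j z w => localFrame u T (zeroSec x) j z w, fun j => ⟨?_, ?_⟩, ?_⟩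
  · rintro ⟨z', w'⟩ ⟨hz', hw'⟩
    exact ((hOs hz').1.contMDiffAt_localFrame hT hε hw' j).1.contMDiffWithinAt
  · rintro ⟨z', w'⟩ ⟨hz', hw'⟩
    exact ((hOs hz').1.contMDiffAt_localFrame hT hε hw' j).2.contMDiffWithinAt
  · rintro ⟨z', w'⟩ ⟨hz', hw'⟩
    have h1 := (hOs hz').1.localFrame_spec hT hw'
    refine ⟨h1.1, h1.2.trans ?_⟩
    exact ((hOs hz').1.isContinuationAt hT hε).eq (hQ z' (hOs hz').2) hw' hw'

theorem exists_isContinuation [CompactSpace M] [T2Space M] (g : AnalyticMetric n M)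
    (hβ : β.IsCk ω) (hd : β.d = 0) : ∃ R > 0, ∃ ε > 0, ∃ Q, IsContinuation g β R ε Q ∧
      ∀ z ∈ tube g R, ∀ w ∈ Metric.ball (0 : ℂ) (1 + ε),
        IsLagrangian (twistedForm β z) (Q z w) := by
  -- Any `1 < ρ < T` would do, since a smaller tube buys a longer time; `ρ = 2` corresponds to `ε =
  -- 1`.
  have hT : (0 : ℝ) < 3 := by norm_num
  have hρ : (1 + 1 : ℝ) < 3 := by norm_num
  obtain ⟨r, hr, h⟩ := exists_tube_adapted g hβ hd hT hρ
  have h1 : ∀ z : Cot n M, ∃ S, z ∈ tube g r → IsContinuationAt g β z (1 + 1) S := by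
    intro z
    by_cases hz : z ∈ tube g r
    · obtain ⟨x, u, hu⟩ := h z hz
      exact ⟨_, fun _ => hu.self_of_nhds.isContinuationAt hT hρ⟩
    · exact ⟨fun _ => ⊥, fun h => absurd h hz⟩
  choose Q hQ using h1
  refine ⟨r, hr, 1, one_pos, Q, isContinuation_of_adapted hT hρ hQ h, fun z hz w hw => ?_⟩
  obtain ⟨x, u, hu⟩ := h z hz
  rw [(hQ z hz).eq (hu.self_of_nhds.isContinuationAt hT hρ) hw hw]
  exact hu.self_of_nhds.isLagrangian hT hw

end Tubes

/-! ### Almost complex structures and their `(1,0)`-spaces -/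

section ComplexLinear

variable {V : Type*} [AddCommGroup V] [Module ℝ V] [TopologicalSpace V]

theorem mem_type10 {J : V →L[ℝ] V} {Z : ℂ ⊗[ℝ] V} :
    Z ∈ type10 J ↔ J (reC Z) = -imC Z ∧ J (imC Z) = reC Z := by
  rw [type10, Module.End.mem_eigenspace_iff]
  constructor
  · intro h
    have h1 := congrArg reC h
    have h2 := congrArg imC h
    rw [reC_baseChange, reC_smul] at h1
    rw [imC_baseChange, imC_smul] at h2
    exact ⟨by simpa using h1, by simpa using h2⟩
  · rintro ⟨h1, h2⟩
    refine extC ?_ ?_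
    · rw [reC_baseChange, reC_smul]
      simpa using h1
    · rw [imC_baseChange, imC_smul]
      simpa using h2

theorem mem_type01 {J : V →L[ℝ] V} {Z : ℂ ⊗[ℝ] V} :
    Z ∈ type01 J ↔ J (reC Z) = imC Z ∧ J (imC Z) = -reC Z := by
  rw [type01, Module.End.mem_eigenspace_iff]
  constructor
  · intro h
    have h1 := congrArg reC h
    have h2 := congrArg imC h
    rw [reC_baseChange, reC_smul] at h1
    rw [imC_baseChange, imC_smul] at h2
    exact ⟨by simpa using h1, by simpa using h2⟩
  · rintro ⟨h1, h2⟩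
    refine extC ?_ ?_
    · rw [reC_baseChange, reC_smul]
      simpa using h1
    · rw [imC_baseChange, imC_smul]
      simpa using h2

theorem mkC_mem_type10 {J : V →L[ℝ] V} (hJ : ∀ v, J (J v) = -v) (v : V) :
    mkC v (-(J v)) ∈ type10 J := by
  rw [mem_type10, reC_mkC, imC_mkC, neg_neg]
  refine ⟨rfl, ?_⟩
  rw [map_neg, hJ, neg_neg]

/-- The vector `v - i J v` is of type `(1,0)` for `J`, and its imaginary part recovers `J v`. -/
theorem eq_of_type10_le {J J' : V →L[ℝ] V} (hJ : ∀ v, J (J v) = -v)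
    (h : type10 J ≤ type10 J') : J' = J := by
  refine ContinuousLinearMap.ext fun v => ?_
  have h1 := (mem_type10.1 (h (mkC_mem_type10 hJ v))).1
  rwa [reC_mkC, imC_mkC, neg_neg] at h1

/-- Compatibility of a complex structure with a positive Lagrangian `(1,0)`-space. -/
theorem compatible_of_isPositiveLagrangian {J : V →L[ℝ] V} (hJ : ∀ v, J (J v) = -v)
    {w : V [⋀^Fin 2]→L[ℝ] ℝ} (h : IsPositiveLagrangian w (type10 J)) :
    (∀ ξ η, w ![J ξ, J η] = w ![ξ, η]) ∧ ∀ ξ, ξ ≠ 0 → 0 < w ![ξ, J ξ] := by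
  constructor
  · intro ξ η
    have h1 := h.1.1 _ (mkC_mem_type10 hJ ξ) _ (mkC_mem_type10 hJ η)
    have h2 := congrArg Complex.re h1
    rw [formC, reC_mkC, reC_mkC, imC_mkC, imC_mkC] at h2
    simp only [Complex.add_re, Complex.ofReal_re, Complex.mul_re, Complex.I_re, Complex.I_im,
      Complex.ofReal_im, zero_mul, mul_zero, sub_zero, add_zero, Complex.zero_re, form_neg_left,
      form_neg_right, neg_neg] at h2
    linarith
  · intro ξ hξ
    have h1 := (h.2 _ (mkC_mem_type10 hJ ξ) (fun h0 => hξ (by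
      have := congrArg reC h0
      rwa [reC_mkC, map_zero] at this))).1
    rw [formC_conjC, Complex.ofReal_re, reC_mkC, imC_mkC, form_neg_right] at h1
    linarith

variable {n : ℕ}

theorem bijective_of_injective {D : VM n →L[ℝ] EC n} (hD : ∀ v, D v = 0 → v = 0) :
    Function.Bijective D := by
  have h1 : Function.Injective D.toLinearMap := (injective_iff_map_eq_zero D.toLinearMap).2 hD
  refine ⟨h1, (LinearMap.injective_iff_surjective_of_finrank_eq_finrank ?_).1 h1⟩
  rw [finrank_VM, ← Module.finrank_mul_finrank ℝ ℂ (EC n), Complex.finrank_real_complex,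
    finrank_euclideanSpace_fin]

/-- The complex structure for which the real isomorphism `D` is complex linear. -/
def pullI (D : VM n →L[ℝ] EC n) : VM n →L[ℝ] VM n :=
  D.inverse.comp (((Complex.I • ContinuousLinearMap.id ℂ (EC n)).restrictScalars ℝ).comp D)

theorem exists_equiv_of_bijective {D : VM n →L[ℝ] EC n} (hD : Function.Bijective D) :
    ∃ e : VM n ≃L[ℝ] EC n, (e : VM n →L[ℝ] EC n) = D :=
  ⟨(LinearEquiv.ofBijective D.toLinearMap hD).toContinuousLinearEquiv,
    ContinuousLinearMap.ext fun _ => rfl⟩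

theorem apply_pullI {D : VM n →L[ℝ] EC n} (hD : Function.Bijective D) (v : VM n) :
    D (pullI D v) = Complex.I • D v := by
  obtain ⟨e, rfl⟩ := exists_equiv_of_bijective hD
  change e ((e : VM n →L[ℝ] EC n).inverse (Complex.I • e v)) = Complex.I • e v
  rw [ContinuousLinearMap.inverse_equiv]
  exact e.apply_symm_apply _

theorem mem_type10_pullI {D : VM n →L[ℝ] EC n} (hD : Function.Bijective D) {Z : ℂ ⊗[ℝ] (VM n)} :
    Z ∈ type10 (pullI D) ↔ D (reC Z) = Complex.I • D (imC Z) := by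
  rw [mem_type10]
  constructor
  · rintro ⟨-, h⟩
    rw [← h, apply_pullI hD]
  · intro h
    have h1 : pullI D (imC Z) = reC Z := hD.1 (by rw [apply_pullI hD, h])
    refine ⟨hD.1 ?_, h1⟩
    rw [apply_pullI hD, h, smul_smul, Complex.I_mul_I, neg_one_smul, map_neg]

theorem pullI_pullI {D : VM n →L[ℝ] EC n} (hD : Function.Bijective D) (v : VM n) :
    pullI D (pullI D v) = -v :=
  hD.1 (by rw [apply_pullI hD, apply_pullI hD, smul_smul, Complex.I_mul_I, neg_one_smul, map_neg])

theorem contDiffAt_pullI {D : VM n →L[ℝ] EC n} (hD : Function.Bijective D) :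
    ContDiffAt ℝ ω (pullI (n := n)) D := by
  obtain ⟨e, rfl⟩ := exists_equiv_of_bijective hD
  exact (contDiffAt_map_inverse e).clm_comp (contDiffAt_const.clm_comp contDiffAt_id)

end ComplexLinear

/-! ### Regularity of fields of endomorphisms -/

section EndomorphismFields

variable {E : Type*} [NormedAddCommGroup E] [NormedSpace ℝ E]
  {H : Type*} [TopologicalSpace H] {I : ModelWithCorners ℝ E H} [I.Boundaryless]
  {N : Type*} [TopologicalSpace N] [ChartedSpace H N] [IsManifold I ω N]

/-- A field of endomorphisms is as regular as its coordinate expression. -/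
theorem contMDiffAt_endomorphismField {m : WithTop ℕ∞}
    {J : (z : N) → TangentSpace I z →L[ℝ] TangentSpace I z} {z₀ z : N}
    (hz : z ∈ (extChartAt I z₀).source) {A : N → E →L[ℝ] E} (hA : ContMDiffAt I 𝓘(ℝ, E →L[ℝ] E) m A z)
    (hJ : ∀ᶠ z in 𝓝 z, ∀ v : E, chartDeriv I z₀ z (J z v) = A z (chartDeriv I z₀ z v)) :
    ContMDiffAt I (I.prod 𝓘(ℝ, E →L[ℝ] E)) m (fun z => TotalSpace.mk' (E →L[ℝ] E)
      (E := fun z : N => TangentSpace I z →L[ℝ] TangentSpace I z) z (J z)) z := by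
  have : IsManifold I (m + 1) N := IsManifold.of_le (n := ω) le_top
  have hmem : (TotalSpace.mk' (E →L[ℝ] E)
      (E := fun z : N => TangentSpace I z →L[ℝ] TangentSpace I z) z (J z)) ∈
      (trivializationAt (E →L[ℝ] E) (fun z : N => TangentSpace I z →L[ℝ] TangentSpace I z)
        z₀).source := by
    rw [extChartAt_source] at hz
    rw [hom_trivializationAt_source]
    simpa using hz
  rw [Trivialization.contMDiffAt_iff (IB := I)
    (e := trivializationAt (E →L[ℝ] E) (fun z : N => TangentSpace I z →L[ℝ] TangentSpace I z) z₀)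
    (f := fun z => TotalSpace.mk' (E →L[ℝ] E)
      (E := fun z : N => TangentSpace I z →L[ℝ] TangentSpace I z) z (J z)) hmem]
  refine ⟨contMDiffAt_id, hA.congr_of_eventuallyEq ?_⟩
  filter_upwards [hJ, (isOpen_extChartAt_source z₀).mem_nhds hz] with x hx hxs
  have hxs' := hxs
  rw [extChartAt_source] at hxs'
  refine ContinuousLinearMap.ext fun v => ?_
  have h1 : ∀ v : TangentSpace I x, (trivializationAt E (TangentSpace I) z₀).continuousLinearMapAt
      ℝ x v = chartDeriv I z₀ x v := fun v =>
    congrArg (fun A : E →L[ℝ] E => A v)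
      (TangentBundle.continuousLinearMapAt_trivializationAt (I := I) hxs')
  have h2 : ∀ v : E, (trivializationAt E (TangentSpace I) z₀).symmL ℝ x v =
      chartSymmDeriv I z₀ (extChartAt I z₀ x) v := by
    intro v
    have h3 := TangentBundle.symmL_trivializationAt (I := I) hxs'
    rw [ModelWithCorners.range_eq_univ, mfderivWithin_univ] at h3
    exact congrArg (fun A : E →L[ℝ] E => A v) h3
  have h4 : ((trivializationAt (E →L[ℝ] E)
      (fun z : N => TangentSpace I z →L[ℝ] TangentSpace I z) z₀) (TotalSpace.mk' (E →L[ℝ] E)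
      (E := fun z : N => TangentSpace I z →L[ℝ] TangentSpace I z) x (J x))).2 v =
      (trivializationAt E (TangentSpace I) z₀).continuousLinearMapAt ℝ x
        (J x ((trivializationAt E (TangentSpace I) z₀).symmL ℝ x v)) := rfl
  rw [h4, h1, h2]
  have h5 := hx (chartSymmDeriv I z₀ (extChartAt I z₀ x) v)
  have h6 := chartDeriv_chartSymmDeriv (I := I) z₀ ((extChartAt I z₀).map_source hxs) v
  rw [(extChartAt I z₀).left_inv hxs] at h6
  rw [h6] at h5
  exact h5

end EndomorphismFields

/-! ### Complex and Kähler structures from the continuation -/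

section ComplexStructures

variable {n : ℕ} {M : Type*} [TopologicalSpace M] [ChartedSpace (EuclideanSpace ℝ (Fin n)) M]
  [IsManifold (𝓡 n) ω M] {g : AnalyticMetric n M} {β : DiffForm (𝓡 n) M 2} {T ρ : ℝ} {x : M}
  {u : VM n → L1 (VM n)} {z : Cot n M} {w : ℂ}

theorem conj_div_mem (hT : 0 < T) (hw : w ∈ Metric.ball (0 : ℂ) ρ) :
    starRingEnd ℂ w / T ∈ Metric.ball (0 : ℂ) (ρ / T) := by
  refine norm_div_lt hT ?_
  rw [mem_ball_zero_iff] at hw ⊢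
  rwa [RCLike.norm_conj]

theorem norm_conj_div_lt_one (hT : 0 < T) (hρ : ρ < T) (hw : w ∈ Metric.ball (0 : ℂ) ρ) :
    ‖starRingEnd ℂ w / T‖ < 1 :=
  (mem_ball_zero_iff.1 (conj_div_mem hT hw)).trans ((div_lt_one hT).2 hρ)

theorem add_I_smul_eq_zero_iff_conj {a b a' b' : EC n} (ha : reE a' = reE a ∧ imE a' = -imE a)
    (hb : reE b' = reE b ∧ imE b' = -imE b) : a + Complex.I • b = 0 ↔ a' = Complex.I • b' := by
  constructor
  · intro h
    have h4 := congrArg reE h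
    have h5 := congrArg imE h
    rw [map_add, reE_I_smul, map_zero] at h4
    rw [map_add, imE_I_smul, map_zero] at h5
    refine extE ?_ ?_
    · rw [reE_I_smul, ha.1, hb.2, neg_neg]
      exact sub_eq_zero.1 ((sub_eq_add_neg _ _).trans h4)
    · rw [imE_I_smul, ha.2, hb.1]
      exact neg_eq_of_add_eq_zero_right h5
  · intro h
    have h4 := congrArg reE h
    have h5 := congrArg imE h
    rw [reE_I_smul, ha.1, hb.2, neg_neg] at h4
    rw [imE_I_smul, ha.2, hb.1] at h5
    refine extE ?_ ?_
    · rw [map_add, reE_I_smul, h4, map_zero, add_neg_cancel]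
    · rw [map_add, imE_I_smul, ← h5, map_zero, add_neg_cancel]

theorem dChart_apply (u : VM n → L1 (VM n)) (z₀ : Cot n M) (w : ℂ) (z : Cot n M) (v : VM n) :
    dChart u z₀ w z v =
      dMap u w (extChartAt (cotModel n) z₀ z) (chartDeriv (cotModel n) z₀ z v) := rfl

theorem mem_kerC_toLinearMap {D : VM n →L[ℝ] EC n} {Z : ℂ ⊗[ℝ] (VM n)} :
    Z ∈ kerC D.toLinearMap ↔ D (reC Z) + Complex.I • D (imC Z) = 0 := mem_kerC

/-- Let `D_w` be the derivative of the horizontal position at time `w`. Then `Z = X + iY` lies in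
`P_z(w)` when `D_w X + i D_w Y = 0`; conjugation replaces `w` by `w̄` and gives `D_{w̄} X = i D_{w̄}
Y`. This says that `Z` is of type `(1,0)` for the structure making `D_{w̄}` complex linear. -/
theorem mem_localP_iff_conj (hT : 0 < T) (hρ : ρ < T) (hw : w ∈ Metric.ball (0 : ℂ) ρ)
    {z₀ : Cot n M} {Z : ℂ ⊗[ℝ] (VM n)} : Z ∈ localP u T z₀ z w ↔
      dChart u z₀ (starRingEnd ℂ w / T) z (reC Z) =
        Complex.I • dChart u z₀ (starRingEnd ℂ w / T) z (imC Z) := by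
  have h1 : ‖w / T‖ ≤ 1 :=
    ((mem_ball_zero_iff.1 (norm_div_lt hT hw)).trans ((div_lt_one hT).2 hρ)).le
  have h2 : starRingEnd ℂ (w / T) = starRingEnd ℂ w / T := by
    rw [map_div₀, Complex.conj_ofReal]
  have h3 : ∀ v, reE (dChart u z₀ (starRingEnd ℂ w / T) z v) = reE (dChart u z₀ (w / T) z v) ∧
      imE (dChart u z₀ (starRingEnd ℂ w / T) z v) = -imE (dChart u z₀ (w / T) z v) := by
    intro v
    rw [← h2, dChart_apply, dChart_apply]
    exact dMap_star u h1 (extChartAt (cotModel n) z₀ z) (chartDeriv (cotModel n) z₀ z v)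
  rw [localP, mem_kerC_toLinearMap]
  exact add_I_smul_eq_zero_iff_conj (h3 (reC Z)) (h3 (imC Z))

/-- A real vector killed by the derivative at `w̄` lies in `P_z(w)` and equals its conjugate, so it
vanishes by transversality; the dimensions agree. -/
theorem IsAdaptedAt.bijective_dChart (h : IsAdaptedAt g β T ρ x u z) (hT : 0 < T) (hρ : ρ < T)
    (hw : w ∈ Metric.ball (0 : ℂ) ρ) (hi : w.im ≠ 0) :
    Function.Bijective (dChart u (zeroSec (n := n) x) (starRingEnd ℂ w / T) z) := by
  refine bijective_of_injective fun v hv => ?_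
  have h1 : mkC v 0 ∈ localP u T (zeroSec (n := n) x) z w := by
    rw [mem_localP_iff_conj hT hρ hw, reC_mkC, imC_mkC, hv, map_zero, smul_zero]
  have h2 : conjC (mkC v 0) = mkC v 0 := extC (by simp) (by simp)
  have h3 := h.transverse hT hw hi h1 (by rwa [h2])
  have h4 := congrArg reC h3
  rwa [reC_mkC, map_zero] at h4

theorem IsAdaptedAt.bijective_dMap (h : IsAdaptedAt g β T ρ x u z) (hT : 0 < T) (hρ : ρ < T)
    (hw : w ∈ Metric.ball (0 : ℂ) ρ) (hi : w.im ≠ 0) : Function.Bijective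
      (dMap u (starRingEnd ℂ w / T) (extChartAt (cotModel n) (zeroSec (n := n) x) z)) :=
  (Function.Bijective.of_comp_iff _ (chartEquiv (I := cotModel n) _ h.mem).bijective).1
    (h.bijective_dChart hT hρ hw hi)

theorem IsAdaptedAt.type10_pullI (h : IsAdaptedAt g β T ρ x u z) (hT : 0 < T) (hρ : ρ < T)
    (hw : w ∈ Metric.ball (0 : ℂ) ρ) (hi : w.im ≠ 0) :
    type10 (pullI (dChart u (zeroSec (n := n) x) (starRingEnd ℂ w / T) z)) =
      localP u T (zeroSec x) z w := by
  ext Z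
  rw [mem_type10_pullI (h.bijective_dChart hT hρ hw hi), mem_localP_iff_conj hT hρ hw]

theorem dChart_complexStructure (hT : 0 < T) (hρ : ρ < T) (hw : w ∈ Metric.ball (0 : ℂ) ρ)
    {z₀ : Cot n M} {J : VM n →L[ℝ] VM n} (hJ : ∀ v, J (J v) = -v)
    (h : type10 J = localP u T z₀ z w) (v : VM n) :
    dChart u z₀ (starRingEnd ℂ w / T) z (J v) =
      Complex.I • dChart u z₀ (starRingEnd ℂ w / T) z v := by
  have h1 := mkC_mem_type10 hJ v
  rw [h, mem_localP_iff_conj hT hρ hw, reC_mkC, imC_mkC, map_neg] at h1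
  rw [h1, smul_neg, smul_neg, smul_smul, Complex.I_mul_I, neg_one_smul, neg_neg]

/-- The holomorphic coordinates of the structure with `(1,0)`-space `P_z(w)`. -/
def coordMap (u : VM n → L1 (VM n)) (z₀ : Cot n M) (w : ℂ) (z : Cot n M) : EC n :=
  L1.evalC (ofRealE.comp (ContinuousLinearMap.fst ℝ _ _)) w (u (extChartAt (cotModel n) z₀ z))

theorem IsAdaptedAt.hasMFDerivAt_coordMap (h : IsAdaptedAt g β T ρ x u z) (w : ℂ) :
    HasMFDerivAt (cotModel n) 𝓘(ℝ, EC n) (coordMap u (zeroSec (n := n) x) w) z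
      (dChart u (zeroSec (n := n) x) w z) := by
  have h1 : HasFDerivAt (fun y => L1.evalC (ofRealE.comp (ContinuousLinearMap.fst ℝ _ _)) w (u y))
      (dMap u w (extChartAt (cotModel n) (zeroSec (n := n) x) z))
      (extChartAt (cotModel n) (zeroSec (n := n) x) z) :=
    (ContinuousLinearMap.hasFDerivAt _).comp _ h.analytic.differentiableAt.hasFDerivAt
  exact h1.hasMFDerivAt.comp z (mdifferentiableAt_chart (I := cotModel n) _ h.mem).hasMFDerivAt

theorem IsAdaptedAt.contMDiffAt_coordMap (h : IsAdaptedAt g β T ρ x u z) (w : ℂ) :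
    ContMDiffAt (cotModel n) 𝓘(ℝ, EC n) ω (coordMap u (zeroSec (n := n) x) w) z := by
  have h1 : ContDiffAt ℝ ω (fun y => L1.evalC (ofRealE.comp
      (ContinuousLinearMap.fst ℝ (EuclideanSpace ℝ (Fin n)) (Covec n))) w (u y))
      (extChartAt (cotModel n) (zeroSec (n := n) x) z) :=
    (ContinuousLinearMap.contDiff _).contDiffAt.comp _ h.analytic.contDiffAt
  exact h1.contMDiffAt.comp z (contMDiffAt_chart (I := cotModel n) _ h.mem)

theorem IsAdaptedAt.exists_injOn_coordMap (h : IsAdaptedAt g β T ρ x u z) (hT : 0 < T)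
    (hρ : ρ < T) (hw : w ∈ Metric.ball (0 : ℂ) ρ) (hi : w.im ≠ 0) :
    ∃ U ∈ 𝓝 z, InjOn (coordMap u (zeroSec (n := n) x) (starRingEnd ℂ w / T)) U := by
  set y := extChartAt (cotModel n) (zeroSec (n := n) x) z with hy
  set f : VM n → EC n := fun y => L1.evalC (ofRealE.comp
    (ContinuousLinearMap.fst ℝ (EuclideanSpace ℝ (Fin n)) (Covec n))) (starRingEnd ℂ w / T) (u y)
    with hf
  have h1 : ContDiffAt ℝ ω f y :=
    (ContinuousLinearMap.contDiff _).contDiffAt.comp _ h.analytic.contDiffAt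
  obtain ⟨e, he⟩ := exists_equiv_of_bijective (h.bijective_dMap hT hρ hw hi)
  have h2 : HasFDerivAt f (e : VM n →L[ℝ] EC n) y := by
    rw [he]
    exact (ContinuousLinearMap.hasFDerivAt _).comp _ h.analytic.differentiableAt.hasFDerivAt
  let Φ := h1.toOpenPartialHomeomorph f h2 (by simp)
  have h3 : y ∈ Φ.source := h1.mem_toOpenPartialHomeomorph_source h2 (by simp)
  refine ⟨(extChartAt (cotModel n) (zeroSec (n := n) x)).source ∩
    extChartAt (cotModel n) (zeroSec (n := n) x) ⁻¹' Φ.source, Filter.inter_mem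
      ((isOpen_extChartAt_source _).mem_nhds h.mem)
      ((continuousAt_extChartAt' h.mem).preimage_mem_nhds (Φ.open_source.mem_nhds h3)), ?_⟩
  rintro a ⟨ha, ha'⟩ b ⟨hb, hb'⟩ hab
  exact (extChartAt (cotModel n) (zeroSec (n := n) x)).injOn ha hb (Φ.injOn ha' hb' hab)

/-- The structure is the pullback of multiplication by `i` under the differential of `coordMap`, so
`coordMap` itself supplies the holomorphic coordinates and the smoothness of `J` follows from that
of the differential. -/
theorem isComplexStructureOn_of_adapted (hT : 0 < T) (hρ : ρ < T)
    (hw : w ∈ Metric.ball (0 : ℂ) ρ) (hi : w.im ≠ 0) {J : EndField n M} {S : Set (Cot n M)}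
    (hS : IsOpen S) (hJ : ∀ z ∈ S, ∀ ξ, J z (J z ξ) = -ξ)
    (h : ∀ z ∈ S, ∃ x u, ∀ᶠ z' in 𝓝 z, IsAdaptedAt g β T ρ x u z' ∧
      type10 (J z') = localP u T (zeroSec x) z' w) : IsComplexStructureOn J S := by
  have hcpx : ∀ (x : M) (u : VM n → L1 (VM n)) (z : Cot n M), z ∈ S →
      type10 (J z) = localP u T (zeroSec x) z w → ∀ v : VM n,
      dChart u (zeroSec x) (starRingEnd ℂ w / T) z (J z v) =
        Complex.I • dChart u (zeroSec x) (starRingEnd ℂ w / T) z v := fun x u z hz hP =>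
    dChart_complexStructure (J := J z) hT hρ hw (hJ z hz) hP
  refine ⟨fun z hz => ?_, hJ, fun z hz => ?_⟩
  · obtain ⟨x, u, hu⟩ := h z hz
    have h0 := hu.self_of_nhds.1
    refine ContMDiffAt.contMDiffWithinAt ?_
    refine contMDiffAt_endomorphismField (I := cotModel n) (z₀ := zeroSec x) h0.mem
      (A := fun z => pullI (dMap u (starRingEnd ℂ w / T)
        (extChartAt (cotModel n) (zeroSec (n := n) x) z))) ?_ ?_
    · have h1 : ContDiffAt ℝ ω (fun y => dMap u (starRingEnd ℂ w / T) y)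
          (extChartAt (cotModel n) (zeroSec (n := n) x) z) :=
        (contDiffAt_dMap h0.analytic (norm_conj_div_lt_one hT hρ hw)).comp
          (f := fun y => (y, starRingEnd ℂ w / (T : ℂ))) _ (contDiffAt_id.prodMk contDiffAt_const)
      have h2 := (contDiffAt_pullI (h0.bijective_dMap hT hρ hw hi)).comp _ h1
      exact (h2.contMDiffAt.comp z (contMDiffAt_chart (I := cotModel n) _ h0.mem)).of_le le_top
    · filter_upwards [hu, hS.mem_nhds hz] with z' hz' hzS v
      refine (hz'.1.bijective_dMap hT hρ hw hi).1 ?_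
      rw [apply_pullI (hz'.1.bijective_dMap hT hρ hw hi)]
      exact hcpx x u z' hzS hz'.2 v
  · obtain ⟨x, u, hu⟩ := h z hz
    obtain ⟨U, hU, hinj⟩ := hu.self_of_nhds.1.exists_injOn_coordMap hT hρ hw hi
    obtain ⟨O, hOs, hO, hzO⟩ := mem_nhds_iff.1
      (Filter.inter_mem (Filter.inter_mem hu hU) (hS.mem_nhds hz))
    refine ⟨O, hO, hzO, fun z' hz' => (hOs hz').2,
      coordMap u (zeroSec x) (starRingEnd ℂ w / T), fun z' hz' =>
      (((hOs hz').1.1.1.contMDiffAt_coordMap _).of_le le_top).contMDiffWithinAt,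
      hinj.mono fun z' hz' => (hOs hz').1.2, fun z' hz' => ?_⟩
    have h1 : cDeriv (coordMap u (zeroSec x) (starRingEnd ℂ w / T)) z' =
        dChart u (zeroSec x) (starRingEnd ℂ w / T) z' :=
      ((hOs hz').1.1.1.hasMFDerivAt_coordMap _).mfderiv
    rw [h1]
    exact ⟨(hOs hz').1.1.1.bijective_dChart hT hρ hw hi,
      hcpx x u z' (hOs hz').2 (hOs hz').1.1.2⟩

theorem isKaehlerOn_of_isPositiveLagrangian (hβ : β.IsCk ω) (hd : β.d = 0) {J : EndField n M}
    {S : Set (Cot n M)} (hJ : IsComplexStructureOn J S)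
    (h : ∀ z ∈ S, IsPositiveLagrangian (twistedForm β z) (type10 (J z))) :
    IsKaehlerOn J (twistedForm β) S :=
  ⟨hJ, fun z => ((isCk_twistedForm hβ) z).of_le le_top, fun z _ => d_twistedForm hβ hd z,
    fun z hz => (compatible_of_isPositiveLagrangian (hJ.2.1 z hz) (h z hz)).1,
    fun z hz => (compatible_of_isPositiveLagrangian (hJ.2.1 z hz) (h z hz)).2⟩

/-- The radius is fixed by `R` and `ε` before `w` is given, because the local estimates are uniform
on the closed disk of times. -/
theorem IsContinuation.exists_tube [CompactSpace M] [T2Space M] (hβ : β.IsCk ω) (hd : β.d = 0)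
    {R ε : ℝ} (hR : 0 < R) (hε : 0 < ε) {Q : (z : Cot n M) → ℂ → Submodule ℂ (TCotC z)}
    (hQ : IsContinuation g β R ε Q) : ∃ r > 0, r ≤ R ∧
      (∀ w ∈ Metric.ball (0 : ℂ) (1 + ε), w.im ≠ 0 →
        (∀ z ∈ tube g r, ∀ Z ∈ Q z w, conjC Z ∈ Q z w → Z = 0) ∧
        ∃ J : EndField n M,
          (IsComplexStructureOn J (tube g r) ∧
            ∀ z ∈ tube g r, type10 (J z) = Q z w) ∧
          ∀ J' : EndField n M,
            IsComplexStructureOn J' (tube g r) →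
            (∀ z ∈ tube g r, type10 (J' z) = Q z w) →
            ∀ z ∈ tube g r, J' z = J z) ∧
      (∀ w ∈ Metric.ball (0 : ℂ) (1 + ε), 0 < w.im →
        (∀ z ∈ tube g r,
          IsPositiveLagrangian (twistedForm β z) (Q z w)) ∧
        ∀ J : EndField n M,
          IsComplexStructureOn J (tube g r) →
          (∀ z ∈ tube g r, type10 (J z) = Q z w) →
          IsKaehlerOn J (twistedForm β) (tube g r)) := by
  -- The time scale only has to exceed the radius `1 + ε` of the given disk, however large `ε` is.
  have hT : 0 < 2 + ε := by linarith
  have hρ : 1 + ε < 2 + ε := by linarith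
  obtain ⟨r₀, hr₀, had⟩ := exists_tube_adapted g hβ hd hT hρ
  have hr : 0 < min r₀ R := lt_min hr₀ hR
  have hsub := tube_subset_tube g hr (min_le_left r₀ R)
  have hsubR := tube_subset_tube g hr (min_le_right r₀ R)
  have hQP : ∀ (x : M) (u : VM n → L1 (VM n)), ∀ z ∈ tube g (min r₀ R),
      IsAdaptedAt g β (2 + ε) (1 + ε) x u z → ∀ w ∈ Metric.ball (0 : ℂ) (1 + ε),
      Q z w = localP u (2 + ε) (zeroSec x) z w := fun x u z hz h w hw =>
    (hQ.1 z (hsubR hz)).eq (h.isContinuationAt hT hρ) hw hw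
  have hpos : ∀ w ∈ Metric.ball (0 : ℂ) (1 + ε), 0 < w.im → ∀ z ∈ tube g (min r₀ R),
      IsPositiveLagrangian (twistedForm β z) (Q z w) := by
    intro w hw hi z hz
    obtain ⟨x, u, hu⟩ := had z (hsub hz)
    rw [hQP x u z hz hu.self_of_nhds w hw]
    exact hu.self_of_nhds.isPositiveLagrangian hT hw hi
  refine ⟨min r₀ R, hr, min_le_right _ _, fun w hw hi => ⟨fun z hz Z hZ hZ' => ?_, ?_⟩,
    fun w hw hi => ⟨hpos w hw hi, fun J hJ hJQ => ?_⟩⟩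
  · obtain ⟨x, u, hu⟩ := had z (hsub hz)
    rw [hQP x u z hz hu.self_of_nhds w hw] at hZ hZ'
    exact hu.self_of_nhds.transverse hT hw hi hZ hZ'
  · have hex : ∀ z : Cot n M, ∃ A : TCot z →L[ℝ] TCot z, z ∈ tube g (min r₀ R) →
        (∀ ξ, A (A ξ) = -ξ) ∧ type10 A = Q z w := by
      intro z
      by_cases hz : z ∈ tube g (min r₀ R)
      · obtain ⟨x, u, hu⟩ := had z (hsub hz)
        refine ⟨pullI (dChart u (zeroSec x) (starRingEnd ℂ w / (2 + ε : ℝ)) z), fun _ => ⟨?_, ?_⟩⟩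
        · exact pullI_pullI (hu.self_of_nhds.bijective_dChart hT hρ hw hi)
        · rw [hQP x u z hz hu.self_of_nhds w hw]
          exact hu.self_of_nhds.type10_pullI hT hρ hw hi
      · exact ⟨0, fun h => absurd h hz⟩
    choose J hJ using hex
    refine ⟨J, ⟨?_, fun z hz => (hJ z hz).2⟩, fun J' hJ' hJQ' z hz => ?_⟩
    · refine isComplexStructureOn_of_adapted (g := g) (β := β) hT hρ hw hi (isOpen_tube g _)
        (fun z hz => (hJ z hz).1) fun z hz => ?_
      obtain ⟨x, u, hu⟩ := had z (hsub hz)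
      refine ⟨x, u, ?_⟩
      filter_upwards [hu, (isOpen_tube g (min r₀ R)).mem_nhds hz] with z' hz' hzt
      exact ⟨hz', (hJ z' hzt).2.trans (hQP x u z' hzt hz' w hw)⟩
    · exact eq_of_type10_le (hJ z hz).1 ((hJ z hz).2.trans (hJQ' z hz).symm).le
  · exact isKaehlerOn_of_isPositiveLagrangian hβ hd hJ fun z hz => by
      rw [hJQ z hz]
      exact hpos w hw hi z hz

end ComplexStructures

/-! ### Fibre inversion and the reversal of the magnetic field -/

section FibreInversion

variable {n : ℕ} {M : Type*} [TopologicalSpace M] [ChartedSpace (EuclideanSpace ℝ (Fin n)) M]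
  [IsManifold (𝓡 n) ω M] {g : AnalyticMetric n M} {β : DiffForm (𝓡 n) M 2}

theorem DiffForm.inChart_neg {E H N : Type*} [NormedAddCommGroup E] [NormedSpace ℝ E]
    [TopologicalSpace H] {I : ModelWithCorners ℝ E H} [TopologicalSpace N] [ChartedSpace H N] {k : ℕ}
    (α : DiffForm I N k) (x : N) : (-α).inChart x = fun y => -α.inChart x y := rfl

theorem DiffForm.IsCk.neg {E H N : Type*} [NormedAddCommGroup E] [NormedSpace ℝ E]
    [TopologicalSpace H] {I : ModelWithCorners ℝ E H} [TopologicalSpace N] [ChartedSpace H N] {k : ℕ}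
    {α : DiffForm I N k} {m : WithTop ℕ∞} (h : α.IsCk m) : (-α).IsCk m := fun x => (h x).neg

theorem d_neg_eq_zero (h : β.d = 0) : (-β).d = 0 := by
  funext x
  have h1 := congrFun h x
  have h2 : extDeriv (fun y => -β.inChart x y) (extChartAt (𝓡 n) x x) =
      -extDeriv (β.inChart x) (extChartAt (𝓡 n) x x) := by
    simp only [extDeriv, fderiv_fun_neg]
    exact map_neg (ContinuousAlternatingMap.alternatizeUncurryFinCLM ℝ _ _) _
  rw [DiffForm.d, DiffForm.inChart_neg, h2]
  have h3 : ∀ (A : EuclideanSpace ℝ (Fin n) [⋀^Fin 3]→L[ℝ] ℝ)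
      (L : EuclideanSpace ℝ (Fin n) →L[ℝ] EuclideanSpace ℝ (Fin n)),
      A.compContinuousLinearMap L = 0 → (-A).compContinuousLinearMap L = 0 := by
    intro A L h
    refine ContinuousAlternatingMap.ext fun v => ?_
    have h4 := congrArg (fun B : EuclideanSpace ℝ (Fin n) [⋀^Fin 3]→L[ℝ] ℝ => B v) h
    change -A (fun i => L (v i)) = 0
    exact neg_eq_zero.2 h4
  exact h3 _ _ h1

/-- Fibre inversion in the model space. -/
def negSnd (n : ℕ) : VM n →L[ℝ] VM n :=
  (ContinuousLinearMap.fst ℝ _ _).prod (-ContinuousLinearMap.snd ℝ _ _)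

theorem negSnd_apply (v : VM n) : negSnd n v = (v.1, -v.2) := rfl

@[simp] theorem fiberInv_fiberInv (z : Cot n M) : fiberInv (fiberInv z) = z := by
  obtain ⟨x, p⟩ := z
  exact congrArg (fun q : Covec n => (⟨x, q⟩ : Cot n M)) (neg_neg p)

theorem fiberInv_mem_source {z₀ z : Cot n M} (hz : z ∈ (extChartAt (cotModel n) z₀).source) :
    fiberInv z ∈ (extChartAt (cotModel n) z₀).source :=
  mem_cotChart_source.2 (mem_cotChart_source.1 hz)

theorem cotChart_fiberInv {z₀ z : Cot n M} (hz : z ∈ (extChartAt (cotModel n) z₀).source) :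
    extChartAt (cotModel n) z₀ (fiberInv z) = negSnd n (extChartAt (cotModel n) z₀ z) := by
  rw [cotChart_apply hz, cotChart_apply (fiberInv_mem_source hz)]
  exact Prod.ext rfl (ContinuousLinearMap.neg_comp _ _)

theorem negSnd_mem_target {z₀ : Cot n M} {y : VM n} (hy : y ∈ (extChartAt (cotModel n) z₀).target) :
    negSnd n y ∈ (extChartAt (cotModel n) z₀).target := by
  rw [cotChart_target] at hy ⊢
  exact ⟨hy.1, mem_univ _⟩

theorem fiberInv_cotChart_symm {z₀ : Cot n M} {y : VM n}
    (hy : y ∈ (extChartAt (cotModel n) z₀).target) :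
    fiberInv ((extChartAt (cotModel n) z₀).symm y) =
      (extChartAt (cotModel n) z₀).symm (negSnd n y) := by
  have h := (extChartAt (cotModel n) z₀).map_target hy
  rw [← (extChartAt (cotModel n) z₀).left_inv (fiberInv_mem_source h), cotChart_fiberInv h,
    (extChartAt (cotModel n) z₀).right_inv hy]

theorem hasMFDerivAt_fiberInv {z₀ z : Cot n M} (hz : z ∈ (extChartAt (cotModel n) z₀).source) :
    HasMFDerivAt (cotModel n) (cotModel n) fiberInv z
      ((chartSymmDeriv (cotModel n) z₀ (negSnd n (extChartAt (cotModel n) z₀ z))).comp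
        ((negSnd n).comp (chartDeriv (cotModel n) z₀ z)) : VM n →L[ℝ] VM n) := by
  have ht := (extChartAt (cotModel n) z₀).map_source hz
  refine hasMFDerivAt_of_chart (I := cotModel n) (F := negSnd n) hz (negSnd n).hasFDerivAt
    (negSnd_mem_target ht) ?_
  filter_upwards [(isOpen_extChartAt_target z₀).mem_nhds ht] with y hy
  exact fiberInv_cotChart_symm hy

theorem contMDiff_fiberInv :
    ContMDiff (cotModel n) (cotModel n) ω (fiberInv (n := n) (M := M)) := by
  intro z
  have hz := mem_extChartAt_source (I := cotModel n) z
  have h1 : ContMDiffAt (cotModel n) (cotModel n) ω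
      (fun z' => (extChartAt (cotModel n) z).symm (negSnd n (extChartAt (cotModel n) z z'))) z :=
    (contMDiffAt_chartSymm z (negSnd_mem_target (mem_extChartAt_target z))).comp z
      ((negSnd n).contDiff.contDiffAt.contMDiffAt.comp z (contMDiffAt_chart z hz))
  refine h1.congr_of_eventuallyEq ?_
  filter_upwards [(isOpen_extChartAt_source z).mem_nhds hz] with z' hz'
  rw [← cotChart_fiberInv hz', (extChartAt (cotModel n) z).left_inv (fiberInv_mem_source hz')]

theorem mdifferentiable_fiberInv :
    MDifferentiable (cotModel n) (cotModel n) (fiberInv (n := n) (M := M)) :=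
  contMDiff_fiberInv.mdifferentiable (by simp)

/-- The differential of the fibre inversion. -/
def fiberInvD (z : Cot n M) : VM n →L[ℝ] VM n :=
  (mfderiv (cotModel n) (cotModel n) fiberInv z :)

theorem fiberInvD_eq {z₀ z : Cot n M} (hz : z ∈ (extChartAt (cotModel n) z₀).source) (v : VM n) :
    chartDeriv (cotModel n) z₀ (fiberInv z) (fiberInvD z v) =
      negSnd n (chartDeriv (cotModel n) z₀ z v) := by
  have h1 : fiberInvD z v = chartSymmDeriv (cotModel n) z₀ (negSnd n (extChartAt (cotModel n) z₀ z))
      (negSnd n (chartDeriv (cotModel n) z₀ z v)) :=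
    congrArg (fun A : VM n →L[ℝ] VM n => A v) (hasMFDerivAt_fiberInv hz).mfderiv
  have ht := negSnd_mem_target ((extChartAt (cotModel n) z₀).map_source hz)
  have h2 := chartDeriv_chartSymmDeriv (I := cotModel n) z₀ ht
    (negSnd n (chartDeriv (cotModel n) z₀ z v))
  rw [← cotChart_fiberInv hz, (extChartAt (cotModel n) z₀).left_inv (fiberInv_mem_source hz),
    cotChart_fiberInv hz] at h2
  rw [h1, h2]

theorem fiberInvD_fiberInvD (z : Cot n M) (v : VM n) :
    fiberInvD (fiberInv z) (fiberInvD z v) = v := by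
  have h1 := (mdifferentiable_fiberInv (fiberInv z)).hasMFDerivAt.comp z
    (mdifferentiable_fiberInv z).hasMFDerivAt
  have h2 : (fiberInv ∘ fiberInv : Cot n M → Cot n M) = id := funext fiberInv_fiberInv
  rw [h2] at h1
  exact congrArg (fun A : VM n →L[ℝ] VM n => A v)
    (hasMFDerivAt_unique h1 (hasMFDerivAt_id (I := cotModel n) z))

theorem fiberInvD_fiberInvD' (z : Cot n M) (v : VM n) :
    fiberInvD z (fiberInvD (fiberInv z) v) = v := by
  have h := fiberInvD_fiberInvD (fiberInv z) v
  rwa [fiberInv_fiberInv] at h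

theorem projDeriv_fiberInvD (z : Cot n M) (v : VM n) :
    projDeriv (fiberInv z) (fiberInvD z v) = projDeriv z v := by
  have h1 := (mdifferentiable_proj (fiberInv z)).hasMFDerivAt.comp z
    (mdifferentiable_fiberInv z).hasMFDerivAt
  have h2 : (proj ∘ fiberInv : Cot n M → M) = proj := rfl
  rw [h2] at h1
  exact (congrArg (fun A : VM n →L[ℝ] EuclideanSpace ℝ (Fin n) => A v) h1.mfderiv).symm

theorem normSq_fiberInv (g : AnalyticMetric n M) (z : Cot n M) :
    normSq g (fiberInv z) = normSq g z := by
  obtain ⟨v, hv'⟩ : ∃ v : EuclideanSpace ℝ (Fin n), metricVal g z.proj v = z.snd :=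
    exists_sharp g z.proj z.snd
  have hv'' : metricVal g z.proj (-v) = -(z.snd : Covec n) := by
    rw [map_neg]
    exact congrArg Neg.neg hv'
  rw [normSq_eq g z hv', normSq_eq g (fiberInv z) (v := -v) hv'']
  have h : ∀ p : Covec n, (-p) (-v) = p v := fun p => by rw [neg_apply, map_neg, neg_neg]
  exact h z.snd

theorem energy_fiberInv (g : AnalyticMetric n M) (z : Cot n M) :
    energy g (fiberInv z) = energy g z := by
  rw [energy, energy, normSq_fiberInv]

theorem energyDeriv_fiberInvD (g : AnalyticMetric n M) (z : Cot n M) (v : VM n) :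
    energyDeriv g (fiberInv z) (fiberInvD z v) = energyDeriv g z v := by
  have h1 := (((contMDiff_energy g).mdifferentiable (by simp)) (fiberInv z)).hasMFDerivAt.comp z
    (mdifferentiable_fiberInv z).hasMFDerivAt
  have h2 : energy g ∘ fiberInv = energy g := funext (energy_fiberInv g)
  rw [h2] at h1
  exact (congrArg (fun A : VM n →L[ℝ] ℝ => A v) h1.mfderiv).symm

/-- Inversion changes the sign of the canonical part and keeps the magnetic part, so `ν^* ω^β =
-ω^{-β}`. -/
theorem modelForm_negSnd
    (b : EuclideanSpace ℝ (Fin n) → (EuclideanSpace ℝ (Fin n)) [⋀^Fin 2]→L[ℝ] ℝ) (y v w : VM n) :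
    modelForm b (negSnd n y) ![negSnd n v, negSnd n w] =
      -modelForm (fun y => -b y) y ![v, w] := by
  rw [modelForm_apply, modelForm_apply]
  have h1 : (-b y.1) ![v.1, w.1] = -b y.1 ![v.1, w.1] := rfl
  rw [h1]
  simp only [negSnd_apply, neg_apply]
  ring

theorem twistedForm_fiberInvD (β : DiffForm (𝓡 n) M 2) (z : Cot n M) (v w : VM n) :
    (twistedForm β).val (fiberInv z) ![fiberInvD z v, fiberInvD z w] =
      -(twistedForm (-β)).val z ![v, w] := by
  have hz := mem_extChartAt_source (I := cotModel n) z
  rw [twistedForm_val β z (fiberInv_mem_source hz), twistedForm_val (-β) z hz, fiberInvD_eq hz,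
    fiberInvD_eq hz, cotChart_fiberInv hz, modelForm_negSnd, DiffForm.inChart_neg]

theorem twistedForm_neg_fiberInvD (β : DiffForm (𝓡 n) M 2) (z : Cot n M) (v w : VM n) :
    (twistedForm (-β)).val z ![-fiberInvD (fiberInv z) v, w] =
      (twistedForm β).val (fiberInv z) ![v, fiberInvD z w] := by
  have h1 := twistedForm_fiberInvD (-β) (fiberInv z) v (fiberInvD z w)
  rw [neg_neg, fiberInv_fiberInv, fiberInvD_fiberInvD] at h1
  rw [form_neg_left, h1, neg_neg]

/-- The energy is invariant while the symplectic form changes sign, so `ν_* X^β = -X^{-β}`. -/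
theorem isHamiltonianField_neg {X : (z : Cot n M) → TCot z} (hX : IsHamiltonianField g β X) :
    IsHamiltonianField g (-β) (fun z => -fiberInvD (fiberInv z) (X (fiberInv z))) := fun z ξ =>
  ((twistedForm_neg_fiberInvD β z (X (fiberInv z)) ξ).trans
    (hX (fiberInv z) (fiberInvD z ξ))).trans (energyDeriv_fiberInvD g z ξ)

variable [CompactSpace M] [T2Space M]

/-- Inverting a time-reversed integral curve for `β` gives one for `-β`; uniqueness identifies the
flows. -/
theorem magneticFlow_neg_form (hβ : β.IsCk ω) (t : ℝ) (z : Cot n M) :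
    magneticFlow g (-β) t z = fiberInv (magneticFlow g β (-t) (fiberInv z)) := by
  obtain ⟨X, hX⟩ := exists_isHamiltonianField g β
  set γ : ℝ → Cot n M := fun t => fiberInv (magneticFlow g β (-t) (fiberInv z)) with hγ
  have h1 : IsMIntegralCurve (I := cotModel n) γ
      (fun z => -fiberInvD (fiberInv z) (X (fiberInv z))) := by
    intro s
    have h2 := ((magneticFlow_isMIntegralCurve hβ hX (fiberInv z)).comp_mul (-1)) s
    have h3 := (mdifferentiable_fiberInv _).hasMFDerivAt.comp s h2
    have h4 : (fiberInv ∘ (fun σ => magneticFlow g β σ (fiberInv z)) ∘ (fun x => x * -1)) = γ := by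
      funext s
      simp [hγ]
    rw [h4] at h3
    refine h3.congr_mfderiv ?_
    refine ContinuousLinearMap.ext fun (r : ℝ) => ?_
    have h5 : fiberInv (γ s) = magneticFlow g β (s * -1) (fiberInv z) := by
      simp [hγ]
    have h6 : ∀ (X : Cot n M → VM n) (y y' : Cot n M), y = y' →
        fiberInvD y (r • ((-1 : ℝ) • X y)) = r • -fiberInvD y' (X y') := by
      rintro X y _ rfl
      rw [map_smul, neg_one_smul, map_neg]
    exact h6 X _ _ h5.symm
  have h7 := magneticFlow_eq_of_isMIntegralCurve (hβ.neg) (isHamiltonianField_neg hX) h1 t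
  have h8 : γ 0 = z := by
    simp only [hγ, neg_zero]
    rw [magneticFlow_zero hβ, fiberInv_fiberInv]
  rwa [h8] at h7

theorem flowD_neg_form (hβ : β.IsCk ω) (t : ℝ) (z : Cot n M) (v : VM n) :
    flowD g (-β) t (fiberInv z) v = fiberInvD (magneticFlow g β (-t) z)
      (flowD g β (-t) z (fiberInvD (fiberInv z) v)) := by
  have h1 : magneticFlow g (-β) t = fiberInv ∘ magneticFlow g β (-t) ∘ fiberInv :=
    funext fun z => magneticFlow_neg_form hβ t z
  by_cases h : MDifferentiableAt (cotModel n) (cotModel n) (magneticFlow g β (-t)) z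
  · have h2 : HasMFDerivAt (cotModel n) (cotModel n) (magneticFlow g β (-t))
        (fiberInv (fiberInv z)) (flowD g β (-t) z) := by
      rw [fiberInv_fiberInv]
      exact h.hasMFDerivAt
    have h3 := h2.comp (fiberInv z) (mdifferentiable_fiberInv (fiberInv z)).hasMFDerivAt
    have h4 : HasMFDerivAt (cotModel n) (cotModel n) fiberInv
        ((magneticFlow g β (-t) ∘ fiberInv) (fiberInv z))
        (fiberInvD (magneticFlow g β (-t) z)) := by
      rw [Function.comp_apply, fiberInv_fiberInv]
      exact (mdifferentiable_fiberInv _).hasMFDerivAt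
    have h5 := h4.comp (fiberInv z) h3
    rw [← h1] at h5
    exact congrArg (fun A : VM n →L[ℝ] VM n => A v) h5.mfderiv
  -- Away from the zero section, differentiability of the flow has not been established. If it
  -- fails, it fails on both sides, and both derivatives have the default value `0`.
  · have h2 : ¬ MDifferentiableAt (cotModel n) (cotModel n) (magneticFlow g (-β) t)
        (fiberInv z) := by
      intro h3
      refine h ?_
      have h4 : magneticFlow g β (-t) = fiberInv ∘ magneticFlow g (-β) t ∘ fiberInv := by
        rw [h1]
        funext y
        simp
      rw [h4]
      exact (mdifferentiable_fiberInv _).comp z (h3.comp z (mdifferentiable_fiberInv z))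
    have h3 : flowD g (-β) t (fiberInv z) = 0 := mfderiv_zero_of_not_mdifferentiableAt h2
    have h4 : flowD g β (-t) z = 0 := mfderiv_zero_of_not_mdifferentiableAt h
    rw [h3, h4]
    exact (map_zero (fiberInvD (magneticFlow g β (-t) z))).symm

/-- The real subspace whose complexification is `P_z(σ)`. -/
def realP (g : AnalyticMetric n M) (β : DiffForm (𝓡 n) M 2) (z : Cot n M) (σ : ℝ) :
    Submodule ℝ (VM n) :=
  (LinearMap.ker (projDeriv (magneticFlow g β (-σ) z)).toLinearMap).map
    (flowD g β σ (magneticFlow g β (-σ) z)).toLinearMap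

theorem map_baseChange_eq {V W : Type*} [AddCommGroup V] [Module ℝ V] [AddCommGroup W] [Module ℝ W]
    (f : V →ₗ[ℝ] W) (p : Submodule ℝ V) :
    (p.baseChange ℂ).map (f.baseChange ℂ) = (p.map f).baseChange ℂ := by
  ext Z
  rw [mem_baseChange_iff]
  constructor
  · rintro ⟨Y, hY, rfl⟩
    have h := (mem_baseChange_iff p Y).1 hY
    rw [reC_baseChange, imC_baseChange]
    exact ⟨⟨_, h.1, rfl⟩, ⟨_, h.2, rfl⟩⟩
  · rintro ⟨⟨a, ha, ha'⟩, ⟨b, hb, hb'⟩⟩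
    refine ⟨mkC a b, (mem_baseChange_iff p _).2 ?_, extC ?_ ?_⟩
    · rw [reC_mkC, imC_mkC]
      exact ⟨ha, hb⟩
    · rw [reC_baseChange, reC_mkC, ha']
    · rw [imC_baseChange, imC_mkC, hb']

theorem PVal_eq_realP (z : Cot n M) (σ : ℝ) : PVal g β z σ = (realP g β z σ).baseChange ℂ :=
  map_baseChange_eq (flowD g β σ (magneticFlow g β (-σ) z)).toLinearMap
    (LinearMap.ker (projDeriv (magneticFlow g β (-σ) z)).toLinearMap)

theorem conjSubmodule_PVal (z : Cot n M) (σ : ℝ) :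
    conjSubmodule (PVal g β z σ) = PVal g β z σ := by
  ext Z
  rw [mem_conjSubmodule, PVal_eq_realP, mem_baseChange_iff, mem_baseChange_iff, reC_conjC,
    imC_conjC, neg_mem_iff]

/-- Inversion preserves the vertical spaces and exchanges the flow of `-β` with the reversed flow of
`β`, so it sends `P_z(-σ)` to the space of `-β` at time `σ`. -/
theorem realP_neg_form (hβ : β.IsCk ω) (z : Cot n M) (σ : ℝ) :
    realP g (-β) (fiberInv z) σ = (realP g β z (-σ)).map (fiberInvD z).toLinearMap := by
  have h1 : magneticFlow g (-β) (-σ) (fiberInv z) = fiberInv (magneticFlow g β σ z) := by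
    rw [magneticFlow_neg_form hβ, neg_neg, fiberInv_fiberInv]
  have h2 := magneticFlow_cancel_neg (g := g) hβ σ z
  have h3 : ∀ v, flowD g (-β) σ (fiberInv (magneticFlow g β σ z)) v =
      fiberInvD z (flowD g β (-σ) (magneticFlow g β σ z)
        (fiberInvD (fiberInv (magneticFlow g β σ z)) v)) := by
    intro v
    rw [flowD_neg_form hβ, h2]
  rw [realP, realP, h1, neg_neg]
  set y := magneticFlow g β σ z
  ext v
  constructor
  · rintro ⟨a, ha, rfl⟩
    refine ⟨flowD g β (-σ) y (fiberInvD (fiberInv y) a), ⟨fiberInvD (fiberInv y) a, ?_, rfl⟩,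
      (h3 a).symm⟩
    have h4 := projDeriv_fiberInvD (fiberInv y) a
    rw [fiberInv_fiberInv] at h4
    exact h4.trans ha
  · rintro ⟨_, ⟨a, ha, rfl⟩, rfl⟩
    refine ⟨fiberInvD y a, (projDeriv_fiberInvD y a).trans ha, ?_⟩
    have h4 := h3 (fiberInvD y a)
    rw [fiberInvD_fiberInvD] at h4
    exact h4

end FibreInversion

/-! ### Existence, uniqueness and symmetry of magnetic complex structures -/

section MagneticStructures

variable {n : ℕ} {M : Type*} [TopologicalSpace M] [ChartedSpace (EuclideanSpace ℝ (Fin n)) M]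
  [IsManifold (𝓡 n) ω M] {g : AnalyticMetric n M} {β : DiffForm (𝓡 n) M 2} {R r : ℝ}
  {J J' : EndField n M}

theorem IsComplexStructureOn.mono {S S' : Set (Cot n M)} (h : IsComplexStructureOn J S)
    (hS' : IsOpen S') (hs : S' ⊆ S) : IsComplexStructureOn J S' := by
  refine ⟨h.1.mono hs, fun z hz => h.2.1 z (hs hz), fun z hz => ?_⟩
  obtain ⟨U, hU, hzU, -, F, hF, hinj, hD⟩ := h.2.2 z (hs hz)
  exact ⟨U ∩ S', hU.inter hS', ⟨hzU, hz⟩, inter_subset_right, F, hF.mono inter_subset_left,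
    hinj.mono inter_subset_left, fun y hy => hD y hy.1⟩

theorem IsKaehlerOn.mono {w : DiffForm (cotModel n) (Cot n M) 2} {S S' : Set (Cot n M)}
    (h : IsKaehlerOn J w S) (hS' : IsOpen S') (hs : S' ⊆ S) : IsKaehlerOn J w S' :=
  ⟨h.1.mono hS' hs, h.2.1, fun z hz => h.2.2.1 z (hs hz), fun z hz => h.2.2.2.1 z (hs hz),
    fun z hz => h.2.2.2.2 z (hs hz)⟩

theorem IsMagneticComplexStructure.mono (h : IsMagneticComplexStructure g β R J) (hr : 0 < r)
    (hrR : r ≤ R) : IsMagneticComplexStructure g β r J :=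
  ⟨h.1.mono (isOpen_tube g r) (tube_subset_tube g hr hrR),
    fun z hz => h.2 z (tube_subset_tube g hr hrR hz)⟩

theorem I_mem_ball {ρ : ℝ} (hρ : 1 < ρ) : Complex.I ∈ Metric.ball (0 : ℂ) ρ := by
  rw [mem_ball_zero_iff, Complex.norm_I]
  exact hρ

/-- The definition lets the disk and the continuation vary with the point and the structure, but `i`
lies in every such disk and continuations agree there. -/
theorem IsMagneticComplexStructure.unique (h : IsMagneticComplexStructure g β R J)
    (h' : IsMagneticComplexStructure g β R J') {z : Cot n M} (hz : z ∈ tube g R) :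
    J' z = J z := by
  obtain ⟨ρ, hρ, S, hS, hJS⟩ := h.2 z hz
  obtain ⟨ρ', hρ', S', hS', hJS'⟩ := h'.2 z hz
  refine eq_of_type10_le (h.1.2.1 z hz) (le_of_eq ?_)
  rw [hJS, hJS']
  exact hS.eq hS' (I_mem_ball hρ) (I_mem_ball hρ')

/-- The differential of the zero-section. -/
def zeroSecD (x : M) : EuclideanSpace ℝ (Fin n) →L[ℝ] VM n :=
  (mfderiv (𝓡 n) (cotModel n) (zeroSec (n := n)) x :)

theorem contMDiff_zeroSec : ContMDiff (𝓡 n) (cotModel n) ω (zeroSec (n := n) (M := M)) :=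
  Bundle.contMDiff_zeroSection ℝ (fun x : M => TangentSpace (𝓡 n) x →L[ℝ] ℝ)

theorem projDeriv_zeroSecD (x : M) (v : EuclideanSpace ℝ (Fin n)) :
    projDeriv (zeroSec x) (zeroSecD x v) = v := by
  have h1 := (mdifferentiable_proj (zeroSec (n := n) x)).hasMFDerivAt.comp x
    ((contMDiff_zeroSec (n := n)).mdifferentiable (by simp) x).hasMFDerivAt
  have h2 : (proj ∘ zeroSec (n := n) : M → M) = id := rfl
  rw [h2] at h1
  exact congrArg (fun A : EuclideanSpace ℝ (Fin n) →L[ℝ] EuclideanSpace ℝ (Fin n) => A v)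
    (hasMFDerivAt_unique h1 (hasMFDerivAt_id (I := 𝓡 n) x))

/-- In a cotangent chart the zero section has constant covector component `0`. -/
theorem chartDeriv_zeroSecD_snd (x : M) (v : EuclideanSpace ℝ (Fin n)) :
    (chartDeriv (cotModel n) (zeroSec (n := n) x) (zeroSec (n := n) x) (zeroSecD x v)).2 = 0 := by
  have hz := mem_extChartAt_source (I := cotModel n) (zeroSec (n := n) x)
  have h0 := (ContinuousLinearMap.snd ℝ (EuclideanSpace ℝ (Fin n)) (Covec n)).hasMFDerivAt
    (x := extChartAt (cotModel n) (zeroSec (n := n) x) (zeroSec x))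
  have h1 := h0.comp x ((mdifferentiableAt_chart (I := cotModel n) (zeroSec (n := n) x)
    hz).hasMFDerivAt.comp x
    ((contMDiff_zeroSec (n := n)).mdifferentiable (by simp) x).hasMFDerivAt)
  have h2 : HasMFDerivAt (𝓡 n) 𝓘(ℝ, Covec n) (fun _ : M => (0 : Covec n)) x
      (0 : EuclideanSpace ℝ (Fin n) →L[ℝ] Covec n) := hasMFDerivAt_const _ _
  have h3 := h2.congr_of_eventuallyEq (f₁ := ContinuousLinearMap.snd ℝ (EuclideanSpace ℝ (Fin n)) (Covec n) ∘
    extChartAt (cotModel n) (zeroSec (n := n) x) ∘ zeroSec) (by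
      filter_upwards [(isOpen_extChartAt_source (I := 𝓡 n) x).mem_nhds
        (mem_extChartAt_source x)] with y hy
      have hy' : zeroSec (n := n) y ∈ (extChartAt (cotModel n) (zeroSec (n := n) x)).source :=
        mem_cotChart_source.2 hy
      change (extChartAt (cotModel n) (zeroSec (n := n) x) (zeroSec y)).2 = 0
      rw [cotChart_apply hy']
      exact ContinuousLinearMap.zero_comp _)
  exact congrArg (fun A : EuclideanSpace ℝ (Fin n) →L[ℝ] Covec n => A v)
    (hasMFDerivAt_unique h1 h3)

theorem isEmbedding_zeroSec : Topology.IsEmbedding (zeroSec (n := n) (M := M)) :=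
  Topology.IsEmbedding.of_leftInverse (f := proj) (fun _ => rfl) continuous_proj
    contMDiff_zeroSec.continuous

/-- At the zero-section, the continuation of `P_z` contains no nonzero horizontal vectors. -/
theorem IsAdaptedAt.eq_zero_of_horizontal {T ρ : ℝ} {x : M} {u : VM n → L1 (VM n)} {w : ℂ}
    {z : Cot n M} (h : IsAdaptedAt g β T ρ x u z) (hT : 0 < T) (hw : w ∈ Metric.ball (0 : ℂ) ρ)
    {Z : ℂ ⊗[ℝ] (VM n)} (hZ : Z ∈ localP u T (zeroSec x) z w)
    (h1 : (chartDeriv (cotModel n) (zeroSec x) z (reC Z)).2 = 0)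
    (h2 : (chartDeriv (cotModel n) (zeroSec x) z (imC Z)).2 = 0) : Z = 0 := by
  obtain ⟨c, hc⟩ := (mem_kerC_iff_graph
    (h.unit _ (Metric.ball_subset_closedBall (norm_div_lt hT hw))) _).1 (mem_localP.1 hZ)
  have hre := congrArg reC hc
  have him := congrArg imC hc
  rw [reC_toTensor, reC_baseChange] at hre
  rw [imC_toTensor, imC_baseChange] at him
  have h3 : covE n (reE c) = 0 := (congrArg Prod.snd hre).trans h1
  have h4 : covE n (imE c) = 0 := (congrArg Prod.snd him).trans h2
  have h5 : c = 0 := extE (by rw [(covE n).map_eq_zero_iff.1 h3, map_zero])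
    (by rw [(covE n).map_eq_zero_iff.1 h4, map_zero])
  rw [h5, map_zero] at hre him
  refine eq_zero_iffC.2 ⟨(chartEquiv (I := cotModel n) _ h.mem).map_eq_zero_iff.1 ?_,
    (chartEquiv (I := cotModel n) _ h.mem).map_eq_zero_iff.1 ?_⟩
  · refine hre.symm.trans ?_
    rw [map_zero, map_zero]
    rfl
  · refine him.symm.trans ?_
    rw [map_zero, map_zero]
    rfl

section Compact

variable [CompactSpace M] [T2Space M]

theorem exists_isMagneticComplexStructure (g : AnalyticMetric n M) (hβ : β.IsCk ω)
    (hd : β.d = 0) : ∃ R > 0, ∃ J : EndField n M, IsMagneticComplexStructure g β R J ∧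
      IsKaehlerOn J (twistedForm β) (tube g R) := by
  obtain ⟨R, hR, ε, hε, Q, hQ, -⟩ := exists_isContinuation g hβ hd
  obtain ⟨r, hr, hrR, h1, h2⟩ := hQ.exists_tube hβ hd hR hε
  have hI : Complex.I ∈ Metric.ball (0 : ℂ) (1 + ε) := I_mem_ball (by linarith)
  obtain ⟨-, J, ⟨hJ, hJQ⟩, -⟩ := h1 Complex.I hI (by simp)
  exact ⟨r, hr, J, ⟨hJ, fun z hz => ⟨1 + ε, by linarith, Q z,
    hQ.1 z (tube_subset_tube g hr hrR hz), hJQ z hz⟩⟩, (h2 Complex.I hI (by simp)).2 J hJ hJQ⟩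

theorem IsMagneticComplexStructure.isMaximalTotallyReal (hβ : β.IsCk ω) (hd : β.d = 0)
    (hR : 0 < R) (h : IsMagneticComplexStructure g β R J) : IsMaximalTotallyReal J zeroSec := by
  refine ⟨contMDiff_zeroSec.of_le le_top, isEmbedding_zeroSec, fun x => ?_⟩
  have hinj : Function.Injective (zeroSecD (n := n) x) := fun v v' hv => by
    rw [← projDeriv_zeroSecD x v, ← projDeriv_zeroSecD x v', hv]
  refine ⟨hinj, ?_, ?_⟩
  · have hz := zeroSec_mem_tube g hR x
    -- Any `1 < ρ < T` puts `i` inside the disk. Since the given tube contains the point `(x, 0)`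
    -- itself, no shrinking of the tube is needed.
    obtain ⟨u, hu⟩ := exists_eventually_isAdaptedAt g hβ hd (T := 3) (ρ := 2) (by norm_num)
      (by norm_num) x
    have had := hu.self_of_nhds
    obtain ⟨ρ, hρ, S, hS, hJS⟩ := h.2 _ hz
    have hP : type10 (J (zeroSec x)) = localP u 3 (zeroSec x) (zeroSec x) Complex.I :=
      hJS.trans (hS.eq (had.isContinuationAt (by norm_num) (by norm_num)) (I_mem_ball hρ)
        (I_mem_ball (by norm_num)))
    -- If `a = A b` with `a` and `b` tangent to the zero section, then `b - i A b` lies in `P_z(i)`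
    -- and has no covector component; a graph over the vertical space contains no such vector but
    -- zero.
    have key : ∀ (A : VM n →L[ℝ] VM n), (∀ v, A (A v) = -v) →
        type10 A = localP u 3 (zeroSec x) (zeroSec x) Complex.I →
        Disjoint (LinearMap.range (zeroSecD x).toLinearMap)
          ((LinearMap.range (zeroSecD x).toLinearMap).map A.toLinearMap) := by
      intro A hA hAP
      rw [Submodule.disjoint_def]
      rintro _ ⟨a, rfl⟩ ⟨_, ⟨b, rfl⟩, hb⟩
      have hb' : A (zeroSecD x b) = zeroSecD x a := hb
      have h1 := mkC_mem_type10 hA (zeroSecD x b)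
      rw [hAP] at h1
      have h2 := had.eq_zero_of_horizontal (by norm_num) (I_mem_ball (by norm_num)) h1
        (by rw [reC_mkC]; exact chartDeriv_zeroSecD_snd x b)
        (by
          rw [imC_mkC, hb', map_neg]
          exact neg_eq_zero.2 (chartDeriv_zeroSecD_snd x a))
      have h3 := congrArg imC h2
      rw [imC_mkC, map_zero, hb', neg_eq_zero] at h3
      exact h3
    exact key (J (zeroSec x)) (h.1.2.1 _ hz) hP
  · have h1 : Module.finrank ℝ (LinearMap.range (zeroSecD (n := n) x).toLinearMap) = n := by
      rw [LinearMap.finrank_range_of_inj hinj, finrank_euclideanSpace_fin]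
    have h2 : 2 * Module.finrank ℝ (LinearMap.range (zeroSecD (n := n) x).toLinearMap) =
        Module.finrank ℝ (VM n) := by rw [h1, finrank_VM]
    exact h2

/-- The relation at real times is `P^{-β}_{ν z}(σ) = ν_* P_z(-σ)`, and `w ↦ -w` preserves the disk.
-/
theorem IsContinuationAt.fiberInv (hβ : β.IsCk ω) {z : Cot n M} {ρ : ℝ}
    {S : ℂ → Submodule ℂ (ℂ ⊗[ℝ] (VM n))} (hS : IsContinuationAt g β z ρ S) :
    IsContinuationAt g (-β) (fiberInv z) ρ
      (fun w => (S (-w)).map ((fiberInvD z).toLinearMap.baseChange ℂ)) := by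
  refine ⟨?_, fun σ hσ => ?_⟩
  · exact (hS.1.comp (f := fun w => -w) (by fun_prop) (D' := Metric.ball 0 ρ) fun w hw => by
      rw [mem_ball_zero_iff] at hw ⊢
      rwa [norm_neg]).map ((LinearEquiv.ofLinearMap (fiberInvD z).toLinearMap
        (fiberInvD (MagneticFlow.fiberInv z)).toLinearMap
        (LinearMap.ext fun v => fiberInvD_fiberInvD' z v)
        (LinearMap.ext fun v => fiberInvD_fiberInvD z v)).baseChange ℝ ℂ (VM n) (VM n))
  · have h1 : S (-(σ : ℂ)) = PVal g β z (-σ) := by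
      have h2 := hS.2 (-σ) (by rwa [abs_neg])
      rw [Complex.ofReal_neg] at h2
      exact h2
    have h3 : PVal g (-β) (MagneticFlow.fiberInv z) σ =
        (S (-(σ : ℂ))).map ((fiberInvD z).toLinearMap.baseChange ℂ) := by
      rw [h1, PVal_eq_realP, PVal_eq_realP, map_baseChange_eq, realP_neg_form hβ]
    exact h3.symm

/-- Compare real and imaginary parts for the image of `v + i A v`, the conjugate of the
`(1,0)`-vector `v - i A v`. -/
theorem antiholomorphic_of_type10 {V W : Type*} [AddCommGroup V] [Module ℝ V] [TopologicalSpace V]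
    [AddCommGroup W] [Module ℝ W] [TopologicalSpace W] {A : V →L[ℝ] V} {B : W →L[ℝ] W}
    (hA : ∀ v, A (A v) = -v) {f : V →ₗ[ℝ] W} (h : type10 B =
      (conjSubmodule (type10 A)).map (f.baseChange ℂ)) (v : V) : f (A v) = -B (f v) := by
  have h1 : f.baseChange ℂ (mkC v (A v)) ∈ type10 B := by
    rw [h]
    refine Submodule.mem_map_of_mem ?_
    rw [mem_conjSubmodule]
    have h2 : conjC (mkC v (A v)) = mkC v (-(A v)) := extC (by simp) (by simp)
    rw [h2]
    exact mkC_mem_type10 hA v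
  have h3 := (mem_type10.1 h1).1
  rw [reC_baseChange, imC_baseChange, reC_mkC, imC_mkC] at h3
  rw [h3, neg_neg]

theorem map_type10_eq_type01 {V W : Type*} [AddCommGroup V] [Module ℝ V] [TopologicalSpace V]
    [AddCommGroup W] [Module ℝ W] [TopologicalSpace W] {A : V →L[ℝ] V} {B : W →L[ℝ] W}
    {f : V →ₗ[ℝ] W} {f' : W →ₗ[ℝ] V} (hff' : ∀ v, f (f' v) = v) (hf'f : ∀ v, f' (f v) = v)
    (h : ∀ v, f (A v) = -B (f v)) : (type10 A).map (f.baseChange ℂ) = type01 B := by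
  ext Z
  rw [mem_type01]
  constructor
  · rintro ⟨Y, hY, rfl⟩
    have h1 := mem_type10.1 hY
    rw [reC_baseChange, imC_baseChange]
    constructor
    · rw [← neg_neg (B _), ← h, h1.1, map_neg, neg_neg]
    · rw [← neg_neg (B _), ← h, h1.2]
  · rintro ⟨h1, h2⟩
    refine ⟨f'.baseChange ℂ Z, mem_type10.2 ⟨?_, ?_⟩, extC ?_ ?_⟩
    · rw [reC_baseChange, imC_baseChange]
      refine (hf'f _).symm.trans ?_
      rw [h, hff', h1, map_neg]
    · rw [reC_baseChange, imC_baseChange]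
      refine (hf'f _).symm.trans ?_
      rw [h, hff', h2, neg_neg]
    · rw [reC_baseChange, reC_baseChange, hff']
    · rw [imC_baseChange, imC_baseChange, hff']

/-- At time `i` the space of `-β` is `ν_* P_z(-i)`, and by Schwarz reflection `P_z(-i)` is the
conjugate of `P_z(i)`: `ν` maps type `(0,1)` to type `(1,0)`. -/
theorem IsMagneticComplexStructure.fiberInvD_apply (hβ : β.IsCk ω)
    (h : IsMagneticComplexStructure g β R J) (h' : IsMagneticComplexStructure g (-β) R J')
    {z : Cot n M} (hz : z ∈ tube g R) (v : VM n) :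
    fiberInvD z (J z v) = (-(J' (fiberInv z) (fiberInvD z v) : VM n) : VM n) := by
  have hz' : fiberInv z ∈ tube g R := by
    change normSq g (fiberInv z) < R ^ 2
    rw [normSq_fiberInv]
    exact hz
  obtain ⟨ρ, hρ, S, hS, hJS⟩ := h.2 z hz
  obtain ⟨ρ', hρ', S', hS', hJS'⟩ := h'.2 _ hz'
  have hI := I_mem_ball hρ
  -- Reflection is available because at real time `P_z(σ)` is the complexification of a real
  -- subspace.
  have h1 : conjSubmodule (S (starRingEnd ℂ (-Complex.I))) = S (-Complex.I) := by
    refine hS.1.conj_eq (fun σ hσ => ?_) (by rwa [mem_ball_zero_iff, norm_neg, ← mem_ball_zero_iff])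
    rw [hS.2 σ hσ]
    exact conjSubmodule_PVal z σ
  rw [map_neg, Complex.conj_I, neg_neg, ← hJS] at h1
  have h2 : type10 (J' (fiberInv z)) = (S (-Complex.I)).map
      ((fiberInvD z).toLinearMap.baseChange ℂ) :=
    hJS'.trans (hS'.eq (IsContinuationAt.fiberInv hβ hS) (I_mem_ball hρ') hI)
  rw [← h1] at h2
  exact antiholomorphic_of_type10 (A := (J z : VM n →L[ℝ] VM n))
    (B := (J' (fiberInv z) : VM n →L[ℝ] VM n)) (f := (fiberInvD z).toLinearMap)
    (h.1.2.1 z hz) h2 v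

theorem IsMagneticComplexStructure.antiholomorphic (hβ : β.IsCk ω)
    (h : IsMagneticComplexStructure g β R J) (h' : IsMagneticComplexStructure g (-β) R J') :
    IsAntiholomorphic J (tube g R) J' (tube g R) fiberInv ∧
      ∀ z ∈ tube g R, (type10 (J z)).map ((mfderiv (cotModel n) (cotModel n)
        fiberInv z).toLinearMap.baseChange ℂ) = type01 (J' (fiberInv z)) := by
  refine ⟨⟨fun z hz => ?_, (contMDiff_fiberInv.of_le le_top).contMDiffOn, fun z hz ξ =>
    h.fiberInvD_apply hβ h' hz ξ⟩, fun z hz => ?_⟩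
  · change normSq g (fiberInv z) < R ^ 2
    rw [normSq_fiberInv]
    exact hz
  · exact map_type10_eq_type01 (A := (J z : VM n →L[ℝ] VM n))
      (B := (J' (fiberInv z) : VM n →L[ℝ] VM n)) (f := (fiberInvD z).toLinearMap)
      (f' := (fiberInvD (fiberInv z)).toLinearMap) (fiberInvD_fiberInvD' z)
      (fiberInvD_fiberInvD z) (h.fiberInvD_apply hβ h' hz)

end Compact

end MagneticStructures

end MagneticFlow

end

theorem mainTheorem2 {n : ℕ} {M : Type*} [TopologicalSpace M]
    [ChartedSpace (EuclideanSpace ℝ (Fin n)) M] [IsManifold (𝓡 n) ω M] [CompactSpace M] [T2Space M]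
    (g : AnalyticMetric n M) (β : DiffForm (𝓡 n) M 2)
    (hβ : β.IsCk ω) (hdβ : β.d = 0) :
    -- the magnetic flow is defined for all times
    IsMagneticFlow g β (magneticFlow g β) ∧
    -- on some tube, `P_z` has an analytic continuation to a disk of radius greater than one, with
    -- values in the Lagrangian Grassmannian
    (∃ R > 0, ∃ ε > 0, ∃ Q, IsContinuation g β R ε Q ∧
      ∀ z ∈ tube g R, ∀ w ∈ Metric.ball (0 : ℂ) (1 + ε),
        IsLagrangian (twistedForm β z) (Q z w)) ∧
    -- for every such tube and disk there is a smaller tube with the following properties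
    (∀ R > 0, ∀ ε > 0, ∀ Q, IsContinuation g β R ε Q → ∃ r > 0, r ≤ R ∧
      (∀ w ∈ Metric.ball (0 : ℂ) (1 + ε), w.im ≠ 0 →
        (∀ z ∈ tube g r, ∀ Z ∈ Q z w, conjC Z ∈ Q z w → Z = 0) ∧
        ∃ J : EndField n M,
          (IsComplexStructureOn J (tube g r) ∧
            ∀ z ∈ tube g r, type10 (J z) = Q z w) ∧
          ∀ J' : EndField n M,
            IsComplexStructureOn J' (tube g r) →
            (∀ z ∈ tube g r, type10 (J' z) = Q z w) →
            ∀ z ∈ tube g r, J' z = J z) ∧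
      (∀ w ∈ Metric.ball (0 : ℂ) (1 + ε), 0 < w.im →
        (∀ z ∈ tube g r,
          IsPositiveLagrangian (twistedForm β z) (Q z w)) ∧
        ∀ J : EndField n M,
          IsComplexStructureOn J (tube g r) →
          (∀ z ∈ tube g r, type10 (J z) = Q z w) →
          IsKaehlerOn J (twistedForm β) (tube g r))) ∧
    -- on some tube, the magnetic complex structures for `β` and `-β` exist and are Kähler
    (∃ R > 0, ∃ J J' : EndField n M,
      IsMagneticComplexStructure g β R J ∧
      IsMagneticComplexStructure g (-β) R J' ∧
      IsKaehlerOn J (twistedForm β) (tube g R) ∧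
      IsKaehlerOn J' (twistedForm (-β)) (tube g R)) ∧
    -- whenever the magnetic complex structure exists on a tube, it is unique and the zero-section
    -- is maximal totally real
    (∀ R > 0, ∀ J : EndField n M,
      IsMagneticComplexStructure g β R J →
      (∀ J' : EndField n M, IsMagneticComplexStructure g β R J' →
        ∀ z ∈ tube g R, J' z = J z) ∧
      IsMaximalTotallyReal J zeroSec) ∧
    -- the fibre inversion is antiholomorphic from the structure for `β` to that for `-β`
    (∀ R > 0, ∀ J J' : EndField n M,
      IsMagneticComplexStructure g β R J →
      IsMagneticComplexStructure g (-β) R J' →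
      IsAntiholomorphic J (tube g R) J' (tube g R)
        fiberInv ∧
      ∀ z ∈ tube g R,
        (type10 (J z)).map
            ((mfderiv (cotModel n) (cotModel n)
              fiberInv z).toLinearMap.baseChange ℂ) =
          type01 (J' (fiberInv z))) := by
  refine ⟨isMagneticFlow_magneticFlow g hβ, exists_isContinuation g hβ hdβ,
    fun R hR ε hε Q hQ => hQ.exists_tube hβ hdβ hR hε, ?_, fun R hR J hJ =>
      ⟨fun J' hJ' z hz => hJ.unique hJ' hz, hJ.isMaximalTotallyReal hβ hdβ hR⟩,
    fun R hR J J' hJ hJ' => hJ.antiholomorphic hβ hJ'⟩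
  obtain ⟨R₁, h₁, J, hJ, hK⟩ := exists_isMagneticComplexStructure g hβ hdβ
  obtain ⟨R₂, h₂, J', hJ', hK'⟩ := exists_isMagneticComplexStructure g hβ.neg (d_neg_eq_zero hdβ)
  have h := lt_min h₁ h₂
  exact ⟨min R₁ R₂, h, J, J', hJ.mono h (min_le_left _ _), hJ'.mono h (min_le_right _ _),
    hK.mono (isOpen_tube g _) (tube_subset_tube g h (min_le_left _ _)),
    hK'.mono (isOpen_tube g _) (tube_subset_tube g h (min_le_right _ _))⟩
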